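/- Let $\mathbf k$ be a field of characteristic $0$, $\lambda\in\mathbf k$, and let $V=\bigoplus_{i\in\mathbb Z}V_i$ be a graded $\mathbf k$-vector space (homological grading, Koszul sign rule; $sV$ is the suspension, $|sv|=|v|+1$). Let $\mathrm{RB}^{¡}$ be the Koszul dual homotopy cooperad of the operad of Rota–Baxter algebras of weight $\lambda$: $\mathrm{RB}^{¡}(n)=\mathbf k e_n\oplus\mathbf k o_n$ for $n\ge1$, $|e_n|=n-1$, $|o_n|=n$, with decompositions $\Delta_T$ along planar trees $T$ given by $$\sum_T\Delta_T(e_n)=\sum_{j=1}^n\sum_{i=1}^{n-j+1}(-1)^{(j-1)(n-i+1)}\,e_{n-j+1}\circ_i e_j,$$ $$\sum_T\Delta_T(o_n)=\sum_{r_1+\cdots+r_m=n}(-1)^{m(m-1)/2}\,e_m(o_{r_1},\dots,o_{r_m})+\sum(-1)^{\gamma}\lambda^{p-q}\,o_{r_1}\circ_i\big(e_p\ \text{with}\ o_{r_2},\dots,o_{r_q}\ \text{at its inputs}\ k_1<\cdots<k_{q-1}\big),$$ where each right-hand side denotes a sum of trees with labelled vertices, $m\ge 1$ and all $r_t\ge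 1$ in the first sum, the last sum is over $1\le q\le p$, $r_t\ge1$, $1\le k_1<\cdots<k_{q-1}\le p$, $r_1+\cdots+r_q+p-q=n$, $1\le i\le r_1$, and $\gamma=\sum_{j=1}^{q-1}(q-j)r_j+(p-1)(q-1)+\big(\sum_{j\ge2}r_j+p-q\big)(r_1-i)+\sum_{j\ge2}(r_j-1)(p-k_{j-1})$. Let $$\mathfrak C_{\mathrm{RBA}}(V)=\prod_{n\ge1}\mathrm{Hom}\big(\mathrm{RB}^{¡}(n),\mathrm{End}_V(n)\big)$$ with the operations $l_n(x_1\otimes\cdots\otimes x_n)=\sum_{\sigma\in S_n}\chi(\sigma;x)\,m_n(x_{\sigma(1)}\otimes\cdots\otimes x_{\sigma(n)})$, where $\chi$ is the sign of $\sigma$ times the Koszul sign, $m_1=0$, and for $n\ge2$ $$m_n(x_1\otimes\cdots\otimes x_n)=\sum_{T}(-1)^{\frac{n(n-1)}2+1+n\sum|x_i|}\,\mathrm{comp}_T\circ(x_1\otimes\cdots\otimes x_n)\circ\Delta_T,$$ the sum being over the trees $T$ with $n$ vertices and $\mathrm{comp}_T$ being composition along $T$ in $\mathrm{End}_V$. Then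 the following hold. 1. $(\mathfrak C_{\mathrm{RBA}}(V),\{l_n\}_{n\ge1})$ is an $L_\infty$-algebra ($|l_n|=n-2$, generalised antisymmetry, generalised Jacobi identities). 2. The assignment $x\mapsto(sf,g)$, where $sf(sv_1,\dots,sv_n)=(-1)^{\sum_j(n-j)|v_j|}s\,x(e_n)(v_1,\dots,v_n)$ and $g(sv_1,\dots,sv_n)=(-1)^{|x|+\sum_j(n-j)|v_j|}x(o_n)(v_1,\dots,v_n)$, identifies $\mathfrak C_{\mathrm{RBA}}(V)$ with $\prod_n\mathrm{Hom}((sV)^{\otimes n},sV)\oplus\prod_n\mathrm{Hom}((sV)^{\otimes n},V)$, and under it the brackets become the following. $l_2(sf\otimes sh)=[sf,sh]_G$ is the Gerstenhaber bracket. For $m\ge1$, $$l_{m+1}(sh\otimes g_1\otimes\cdots\otimes g_m)=\sum_{\sigma\in S_m}(-1)^{\eta}\Big(h_m\circ(sg_{\sigma(1)}\otimes\cdots\otimes sg_{\sigma(m)})-(-1)^{(|g_{\sigma(1)}|+1)|sh|}\sum_{n\ge m}\lambda^{n-m}\,s^{-1}(sg_{\sigma(1)})\big\{sh_n\{sg_{\sigma(2)},\dots,sg_{\sigma(m)}\}\big\}\Big),$$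 where $h_n$ is the component of arity $n$ of $h$, $f\{\cdots\}$ is the brace operation of $\mathrm{End}_{sV}$, and $(-1)^\eta=\chi(\sigma;g)(-1)^{m|sh|+\sum_j(m-j)|g_{\sigma(j)}|}$. Moreover $l_{m+1}(g_1\otimes\cdots\otimes g_i\otimes sh\otimes g_{i+1}\otimes\cdots\otimes g_m)=(-1)^{|sh|(|g_1|+\cdots+|g_i|)+i}\,l_{m+1}(sh\otimes g_1\otimes\cdots\otimes g_m)$. All other components vanish. 3. A homotopy Rota–Baxter algebra structure of weight $\lambda$ on $V$ consists of maps $m_n,T_n:V^{\otimes n}\to V$ ($n\ge1$) of degrees $n-2$ and $n-1$ such that for all $n\ge1$ $$\sum_{i+j+l=n,\ j\ge1}(-1)^{i+jl}m_{i+1+l}\circ(\mathrm{id}^{\otimes i}\otimes m_j\otimes\mathrm{id}^{\otimes l})=0,$$ $$\sum_{l_1+\cdots+l_p=n}(-1)^{\delta}m_p\circ(T_{l_1}\otimes\cdots\otimes T_{l_p})=\sum(-1)^{\eta}\lambda^{p-q}\,T_{r_1}\circ\big(\mathrm{id}^{\otimes i}\otimes m_p\circ(\mathrm{id}^{\otimes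 j_1}\otimes T_{r_2}\otimes\mathrm{id}^{\otimes j_2}\otimes\cdots\otimes T_{r_q}\otimes\mathrm{id}^{\otimes j_q})\otimes\mathrm{id}^{\otimes l}\big),$$ where $p\ge1$ and $l_t\ge1$ on the left, the right-hand sum is over $1\le q\le p$, $r_t\ge1$, $r_1+\cdots+r_q+p-q=n$, $i+1+l=r_1$, $j_1+\cdots+j_q+q-1=p$ ($i,l,j_t\ge0$), and $\delta=\frac{p(p-1)}2+\frac{n(n-1)}2+\sum_t(p-t)l_t$, $\eta=\frac{n(n-1)}2+i+\big(p+\sum_{t\ge2}(r_t-1)\big)l+\sum_{t=2}^q(r_t-1)\big(j_t+\cdots+j_q+q-t\big)$. A Maurer–Cartan element is an $\alpha$ of degree $-1$ with $\sum_{n\ge1}\frac1{n!}(-1)^{n(n-1)/2}l_n(\alpha^{\otimes n})=0$ (a sum with finitely many nonzero terms in each arity). The assignment $m_n=-\alpha(e_n)$, $T_n=-\alpha(o_n)$ is a bijection from the Maurer–Cartan elements of $\mathfrak C_{\mathrm{RBA}}(V)$ to the homotopy Rota–Baxter algebra structures of weight $\lambda$ on $V$. 4. If $V$ is concentrated in degree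 $0$, then $\alpha\mapsto(\mu,T)=(-\alpha(e_2),-\alpha(o_1))$ is a bijection from the Maurer–Cartan elements of $\mathfrak C_{\mathrm{RBA}}(V)$ to the Rota–Baxter algebra structures of weight $\lambda$ on $V$, i.e. pairs of an associative product $\mu=\cdot$ on $V$ and a linear map $T:V\to V$ with $T(a)\cdot T(b)=T\big(a\cdot T(b)+T(a)\cdot b+\lambda\,a\cdot b\big)$ for all $a,b\in V$. -/

import Mathlib

noncomputable section

namespace HomotopyRB

universe u v

/-! ## Signs -/

/-- The Koszul sign `ε(σ; x₁,…,xₙ)` of homogeneous elements of degrees `d 0, …, d (n-1)`: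
`x₁ ⋯ xₙ = ε(σ) x_{σ 1} ⋯ x_{σ n}` in the free graded commutative algebra. -/
def koszulSign {n : ℕ} (σ : Equiv.Perm (Fin n)) (d : Fin n → ℤ) : ℤˣ :=
  ∏ i : Fin n, ∏ j : Fin n,
    if i < j ∧ σ j < σ i then (d (σ i) * d (σ j)).negOnePow else 1

/-- `χ(σ; x₁,…,xₙ) = sgn(σ) ε(σ; x₁,…,xₙ)`. -/
def chi {n : ℕ} (σ : Equiv.Perm (Fin n)) (d : Fin n → ℤ) : ℤˣ :=
  Equiv.Perm.sign σ * koszulSign σ d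

/-! ## `L∞`-algebras -/

/-- `σ` is an `(i, n-i)`-shuffle. -/
def IsShuffle {n : ℕ} (i : ℕ) (σ : Equiv.Perm (Fin n)) : Prop :=
  ∀ a b : Fin n, a < b → ((b : ℕ) < i ∨ i ≤ (a : ℕ)) → σ a < σ b

open Classical in
/-- The left-hand side of the `n`-th generalised Jacobi identity for operations `l`, evaluated on
elements `x t` of degrees `d t`; the summation index `i : Fin n` stands for the number `i + 1` of
inputs of the inner operation, and the degree of the inner value is the sum of the degrees of its
inputs plus `(i + 1) - 2`. -/
def jacobiator {L : Type v} [AddCommGroup L]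
    (l : (n : ℕ) → (Fin n → ℤ) → (Fin n → L) → L)
    (n : ℕ) (d : Fin n → ℤ) (x : Fin n → L) : L :=
  ∑ i : Fin n, ∑ σ : Equiv.Perm (Fin n),
    if IsShuffle ((i : ℕ) + 1) σ then
      let s : Fin ((i : ℕ) + 1) → Fin n := fun t => σ ⟨t, by omega⟩
      let r : Fin (n - ((i : ℕ) + 1)) → Fin n := fun t => σ ⟨(i : ℕ) + 1 + t, by omega⟩
      (chi σ d * ((((i : ℕ) + 1) * (n - ((i : ℕ) + 1)) : ℕ) : ℤ).negOnePow) •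
        l (n - ((i : ℕ) + 1) + 1)
          (Fin.cons ((∑ t, d (s t)) + (((i : ℕ) + 1 : ℕ) : ℤ) - 2) (fun t => d (r t)))
          (Fin.cons (l ((i : ℕ) + 1) (fun t => d (s t)) (fun t => x (s t))) (fun t => x (r t)))
    else 0

/-- An `L∞`-algebra structure on the graded space `(ℒ d)_{d : ℤ}`, whose homogeneous components are
subspaces of an ambient space `L`.  The operation `lₙ` restricted to
`ℒ (d 0) ⊗ ⋯ ⊗ ℒ (d (n-1))` is `l n d`. -/
structure IsLInfinity {k : Type u} {L : Type v} [Field k] [AddCommGroup L] [Module k L]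
    (ℒ : ℤ → Submodule k L) (l : (n : ℕ) → (Fin n → ℤ) → (Fin n → L) → L) : Prop where
  multilinear : ∀ (n : ℕ) (d : Fin n → ℤ), 1 ≤ n →
    ∃ F : MultilinearMap k (fun t => ℒ (d t)) L,
      ∀ x : (t : Fin n) → ℒ (d t), l n d (fun t => (x t : L)) = F x
  degree : ∀ (n : ℕ) (d : Fin n → ℤ) (x : Fin n → L), 1 ≤ n → (∀ t, x t ∈ ℒ (d t)) →
    l n d x ∈ ℒ ((∑ t, d t) + (n : ℤ) - 2)
  antisymm : ∀ (n : ℕ) (d : Fin n → ℤ) (x : Fin n → L) (σ : Equiv.Perm (Fin n)), 1 ≤ n →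
    (∀ t, x t ∈ ℒ (d t)) →
    l n (fun t => d (σ t)) (fun t => x (σ t)) = chi σ d • l n d x
  jacobi : ∀ (n : ℕ) (d : Fin n → ℤ) (x : Fin n → L), 1 ≤ n → (∀ t, x t ∈ ℒ (d t)) →
    jacobiator l n d x = 0

/-! ## Graded spaces and families of multilinear maps -/

section Graded

variable {k : Type u} {V : Type v} [Field k] [AddCommGroup V] [Module k V]

/-- The linear map `v ↦ (-1)^{d (|v| + c)} v`.  For `c = 0` it is the Koszul sign produced by moving
a map of degree `d` past an element `v` of `V`; for `c = 1` the one produced by moving it past the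
element `sv` of the suspension `sV` (where `|sv| = |v| + 1`). -/
def koszul (𝒱 : ℤ → Submodule k V) [DirectSum.Decomposition 𝒱] (c d : ℤ) : V →ₗ[k] V :=
  (DirectSum.toModule k ℤ V fun i => ((d * (i + c)).negOnePow : ℤ) • (𝒱 i).subtype) ∘ₗ
    (DirectSum.decomposeLinearEquiv 𝒱).toLinearMap

theorem koszul_of_mem (𝒱 : ℤ → Submodule k V) [DirectSum.Decomposition 𝒱] (c d i : ℤ) (v : V)
    (hv : v ∈ 𝒱 i) : koszul 𝒱 c d v = (d * (i + c)).negOnePow • v := by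
  simp only [koszul, LinearMap.comp_apply, LinearEquiv.coe_coe,
    DirectSum.decomposeLinearEquiv_apply]
  rw [DirectSum.decompose_of_mem 𝒱 hv]
  erw [DirectSum.toModule_lof]
  simp [Units.smul_def]

/-- `f` has, in arity `n`, a `k`-multilinear restriction which maps `𝒮 i₁ ⊗ ⋯ ⊗ 𝒮 iₙ` to
`𝒯 (i₁ + ⋯ + iₙ + e)`. -/
def IsHomogeneousMap (𝒮 𝒯 : ℤ → Submodule k V) (n : ℕ) (e : ℤ) (f : List V → V) : Prop :=
  (∃ F : MultilinearMap k (fun _ : Fin n => V) V, ∀ v : Fin n → V, f (List.ofFn v) = F v) ∧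
    ∀ (i : Fin n → ℤ) (v : Fin n → V), (∀ t, v t ∈ 𝒮 (i t)) →
      f (List.ofFn v) ∈ 𝒯 ((∑ t, i t) + e)

/-- The space `∏_{n ≥ 1} Hom(S^{⊗ n}, T)_{e n}` of families of maps of degree `e n` in arity `n`,
for gradings `𝒮`, `𝒯` of the space `V`.  A family is encoded as one function of lists: on lists of
length `n` it is the component of arity `n`. -/
def homProd (𝒮 𝒯 : ℤ → Submodule k V) (e : ℕ → ℤ) : Submodule k (List V → V) where
  carrier := {f | f [] = 0 ∧ ∀ n : ℕ, IsHomogeneousMap 𝒮 𝒯 n (e n) f}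
  zero_mem' := ⟨rfl, fun _ => ⟨⟨0, fun _ => rfl⟩, fun _ _ _ => Submodule.zero_mem _⟩⟩
  add_mem' := by
    rintro f g ⟨hf0, hf⟩ ⟨hg0, hg⟩
    refine ⟨by simp [hf0, hg0], fun n => ⟨?_, fun i v hv => ?_⟩⟩
    · obtain ⟨F, hF⟩ := (hf n).1
      obtain ⟨G, hG⟩ := (hg n).1
      exact ⟨F + G, fun v => by simp [hF v, hG v]⟩
    · exact Submodule.add_mem _ ((hf n).2 i v hv) ((hg n).2 i v hv)
  smul_mem' := by
    rintro c f ⟨hf0, hf⟩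
    refine ⟨by simp [hf0], fun n => ⟨?_, fun i v hv => ?_⟩⟩
    · obtain ⟨F, hF⟩ := (hf n).1
      exact ⟨c • F, fun v => by simp [hF v]⟩
    · exact Submodule.smul_mem _ _ ((hf n).2 i v hv)

end Graded

/-! ## Planar trees and composition along a tree in an endomorphism operad -/

/-- Planar forests (finite sequences of planar trees) with vertices labelled by `X`: the empty
forest; a forest whose first tree is a bare leaf; a forest whose first tree has a root vertex
labelled by an element of `X`, the subtrees of that vertex being listed by the second argument.
In the last two cases the final argument lists the remaining trees. -/
inductive Forest (X : Type v) : Type v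
  | nil : Forest X
  | leaf : Forest X → Forest X
  | vertex : X → Forest X → Forest X → Forest X

namespace Forest

variable {X : Type v}

/-- The number of trees in a forest. -/
def width : Forest X → ℕ
  | nil => 0
  | leaf r => r.width + 1
  | vertex _ _ r => r.width + 1

/-- The number of leaves. -/
def leaves : Forest X → ℕ
  | nil => 0
  | leaf r => r.leaves + 1
  | vertex _ c r => c.leaves + r.leaves

/-- The number of vertices. -/
def weight : Forest X → ℕ
  | nil => 0
  | leaf r => r.weight
  | vertex _ c r => 1 + c.weight + r.weight

/-- Prepend `n` bare leaves. -/
def addLeaves : ℕ → Forest X → Forest X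
  | 0, r => r
  | n + 1, r => leaf (addLeaves n r)

/-- The corolla with `n` leaves and its vertex labelled by `x`, followed by a forest. -/
def corolla (x : X) (n : ℕ) (r : Forest X) : Forest X := vertex x (addLeaves n nil) r

/-- The sequence of trees described by a list of numbers: `0` stands for a bare leaf and `r > 0`
for the corolla with `r` leaves whose vertex is labelled by `x`. -/
def corollas (x : X) : List ℕ → Forest X
  | [] => nil
  | 0 :: t => leaf (corollas x t)
  | (r + 1) :: t => corolla x (r + 1) (corollas x t)

variable {k : Type u} {V : Type v} [Field k] [AddCommGroup V] [Module k V]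

/-- The sum of the degrees of the maps labelling the vertices of a forest. -/
def totalDegree : Forest (ℤ × (List V → V)) → ℤ
  | nil => 0
  | leaf r => r.totalDegree
  | vertex x c r => x.1 + c.totalDegree + r.totalDegree

/-- Composition in the endomorphism operad of `V` along a forest whose vertices are labelled by
maps with their degrees.  A tree with root `f` and subtrees `t₁,…,tₙ` is composed to
`f ∘ (t₁ ⊗ ⋯ ⊗ tₙ)`, tensor products of maps being evaluated by the Koszul rule; this is the
iterated partial composition in the planar order of the vertices. -/
def comp (𝒱 : ℤ → Submodule k V) [DirectSum.Decomposition 𝒱] :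
    Forest (ℤ × (List V → V)) → List V → List V
  | nil, _ => []
  | leaf r, w => koszul 𝒱 0 r.totalDegree (w.headD 0) :: comp 𝒱 r w.tail
  | vertex x c r, w =>
      x.2 (comp 𝒱 c ((w.take c.leaves).map (koszul 𝒱 0 r.totalDegree))) ::
        comp 𝒱 r (w.drop c.leaves)

end Forest

/-! ## The Koszul dual homotopy cooperad -/

/-- The two kinds of basis elements: in each arity `n ≥ 1` the Koszul dual homotopy cooperad has
the basis `eₙ, oₙ`. -/
inductive Gen : Type
  | e : Gen
  | o : Gen

/-- `|eₙ| = n - 1` and `|oₙ| = n`. -/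
def Gen.degree : Gen → ℕ → ℤ
  | .e, n => (n : ℤ) - 1
  | .o, n => (n : ℤ)

/-- The degrees of the basis elements labelling the vertices of a forest, in the planar order. -/
def Forest.vertexDegrees : Forest Gen → List ℤ
  | .nil => []
  | .leaf r => r.vertexDegrees
  | .vertex b c r => b.degree c.width :: (c.vertexDegrees ++ r.vertexDegrees)

section Cooperad

variable {k : Type u} [Field k]

/-- For `w : Fin p → ℕ` describing the inputs of a vertex with `p` inputs (`0` for a leaf, `r > 0`
for a corolla with `r` leaves), the total number of leaves. -/
def inputLeaves {p : ℕ} (w : Fin p → ℕ) : ℕ := ∑ t, if w t = 0 then 1 else w t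

/-- For `w : Fin p → ℕ` as in `inputLeaves`, the number of corollas. -/
def inputVertices {p : ℕ} (w : Fin p → ℕ) : ℕ := (Finset.univ.filter fun t => w t ≠ 0).card

/-- For the corollas of arities `r₂,…,r_q` placed at the inputs `k₁ < ⋯ < k_{q-1}` (counted from
`1`) of a vertex with `p` inputs, described by `w`, the number
`∑_{j=2}^{q} (q - j) r_j + ∑_{j=2}^{q} (r_j - 1) (p - k_{j-1})`. -/
def inputSign {p : ℕ} (w : Fin p → ℕ) : ℤ :=
  ∑ t : Fin p, if w t = 0 then 0 else
    (w t : ℤ) * ((Finset.univ.filter fun s => t < s ∧ w s ≠ 0).card : ℤ) +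
      ((w t : ℤ) - 1) * ((p : ℤ) - 1 - (t : ℤ))

open Classical in
/-- The sum `∑_T Δ_T(b_N)` over all trees `T`, as a linear combination of trees with vertices
labelled by basis elements of the Koszul dual homotopy cooperad of weight `lam`.

* `Δ(e_N)`: all `e_{N-j+1} ∘_i e_j`, with sign `(-1)^{(j-1)(N-i+1)}`.
* `Δ(o_N)`, first sum: a root `e_m` all of whose inputs are vertices `o_{r_1}, …, o_{r_m}`, with
  sign `(-1)^{m(m-1)/2}`.
* `Δ(o_N)`, second sum: a root `o_{r_1}` with exactly one non-leaf input, namely the `i`-th one,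
  `i = a + 1`, `r_1 = a + 1 + b`; a vertex `e_p` sits there, and `q - 1 < p` of the inputs of the
  latter are vertices `o_{r_2}, …, o_{r_q}`; with coefficient `(-1)^γ lam^{p-q}`. -/
def coproduct (lam : k) : Gen → ℕ → (Forest Gen →₀ k)
  | .e, N =>
      ∑ j ∈ Finset.Icc 1 N, ∑ i ∈ Finset.Icc 1 (N - j + 1),
        Finsupp.single
          (Forest.vertex Gen.e
            (Forest.addLeaves (i - 1)
              (Forest.corolla Gen.e j (Forest.addLeaves (N - j + 1 - i) Forest.nil)))
            Forest.nil)
          ((((j : ℤ) - 1) * ((N : ℤ) - i + 1)).negOnePow : k)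
  | .o, N =>
      (∑ m ∈ Finset.Icc 1 N, ∑ r : Fin m → Fin (N + 1),
        if (∀ t, (r t : ℕ) ≠ 0) ∧ ∑ t, (r t : ℕ) = N then
          Finsupp.single
            (Forest.vertex Gen.e
              (Forest.corollas Gen.o (List.ofFn fun t => (r t : ℕ))) Forest.nil)
            (((m * (m - 1) / 2 : ℕ) : ℤ).negOnePow : k)
        else 0) +
      ∑ p ∈ Finset.Icc 1 N, ∑ w : Fin p → Fin (N + 1),
        ∑ a ∈ Finset.range N, ∑ b ∈ Finset.range N,
          let w' : Fin p → ℕ := fun t => w t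
          let q : ℕ := inputVertices w' + 1
          let γ : ℤ := ((q : ℤ) - 1) * ((a : ℤ) + 1 + b) + ((p : ℤ) - 1) * ((q : ℤ) - 1) +
            ((inputLeaves w' : ℤ) - 1) * b + inputSign w'
          if q ≤ p ∧ a + inputLeaves w' + b = N then
            Finsupp.single
              (Forest.vertex Gen.o
                (Forest.addLeaves a
                  (Forest.vertex Gen.e (Forest.corollas Gen.o (List.ofFn w'))
                    (Forest.addLeaves b Forest.nil)))
                Forest.nil)
              ((γ.negOnePow : k) * lam ^ (p - q))
          else 0

end Cooperad

/-! ## The convolution `L∞`-algebra -/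

section Convolution

variable {k : Type u} {V : Type v} [Field k] [AddCommGroup V] [Module k V]

/-- The homogeneous component of degree `d` of the deformation complex, i.e. of the graded space
`∏_{n ≥ 1} Hom(C(n), End_V(n))`, `C(n)` being the space with basis `eₙ, oₙ`: the value `x b` of a
cochain `x` on the basis elements of kind `b` is the family of the maps
`x(bₙ) : V^{⊗ n} → V`, which have degree `d + |bₙ|`. -/
def cochains (𝒱 : ℤ → Submodule k V) (d : ℤ) : Submodule k (Gen → List V → V) :=
  Submodule.pi Set.univ fun b : Gen => homProd 𝒱 𝒱 fun n => d + b.degree n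

/-- Replace the basis elements labelling the vertices of a tree by the values on them of cochains
`x` (given with their degrees `d`), the `i`-th cochain being used at the `i`-th vertex in the
planar order. -/
def Forest.decorate : Forest Gen → List (ℤ × (Gen → List V → V)) → Forest (ℤ × (List V → V))
  | .nil, _ => .nil
  | .leaf r, fs => .leaf (r.decorate fs)
  | .vertex b c r, fs =>
      let f := fs.headD (0, 0)
      .vertex (f.1 + b.degree c.width, f.2 b) (c.decorate (fs.tail.take c.weight))
        (r.decorate (fs.tail.drop c.weight))

variable (𝒱 : ℤ → Submodule k V) [DirectSum.Decomposition 𝒱]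

/-- `m_n = ∑_T m_T` over the trees with `n` vertices, where
`m_T(x₁ ⊗ ⋯ ⊗ xₙ) = (-1)^{n(n-1)/2 + 1 + n ∑ |x_i|} comp_T ∘ (x₁ ⊗ ⋯ ⊗ xₙ) ∘ Δ_T`.
The last summand of the exponent in the code comes from
`(x₁ ⊗ ⋯ ⊗ xₙ)(c₁ ⊗ ⋯ ⊗ cₙ) = (-1)^{∑_{i<j} |x_j| |c_i|} x₁(c₁) ⊗ ⋯ ⊗ xₙ(cₙ)`.
(`V` has no differential and `Δ_T = 0` for `T` with one vertex, so `m₁ = 0`.) -/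
def convolution (lam : k) (n : ℕ) (d : Fin n → ℤ) (x : Fin n → Gen → List V → V) :
    Gen → List V → V := fun b v =>
  (coproduct lam b v.length).sum fun T c =>
    if T.weight = n then
      ((((n * (n - 1) / 2 : ℕ) : ℤ) + 1 + n * (∑ i, d i) +
          ∑ j : Fin n, ∑ i : Fin n,
            if i < j then d j * T.vertexDegrees.getD (i : ℕ) 0 else 0).negOnePow) •
        c • (Forest.comp 𝒱 (T.decorate (List.ofFn fun i => (d i, x i))) v).headD 0
    else 0

/-- The `L∞`-operations of the deformation complex: the antisymmetrisations of the `m_n`. -/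
def bracket (lam : k) (n : ℕ) (d : Fin n → ℤ) (x : Fin n → Gen → List V → V) :
    Gen → List V → V :=
  ∑ σ : Equiv.Perm (Fin n),
    chi σ d • convolution 𝒱 lam n (fun i => d (σ i)) (fun i => x (σ i))

/-- The `n`-th summand `(1/n!) (-1)^{n(n-1)/2} l_n(α,…,α)` of the Maurer–Cartan series. -/
def mcTerm (lam : k) (α : Gen → List V → V) (n : ℕ) : Gen → List V → V :=
  ((n * (n - 1) / 2 : ℕ) : ℤ).negOnePow •
    ((n.factorial : k)⁻¹ • bracket 𝒱 lam n (fun _ => -1) (fun _ => α))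

/-- Maurer–Cartan elements of the deformation complex: elements `α` of degree `-1` for which the
series `∑_{n ≥ 1} (1/n!) (-1)^{n(n-1)/2} l_n(α,…,α)` exists (in the product over the arities: only
finitely many terms contribute to each arity) and is `0`. -/
def IsMaurerCartan (lam : k) (α : Gen → List V → V) : Prop :=
  α ∈ cochains 𝒱 (-1) ∧
    (∀ (b : Gen) (N : ℕ),
      {n : ℕ | ∃ v : List V, v.length = N ∧ mcTerm 𝒱 lam α (n + 1) b v ≠ 0}.Finite) ∧
    ∀ (b : Gen) (v : List V), ∑ᶠ n : ℕ, mcTerm 𝒱 lam α (n + 1) b v = 0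

end Convolution

/-! ## The explicit form of the brackets -/

section Explicit

variable {k : Type u} {V : Type v} [Field k] [AddCommGroup V] [Module k V]

/-- The grading of the suspension `sV`: `(sV)_i = V_{i-1}`.  (The underlying ungraded space of
`sV` is that of `V`, and `s` is the identity on it.) -/
def suspension (𝒱 : ℤ → Submodule k V) : ℤ → Submodule k V := fun i => 𝒱 (i - 1)

/-- The component of degree `d` of
`∏_{n ≥ 1} Hom((sV)^{⊗ n}, sV) ⊕ ∏_{n ≥ 1} Hom((sV)^{⊗ n}, V)`. -/
def explicitCochains (𝒱 : ℤ → Submodule k V) (d : ℤ) :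
    Submodule k ((List V → V) × (List V → V)) :=
  (homProd (suspension 𝒱) (suspension 𝒱) fun _ => d).prod (homProd (suspension 𝒱) 𝒱 fun _ => d)

variable (𝒱 : ℤ → Submodule k V) [DirectSum.Decomposition 𝒱]

/-- `(v₁,…,vₙ) ↦ (-1)^{∑_j (n-j) |v_j|} (v₁,…,vₙ)`, applied to the entries. -/
def desuspend : List V → List V
  | [] => []
  | a :: t => koszul 𝒱 0 (t.length : ℤ) a :: desuspend t

/-- The identification of the deformation complex with
`∏ Hom((sV)^{⊗ n}, sV) ⊕ ∏ Hom((sV)^{⊗ n}, V)` in degree `d`.  It sends `x` to `(sf, g)` with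
`sf(sv₁,…,svₙ) = (-1)^{∑ (n-j)|v_j|} s (x(eₙ)(v₁,…,vₙ))` and
`g(sv₁,…,svₙ) = (-1)^{d + ∑ (n-j)|v_j|} x(oₙ)(v₁,…,vₙ)`. -/
def identification (d : ℤ) (x : Gen → List V → V) : (List V → V) × (List V → V) :=
  (fun v => x .e (desuspend 𝒱 v), fun v => d.negOnePow • x .o (desuspend 𝒱 v))

/-- All ways to apply maps `G₁, …, G_m` (given with their degrees), in this order, to disjoint
nonempty intervals of a list of elements of `sV`, with Koszul signs.  The triples `(i, j)` below
describe the interval of the first map: the list is cut into parts of lengths `i`, `j + 1` and the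
rest. -/
def insertions : List (ℤ × (List V → V)) → List V → List (List V)
  | [], v => [v]
  | G :: Gs, v =>
      (List.range v.length).flatMap fun i =>
        (List.range (v.length - i)).flatMap fun j =>
          (insertions Gs (v.drop (i + (j + 1)))).map fun w =>
            (v.take i).map (koszul 𝒱 1 (G.1 + (Gs.map Prod.fst).sum)) ++
              G.2 (((v.drop i).take (j + 1)).map (koszul 𝒱 1 (Gs.map Prod.fst).sum)) :: w

/-- The brace `f{G₁,…,G_m}` in the endomorphism operad of `sV`. -/
def brace (f : List V → V) (G : List (ℤ × (List V → V))) : List V → V := fun v =>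
  ((insertions 𝒱 G v).map f).sum

/-- The arity `m` component of a family of maps. -/
def arityPart (m : ℕ) (f : List V → V) : List V → V := fun w => if w.length = m then f w else 0

/-- `∑_{n ≥ m} lam^{n-m} h_n`, where `h_n` is the arity `n` component of `h`. -/
def weighted (lam : k) (m : ℕ) (h : List V → V) : List V → V := fun w =>
  if m ≤ w.length then lam ^ (w.length - m) • h w else 0

/-- `l_{m+1}(sh ⊗ g₁ ⊗ ⋯ ⊗ g_m)`, `m ≥ 1`, for `sh` of degree `dh` in `∏ Hom((sV)^{⊗ n}, sV)` and
`g_t` of degree `dg t` in `∏ Hom((sV)^{⊗ n}, V)` (the map `sg` has degree `|g| + 1` and the same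
underlying function as `g`).  It is
`∑_σ ± (h_m ∘ (sg_{σ1} ⊗ ⋯ ⊗ sg_{σm})
  - (-1)^{(|g_{σ1}|+1)|sh|} ∑_{n ≥ m} lam^{n-m} s⁻¹ (sg_{σ1}){sh_n{sg_{σ2},…,sg_{σm}}})`
with the sign `χ(σ; g) (-1)^{m |sh| + ∑_{j} (m-j) |g_{σj}|}`. -/
def mixedBracket (lam : k) : (m : ℕ) → ℤ → (List V → V) → (Fin m → ℤ) → (Fin m → List V → V) →
    List V → V
  | 0, _, _, _, _ => 0
  | m + 1, dh, h, dg, g =>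
      ∑ σ : Equiv.Perm (Fin (m + 1)),
        (chi σ dg * (((m : ℤ) + 1) * dh + ∑ j : Fin (m + 1), ((m : ℤ) - j) * dg (σ j)).negOnePow) •
          (brace 𝒱 (arityPart (m + 1) h) (List.ofFn fun j => (dg (σ j) + 1, g (σ j))) -
            ((dg (σ 0) + 1) * dh).negOnePow •
              brace 𝒱 (g (σ 0))
                [(dh + ∑ j : Fin m, (dg (σ j.succ) + 1),
                  brace 𝒱 (weighted lam (m + 1) h)
                    (List.ofFn fun j : Fin m => (dg (σ j.succ) + 1, g (σ j.succ))))])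

/-- The Gerstenhaber bracket `[f, g] = f{g} - (-1)^{|f||g|} g{f}`. -/
def gerstenhaber (d d' : ℤ) (f g : List V → V) : List V → V :=
  brace 𝒱 f [(d', g)] - (d * d').negOnePow • brace 𝒱 g [(d, f)]

/-- The first component of the explicit bracket: only `l₂` is nonzero. -/
def algebraBracket : (n : ℕ) → (Fin n → ℤ) → (Fin n → List V → V) → List V → V
  | 2, d, f => gerstenhaber 𝒱 (d 0) (d 1) (f 0) (f 1)
  | _, _, _ => 0

/-- The second component of the explicit bracket: the sum over the position `i` of the argument from
`∏ Hom((sV)^{⊗ n}, sV)`, which is moved to the front by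
`l(g₁,…,g_i, sh, g_{i+1},…,g_m) = (-1)^{|sh| (|g₁| + ⋯ + |g_i|) + i} l(sh, g₁,…,g_m)`. -/
def operatorBracket (lam : k) : (n : ℕ) → (Fin n → ℤ) →
    (Fin n → (List V → V) × (List V → V)) → List V → V
  | 0, _, _ => 0
  | m + 1, d, y =>
      ∑ i : Fin (m + 1),
        (d i * (∑ j : Fin (m + 1), if j < i then d j else 0) + (i : ℤ)).negOnePow •
          mixedBracket 𝒱 lam m (d i) (y i).1
            (fun j => d (i.succAbove j)) (fun j => (y (i.succAbove j)).2)

/-- The explicit brackets on `∏ Hom((sV)^{⊗ n}, sV) ⊕ ∏ Hom((sV)^{⊗ n}, V)`. -/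
def explicitBracket (lam : k) (n : ℕ) (d : Fin n → ℤ)
    (y : Fin n → (List V → V) × (List V → V)) : (List V → V) × (List V → V) :=
  (algebraBracket 𝒱 n d (fun i => (y i).1), operatorBracket 𝒱 lam n d y)

end Explicit

/-! ## Homotopy Rota–Baxter algebras -/

section HomotopyAlgebra

variable {k : Type u} {V : Type v} [Field k] [AddCommGroup V] [Module k V]

/-- A map with its degree and its arity. -/
structure Piece (V : Type v) where
  degree : ℤ
  arity : ℕ
  map : List V → V

/-- The identity map of `V`. -/
def Piece.id : Piece V := ⟨0, 1, fun v => v.headD 0⟩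

variable (𝒱 : ℤ → Submodule k V) [DirectSum.Decomposition 𝒱]

/-- The value of `f₁ ⊗ ⋯ ⊗ f_m` on `v₁ ⊗ ⋯ ⊗ vₙ`, by the Koszul rule. -/
def tensorEval : List (Piece V) → List V → List V
  | [], _ => []
  | f :: fs, v =>
      f.map ((v.take f.arity).map (koszul 𝒱 0 (fs.map Piece.degree).sum)) ::
        tensorEval fs (v.drop f.arity)

/-- The arity `n` Stasheff sum `∑_{i+j+l=n, j ≥ 1} (-1)^{i+jl} m_{i+1+l} ∘ (id^i ⊗ m_j ⊗ id^l)`. -/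
def stasheff (m : List V → V) (v : List V) : V :=
  ∑ j ∈ Finset.Icc 1 v.length, ∑ i ∈ Finset.range (v.length - j + 1),
    let l : ℕ := v.length - j - i
    (((i : ℤ) + j * l).negOnePow) •
      m (tensorEval 𝒱 (List.replicate i Piece.id ++ [⟨(j : ℤ) - 2, j, m⟩] ++
        List.replicate l Piece.id) v)

/-- `∑_{l₁+⋯+l_p=n} (-1)^δ m_p ∘ (T_{l₁} ⊗ ⋯ ⊗ T_{l_p})`,
`δ = p(p-1)/2 + n(n-1)/2 + ∑_j (p-j) l_j`. -/
def rotaBaxterLeft (m T : List V → V) (v : List V) : V :=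
  ∑ p ∈ Finset.Icc 1 v.length, ∑ r : Fin p → Fin (v.length + 1),
    if (∀ t, (r t : ℕ) ≠ 0) ∧ ∑ t, (r t : ℕ) = v.length then
      (((p * (p - 1) / 2 : ℕ) : ℤ) + ((v.length * (v.length - 1) / 2 : ℕ) : ℤ) +
          ∑ t : Fin p, ((p : ℤ) - 1 - t) * (r t : ℕ)).negOnePow •
        m (tensorEval 𝒱 (List.ofFn fun t => ⟨((r t : ℕ) : ℤ) - 1, r t, T⟩) v)
    else 0

/-- `∑ (-1)^η lam^{p-q} T_{r₁} ∘ (id^i ⊗ m_p ∘ (id^{j₁} ⊗ T_{r₂} ⊗ ⋯ ⊗ T_{r_q} ⊗ id^{j_q}) ⊗ id^l)`,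
summed over `1 ≤ q ≤ p` and `r₁ + ⋯ + r_q + p - q = n`, `i + 1 + l = r₁`,
`j₁ + ⋯ + j_q + q - 1 = p`, where
`η = n(n-1)/2 + i + (p + ∑_{t≥2} (r_t - 1)) l + ∑_{t=2}^q (r_t - 1)(j_t + ⋯ + j_q + q - t)`.
The `p` tensor factors `id, T_{r_2}, …, T_{r_q}` inside `m_p` are described by a function `w`: `0`
stands for `id` and `r > 0` for `T_r`. -/
def rotaBaxterRight (lam : k) (m T : List V → V) (v : List V) : V :=
  ∑ p ∈ Finset.Icc 1 v.length, ∑ w : Fin p → Fin (v.length + 1),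
    ∑ i ∈ Finset.range v.length, ∑ l ∈ Finset.range v.length,
      let w' : Fin p → ℕ := fun t => w t
      let q : ℕ := inputVertices w' + 1
      let D : ℤ := ∑ t, if w' t = 0 then 0 else (w' t : ℤ) - 1
      let η : ℤ := ((v.length * (v.length - 1) / 2 : ℕ) : ℤ) + i + (p + D) * l +
        ∑ t : Fin p, if w' t = 0 then 0 else ((w' t : ℤ) - 1) * ((p : ℤ) - 1 - t)
      if q ≤ p ∧ i + inputLeaves w' + l = v.length then
        η.negOnePow • lam ^ (p - q) •
          T (tensorEval 𝒱 (List.replicate i Piece.id ++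
            [⟨(p : ℤ) - 2 + D, inputLeaves w', fun u =>
              m (tensorEval 𝒱 (List.ofFn fun t =>
                if w' t = 0 then Piece.id else ⟨(w' t : ℤ) - 1, w' t, T⟩) u)⟩] ++
            List.replicate l Piece.id) v)
      else 0

/-- Homotopy Rota–Baxter algebra structures of weight `lam` on the graded space `V`: families of
maps `m_n, T_n : V^{⊗ n} → V`, `n ≥ 1`, of degrees `n - 2` and `n - 1`, subject to the Stasheff
identities and the homotopy Rota–Baxter identities. -/
structure HomotopyRotaBaxter (lam : k) where
  m : List V → V
  T : List V → V
  m_mem : m ∈ homProd 𝒱 𝒱 fun n => (n : ℤ) - 2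
  T_mem : T ∈ homProd 𝒱 𝒱 fun n => (n : ℤ) - 1
  stasheff_eq : ∀ v : List V, stasheff 𝒱 m v = 0
  rotaBaxter_eq : ∀ v : List V, rotaBaxterLeft 𝒱 m T v = rotaBaxterRight 𝒱 lam m T v

end HomotopyAlgebra

/-- Rota–Baxter algebra structures of weight `lam` on the vector space `V`. -/
structure RotaBaxter {k : Type u} (V : Type v) [Field k] [AddCommGroup V] [Module k V]
    (lam : k) where
  mul : V →ₗ[k] V →ₗ[k] V
  T : V →ₗ[k] V
  mul_assoc : ∀ a b c : V, mul (mul a b) c = mul a (mul b c)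
  rotaBaxter : ∀ a b : V,
    mul (T a) (T b) = T (mul a (T b) + mul (T a) b + lam • mul a b)

end HomotopyRB

end

/-!
The proof compares three descriptions of the brackets: sums over trees, braces of maps on the
suspension, and higher derived brackets of a graded Lie algebra. Maps of all arities are handled
together as functions of lists, multilinear in each length, so that insertions, braces and
compositions along trees are recursions over lists.

*Trees and braces.* The trees which occur in the decompositions are a root `e` or `o` with one layer
of operators below it, possibly with one `e` in between, and are described by patterns: lists in
which `0` stands for a leaf and `r > 0` for an operator with `r` inputs. A brace is a sum over
patterns too (`multiBrace_eq_sum`). The sign of a tree in the decomposition, the Koszul signs of the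
composition and the signs of the passage to the suspension add up to a sign which depends on the
degrees of the arguments but not on the arities of the operators (`pattern_signs`), so that the sums
over trees are braces (`treeValue_root_e`, `treeValue_root_o`, `identification_bracket`).

*Derived brackets.* Over `k[u] / (u² - lam u)`, the extension of scalars of `V` is
`V × V = u ⊗ V ⊕ 1 ⊗ V`. A product `h` is extended linearly over this ring (`extend`). An operator
`g` is regarded as a map which takes `u ⊗ V` to `1 ⊗ V` and kills `1 ⊗ V` (`operatorLift`). The
operators form an abelian subalgebra of the Gerstenhaber Lie algebra of `V × V`, and the components
`u ⊗ V → 1 ⊗ V` define a projection onto it whose kernel is a subalgebra containing the extended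
products (`derivedBracketData_operatorProj`). Iterated commutators of the extension of `h` with
operators are symmetrised braces (`iter_lieBr`), and their projections are exactly the mixed
brackets: an argument of `h` in `u ⊗ V` counts a factor `u`, and `u ^ (r + 1) = lam ^ r u` accounts
for the powers of the weight (`extend_pureList`, `operatorLift_mixedBracket`). For brackets derived
in this way, the generalised Jacobi identities follow formally from the Jacobi identity of the Lie
algebra (`derived_jacobi`, in which one divides by two). The sums over shuffles are converted to
sums over the ways to distribute a list over two sublists (`splitSum_reverse_ofFn`), and give the
homotopy Lie algebra (`jacobiator_explicitBracket`, `isLInfinity`).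

*The Maurer–Cartan equation.* If all arguments are equal and of degree `-1`, all permutations
contribute the same term, the factorials cancel (`mcTerm_eq`), and the Maurer–Cartan series is a sum
over the trees of the decompositions. It agrees term by term with the Stasheff identities and the
homotopy Rota–Baxter identities (`linearCombination_mcValue_e`, `linearCombination_mcValue_o`). In a
space concentrated in degree zero, the components of a Maurer–Cartan element are in arities `2` and
`1`, and those of the equation in arities `3` and `2`, where it is associativity and the Rota–Baxter
identity (`isMaurerCartan_iff_of_concentrated`).
-/

noncomputable section

set_option linter.unusedSectionVars false

namespace HomotopyRB

universe u v w

/-! ### Signs and multilinear families -/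

theorem negOnePow_congr {a b : ℤ} (h : Even (a - b)) : a.negOnePow = b.negOnePow :=
  (Int.negOnePow_eq_iff a b).2 h

theorem negOnePow_smul_smul {X : Type*} [AddCommGroup X] (a b : ℤ) (x : X) :
    a.negOnePow • b.negOnePow • x = (a + b).negOnePow • x := by
  rw [smul_smul, ← Int.negOnePow_add]

theorem negOnePow_smul_self {X : Type*} [AddCommGroup X] (a : ℤ) (x : X) :
    a.negOnePow • a.negOnePow • x = x := by
  rw [negOnePow_smul_smul, Int.negOnePow_even _ ⟨a, rfl⟩, one_smul]

theorem negOnePow_cast_smul {k : Type*} {X : Type*} [Field k] [AddCommGroup X] [Module k X]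
    (a : ℤ) (x : X) : (((a.negOnePow : ℤˣ) : ℤ) : k) • x = a.negOnePow • x := by
  rw [Int.cast_smul_eq_zsmul, Units.smul_def]

section

variable {k : Type u} {M : Type v} {N : Type w} [Field k] [AddCommGroup M] [Module k M]
  [AddCommGroup N] [Module k N]

variable (k) in
/-- A function of lists all of whose restrictions to lists of a given length are multilinear. -/
structure IsMultilinear (f : List M → N) : Prop where
  add : ∀ l r a b, f (l ++ (a + b) :: r) = f (l ++ a :: r) + f (l ++ b :: r)
  smul : ∀ l r (c : k) a, f (l ++ (c • a) :: r) = c • f (l ++ a :: r)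

namespace IsMultilinear

variable {f g : List M → N}

theorem append (hf : IsMultilinear k f) (p : List M) : IsMultilinear k fun l => f (p ++ l) :=
  ⟨fun l r a b => by simpa using hf.add (p ++ l) r a b,
    fun l r c a => by simpa using hf.smul (p ++ l) r c a⟩

theorem cons (hf : IsMultilinear k f) (x : M) : IsMultilinear k fun l => f (x :: l) :=
  hf.append [x]

theorem comp_map {M' : Type*} [AddCommGroup M'] [Module k M'] (hf : IsMultilinear k f)
    (φ : M' →ₗ[k] M) : IsMultilinear k fun l => f (l.map φ) :=
  ⟨fun l r a b => by simpa using hf.add (l.map φ) (r.map φ) (φ a) (φ b),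
    fun l r c a => by simpa using hf.smul (l.map φ) (r.map φ) c (φ a)⟩

theorem linear_comp {N' : Type*} [AddCommGroup N'] [Module k N'] (hf : IsMultilinear k f)
    (φ : N →ₗ[k] N') : IsMultilinear k fun l => φ (f l) :=
  ⟨fun l r a b => by simp [hf.add], fun l r c a => by simp [hf.smul]⟩

theorem neg (hf : IsMultilinear k f) : IsMultilinear k (-f) :=
  ⟨fun l r a b => by simp only [Pi.neg_apply, hf.add]; abel,
    fun l r c a => by simp only [Pi.neg_apply, hf.smul, smul_neg]⟩

theorem smul_length (hf : IsMultilinear k f) (c : ℕ → k) :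
    IsMultilinear k fun l => c l.length • f l :=
  ⟨fun l r a b => by simp [hf.add], fun l r d a => by simp [hf.smul, smul_comm d]⟩

theorem sign_length (hf : IsMultilinear k f) (c : ℕ → ℤ) :
    IsMultilinear k fun l => (c l.length).negOnePow • f l := by
  simpa only [negOnePow_cast_smul] using
    hf.smul_length fun n => (((c n).negOnePow : ℤˣ) : ℤ)

theorem add_head (hf : IsMultilinear k f) (a b : M) (r : List M) :
    f ((a + b) :: r) = f (a :: r) + f (b :: r) := hf.add [] r a b

theorem smul_head (hf : IsMultilinear k f) (c : k) (a : M) (r : List M) :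
    f ((c • a) :: r) = c • f (a :: r) := hf.smul [] r c a

/-- The first entry as the argument of a linear map. -/
def headMap (hf : IsMultilinear k f) (r : List M) : M →ₗ[k] N where
  toFun a := f (a :: r)
  map_add' a b := hf.add_head a b r
  map_smul' c a := hf.smul_head c a r

/-- An arbitrary entry as the argument of a linear map. -/
def slotMap (hf : IsMultilinear k f) (l r : List M) : M →ₗ[k] N where
  toFun a := f (l ++ a :: r)
  map_add' a b := hf.add l r a b
  map_smul' c a := hf.smul l r c a

theorem sign_head (hf : IsMultilinear k f) (c : ℤ) (a : M) (r : List M) :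
    f ((c.negOnePow • a) :: r) = c.negOnePow • f (a :: r) := by
  simp only [Units.smul_def]
  exact map_zsmul (hf.headMap r) ((c.negOnePow : ℤˣ) : ℤ) a

theorem sign_slot (hf : IsMultilinear k f) (l r : List M) (c : ℤ) (a : M) :
    f (l ++ (c.negOnePow • a) :: r) = c.negOnePow • f (l ++ a :: r) := by
  simp only [Units.smul_def]
  exact map_zsmul (hf.slotMap l r) ((c.negOnePow : ℤˣ) : ℤ) a

theorem zero_head (hf : IsMultilinear k f) (r : List M) : f (0 :: r) = 0 :=
  map_zero (hf.headMap r)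

theorem zero_slot (hf : IsMultilinear k f) (l r : List M) : f (l ++ 0 :: r) = 0 :=
  map_zero (hf.slotMap l r)

theorem sum_slot (hf : IsMultilinear k f) {ι : Type*} (s : Finset ι) (a : ι → M)
    (l r : List M) : f (l ++ (∑ i ∈ s, a i) :: r) = ∑ i ∈ s, f (l ++ a i :: r) :=
  map_sum (hf.slotMap l r) a s

end IsMultilinear

/-- `κ` is the family of sign operators `x ↦ (-1)^{d |x|} x` of a graded space. -/
structure SignRule (𝓜 : ℤ → Submodule k M) (κ : ℤ → M →ₗ[k] M) : Prop where
  apply_mem : ∀ d i x, x ∈ 𝓜 i → κ d x = (d * i).negOnePow • x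
  span : ⨆ i, 𝓜 i = ⊤

namespace SignRule

variable {𝓜 : ℤ → Submodule k M} {κ : ℤ → M →ₗ[k] M}

theorem induction (hκ : SignRule 𝓜 κ) {p : M → Prop} (x : M) (h0 : p 0)
    (hm : ∀ i x, x ∈ 𝓜 i → p x) (ha : ∀ x y, p x → p y → p (x + y)) : p x :=
  Submodule.iSup_induction 𝓜 (motive := p) (hκ.span ▸ Submodule.mem_top) hm h0 ha

theorem add (hκ : SignRule 𝓜 κ) (d e : ℤ) (x : M) : κ (d + e) x = κ d (κ e x) := by
  induction x using hκ.induction with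
  | h0 => simp
  | hm i x hx =>
    rw [hκ.apply_mem _ i x hx, hκ.apply_mem e i x hx, Units.smul_def, Units.smul_def, map_zsmul,
      hκ.apply_mem d i x hx, ← Units.smul_def, ← Units.smul_def, negOnePow_smul_smul]
    congr 2; ring
  | ha x y hx hy => simp [hx, hy]

theorem congr (hκ : SignRule 𝓜 κ) {d e : ℤ} (h : Even (d - e)) (x : M) : κ d x = κ e x := by
  induction x using hκ.induction with
  | h0 => simp
  | hm i x hx =>
    rw [hκ.apply_mem _ i x hx, hκ.apply_mem e i x hx]
    congr 1
    apply negOnePow_congr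
    rw [← sub_mul]
    exact h.mul_right i
  | ha x y hx hy => simp [hx, hy]

theorem even (hκ : SignRule 𝓜 κ) {d : ℤ} (h : Even d) (x : M) : κ d x = x := by
  induction x using hκ.induction with
  | h0 => simp
  | hm i x hx =>
    rw [hκ.apply_mem _ i x hx, Int.negOnePow_even _ (h.mul_right i), one_smul]
  | ha x y hx hy => simp [hx, hy]

theorem zero (hκ : SignRule 𝓜 κ) (x : M) : κ 0 x = x := hκ.even Even.zero x

theorem comm (hκ : SignRule 𝓜 κ) (d e : ℤ) (x : M) : κ d (κ e x) = κ e (κ d x) := by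
  rw [← hκ.add, ← hκ.add, add_comm]

theorem mem (hκ : SignRule 𝓜 κ) {i : ℤ} {x : M} (d : ℤ) (hx : x ∈ 𝓜 i) : κ d x ∈ 𝓜 i := by
  rw [hκ.apply_mem d i x hx, Units.smul_def]
  exact zsmul_mem hx _

theorem map_zero_list (hκ : SignRule 𝓜 κ) (l : List M) : l.map (κ 0) = l := by
  rw [List.map_congr_left (g := id) fun x _ => hκ.zero x, List.map_id]

theorem map_map (hκ : SignRule 𝓜 κ) (d e : ℤ) (l : List M) :
    (l.map (κ e)).map (κ d) = l.map (κ (d + e)) := by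
  rw [List.map_map]
  exact List.map_congr_left fun x _ => (hκ.add d e x).symm

theorem map_congr (hκ : SignRule 𝓜 κ) {d e : ℤ} (h : Even (d - e)) (l : List M) :
    l.map (κ d) = l.map (κ e) :=
  List.map_congr_left fun x _ => hκ.congr h x

end SignRule

/-- The entries of a list are homogeneous of the given degrees. -/
abbrev HomList (𝓜 : ℤ → Submodule k M) (i : List ℤ) (v : List M) : Prop :=
  List.Forall₂ (fun j x => x ∈ 𝓜 j) i v

theorem HomList.apply_sign {𝓜 : ℤ → Submodule k M} {κ : ℤ → M →ₗ[k] M} (hκ : SignRule 𝓜 κ)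
    {f : List M → N} (hf : IsMultilinear k f) (d : ℤ)
    {i : List ℤ} {v : List M} (h : HomList 𝓜 i v) :
    f (v.map (κ d)) = (d * i.sum).negOnePow • f v := by
  induction h generalizing f with
  | nil => simp
  | @cons j x i v hx _ ih =>
    simp only [List.map_cons, List.sum_cons]
    rw [hκ.apply_mem d j x hx, hf.sign_head, ih (hf.cons x), negOnePow_smul_smul]
    congr 2; ring

/-- Multilinear families are determined by their values on homogeneous elements. -/
theorem IsMultilinear.ext_homogeneous {𝓜 : ℤ → Submodule k M} (h𝓜 : ⨆ i, 𝓜 i = ⊤)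
    {f g : List M → N} (hf : IsMultilinear k f) (hg : IsMultilinear k g)
    (h : ∀ i v, HomList 𝓜 i v → f v = g v) (v : List M) : f v = g v := by
  suffices H : ∀ (r l : List M) (i : List ℤ), HomList 𝓜 i l → f (l ++ r) = g (l ++ r) from
    H v [] [] .nil
  intro r
  induction r with
  | nil => intro l i hl; simpa using h i l hl
  | cons x r ih =>
    intro l i hl
    refine Submodule.iSup_induction 𝓜 (motive := fun x => f (l ++ x :: r) = g (l ++ x :: r))
      (h𝓜 ▸ Submodule.mem_top : x ∈ ⨆ i, 𝓜 i) ?_ ?_ ?_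
    · intro j x hx
      have := ih (l ++ [x]) (i ++ [j]) (List.rel_append hl (.cons hx .nil))
      simpa using this
    · rw [hf.zero_slot, hg.zero_slot]
    · intro x y hx hy
      rw [hf.add, hg.add, hx, hy]

theorem set_ofFn_update {α : Type*} {n : ℕ} (f : Fin n → α) (i : Fin n) (a : α) :
    List.ofFn (Function.update f i a) = (List.ofFn f).set i a := by
  apply List.ext_getElem (by simp)
  intro j h1 h2
  simp only [List.getElem_ofFn, List.getElem_set, Function.update_apply]
  by_cases h : (i : ℕ) = j
  · rw [if_pos h, if_pos (Fin.ext h.symm)]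
  · rw [if_neg h, if_neg fun e => h (by rw [← e])]

theorem ofFn_update_eq {α : Type*} {n : ℕ} (f : Fin n → α) (i : Fin n) (a : α) :
    List.ofFn (Function.update f i a) =
      (List.ofFn f).take i ++ a :: (List.ofFn f).drop (i + 1) := by
  rw [set_ofFn_update, List.set_eq_take_append_cons_drop, if_pos (by simp)]

theorem isMultilinear_iff (f : List M → N) : IsMultilinear k f ↔
    ∀ n : ℕ, ∃ F : MultilinearMap k (fun _ : Fin n => M) N, ∀ v, f (List.ofFn v) = F v := by
  constructor
  · intro hf n
    refine ⟨{ toFun := fun v => f (List.ofFn v), map_update_add' := ?_, map_update_smul' := ?_ },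
      fun v => rfl⟩
    · intro inst v i x y
      obtain rfl : inst = instDecidableEqFin n := Subsingleton.elim _ _
      simp only [ofFn_update_eq, hf.add]
    · intro inst v i c x
      obtain rfl : inst = instDecidableEqFin n := Subsingleton.elim _ _
      simp only [ofFn_update_eq, hf.smul]
  · intro h
    have key : ∀ (l r : List M) (x : M), l ++ x :: r =
        List.ofFn (Function.update (fun i : Fin (l ++ (0 : M) :: r).length => (l ++ (0 : M) :: r).get i)
          ⟨l.length, by simp⟩ x) := by
      intro l r x
      rw [ofFn_update_eq, List.ofFn_get]
      simp
    constructor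
    · intro l r a b
      obtain ⟨F, hF⟩ := h (l ++ (0 : M) :: r).length
      rw [key l r (a + b), key l r a, key l r b, hF, hF, hF, F.map_update_add]
    · intro l r c a
      obtain ⟨F, hF⟩ := h (l ++ (0 : M) :: r).length
      rw [key l r (c • a), key l r a, hF, hF, F.map_update_smul]

theorem mem_homProd_iff {𝒮 𝒯 : ℤ → Submodule k M} {e : ℕ → ℤ} {f : List M → M} :
    f ∈ homProd 𝒮 𝒯 e ↔ f [] = 0 ∧ IsMultilinear k f ∧
      ∀ i v, HomList 𝒮 i v → f v ∈ 𝒯 (i.sum + e v.length) := by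
  change (f [] = 0 ∧ ∀ n : ℕ, IsHomogeneousMap 𝒮 𝒯 n (e n) f) ↔ _
  rw [isMultilinear_iff]
  constructor
  · rintro ⟨h0, h⟩
    refine ⟨h0, fun n => (h n).1, fun i v hv => ?_⟩
    have hl := hv.length_eq
    have := (h v.length).2 (fun t => i[t]'(by rw [hl]; exact t.2)) v.get
      (fun t => hv.get (by rw [hl]; exact t.2) t.2)
    rw [List.ofFn_get] at this
    convert this using 2
    rw [← Fin.sum_univ_getElem]
    congr 1
    exact Fintype.sum_equiv (finCongr hl) _ _ fun _ => rfl
  · rintro ⟨h0, h1, h2⟩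
    refine ⟨h0, fun n => ⟨h1 n, fun i v hv => ?_⟩⟩
    have := h2 (List.ofFn i) (List.ofFn v) (List.forall₂_iff_get.2 ⟨by simp, fun j h1 h2 => by
      simpa using hv ⟨j, by simpa using h1⟩⟩)
    simpa [List.sum_ofFn] using this

section homProd

variable {𝒮 𝒯 : ℤ → Submodule k M} {e : ℕ → ℤ} {f : List M → M}

theorem homProd_nil (hf : f ∈ homProd 𝒮 𝒯 e) : f [] = 0 := hf.1

theorem homProd_multilinear (hf : f ∈ homProd 𝒮 𝒯 e) : IsMultilinear k f :=
  (mem_homProd_iff.1 hf).2.1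

theorem homProd_apply_mem (hf : f ∈ homProd 𝒮 𝒯 e) {i v} (h : HomList 𝒮 i v) :
    f v ∈ 𝒯 (i.sum + e v.length) :=
  (mem_homProd_iff.1 hf).2.2 i v h

/-- The Koszul rule: a homogeneous map commutes with the sign operators up to sign. -/
theorem homProd_map_sign {κ κ' : ℤ → M →ₗ[k] M} (hκ : SignRule 𝒮 κ) (hκ' : SignRule 𝒯 κ')
    (hf : f ∈ homProd 𝒮 𝒯 e) (d : ℤ) (v : List M) :
    f (v.map (κ d)) = (d * e v.length).negOnePow • κ' d (f v) := by
  have hm := homProd_multilinear hf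
  refine IsMultilinear.ext_homogeneous (k := k) hκ.span (hm.comp_map (κ d))
    ((hm.linear_comp (κ' d)).sign_length fun n => d * e n) ?_ v
  intro i v hv
  rw [hv.apply_sign hκ hm, hκ'.apply_mem _ _ _ (homProd_apply_mem hf hv), negOnePow_smul_smul]
  congr 1
  apply negOnePow_congr
  grind

end homProd

end

/-! ### Insertion of one family of maps into another -/

section

variable {k : Type u} {M : Type v} {X : Type w} [Field k] [AddCommGroup M] [Module k M]
  [AddCommGroup X] [Module k X]

/-- The sum of `Ψ (g v₁) v₂` over all ways to cut a list into a nonempty beginning `v₁` and a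
rest `v₂`. -/
def prefixSum : (List M → M) → (M → List M → X) → List M → X
  | _, _, [] => 0
  | g, Ψ, x :: t => Ψ (g [x]) t + prefixSum (fun l => g (x :: l)) Ψ t

/-- The insertion `f{g}` of a map `g` of degree `d`: the sum of `± f (v₁, g v₂, v₃)` over all ways
to cut a list into three parts, the second one nonempty. -/
def insertOp (κ : ℤ → M →ₗ[k] M) (d : ℤ) (g : List M → M) : (List M → X) → List M → X
  | _, [] => 0
  | f, x :: t => prefixSum g (fun w t' => f (w :: t')) (x :: t) +
      insertOp κ d g (fun l => f (κ d x :: l)) t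

/-- The sum of `± R (f (v₁, g v₂, ·)) v₃` over all ways to cut a list into three parts, the second
one nonempty: `R` acts on the part of the list to the right of the inserted map `g`.  The sign
operators of degrees `d` and `s` are applied to `v₁` and `v₂`. -/
def insertThen (κ : ℤ → M →ₗ[k] M) (d s : ℤ) (g : List M → M)
    (R : (List M → X) → List M → X) : (List M → X) → List M → X
  | _, [] => 0
  | f, x :: t =>
      prefixSum (fun l => g (l.map (κ s))) (fun w t' => R (fun l => f (w :: l)) t') (x :: t) +
        insertThen κ d s g R (fun l => f (κ d x :: l)) t

theorem prefixSum_add_right (g : List M → M) (Ψ Ψ' : M → List M → X) (v : List M) :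
    prefixSum g (fun w t => Ψ w t + Ψ' w t) v = prefixSum g Ψ v + prefixSum g Ψ' v := by
  induction v generalizing g with
  | nil => simp [prefixSum]
  | cons x t ih => simp only [prefixSum, ih]; abel

theorem prefixSum_map_right {Y : Type*} [AddCommGroup Y] (φ : X →+ Y) (g : List M → M)
    (Ψ : M → List M → X) (v : List M) :
    prefixSum g (fun w t => φ (Ψ w t)) v = φ (prefixSum g Ψ v) := by
  induction v generalizing g with
  | nil => simp [prefixSum]
  | cons x t ih => simp only [prefixSum, ih, map_add]

theorem prefixSum_add_left (g g' : List M → M) {Ψ : M → List M → X}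
    (hΨ : ∀ t a b, Ψ (a + b) t = Ψ a t + Ψ b t) (v : List M) :
    prefixSum (fun l => g l + g' l) Ψ v = prefixSum g Ψ v + prefixSum g' Ψ v := by
  induction v generalizing g g' with
  | nil => simp [prefixSum]
  | cons x t ih => simp only [prefixSum, ih, hΨ]; abel

theorem prefixSum_smul_left (c : k) (g : List M → M) {Ψ : M → List M → X}
    (hΨ : ∀ t a, Ψ (c • a) t = c • Ψ a t) (v : List M) :
    prefixSum (fun l => c • g l) Ψ v = c • prefixSum g Ψ v := by
  induction v generalizing g with
  | nil => simp [prefixSum]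
  | cons x t ih => simp only [prefixSum, ih, hΨ, smul_add]

theorem prefixSum_sign_left (c : ℤ) (g : List M → M) {Ψ : M → List M → X}
    (hΨ : ∀ t a, Ψ (c.negOnePow • a) t = c.negOnePow • Ψ a t) (v : List M) :
    prefixSum (fun l => c.negOnePow • g l) Ψ v = c.negOnePow • prefixSum g Ψ v := by
  induction v generalizing g with
  | nil => simp [prefixSum]
  | cons x t ih => simp only [prefixSum, ih, hΨ, smul_add]

/-- Two successive cuts: `g` consumes a beginning of the list, and then `f` consumes the output of
`g` together with a beginning of the rest. -/
theorem prefixSum_prefixSum (g f : List M → M) {Ψ : M → List M → X}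
    (hΨ : ∀ t a b, Ψ (a + b) t = Ψ a t + Ψ b t) (v : List M) :
    prefixSum g (fun w t => prefixSum f Ψ (w :: t)) v =
      prefixSum (prefixSum g fun w t => f (w :: t)) Ψ v := by
  induction v generalizing g with
  | nil => simp [prefixSum]
  | cons x t ih =>
    have h : prefixSum (fun l => g (x :: l)) (fun w t => f (w :: t)) ([] : List M) = 0 := rfl
    conv_lhs => rw [prefixSum, ih]
    simp only [prefixSum]
    rw [prefixSum_add_left _ _ hΨ]
    simp only [add_zero]
    abel

variable (κ : ℤ → M →ₗ[k] M)

theorem insertOp_add (d : ℤ) (g : List M → M) (f f' : List M → X) (v : List M) :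
    insertOp κ d g (fun l => f l + f' l) v = insertOp κ d g f v + insertOp κ d g f' v := by
  induction v generalizing f f' with
  | nil => simp [insertOp]
  | cons x t ih => simp only [insertOp, ih, prefixSum_add_right]; abel

theorem insertOp_map {Y : Type*} [AddCommGroup Y] (φ : X →+ Y) (d : ℤ)
    (g : List M → M) (f : List M → X) (v : List M) :
    insertOp κ d g (fun l => φ (f l)) v = φ (insertOp κ d g f v) := by
  induction v generalizing f with
  | nil => simp [insertOp]
  | cons x t ih => simp only [insertOp, ih, prefixSum_map_right, map_add]

theorem insertOp_sign (c d : ℤ) (g : List M → M) (f : List M → X) (v : List M) :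
    insertOp κ d g (fun l => c.negOnePow • f l) v = c.negOnePow • insertOp κ d g f v :=
  insertOp_map κ (DistribSMul.toAddMonoidHom X c.negOnePow) d g f v

theorem insertOp_add_left (d : ℤ) (g g' : List M → M) {f : List M → X} (hf : IsMultilinear k f)
    (v : List M) :
    insertOp κ d (fun l => g l + g' l) f v = insertOp κ d g f v + insertOp κ d g' f v := by
  induction v generalizing f with
  | nil => simp [insertOp]
  | cons x t ih =>
    simp only [insertOp]
    rw [ih (hf.cons _), prefixSum_add_left _ _ fun t a b => hf.add_head a b t]
    abel

theorem insertOp_smul_left (c : k) (d : ℤ) (g : List M → M) {f : List M → X}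
    (hf : IsMultilinear k f) (v : List M) :
    insertOp κ d (fun l => c • g l) f v = c • insertOp κ d g f v := by
  induction v generalizing f with
  | nil => simp [insertOp]
  | cons x t ih =>
    simp only [insertOp]
    rw [ih (hf.cons _), prefixSum_smul_left _ _ fun t a => hf.smul_head c a t, smul_add]

theorem insertOp_sign_left (c d : ℤ) (g : List M → M) {f : List M → X}
    (hf : IsMultilinear k f) (v : List M) :
    insertOp κ d (fun l => c.negOnePow • g l) f v = c.negOnePow • insertOp κ d g f v := by
  simpa only [negOnePow_cast_smul] using
    insertOp_smul_left κ (((c.negOnePow : ℤˣ) : ℤ) : k) d g hf v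

/-- Inserting `g` after `f` has consumed a beginning of the list: `g` lands either inside `f` or to
the right of it. -/
theorem insertOp_prefixSum (d : ℤ) (g f : List M → M) {Ψ : M → List M → X}
    (hΨ : ∀ t a b, Ψ (a + b) t = Ψ a t + Ψ b t) (v : List M) :
    insertOp κ d g (prefixSum f Ψ) v =
      prefixSum (insertOp κ d g f) Ψ v +
        prefixSum (fun l => f (l.map (κ d))) (fun w => insertOp κ d g (Ψ w)) v := by
  induction v generalizing f with
  | nil => simp [insertOp, prefixSum]
  | cons x t ih =>
    have h1 : insertOp κ d g (fun l => prefixSum f Ψ (κ d x :: l)) t =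
        insertOp κ d g (Ψ (f [κ d x])) t +
          insertOp κ d g (prefixSum (fun l => f (κ d x :: l)) Ψ) t :=
      insertOp_add κ d g (Ψ (f [κ d x])) _ t
    have h2 : prefixSum (insertOp κ d g f) Ψ (x :: t) =
        prefixSum (prefixSum g fun w t => f (w :: t)) Ψ (x :: t) +
          prefixSum (insertOp κ d g fun l => f (κ d x :: l)) Ψ t := by
      conv_lhs => rw [prefixSum]
      conv_rhs => rw [prefixSum]
      simp only [insertOp, add_zero]
      rw [prefixSum_add_left _ _ hΨ]
      abel
    conv_lhs => rw [insertOp]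
    rw [h1, ih, h2, prefixSum_prefixSum _ _ hΨ]
    conv_rhs => enter [2]; rw [prefixSum]
    simp only [List.map_cons, List.map_nil]
    abel

variable {κ} {𝓜 : ℤ → Submodule k M}

/-- The graded pre-Lie identity: inserting two maps one after the other is inserting the composite,
plus inserting them side by side in the two possible orders. -/
theorem insertOp_insertOp (hκ : SignRule 𝓜 κ) (d e : ℤ) {f g : List M → M}
    (hg : ∀ v, g (v.map (κ d)) = (d * e).negOnePow • κ d (g v))
    {h : List M → X} (hh : IsMultilinear k h) (v : List M) :
    insertOp κ e g (insertOp κ d f h) v =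
      insertOp κ (d + e) (insertOp κ e g f) h v + insertThen κ (d + e) e f (insertOp κ e g) h v +
        (d * e).negOnePow • insertThen κ (d + e) d g (insertOp κ d f) h v := by
  induction v generalizing h with
  | nil => simp [insertOp, insertThen]
  | cons x t ih =>
    -- If `g` is inserted at the beginning of the list, `f` is inserted around it or to the right of
    -- it.
    have h1 : prefixSum g (fun w t' => insertOp κ d f h (w :: t')) (x :: t) =
        prefixSum g (fun w t' => prefixSum f (fun w' t => h (w' :: t)) (w :: t')) (x :: t) +
        prefixSum g (fun w t' => insertOp κ d f (fun l => h (κ d w :: l)) t') (x :: t) := by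
      rw [← prefixSum_add_right]
      rfl
    -- If `g` is inserted later, `f` is inserted at the beginning of the list, or later too.
    have h2 : insertOp κ e g (fun l => insertOp κ d f h (κ e x :: l)) t =
        insertOp κ e g (fun l => prefixSum f (fun w' t => h (w' :: t)) (κ e x :: l)) t +
        insertOp κ e g (insertOp κ d f fun l => h (κ d (κ e x) :: l)) t := by
      rw [← insertOp_add]
      rfl
    have h3 : prefixSum g (fun w t' => prefixSum f (fun w' t => h (w' :: t)) (w :: t')) (x :: t) +
        insertOp κ e g (fun l => prefixSum f (fun w' t => h (w' :: t)) (κ e x :: l)) t =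
        insertOp κ e g (prefixSum f fun w t => h (w :: t)) (x :: t) := rfl
    -- The Koszul rule: the sign operator for `f` is moved from the output of `g` to its inputs.
    have h4 : prefixSum g (fun w t' => insertOp κ d f (fun l => h (κ d w :: l)) t') (x :: t) =
        (d * e).negOnePow • prefixSum (fun l => g (l.map (κ d)))
          (fun w t' => insertOp κ d f (fun l => h (w :: l)) t') (x :: t) := by
      have : ∀ (g : List M → M) (v : List M),
          prefixSum g (fun w t' => insertOp κ d f (fun l => h (κ d w :: l)) t') v =
          prefixSum (fun l => κ d (g l)) (fun w t' => insertOp κ d f (fun l => h (w :: l)) t') v := by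
        intro g v
        induction v generalizing g with
        | nil => rfl
        | cons x t ih => simp only [prefixSum, ih]
      rw [this]
      simp only [hg]
      rw [prefixSum_sign_left, negOnePow_smul_self]
      intro t a
      rw [← insertOp_sign]
      congr 1
      funext l
      rw [hh.sign_head]
    rw [insertOp, h1, h2, add_add_add_comm, h3, insertOp_prefixSum κ e g f fun t a b => hh.add_head a b t,
      h4, ih (hh.cons _), ← hκ.add, insertThen, insertThen, insertOp, smul_add]
    abel

/-! ### The graded Lie algebra of families of maps -/

theorem prefixSum_multilinear {g : List M → M} (hg : IsMultilinear k g) {f : List M → X}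
    (hf : IsMultilinear k f) : IsMultilinear k (prefixSum g fun w t => f (w :: t)) := by
  constructor
  · intro l r a b
    induction l generalizing g with
    | nil =>
      simp only [List.nil_append, prefixSum, hg.add_head, hf.add_head]
      rw [prefixSum_add_left _ _ fun t a b => hf.add_head a b t]
      abel
    | cons x l ih =>
      simp only [List.cons_append, prefixSum]
      rw [ih (hg.cons x), ← List.cons_append, hf.add]
      simp only [List.cons_append]
      abel
  · intro l r c a
    induction l generalizing g with
    | nil =>
      simp only [List.nil_append, prefixSum, hg.smul_head, hf.smul_head]
      rw [prefixSum_smul_left _ _ fun t a => hf.smul_head c a t, smul_add]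
    | cons x l ih =>
      simp only [List.cons_append, prefixSum]
      rw [ih (hg.cons x), ← List.cons_append, hf.smul]
      simp only [List.cons_append, smul_add]

theorem insertOp_multilinear (d : ℤ) {g : List M → M} (hg : IsMultilinear k g) {f : List M → X}
    (hf : IsMultilinear k f) : IsMultilinear k (insertOp κ d g f) := by
  have hp := prefixSum_multilinear hg hf
  constructor
  · intro l r a b
    induction l generalizing f with
    | nil =>
      have h := (prefixSum_multilinear hg hf).add_head a b r
      simp only [List.nil_append, insertOp, map_add, hf.add_head]
      rw [h, insertOp_add]
      abel
    | cons x l ih =>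
      have h := (prefixSum_multilinear hg hf).add (x :: l) r a b
      simp only [List.cons_append, insertOp] at h ⊢
      rw [h, ih (hf.cons _) (prefixSum_multilinear hg (hf.cons _))]
      abel
  · intro l r c a
    induction l generalizing f with
    | nil =>
      have h := (prefixSum_multilinear hg hf).smul_head c a r
      simp only [List.nil_append, insertOp, map_smul, hf.smul_head]
      rw [h, smul_add]
      congr 1
      exact insertOp_map κ (DistribSMul.toAddMonoidHom X c) d g _ r
    | cons x l ih =>
      have h := (prefixSum_multilinear hg hf).smul (x :: l) r c a
      simp only [List.cons_append, insertOp] at h ⊢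
      rw [h, ih (hf.cons _) (prefixSum_multilinear hg (hf.cons _)), smul_add]

theorem prefixSum_mem {d e : ℤ} {g f : List M → M}
    (hg : ∀ i v, HomList 𝓜 i v → g v ∈ 𝓜 (i.sum + d))
    (hf : ∀ i v, HomList 𝓜 i v → f v ∈ 𝓜 (i.sum + e)) {i : List ℤ} {v : List M}
    (hv : HomList 𝓜 i v) : prefixSum g (fun w t => f (w :: t)) v ∈ 𝓜 (i.sum + (d + e)) := by
  induction hv generalizing g d with
  | nil => exact zero_mem _
  | @cons j x i v hx hv ih =>
    refine add_mem ?_ ?_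
    · convert hf _ _ (.cons (hg [j] [x] (.cons hx .nil)) hv) using 2
      simp only [List.sum_cons, List.sum_nil]; ring
    · have := ih (d := j + d) (g := fun l => g (x :: l)) fun i' v' h' => by
        convert hg _ _ (.cons hx h') using 2
        simp only [List.sum_cons]; ring
      convert this using 2
      simp only [List.sum_cons]; ring

theorem insertOp_mem (hκ : SignRule 𝓜 κ) (c : ℤ) {d e : ℤ} {g f : List M → M}
    (hg : ∀ i v, HomList 𝓜 i v → g v ∈ 𝓜 (i.sum + d))
    (hf : ∀ i v, HomList 𝓜 i v → f v ∈ 𝓜 (i.sum + e)) {i : List ℤ} {v : List M}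
    (hv : HomList 𝓜 i v) : insertOp κ c g f v ∈ 𝓜 (i.sum + (d + e)) := by
  induction hv generalizing f e with
  | nil => exact zero_mem _
  | @cons j x i v hx hv ih =>
    refine add_mem (prefixSum_mem hg hf (.cons hx hv)) ?_
    have := ih (e := j + e) (f := fun l => f (κ c x :: l)) fun i' v' h' => by
      convert hf _ _ (.cons (hκ.mem c hx) h') using 2
      simp only [List.sum_cons]; ring
    convert this using 2
    simp only [List.sum_cons]; ring

variable (𝓜) in
/-- Families of maps of degree `d` of the graded space `𝓜`. -/
abbrev graded (d : ℤ) : Submodule k (List M → M) := homProd 𝓜 𝓜 fun _ => d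

theorem insertOp_mem_graded (hκ : SignRule 𝓜 κ) {d e c : ℤ} {f g : List M → M}
    (hf : f ∈ graded 𝓜 d) (hg : g ∈ graded 𝓜 e) (hc : c = d + e) :
    insertOp κ e g f ∈ graded 𝓜 c := by
  subst hc
  refine mem_homProd_iff.2 ⟨rfl, insertOp_multilinear e (homProd_multilinear hg)
    (homProd_multilinear hf), fun i v hv => ?_⟩
  convert insertOp_mem hκ e (fun i v h => homProd_apply_mem hg h)
    (fun i v h => homProd_apply_mem hf h) hv using 2
  ring

variable (κ) in
/-- The graded commutator `f{g} - (-1)^{de} g{f}` of maps of degrees `d` and `e`. -/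
def lieBr (d e : ℤ) (f g : List M → M) : List M → M :=
  insertOp κ e g f - (d * e).negOnePow • insertOp κ d f g

theorem lieBr_mem (hκ : SignRule 𝓜 κ) {d e : ℤ} {f g : List M → M}
    (hf : f ∈ graded 𝓜 d) (hg : g ∈ graded 𝓜 e) : lieBr κ d e f g ∈ graded 𝓜 (d + e) := by
  refine sub_mem (insertOp_mem_graded hκ hf hg rfl) ?_
  rw [Units.smul_def]
  exact zsmul_mem (insertOp_mem_graded hκ hg hf (add_comm _ _)) _

theorem lieBr_antisymm (d e : ℤ) (f g : List M → M) :
    lieBr κ e d g f = -((d * e).negOnePow • lieBr κ d e f g) := by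
  unfold lieBr
  rw [smul_sub, negOnePow_smul_self, mul_comm e d]
  abel

theorem graded_sign {d : ℤ} {f : List M → M} (hκ : SignRule 𝓜 κ) (hf : f ∈ graded 𝓜 d) (c : ℤ)
    (v : List M) : f (v.map (κ c)) = (c * d).negOnePow • κ c (f v) :=
  homProd_map_sign hκ hκ hf c v

theorem insertOp_lieBr (c d e : ℤ) {f g h : List M → M} (hh : IsMultilinear k h) :
    insertOp κ c (lieBr κ d e f g) h = insertOp κ c (insertOp κ e g f) h -
      (d * e).negOnePow • insertOp κ c (insertOp κ d f g) h := by
  funext v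
  have h1 := insertOp_add_left κ c (insertOp κ e g f)
    (fun l => (d * e + 1).negOnePow • (insertOp κ d f g) l) hh v
  rw [insertOp_sign_left κ _ _ _ hh] at h1
  simp only [Int.negOnePow_succ, Units.neg_smul] at h1
  simp only [Pi.sub_apply, Pi.smul_apply, sub_eq_add_neg]
  rw [← h1]
  congr 1
  funext l
  simp [lieBr, sub_eq_add_neg]

theorem insertOp_of_lieBr (c d e : ℤ) (f g h : List M → M) :
    insertOp κ c h (lieBr κ d e f g) = insertOp κ c h (insertOp κ e g f) -
      (d * e).negOnePow • insertOp κ c h (insertOp κ d f g) := by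
  funext v
  have h1 := insertOp_add κ c h (insertOp κ e g f)
    (fun l => (d * e + 1).negOnePow • (insertOp κ d f g) l) v
  rw [insertOp_sign κ] at h1
  simp only [Int.negOnePow_succ, Units.neg_smul] at h1
  simp only [Pi.sub_apply, Pi.smul_apply, sub_eq_add_neg]
  rw [← h1]
  congr 1
  funext l
  simp [lieBr, sub_eq_add_neg]

/-- The graded Jacobi identity, as a derivation property of `[·, h]`. -/
theorem lieBr_jacobi (hκ : SignRule 𝓜 κ) {d e c : ℤ} {f g h : List M → M}
    (hf : f ∈ graded 𝓜 d) (hg : g ∈ graded 𝓜 e) (hh : h ∈ graded 𝓜 c) :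
    lieBr κ (d + e) c (lieBr κ d e f g) h =
      lieBr κ d (e + c) f (lieBr κ e c g h) +
        (c * e).negOnePow • lieBr κ (d + c) e (lieBr κ d c f h) g := by
  have mf := homProd_multilinear hf
  have mg := homProd_multilinear hg
  have mh := homProd_multilinear hh
  -- In the pre-Lie identity, the terms with two maps inserted side by side are symmetric in these
  -- maps up to the Koszul sign, so that they cancel below.
  have key : ∀ {a b : ℤ} {p q r : List M → M}, q ∈ graded 𝓜 b → IsMultilinear k r →
      insertOp κ b q (insertOp κ a p r) = insertOp κ (a + b) (insertOp κ b q p) r +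
        (insertThen κ (a + b) b p (insertOp κ b q) r +
          (a * b).negOnePow • insertThen κ (a + b) a q (insertOp κ a p) r) := by
    intro a b p q r hq hr
    funext v
    rw [insertOp_insertOp hκ a b (fun v => graded_sign hκ hq a v) hr, add_assoc]
    rfl
  unfold lieBr
  change insertOp κ c h (lieBr κ d e f g) - _ • insertOp κ (d + e) (lieBr κ d e f g) h =
    insertOp κ (e + c) (lieBr κ e c g h) f - _ • insertOp κ d f (lieBr κ e c g h) +
    _ • (insertOp κ e g (lieBr κ d c f h) - _ • insertOp κ (d + c) (lieBr κ d c f h) g)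
  simp only [insertOp_of_lieBr, insertOp_lieBr _ _ _ mf, insertOp_lieBr _ _ _ mg,
    insertOp_lieBr _ _ _ mh]
  rw [key hh mf, key hh mg, key hf mg, key hf mh, key hg mf, key hg mh]
  simp only [add_mul, mul_add, Int.negOnePow_add, mul_comm e d, mul_comm c d, mul_comm c e,
    add_comm e d, add_comm c d, add_comm c e]
  -- All signs are products of those of `d * e`, `d * c` and `e * c`.
  rcases Int.units_eq_one_or (d * e).negOnePow with h1 | h1 <;>
  rcases Int.units_eq_one_or (d * c).negOnePow with h2 | h2 <;>
  rcases Int.units_eq_one_or (e * c).negOnePow with h3 | h3 <;>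
  · simp only [h1, h2, h3, one_smul, Units.neg_smul, mul_one, mul_neg, neg_neg]
    abel

end

/-! ### Higher derived brackets -/

/-- A graded Lie algebra `𝔏` (with bracket `br d e` of elements of degrees `d` and `e`) together with
a projection `P` onto an abelian subalgebra whose kernel is a subalgebra too; `P_br` is the form in
which the latter is used. -/
structure DerivedBracketData {k : Type u} {E : Type v} [Field k] [AddCommGroup E] [Module k E]
    (𝔏 : ℤ → Submodule k E) (br : ℤ → ℤ → E → E → E) (P : E →ₗ[k] E) : Prop where
  mem : ∀ {d e f g}, f ∈ 𝔏 d → g ∈ 𝔏 e → br d e f g ∈ 𝔏 (d + e)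
  add_left : ∀ {d e f f' g}, g ∈ 𝔏 e → br d e (f + f') g = br d e f g + br d e f' g
  smul_left : ∀ {d e f g} (c : k), g ∈ 𝔏 e → br d e (c • f) g = c • br d e f g
  antisymm : ∀ {d e f g}, br e d g f = -((d * e).negOnePow • br d e f g)
  jacobi : ∀ {d e c f g h}, f ∈ 𝔏 d → g ∈ 𝔏 e → h ∈ 𝔏 c → br (d + e) c (br d e f g) h =
    br d (e + c) f (br e c g h) + (c * e).negOnePow • br (d + c) e (br d c f h) g
  P_idem : ∀ f, P (P f) = P f
  P_mem : ∀ {d f}, f ∈ 𝔏 d → P f ∈ 𝔏 d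
  P_br : ∀ {d e f g}, f ∈ 𝔏 d → g ∈ 𝔏 e →
    P (br d e f g) = P (br d e (P f) g) + P (br d e f (P g))
  P_comm : ∀ {d e f g}, f ∈ 𝔏 d → g ∈ 𝔏 e → br d e (P f) (P g) = 0

/-- An argument of the derived brackets: an element `H` of degree `p - 1` of the Lie algebra and an
element `a` of degree `p` of its abelian subalgebra. -/
structure Entry (E : Type v) where
  p : ℤ
  H : E
  a : E

/-- The total degree of a list of arguments. -/
def totalP {E : Type v} (A : List (Entry E)) : ℤ := (A.map Entry.p).sum

section Splits

variable {E : Type v}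

@[simp] theorem totalP_nil : totalP ([] : List (Entry E)) = 0 := rfl

@[simp] theorem totalP_cons (t : Entry E) (A : List (Entry E)) :
    totalP (t :: A) = t.p + totalP A := by simp [totalP]

@[simp] theorem totalP_append (A B : List (Entry E)) :
    totalP (A ++ B) = totalP A + totalP B := by simp [totalP]

variable {X : Type w} [AddCommGroup X]

/-- The sum of `± Φ A B` over all ways to distribute the members of a list over two sublists `A` and
`B`.  Lists of arguments are written in reverse order, and the sign is the Koszul sign of moving `A`
in front of `B`. -/
def splitSum : (List (Entry E) → List (Entry E) → X) → List (Entry E) → X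
  | Φ, [] => Φ [] []
  | Φ, t :: L => splitSum (fun A B => (t.p * totalP B).negOnePow • Φ (t :: A) B) L +
      splitSum (fun A B => Φ A (t :: B)) L

theorem splitSum_congr {L : List (Entry E)} {Φ Ψ : List (Entry E) → List (Entry E) → X}
    (h : ∀ A B, (∀ t ∈ A, t ∈ L) → (∀ t ∈ B, t ∈ L) → totalP A + totalP B = totalP L →
      A.length + B.length = L.length → Φ A B = Ψ A B) : splitSum Φ L = splitSum Ψ L := by
  induction L generalizing Φ Ψ with
  | nil => exact h [] [] (by simp) (by simp) (by simp) (by simp)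
  | cons t L ih =>
    simp only [splitSum]
    congr 1
    · refine ih fun A B hA hB hp hl => ?_
      rw [h (t :: A) B (by simp; grind) (by simp; grind) (by simp; lia) (by simp; lia)]
    · exact ih fun A B hA hB hp hl =>
        h A (t :: B) (by simp; grind) (by simp; grind) (by simp; lia) (by simp; lia)

theorem splitSum_add (Φ Ψ : List (Entry E) → List (Entry E) → X) (L : List (Entry E)) :
    splitSum (fun A B => Φ A B + Ψ A B) L = splitSum Φ L + splitSum Ψ L := by
  induction L generalizing Φ Ψ with
  | nil => rfl
  | cons t L ih => simp only [splitSum, smul_add, ih]; abel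

theorem splitSum_map {Y : Type*} [AddCommGroup Y] (φ : X →+ Y)
    (Φ : List (Entry E) → List (Entry E) → X) (L : List (Entry E)) :
    splitSum (fun A B => φ (Φ A B)) L = φ (splitSum Φ L) := by
  induction L generalizing Φ with
  | nil => rfl
  | cons t L ih =>
    have h : ∀ A B, (t.p * totalP B).negOnePow • φ (Φ (t :: A) B) =
        φ ((t.p * totalP B).negOnePow • Φ (t :: A) B) := fun A B => by
      rw [Units.smul_def, Units.smul_def, map_zsmul]
    simp only [splitSum, map_add, h, ih]

theorem splitSum_sign (c : ℤ) (Φ : List (Entry E) → List (Entry E) → X) (L : List (Entry E)) :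
    splitSum (fun A B => c.negOnePow • Φ A B) L = c.negOnePow • splitSum Φ L :=
  splitSum_map (DistribSMul.toAddMonoidHom X c.negOnePow) Φ L

theorem splitSum_zero (L : List (Entry E)) :
    splitSum (fun _ _ => (0 : X)) L = 0 := by
  induction L with
  | nil => rfl
  | cons t L ih => simp only [splitSum, smul_zero, ih, add_zero]

/-- Only the distribution with `A` empty contributes. -/
theorem splitSum_nil_left (Ψ : List (Entry E) → X) (L : List (Entry E)) :
    splitSum (fun A B => if A = [] then Ψ B else 0) L = Ψ L := by
  induction L generalizing Ψ with
  | nil => rfl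
  | cons t L ih => simp [splitSum, splitSum_zero, ih fun B => Ψ (t :: B)]

/-- The two sublists can be exchanged, up to the Koszul sign. -/
theorem splitSum_symm (Φ : List (Entry E) → List (Entry E) → X) (L : List (Entry E)) :
    splitSum Φ L = splitSum (fun A B => (totalP A * totalP B).negOnePow • Φ B A) L := by
  induction L generalizing Φ with
  | nil => simp [splitSum]
  | cons t L ih =>
    rw [splitSum, splitSum, ih, add_comm, ih]
    congr 1
    · refine splitSum_congr fun A B _ _ _ _ => ?_
      rw [negOnePow_smul_smul]
      congr 1
      apply negOnePow_congr
      simp only [totalP_cons]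
      grind
    · refine splitSum_congr fun A B _ _ _ _ => ?_
      rw [negOnePow_smul_smul]
      congr 1
      apply negOnePow_congr
      simp only [totalP_cons]
      grind

end Splits

namespace DerivedBracketData

variable {k : Type u} {E : Type v} [Field k] [AddCommGroup E] [Module k E]
  {𝔏 : ℤ → Submodule k E} {br : ℤ → ℤ → E → E → E} {P : E →ₗ[k] E}

theorem sign_mem {d : ℤ} {f : E} (c : ℤ) (hf : f ∈ 𝔏 d) : c.negOnePow • f ∈ 𝔏 d := by
  rw [Units.smul_def]
  exact zsmul_mem hf _

theorem sign_left (hD : DerivedBracketData 𝔏 br P) {d e : ℤ} {f g : E} (c : ℤ) (hg : g ∈ 𝔏 e) :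
    br d e (c.negOnePow • f) g = c.negOnePow • br d e f g := by
  simpa only [negOnePow_cast_smul] using
    hD.smul_left (d := d) (f := f) (((c.negOnePow : ℤˣ) : ℤ) : k) hg

theorem zero_left (hD : DerivedBracketData 𝔏 br P) {d e : ℤ} {g : E} (hg : g ∈ 𝔏 e) :
    br d e 0 g = 0 := by
  simpa using hD.smul_left (d := d) (f := 0) (0 : k) hg

theorem add_right (hD : DerivedBracketData 𝔏 br P) {d e : ℤ} {f g g' : E} (hf : f ∈ 𝔏 d) :
    br d e f (g + g') = br d e f g + br d e f g' := by
  rw [hD.antisymm (d := e) (e := d), hD.add_left hf, hD.antisymm (d := e) (e := d) (f := g),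
    hD.antisymm (d := e) (e := d) (f := g'), smul_add, neg_add]

theorem smul_right (hD : DerivedBracketData 𝔏 br P) {d e : ℤ} {f g : E} (c : k) (hf : f ∈ 𝔏 d) :
    br d e f (c • g) = c • br d e f g := by
  rw [hD.antisymm (d := e) (e := d), hD.smul_left c hf, hD.antisymm (d := e) (e := d) (f := g),
    smul_neg, smul_comm]

theorem sign_right (hD : DerivedBracketData 𝔏 br P) {d e : ℤ} {f g : E} (c : ℤ) (hf : f ∈ 𝔏 d) :
    br d e f (c.negOnePow • g) = c.negOnePow • br d e f g := by
  simpa only [negOnePow_cast_smul] using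
    hD.smul_right (e := e) (g := g) (((c.negOnePow : ℤˣ) : ℤ) : k) hf

variable (𝔏 P) in
/-- The conditions on an argument of the derived brackets. -/
def Valid (t : Entry E) : Prop := t.H ∈ 𝔏 (t.p - 1) ∧ t.a ∈ 𝔏 t.p ∧ P t.H = 0 ∧ P t.a = t.a

variable (br) in
/-- The iterated bracket `[…[f, a₁],…, aₙ]` for `f` of degree `e`, the arguments being listed in
reverse order. -/
def iter (e : ℤ) (f : E) : List (Entry E) → E
  | [] => f
  | t :: A => br (e + totalP A) t.p (iter e f A) t.a

variable (br) in
/-- The sum of the iterated brackets `± […[Hᵢ, a₁],…, aₙ]` without `aᵢ`, over all `i`, the arguments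
being listed in reverse order.  Its projection is the derived bracket of the arguments. -/
def derived : List (Entry E) → E
  | [] => 0
  | t :: A => br (totalP A - 1) t.p (derived A) t.a +
      (t.p * totalP A).negOnePow • iter br (t.p - 1) t.H A

variable (hD : DerivedBracketData 𝔏 br P)
include hD

theorem iter_mem {e : ℤ} {f : E} (hf : f ∈ 𝔏 e) {A : List (Entry E)}
    (hA : ∀ t ∈ A, Valid 𝔏 P t) : iter br e f A ∈ 𝔏 (e + totalP A) := by
  induction A with
  | nil => simpa [iter] using hf
  | cons t A ih =>
    have := hD.mem (ih fun s hs => hA s (by simp [hs])) (hA t (by simp)).2.1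
    rwa [totalP_cons, add_comm t.p, ← add_assoc]

theorem iter_zero {e : ℤ} {A : List (Entry E)} (hA : ∀ t ∈ A, Valid 𝔏 P t) :
    iter br e 0 A = 0 := by
  induction A with
  | nil => rfl
  | cons t A ih =>
    rw [iter, ih fun s hs => hA s (by simp [hs]), hD.zero_left (hA t (by simp)).2.1]

theorem iter_sign {e : ℤ} (c : ℤ) {f : E} {A : List (Entry E)} (hA : ∀ t ∈ A, Valid 𝔏 P t) :
    iter br e (c.negOnePow • f) A = c.negOnePow • iter br e f A := by
  induction A with
  | nil => rfl
  | cons t A ih =>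
    rw [iter, ih fun s hs => hA s (by simp [hs]), hD.sign_left _ (hA t (by simp)).2.1, iter]

theorem derived_mem {A : List (Entry E)} (hA : ∀ t ∈ A, Valid 𝔏 P t) :
    derived br A ∈ 𝔏 (totalP A - 1) := by
  induction A with
  | nil => exact zero_mem _
  | cons t A ih =>
    have hA' : ∀ s ∈ A, Valid 𝔏 P s := fun s hs => hA s (by simp [hs])
    refine add_mem ?_ (sign_mem _ ?_)
    · have := hD.mem (ih hA') (hA t (by simp)).2.1
      convert this using 2
      simp only [totalP_cons]; ring
    · have := hD.iter_mem (hA t (by simp)).1 hA'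
      convert this using 2
      simp only [totalP_cons]; ring

/-- The bracket with an element, as an additive map. -/
def brHom {e : ℤ} {g : E} (d : ℤ) (hg : g ∈ 𝔏 e) : E →+ E :=
  AddMonoidHom.mk' (fun f => br d e f g) fun _ _ => hD.add_left hg

/-- The Leibniz rule for iterated brackets. -/
theorem iter_br {d e : ℤ} {f g : E} (hf : f ∈ 𝔏 d) (hg : g ∈ 𝔏 e) {L : List (Entry E)}
    (hL : ∀ t ∈ L, Valid 𝔏 P t) :
    iter br (d + e) (br d e f g) L = splitSum (fun A B => (totalP A * e).negOnePow •
      br (d + totalP A) (e + totalP B) (iter br d f A) (iter br e g B)) L := by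
  induction L with
  | nil => simp [splitSum, iter]
  | cons t L ih =>
    have hL' : ∀ s ∈ L, Valid 𝔏 P s := fun s hs => hL s (by simp [hs])
    have ht := (hL t (by simp)).2.1
    rw [iter, ih hL']
    change hD.brHom (d + e + totalP L) ht _ = _
    rw [← splitSum_map, splitSum, ← splitSum_add]
    refine splitSum_congr fun A B hA hB hp _ => ?_
    have hA' : ∀ s ∈ A, Valid 𝔏 P s := fun s hs => hL' s (hA s hs)
    have hB' : ∀ s ∈ B, Valid 𝔏 P s := fun s hs => hL' s (hB s hs)
    change br (d + e + totalP L) t.p _ t.a = _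
    rw [hD.sign_left _ ht, ← hp,
      show d + e + (totalP A + totalP B) = (d + totalP A) + (e + totalP B) by ring,
      hD.jacobi (hD.iter_mem hf hA') (hD.iter_mem hg hB') ht, smul_add, add_comm]
    simp only [negOnePow_smul_smul, iter, totalP_cons]
    rw [show d + (t.p + totalP A) = d + totalP A + t.p by ring,
      show e + (t.p + totalP B) = e + totalP B + t.p by ring]
    congr 2
    apply negOnePow_congr
    grind

/-- The first of the arguments (the last member of the list) can be moved to the end, because the
arguments commute with each other. -/
theorem iter_append {e : ℤ} {f : E} (hf : f ∈ 𝔏 e) {z : Entry E} (hz : z.a ∈ 𝔏 z.p)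
    (hz' : P z.a = z.a) {B : List (Entry E)} (hB : ∀ t ∈ B, Valid 𝔏 P t) :
    iter br e f (B ++ [z]) =
      (z.p * totalP B).negOnePow • br (e + totalP B) z.p (iter br e f B) z.a := by
  induction B with
  | nil => simp [iter]
  | cons t B ih =>
    have hB' : ∀ s ∈ B, Valid 𝔏 P s := fun s hs => hB s (by simp [hs])
    obtain ⟨-, ht, -, ht'⟩ := hB t (by simp)
    have h0 : br z.p t.p z.a t.a = 0 := by rw [← hz', ← ht']; exact hD.P_comm hz ht
    have h1 := hD.jacobi (hD.iter_mem hf hB') hz ht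
    have h2 : br (e + totalP B) (z.p + t.p) (iter br e f B) 0 = 0 := by
      rw [hD.antisymm (d := z.p + t.p), hD.zero_left (hD.iter_mem hf hB'), smul_zero, neg_zero]
    rw [h0, h2, zero_add] at h1
    rw [List.cons_append, iter, ih hB', hD.sign_left _ ht, totalP_append, totalP_cons, totalP_nil,
      add_zero, ← add_assoc, h1, negOnePow_smul_smul, iter, totalP_cons]
    rw [show e + (t.p + totalP B) = e + totalP B + t.p by ring]
    congr 1
    apply negOnePow_congr
    grind

/-- The terms of `derived`, according to whether the first of the arguments (the last member of the
list) contributes `H` or `a`. -/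
theorem derived_append {z : Entry E} (hz : z.a ∈ 𝔏 z.p)
    (hz' : P z.a = z.a) {B : List (Entry E)} (hB : ∀ t ∈ B, Valid 𝔏 P t) :
    derived br (B ++ [z]) = iter br (z.p - 1) z.H B +
      (z.p * totalP B).negOnePow • br (totalP B - 1) z.p (derived br B) z.a := by
  induction B with
  | nil =>
    simp [iter, derived, hD.zero_left hz]
  | cons t B ih =>
    have hB' : ∀ s ∈ B, Valid 𝔏 P s := fun s hs => hB s (by simp [hs])
    obtain ⟨htH, ht, -, ht'⟩ := hB t (by simp)
    have h0 : br z.p t.p z.a t.a = 0 := by rw [← hz', ← ht']; exact hD.P_comm hz ht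
    have h1 := hD.jacobi (hD.derived_mem hB') hz ht
    have h2 : br (totalP B - 1) (z.p + t.p) (derived br B) 0 = 0 := by
      rw [hD.antisymm (d := z.p + t.p), hD.zero_left (hD.derived_mem hB'), smul_zero, neg_zero]
    rw [h0, h2, zero_add] at h1
    rw [List.cons_append, derived, ih hB', hD.add_left ht, hD.sign_left _ ht, totalP_append,
      hD.iter_append htH hz hz' hB', derived, hD.add_left hz, hD.sign_left _ hz, iter, totalP_cons,
      totalP_nil, totalP_cons, add_zero,
      show totalP B + z.p - 1 = totalP B - 1 + z.p by ring, h1,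
      show z.p - 1 + totalP B = totalP B - 1 + z.p by ring,
      show t.p + totalP B - 1 = totalP B - 1 + t.p by ring,
      show t.p - 1 + totalP B = totalP B - 1 + t.p by ring, smul_add, add_assoc]
    simp only [negOnePow_smul_smul]
    rw [show t.p * (totalP B + z.p) + z.p * totalP B =
      z.p * (t.p + totalP B) + t.p * totalP B by ring]
    congr 3
    apply negOnePow_congr; grind

variable (br) in
/-- The binary bracket `± [H₁, H₂]` of two arguments, listed in reverse order; zero on lists of any
other length. -/
def pairBr : List (Entry E) → E
  | [t, s] => (s.p + 1).negOnePow • br (s.p - 1) (t.p - 1) s.H t.H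
  | _ => 0

/-- Brackets of `K` with derived brackets are iterated brackets of `[Hₛ, K]`. -/
theorem splitSum_br_iter {e : ℤ} {K : E} (hK : K ∈ 𝔏 e) {L : List (Entry E)}
    (hL : ∀ t ∈ L, Valid 𝔏 P t) :
    splitSum (fun A B => (totalP A + (e + 1) * totalP B).negOnePow •
        br (totalP A - 1) (e + totalP B) (derived br A) (iter br e K B)) L =
      -splitSum (fun A B => ((e + 1) * totalP B).negOnePow •
        iter br (totalP A - 1 + e) (match A with
          | [s] => (s.p + 1).negOnePow • br (s.p - 1) e s.H K
          | _ => 0) B) L := by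
  induction L with
  | nil => simp [splitSum, iter, derived, hD.zero_left hK]
  | cons s L ih =>
    have hL' : ∀ s ∈ L, Valid 𝔏 P s := fun t hs => hL t (by simp [hs])
    obtain ⟨hsH, hs, -, -⟩ := hL s (by simp)
    -- The last argument `s` is split off. By the Jacobi identity the terms with `s.a` are an outer
    -- bracket with `s.a`, and by the Leibniz rule the terms with `s.H` are an iterated bracket of
    -- `[s.H, K]`.
    have h1 : splitSum (fun A B => (totalP A + (e + 1) * totalP B).negOnePow •
        br (totalP A - 1) (e + totalP B) (derived br A) (iter br e K B)) (s :: L) =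
        ((e + 1) * s.p).negOnePow • br (totalP L + e - 1) s.p
          (splitSum (fun A B => (totalP A + (e + 1) * totalP B).negOnePow •
            br (totalP A - 1) (e + totalP B) (derived br A) (iter br e K B)) L) s.a +
        ((s.p + e + 1) * totalP L + s.p).negOnePow •
          iter br (s.p - 1 + e) (br (s.p - 1) e s.H K) L := by
      rw [hD.iter_br hsH hK hL', ← splitSum_sign]
      change _ = ((e + 1) * s.p).negOnePow • hD.brHom (totalP L + e - 1) hs _ + _
      rw [← splitSum_map, ← splitSum_sign, splitSum, ← splitSum_add, ← splitSum_add]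
      refine splitSum_congr fun A B hA hB hp _ => ?_
      have hA' : ∀ s ∈ A, Valid 𝔏 P s := fun s hs => hL' s (hA s hs)
      have hB' : ∀ s ∈ B, Valid 𝔏 P s := fun s hs => hL' s (hB s hs)
      change _ = ((e + 1) * s.p).negOnePow • br (totalP L + e - 1) s.p _ s.a + _
      rw [hD.sign_left _ hs, ← hp,
        show totalP A + totalP B + e - 1 = (totalP A - 1) + (e + totalP B) by ring,
        hD.jacobi (hD.derived_mem hA') (hD.iter_mem hK hB') hs]
      simp only [derived, iter, totalP_cons]
      rw [hD.add_left (hD.iter_mem hK hB'), hD.sign_left _ (hD.iter_mem hK hB'),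
        show s.p + totalP A - 1 = totalP A - 1 + s.p by ring,
        show e + (s.p + totalP B) = e + totalP B + s.p by ring,
        show s.p - 1 + totalP A = totalP A - 1 + s.p by ring]
      simp only [smul_add, negOnePow_smul_smul]
      rw [add_comm, ← add_assoc]
      congr 1
      · congr 2
        · apply negOnePow_congr; grind
        · apply negOnePow_congr; grind
      · congr 1
        apply negOnePow_congr; grind
    rw [h1, ih hL', splitSum, neg_add, add_comm]
    congr 1
    · -- On the right, if `s` is in `A`, only `A = [s]` contributes.
      have h2 := splitSum_nil_left (fun B => ((s.p + (e + 1)) * totalP B).negOnePow •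
        iter br (s.p - 1 + e) ((s.p + 1).negOnePow • br (s.p - 1) e s.H K) B) L
      rw [hD.iter_sign _ hL', negOnePow_smul_smul] at h2
      have h3 : ((s.p + e + 1) * totalP L + s.p).negOnePow =
          -((s.p + (e + 1)) * totalP L + (s.p + 1)).negOnePow := by
        rw [← add_assoc, Int.negOnePow_succ, neg_neg]
        congr 1; ring
      rw [h3, Units.neg_smul, ← h2]
      congr 1
      refine splitSum_congr fun A B hA hB hp _ => ?_
      have hB' : ∀ s ∈ B, Valid 𝔏 P s := fun s hs => hL' s (hB s hs)
      match A with
      | [] =>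
        simp only [totalP_cons, totalP_nil, negOnePow_smul_smul, if_true]
        congr 2
        · ring
        · ring
      | _ :: _ => simp [hD.iter_zero hB']
    · -- If `s` is in `B`, it is the last argument of the iterated bracket.
      have h4 : br (totalP L + e - 1) s.p (-splitSum (fun A B => ((e + 1) * totalP B).negOnePow •
        iter br (totalP A - 1 + e) (match A with
          | [s] => (s.p + 1).negOnePow • br (s.p - 1) e s.H K
          | _ => 0) B) L) s.a = -hD.brHom (totalP L + e - 1) hs (splitSum (fun A B =>
        ((e + 1) * totalP B).negOnePow • iter br (totalP A - 1 + e) (match A with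
          | [s] => (s.p + 1).negOnePow • br (s.p - 1) e s.H K
          | _ => 0) B) L) := by
        rw [← map_neg]; rfl
      rw [h4, ← splitSum_map, smul_neg, ← splitSum_sign]
      congr 1
      refine splitSum_congr fun A B hA hB hp _ => ?_
      change _ • br (totalP L + e - 1) s.p _ s.a = _
      rw [hD.sign_left _ hs, negOnePow_smul_smul, iter, totalP_cons, ← hp,
        show totalP A - 1 + e + totalP B = totalP A + totalP B + e - 1 by ring]
      congr 2
      ring

/-- The sum of all brackets of two derived brackets reduces to the brackets `[Hᵢ, Hⱼ]`. -/
theorem splitSum_derived_derived {L : List (Entry E)} (hL : ∀ t ∈ L, Valid 𝔏 P t) :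
    splitSum (fun A B => (totalP A).negOnePow •
        br (totalP A - 1) (totalP B - 1) (derived br A) (derived br B)) L =
      -((2 : ℤ) • splitSum (fun A B => iter br (totalP A - 2) (pairBr br A) B) L) := by
  induction L with
  | nil =>
    have h := hD.zero_left (d := -1) (zero_mem (𝔏 (-1)))
    simp [splitSum, iter, derived, pairBr, h]
  | cons t L ih =>
    have hL' : ∀ s ∈ L, Valid 𝔏 P s := fun t hs => hL t (by simp [hs])
    obtain ⟨htH, ht, -, -⟩ := hL t (by simp)
    have hval : ∀ {A : List (Entry E)}, (∀ s ∈ A, s ∈ L) → ∀ s ∈ A, Valid 𝔏 P s :=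
      fun h s hs => hL' s (h s hs)
    -- The last argument `t` contributes `t.a`, in an outer bracket, or `t.H`, in one of the two
    -- derived brackets.
    have h1 : splitSum (fun A B => (totalP A).negOnePow •
        br (totalP A - 1) (totalP B - 1) (derived br A) (derived br B)) (t :: L) =
        br (totalP L - 2) t.p (splitSum (fun A B => (totalP A).negOnePow •
          br (totalP A - 1) (totalP B - 1) (derived br A) (derived br B)) L) t.a +
        (splitSum (fun A B => (t.p * totalP B + totalP A + t.p + t.p * totalP A).negOnePow •
          br (t.p - 1 + totalP A) (totalP B - 1) (iter br (t.p - 1) t.H A) (derived br B)) L +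
        splitSum (fun A B => (totalP A + (t.p - 1 + 1) * totalP B).negOnePow •
          br (totalP A - 1) (t.p - 1 + totalP B) (derived br A) (iter br (t.p - 1) t.H B)) L) := by
      change _ = hD.brHom (totalP L - 2) ht _ + _
      rw [← splitSum_map, splitSum, ← splitSum_add, ← splitSum_add, ← splitSum_add]
      refine splitSum_congr fun A B hA hB hp _ => ?_
      change _ = br (totalP L - 2) t.p _ t.a + _
      rw [hD.sign_left _ ht, ← hp,
        show totalP A + totalP B - 2 = (totalP A - 1) + (totalP B - 1) by ring,
        hD.jacobi (hD.derived_mem (hval hA)) (hD.derived_mem (hval hB)) ht]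
      simp only [derived, totalP_cons]
      rw [hD.add_left (hD.derived_mem (hval hB)), hD.sign_left _ (hD.derived_mem (hval hB)),
        hD.add_right (hD.derived_mem (hval hA)), hD.sign_right _ (hD.derived_mem (hval hA)),
        show t.p + totalP A - 1 = totalP A - 1 + t.p by ring,
        show t.p + totalP B - 1 = totalP B - 1 + t.p by ring,
        show t.p - 1 + totalP A = totalP A - 1 + t.p by ring,
        show t.p - 1 + totalP B = totalP B - 1 + t.p by ring]
      simp only [smul_add, negOnePow_smul_smul]
      rw [show ((t.p * totalP B + (t.p + totalP A)).negOnePow : ℤˣ) =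
          (totalP A + t.p * (totalP B - 1)).negOnePow by apply negOnePow_congr; grind,
        show t.p * totalP B + (t.p + totalP A + t.p * totalP A) =
          t.p * totalP B + totalP A + t.p + t.p * totalP A by ring,
        show t.p - 1 + 1 = t.p by ring]
      abel
    -- The two sums with `t.H` agree by antisymmetry, whence the factor `2`.
    have h2 : splitSum (fun A B => (t.p * totalP B + totalP A + t.p + t.p * totalP A).negOnePow •
          br (t.p - 1 + totalP A) (totalP B - 1) (iter br (t.p - 1) t.H A) (derived br B)) L =
        splitSum (fun A B => (totalP A + (t.p - 1 + 1) * totalP B).negOnePow •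
          br (totalP A - 1) (t.p - 1 + totalP B) (derived br A) (iter br (t.p - 1) t.H B)) L := by
      rw [splitSum_symm]
      refine splitSum_congr fun A B hA hB hp _ => ?_
      rw [hD.antisymm (d := totalP A - 1), smul_neg, smul_neg, negOnePow_smul_smul,
        negOnePow_smul_smul, ← Units.neg_smul, ← Int.negOnePow_succ]
      congr 1
      apply negOnePow_congr
      grind
    rw [h1, h2, ih hL', hD.splitSum_br_iter htH hL', splitSum]
    have h3 : br (totalP L - 2) t.p (-((2 : ℤ) • splitSum (fun A B =>
        iter br (totalP A - 2) (pairBr br A) B) L)) t.a =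
        -((2 : ℤ) • splitSum (fun A B => iter br (totalP A - 2) (pairBr br A) (t :: B)) L) := by
      change hD.brHom (totalP L - 2) ht _ = _
      rw [map_neg, map_zsmul, ← splitSum_map]
      congr 2
      refine splitSum_congr fun A B hA hB hp _ => ?_
      change br _ _ _ _ = br _ _ _ _
      rw [← hp]
      congr 1
      ring
    -- The brackets `[s.H, t.H]` are those of the pairs `[t, s]`.
    have h4 : splitSum (fun A B => ((t.p - 1 + 1) * totalP B).negOnePow •
        iter br (totalP A - 1 + (t.p - 1)) (match A with
          | [s] => (s.p + 1).negOnePow • br (s.p - 1) (t.p - 1) s.H t.H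
          | _ => 0) B) L = splitSum (fun A B => (t.p * totalP B).negOnePow •
            iter br (totalP (t :: A) - 2) (pairBr br (t :: A)) B) L := by
      refine splitSum_congr fun A B hA hB hp _ => ?_
      rw [show t.p - 1 + 1 = t.p by ring, totalP_cons,
        show t.p + totalP A - 2 = totalP A - 1 + (t.p - 1) by ring]
      match A with
      | [] => rfl
      | [s] => rfl
      | _ :: _ :: _ => rfl
    rw [h3, h4, two_smul, two_smul]
    abel

/-- The generalised Jacobi identities for the derived brackets. The inner bracket of the arguments
`A` has a part in the Lie algebra, which is `[H₁, H₂]` if there are two of them and zero otherwise,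
and a part in the abelian subalgebra, which is their derived bracket. -/
theorem derived_jacobi [CharZero k] {L : List (Entry E)} (hL : ∀ t ∈ L, Valid 𝔏 P t) :
    splitSum (fun A B => P (derived br (B ++ [⟨totalP A - 1, pairBr br A, P (derived br A)⟩]))) L =
      0 := by
  have hval : ∀ {A : List (Entry E)}, (∀ s ∈ A, s ∈ L) → ∀ s ∈ A, Valid 𝔏 P s :=
    fun h s hs => hL s (h s hs)
  have hPsign : ∀ (c : ℤ) (f : E), P (c.negOnePow • f) = c.negOnePow • P f := fun c f => by
    rw [Units.smul_def, Units.smul_def, map_zsmul]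
  -- The inner bracket contributes by its part in the Lie algebra, or by its part in the abelian
  -- subalgebra.
  have h1 : splitSum (fun A B =>
        P (derived br (B ++ [⟨totalP A - 1, pairBr br A, P (derived br A)⟩]))) L =
      splitSum (fun A B => P (iter br (totalP A - 2) (pairBr br A) B)) L +
      splitSum (fun A B => ((totalP A - 1) * totalP B).negOnePow •
        P (br (totalP B - 1) (totalP A - 1) (derived br B) (P (derived br A)))) L := by
    rw [← splitSum_add]
    refine splitSum_congr fun A B hA hB hp _ => ?_
    rw [hD.derived_append (hD.P_mem (hD.derived_mem (hval hA))) (hD.P_idem _) (hval hB), map_add,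
      hPsign, show totalP A - 1 - 1 = totalP A - 2 by ring]
  -- The second sum, with the two arguments of the bracket in either order.
  have h2 : splitSum (fun A B => ((totalP A - 1) * totalP B).negOnePow •
        P (br (totalP B - 1) (totalP A - 1) (derived br B) (P (derived br A)))) L =
      splitSum (fun A B => (totalP A).negOnePow •
        P (br (totalP A - 1) (totalP B - 1) (derived br A) (P (derived br B)))) L := by
    rw [splitSum_symm]
    refine splitSum_congr fun A B hA hB hp _ => ?_
    rw [negOnePow_smul_smul]
    congr 1
    apply negOnePow_congr
    grind
  have h3 : splitSum (fun A B => ((totalP A - 1) * totalP B).negOnePow •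
        P (br (totalP B - 1) (totalP A - 1) (derived br B) (P (derived br A)))) L =
      splitSum (fun A B => (totalP A).negOnePow •
        P (br (totalP A - 1) (totalP B - 1) (P (derived br A)) (derived br B))) L := by
    refine splitSum_congr fun A B hA hB hp _ => ?_
    rw [hD.antisymm (d := totalP A - 1), map_neg, hPsign, smul_neg, negOnePow_smul_smul,
      ← Units.neg_smul, ← Int.negOnePow_succ]
    congr 1
    apply negOnePow_congr
    grind
  -- The sum of the two forms, by `P [f, g] = P [P f, g] + P [f, P g]`.
  have h4 : splitSum (fun A B => (totalP A).negOnePow •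
        P (br (totalP A - 1) (totalP B - 1) (P (derived br A)) (derived br B))) L +
      splitSum (fun A B => (totalP A).negOnePow •
        P (br (totalP A - 1) (totalP B - 1) (derived br A) (P (derived br B)))) L =
      -((2 : ℤ) • splitSum (fun A B => P (iter br (totalP A - 2) (pairBr br A) B)) L) := by
    have := congrArg P.toAddMonoidHom (hD.splitSum_derived_derived hL)
    rw [map_neg, map_zsmul, ← splitSum_map, ← splitSum_map] at this
    rw [← splitSum_add]
    refine Eq.trans ?_ this
    refine splitSum_congr fun A B hA hB hp _ => ?_
    change _ = P _
    rw [hPsign, hD.P_br (hD.derived_mem (hval hA)) (hD.derived_mem (hval hB)), smul_add]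
  rw [← h3, ← h2] at h4
  rw [h1]
  -- So twice the whole sum vanishes.
  have h5 : (2 : k) • (splitSum (fun A B => P (iter br (totalP A - 2) (pairBr br A) B)) L +
      splitSum (fun A B => ((totalP A - 1) * totalP B).negOnePow •
        P (br (totalP B - 1) (totalP A - 1) (derived br B) (P (derived br A)))) L) = 0 := by
    rw [two_smul] at h4 ⊢
    rw [add_add_add_comm, h4]
    abel
  exact (smul_eq_zero.1 h5).resolve_left two_ne_zero

end DerivedBracketData

/-! ### Braces as sums over patterns -/

section Patterns

/-- The number of leaves of the sequence of trees described by a pattern: `0` stands for a leaf and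
`r > 0` for a corolla with `r` leaves. -/
def patLeaves (w : List ℕ) : ℕ := (w.map fun r => if r = 0 then 1 else r).sum

/-- The number of corollas of a pattern. -/
def patVertices (w : List ℕ) : ℕ := (w.filter fun r => r ≠ 0).length

@[simp] theorem patLeaves_nil : patLeaves [] = 0 := rfl
@[simp] theorem patLeaves_zero (w : List ℕ) : patLeaves (0 :: w) = patLeaves w + 1 := by
  simp [patLeaves, add_comm]
@[simp] theorem patLeaves_succ (r : ℕ) (w : List ℕ) :
    patLeaves ((r + 1) :: w) = patLeaves w + (r + 1) := by
  simp [patLeaves, add_comm]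
@[simp] theorem patVertices_nil : patVertices [] = 0 := rfl
@[simp] theorem patVertices_zero (w : List ℕ) : patVertices (0 :: w) = patVertices w := by
  simp [patVertices]
@[simp] theorem patVertices_succ (r : ℕ) (w : List ℕ) :
    patVertices ((r + 1) :: w) = patVertices w + 1 := by
  simp [patVertices]

theorem length_le_patLeaves (w : List ℕ) : w.length ≤ patLeaves w := by
  induction w with
  | nil => simp
  | cons r w ih => cases r <;> simp <;> lia

theorem le_patLeaves_of_mem {w : List ℕ} {r : ℕ} (h : r ∈ w) : r ≤ patLeaves w := by
  induction w with
  | nil => simp at h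
  | cons s w ih =>
    rcases List.mem_cons.1 h with rfl | h
    · cases r <;> simp
    · have := ih h
      cases s <;> simp <;> lia

theorem patVertices_le_length (w : List ℕ) : patVertices w ≤ w.length := List.length_filter_le _ _

/-- The patterns with a given number of leaves. -/
def patterns : ℕ → Finset (List ℕ)
  | 0 => {[]}
  | n + 1 => (patterns n).image (List.cons 0) ∪
      (Finset.range (n + 1)).biUnion fun r => (patterns (n - r)).image (List.cons (r + 1))
termination_by n => n
decreasing_by all_goals lia

theorem mem_patterns {n : ℕ} {w : List ℕ} : w ∈ patterns n ↔ patLeaves w = n := by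
  induction w generalizing n with
  | nil => cases n <;> simp [patterns]
  | cons r w ih =>
    cases n with
    | zero => cases r <;> simp [patterns]
    | succ n =>
      cases r with
      | zero => simp [patterns, ih]
      | succ r => simp [patterns, ih]; lia

theorem sum_patterns_zero {X : Type*} [AddCommMonoid X] (F : List ℕ → X) :
    ∑ w ∈ patterns 0, F w = F [] := by simp [patterns]

/-- A pattern begins with a leaf or with a corolla. -/
theorem sum_patterns_succ {X : Type*} [AddCommMonoid X] (n : ℕ) (F : List ℕ → X) :
    ∑ w ∈ patterns (n + 1), F w = ∑ w ∈ patterns n, F (0 :: w) +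
      ∑ r ∈ Finset.range (n + 1), ∑ w ∈ patterns (n - r), F ((r + 1) :: w) := by
  rw [patterns, Finset.sum_union, Finset.sum_image, Finset.sum_biUnion]
  · congr 1
    refine Finset.sum_congr rfl fun r _ => ?_
    rw [Finset.sum_image]
    intro a _ b _ h
    exact List.tail_eq_of_cons_eq h
  · intro r _ s _ hrs
    rw [Function.onFun, Finset.disjoint_left]
    intro a ha hb
    simp only [Finset.mem_image] at ha hb
    obtain ⟨x, -, rfl⟩ := ha
    obtain ⟨y, -, h⟩ := hb
    exact hrs (by simpa using (List.head_eq_of_cons_eq h).symm)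
  · intro a _ b _ h
    exact List.tail_eq_of_cons_eq h
  · rw [Finset.disjoint_left]
    intro a ha hb
    simp only [Finset.mem_image, Finset.mem_biUnion] at ha hb
    obtain ⟨x, -, rfl⟩ := ha
    obtain ⟨r, -, y, -, h⟩ := hb
    simp at h

theorem inputLeaves_eq {p : ℕ} (w : Fin p → ℕ) : inputLeaves w = patLeaves (List.ofFn w) := by
  simp [inputLeaves, patLeaves, List.sum_ofFn, List.map_ofFn]

theorem inputVertices_eq {p : ℕ} (w : Fin p → ℕ) :
    inputVertices w = patVertices (List.ofFn w) := by
  unfold inputVertices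
  rw [Finset.card_filter]
  induction p with
  | zero => simp
  | succ p ih =>
    rw [Fin.sum_univ_succ, ih fun i => w i.succ, List.ofFn_succ]
    cases h : w 0 <;> simp [add_comm]

/-- Sums over patterns, in the indexing used for the decomposition maps. -/
theorem sum_fin_eq_sum_patterns {X : Type*} [AddCommMonoid X] (F : List ℕ → X) {n N : ℕ}
    (hn : 1 ≤ n) (hN : n ≤ N) :
    ∑ p ∈ Finset.Icc 1 N, ∑ w : Fin p → Fin (N + 1),
      (if patLeaves (List.ofFn fun t => (w t : ℕ)) = n then
        F (List.ofFn fun t => (w t : ℕ)) else 0) = ∑ w ∈ patterns n, F w := by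
  simp only [← Finset.sum_filter]
  rw [Finset.sum_sigma']
  refine Finset.sum_bij (fun x _ => List.ofFn fun t => (x.2 t : ℕ)) ?_ ?_ ?_ ?_
  · intro x hx
    simpa [mem_patterns] using (Finset.mem_sigma.1 hx).2
  · rintro ⟨p, x⟩ hx ⟨q, y⟩ hy h
    have hpq : p = q := by simpa using congrArg List.length h
    subst hpq
    simp only [Sigma.mk.injEq, heq_eq_eq, true_and]
    funext t
    have := congrFun (List.ofFn_injective h) t
    exact Fin.ext this
  · intro w hw
    have hw := mem_patterns.1 hw
    have hl := length_le_patLeaves w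
    refine ⟨⟨w.length, fun t => ⟨w.get t, ?_⟩⟩, ?_, ?_⟩
    · have := le_patLeaves_of_mem (List.get_mem w t)
      lia
    · simp only [Finset.mem_sigma, Finset.mem_Icc, Finset.mem_filter, Finset.mem_univ, true_and]
      refine ⟨⟨?_, by lia⟩, ?_⟩
      · cases w
        · simp at hw; lia
        · simp
      · simpa using hw
    · simp
  · intro x _
    rfl

end Patterns

section Braces

variable {k : Type u} {M : Type v} {X : Type w} [Field k] [AddCommGroup M] [Module k M]
  [AddCommGroup X] [Module k X] (κ : ℤ → M →ₗ[k] M)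

/-- The total degree of a list of maps given with their degrees. -/
def totalDeg {Y : Type*} (Gs : List (ℤ × Y)) : ℤ := (Gs.map Prod.fst).sum

@[simp] theorem totalDeg_nil {Y : Type*} : totalDeg ([] : List (ℤ × Y)) = 0 := rfl

@[simp] theorem totalDeg_cons {Y : Type*} (G : ℤ × Y) (Gs : List (ℤ × Y)) :
    totalDeg (G :: Gs) = G.1 + totalDeg Gs := by simp [totalDeg]

/-- The brace `f{G₁,…,G_m}`. -/
def multiBrace : List (ℤ × (List M → M)) → (List M → X) → List M → X
  | [] => fun f => f
  | G :: Gs => insertThen κ (totalDeg (G :: Gs)) (totalDeg Gs) G.2 (multiBrace Gs)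

/-- The list obtained by applying `G₁, …, G_m` to the intervals of a list described by a pattern. -/
def applyPattern : List ℕ → List (ℤ × (List M → M)) → List M → List M
  | [], _, _ => []
  | 0 :: w, Gs, v => κ (totalDeg Gs) (v.headD 0) :: applyPattern w Gs v.tail
  | (r + 1) :: w, Gs, v =>
      (Gs.headD (0, 0)).2 ((v.take (r + 1)).map (κ (totalDeg Gs.tail))) ::
        applyPattern w Gs.tail (v.drop (r + 1))

theorem applyPattern_length (w : List ℕ) (Gs : List (ℤ × (List M → M))) (v : List M) :
    (applyPattern κ w Gs v).length = w.length := by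
  induction w generalizing Gs v with
  | nil => rfl
  | cons r w ih => cases r <;> simp [applyPattern, ih]

theorem prefixSum_eq_sum (g : List M → M) (Ψ : M → List M → X) (v : List M) :
    prefixSum g Ψ v =
      ∑ r ∈ Finset.range v.length, Ψ (g (v.take (r + 1))) (v.drop (r + 1)) := by
  induction v generalizing g with
  | nil => rfl
  | cons x t ih =>
    rw [prefixSum, ih, List.length_cons, Finset.sum_range_succ', add_comm]
    rfl

variable {κ} {𝓜 : ℤ → Submodule k M}

/-- A brace is the sum over the patterns with as many corollas as there are maps to insert. -/
theorem multiBrace_eq_sum (hκ : SignRule 𝓜 κ) (Gs : List (ℤ × (List M → M))) (f : List M → X)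
    (v : List M) : multiBrace κ Gs f v = ∑ w ∈ patterns v.length,
      if patVertices w = Gs.length then f (applyPattern κ w Gs v) else 0 := by
  induction Gs generalizing f v with
  | nil =>
    induction v generalizing f with
    | nil => simp [multiBrace, sum_patterns_zero, applyPattern]
    | cons x t ih =>
      rw [List.length_cons, sum_patterns_succ]
      have h : multiBrace κ [] f (x :: t) = multiBrace κ [] (fun l => f (x :: l)) t := rfl
      rw [h, ih]
      simp [applyPattern, hκ.zero]
  | cons G Gs ihG =>
    induction v generalizing f with
    | nil => simp [multiBrace, insertThen, sum_patterns_zero]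
    | cons x t ih =>
      have h : multiBrace κ (G :: Gs) f (x :: t) =
          prefixSum (fun l => G.2 (l.map (κ (totalDeg Gs))))
            (fun w t' => multiBrace κ Gs (fun l => f (w :: l)) t') (x :: t) +
          multiBrace κ (G :: Gs) (fun l => f (κ (totalDeg (G :: Gs)) x :: l)) t := rfl
      rw [h, ih, prefixSum_eq_sum, List.length_cons, sum_patterns_succ, add_comm]
      congr 1
      refine Finset.sum_congr rfl fun r hr => ?_
      rw [ihG]
      simp only [List.drop_succ_cons, List.length_drop, List.length_cons, patVertices_succ,
        add_left_inj, applyPattern, List.headD_cons, List.tail_cons]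

end Braces

section BraceRecursion

variable {k : Type u} {V : Type v} [Field k] [AddCommGroup V] [Module k V]
  (𝒱 : ℤ → Submodule k V) [DirectSum.Decomposition 𝒱]

theorem sum_map_flatMap {α β : Type*} (l : List α) (g : α → List β) (f : β → V) :
    ((l.flatMap g).map f).sum = (l.map fun a => ((g a).map f).sum).sum := by
  induction l with
  | nil => rfl
  | cons a l ih => simp [ih]

theorem sum_map_range {n : ℕ} (f : ℕ → V) :
    ((List.range n).map f).sum = ∑ i ∈ Finset.range n, f i := by
  induction n with
  | zero => rfl
  | succ n ih => rw [List.range_succ, Finset.sum_range_succ, ← ih]; simp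

/-- The recursion `multiBrace`, at the level of the suspension, computes the brace defined by lists
of intervals. -/
theorem brace_eq_multiBrace (f : List V → V) (Gs : List (ℤ × (List V → V))) (v : List V) :
    brace 𝒱 f Gs v = multiBrace (koszul 𝒱 1) Gs f v := by
  induction Gs generalizing f v with
  | nil => simp [brace, insertions, multiBrace]
  | cons G Gs ihG =>
    -- The first map is applied to the interval of length `j + 1` which begins at the position `i`.
    have h0 : ∀ (f : List V → V) (v : List V), brace 𝒱 f (G :: Gs) v =
        ∑ i ∈ Finset.range v.length, ∑ j ∈ Finset.range (v.length - i),
          brace 𝒱 (fun w => f ((v.take i).map (koszul 𝒱 1 (totalDeg (G :: Gs))) ++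
            G.2 (((v.drop i).take (j + 1)).map (koszul 𝒱 1 (totalDeg Gs))) :: w)) Gs
            (v.drop (i + (j + 1))) := by
      intro f v
      simp only [brace, insertions]
      rw [sum_map_flatMap, sum_map_range]
      refine Finset.sum_congr rfl fun i _ => ?_
      rw [sum_map_flatMap, sum_map_range]
      refine Finset.sum_congr rfl fun j _ => ?_
      rw [List.map_map]
      rw [totalDeg_cons]
      rfl
    induction v generalizing f with
    | nil => simp [h0, multiBrace, insertThen]
    | cons x t ih =>
      have h : multiBrace (koszul 𝒱 1) (G :: Gs) f (x :: t) =
          prefixSum (fun l => G.2 (l.map (koszul 𝒱 1 (totalDeg Gs))))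
            (fun w t' => multiBrace (koszul 𝒱 1) Gs (fun l => f (w :: l)) t') (x :: t) +
          multiBrace (koszul 𝒱 1) (G :: Gs)
            (fun l => f (koszul 𝒱 1 (totalDeg (G :: Gs)) x :: l)) t := rfl
      rw [h, ← ih, h0, h0, prefixSum_eq_sum, List.length_cons, Finset.sum_range_succ', add_comm]
      congr 1
      · refine Finset.sum_congr rfl fun r hr => ?_
        rw [ihG]
        simp
      · refine Finset.sum_congr rfl fun i hi => ?_
        refine Finset.sum_congr (by simp) fun j hj => ?_
        rw [show i + 1 + (j + 1) = i + (j + 1) + 1 by ring]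
        rfl

end BraceRecursion

/-! ### Symmetrised braces and iterated insertions -/

section PermSum

variable {Y : Type v} {X : Type w} [AddCommGroup X]

/-- The sum of `± Φ` over all ways to insert `a` into a list, with the Koszul sign of moving `a` to
its place from the end of the list. -/
def insSum : (List (ℤ × Y) → X) → ℤ × Y → List (ℤ × Y) → X
  | Φ, a, [] => Φ [a]
  | Φ, a, b :: bs => (a.1 * totalDeg (b :: bs)).negOnePow • Φ (a :: b :: bs) +
      insSum (fun cs => Φ (b :: cs)) a bs

/-- The sum of `± Φ` over all permutations of a list, with Koszul signs.  The list is written in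
reverse order. -/
def permSum : (List (ℤ × Y) → X) → List (ℤ × Y) → X
  | Φ, [] => Φ []
  | Φ, a :: L => permSum (insSum Φ a) L

theorem totalDeg_perm {L L' : List (ℤ × Y)} (h : L.Perm L') : totalDeg L = totalDeg L' :=
  (h.map Prod.fst).sum_eq

theorem insSum_congr {Φ Ψ : List (ℤ × Y) → X} {a : ℤ × Y} {bs : List (ℤ × Y)}
    (h : ∀ cs : List (ℤ × Y), cs.Perm (a :: bs) → Φ cs = Ψ cs) :
    insSum Φ a bs = insSum Ψ a bs := by
  induction bs generalizing Φ Ψ with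
  | nil => exact h _ (.refl _)
  | cons b bs ih =>
    rw [insSum, insSum, h _ (.refl _), ih fun cs hcs => h _ ((hcs.cons b).trans (.swap ..))]

theorem insSum_map {X' : Type*} [AddCommGroup X'] (φ : X →+ X') (Φ : List (ℤ × Y) → X)
    (a : ℤ × Y) (bs : List (ℤ × Y)) : insSum (fun cs => φ (Φ cs)) a bs = φ (insSum Φ a bs) := by
  induction bs generalizing Φ with
  | nil => rfl
  | cons b bs ih => simp only [insSum, ih, map_add, Units.smul_def, map_zsmul]

theorem insSum_add (Φ Ψ : List (ℤ × Y) → X) (a : ℤ × Y) (bs : List (ℤ × Y)) :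
    insSum (fun cs => Φ cs + Ψ cs) a bs = insSum Φ a bs + insSum Ψ a bs := by
  induction bs generalizing Φ Ψ with
  | nil => rfl
  | cons b bs ih => simp only [insSum, ih, smul_add]; abel

theorem insSum_zero (a : ℤ × Y) (bs : List (ℤ × Y)) : insSum (fun _ => (0 : X)) a bs = 0 := by
  induction bs with
  | nil => rfl
  | cons b bs ih => simp only [insSum, ih, smul_zero, add_zero]

theorem permSum_congr {Φ Ψ : List (ℤ × Y) → X} {L : List (ℤ × Y)}
    (h : ∀ cs : List (ℤ × Y), cs.Perm L → Φ cs = Ψ cs) : permSum Φ L = permSum Ψ L := by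
  induction L generalizing Φ Ψ with
  | nil => exact h _ (.refl _)
  | cons a L ih =>
    exact ih fun cs hcs => insSum_congr fun ds hds => h _ (hds.trans (hcs.cons a))

theorem permSum_map {X' : Type*} [AddCommGroup X'] (φ : X →+ X') (Φ : List (ℤ × Y) → X)
    (L : List (ℤ × Y)) : permSum (fun cs => φ (Φ cs)) L = φ (permSum Φ L) := by
  induction L generalizing Φ with
  | nil => rfl
  | cons a L ih => simp only [permSum, ← ih, funext fun cs => insSum_map φ Φ a cs]

theorem permSum_add (Φ Ψ : List (ℤ × Y) → X) (L : List (ℤ × Y)) :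
    permSum (fun cs => Φ cs + Ψ cs) L = permSum Φ L + permSum Ψ L := by
  induction L generalizing Φ Ψ with
  | nil => rfl
  | cons a L ih => simp only [permSum, ← ih, funext fun cs => insSum_add Φ Ψ a cs]

end PermSum

section

variable {k : Type u} {M : Type v} {X : Type w} [Field k] [AddCommGroup M] [Module k M]
  [AddCommGroup X] [Module k X] {κ : ℤ → M →ₗ[k] M} {𝓜 : ℤ → Submodule k M}

theorem insertThen_add (d s : ℤ) (g : List M → M) {R : (List M → X) → List M → X}
    (hR : ∀ f f' v, R (fun l => f l + f' l) v = R f v + R f' v) (f f' : List M → X) (v : List M) :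
    insertThen κ d s g R (fun l => f l + f' l) v =
      insertThen κ d s g R f v + insertThen κ d s g R f' v := by
  induction v generalizing f f' with
  | nil => simp [insertThen]
  | cons x t ih => simp only [insertThen, ih, hR, prefixSum_add_right]; abel

theorem multiBrace_add (Gs : List (ℤ × (List M → M))) (f f' : List M → X) (v : List M) :
    multiBrace κ Gs (fun l => f l + f' l) v = multiBrace κ Gs f v + multiBrace κ Gs f' v := by
  induction Gs generalizing f f' v with
  | nil => rfl
  | cons G Gs ih => exact insertThen_add _ _ _ ih f f' v

theorem multiBrace_add_head (Gs : List (ℤ × (List M → M))) {f : List M → X}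
    (hf : IsMultilinear k f) (t : List M) (a b : M) :
    multiBrace κ Gs (fun l => f ((a + b) :: l)) t =
      multiBrace κ Gs (fun l => f (a :: l)) t + multiBrace κ Gs (fun l => f (b :: l)) t := by
  simp only [hf.add_head, multiBrace_add]

theorem multiBrace_sign_head (Gs : List (ℤ × (List M → M))) {f : List M → X}
    (hf : IsMultilinear k f) (c : ℤ) (t : List M) (a : M) :
    multiBrace κ Gs (fun l => f ((c.negOnePow • a) :: l)) t =
      c.negOnePow • multiBrace κ Gs (fun l => f (a :: l)) t := by
  have h := map_zsmul (AddMonoidHom.mk' (fun a => multiBrace κ Gs (fun l => f (a :: l)) t)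
    (multiBrace_add_head Gs hf t)) ((c.negOnePow : ℤˣ) : ℤ) a
  simp only [Units.smul_def]
  exact h

theorem prefixSum_eq_zero {g : List M → M} {Ψ : M → List M → X} (h : ∀ v t, Ψ (g v) t = 0)
    (v : List M) : prefixSum g Ψ v = 0 := by
  induction v generalizing g with
  | nil => rfl
  | cons x t ih => rw [prefixSum, h, ih fun v t => h (x :: v) t, add_zero]

theorem insertOp_eq_zero {d : ℤ} {g : List M → M} {f : List M → X}
    (h : ∀ l v r, f (l ++ g v :: r) = 0) (v : List M) : insertOp κ d g f v = 0 := by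
  induction v generalizing f with
  | nil => rfl
  | cons x t ih =>
    rw [insertOp, prefixSum_eq_zero fun v t => h [] v t,
      ih fun l v r => h (κ d x :: l) v r, add_zero]

theorem insertThen_eq_zero {d s : ℤ} {g : List M → M} {R : (List M → X) → List M → X}
    {f : List M → X} (h : ∀ l u v, R (fun r => f (l ++ g u :: r)) v = 0) (v : List M) :
    insertThen κ d s g R f v = 0 := by
  induction v generalizing f with
  | nil => rfl
  | cons x t ih =>
    rw [insertThen, prefixSum_eq_zero fun v t => h [] _ t,
      ih fun l v r => h (κ d x :: l) v r, add_zero]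

variable (κ) in
/-- `b` vanishes as soon as one of its inputs is an output of `a`. -/
def Kills (b a : List M → M) : Prop := ∀ c l v r, b (l ++ κ c (a v) :: r) = 0

theorem Kills.apply (hκ : SignRule 𝓜 κ) {b a : List M → M} (h : Kills κ b a) (l v r : List M) :
    b (l ++ a v :: r) = 0 := by
  simpa only [hκ.zero] using h 0 l v r

variable (κ) in
/-- The insertion of a map, as an additive operation. -/
def insertHom (d : ℤ) (g : List M → M) : (List M → X) →+ (List M → X) :=
  AddMonoidHom.mk' (insertOp κ d g) fun f f' => funext fun v => insertOp_add κ d g f f' v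

theorem insSum_apply (Φ : List (ℤ × (List M → M)) → List M → X) (a : ℤ × (List M → M))
    (bs : List (ℤ × (List M → M))) (v : List M) :
    insSum Φ a bs v = insSum (fun cs => Φ cs v) a bs :=
  (insSum_map (Pi.evalAddMonoidHom (fun _ => X) v) Φ a bs).symm

theorem prefixSum_insSum (g : List M → M) (Φ : M → List M → List (ℤ × (List M → M)) → X)
    (a : ℤ × (List M → M)) (bs : List (ℤ × (List M → M))) (v : List M) :
    prefixSum g (fun w t => insSum (Φ w t) a bs) v =
      insSum (fun cs => prefixSum g (fun w t => Φ w t cs) v) a bs := by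
  induction v generalizing g with
  | nil => exact (insSum_zero a bs).symm
  | cons x t ih => simp only [prefixSum, ih, insSum_add]

/-- Inserting `a` into a brace `f{b₁,…,b_m}` whose members do not accept outputs of `a` is the sum
over the ways to place `a` among the `bᵢ`. -/
theorem insertOp_multiBrace (hκ : SignRule 𝓜 κ) {a : ℤ × (List M → M)} (ha : a.2 ∈ graded 𝓜 a.1)
    {bs : List (ℤ × (List M → M))} (hb : ∀ b ∈ bs, Kills κ b.2 a.2)
    (hb' : ∀ b ∈ bs, IsMultilinear k b.2) {f : List M → X}
    (hf : IsMultilinear k f) :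
    insertOp κ a.1 a.2 (multiBrace κ bs f) = insSum (fun cs => multiBrace κ cs f) a bs := by
  induction bs generalizing f with
  | nil =>
    funext v
    induction v generalizing f with
    | nil => rfl
    | cons x t ih =>
      have h := ih (hf.cons (κ a.1 x))
      simp only [multiBrace, insSum, insertOp, insertThen, totalDeg_cons, totalDeg_nil,
        add_zero] at h ⊢
      rw [h]
      congr 1
      congr 1
      funext l
      rw [hκ.map_zero_list]
  | cons G Gs ihG =>
    have hG := hb G (by simp)
    have ihG' : ∀ {f : List M → X}, IsMultilinear k f → insertOp κ a.1 a.2 (multiBrace κ Gs f) =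
        insSum (fun cs => multiBrace κ cs f) a Gs := fun hf =>
      ihG (fun b hb'' => hb b (by simp [hb''])) (fun b hb'' => hb' b (by simp [hb''])) hf
    funext v
    rw [insSum_apply]
    induction v generalizing f with
    | nil =>
      refine ((insSum_congr fun cs hcs => ?_).trans (insSum_zero a (G :: Gs))).symm
      cases cs with
      | nil => simp at hcs
      | cons c cs => rfl
    | cons x t ih =>
      set d := totalDeg (G :: Gs) with hd
      set s := totalDeg Gs with hs
      have hds : d = G.1 + s := by rw [hd, totalDeg_cons]
      -- The first insertion of `G`, at or after the beginning of the list.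
      have e1 : ∀ (f : List M → X) (x : M) (t : List M), multiBrace κ (G :: Gs) f (x :: t) =
          prefixSum (fun l => G.2 (l.map (κ s)))
            (fun w => multiBrace κ Gs (fun l => f (w :: l))) (x :: t) +
          multiBrace κ (G :: Gs) (fun l => f (κ d x :: l)) t := fun _ _ _ => rfl
      -- `a` is inserted into a term of the first kind, or into one of the second kind, at or after
      -- the beginning of the list.
      have e2 : insertOp κ a.1 a.2 (multiBrace κ (G :: Gs) f) (x :: t) =
          insertOp κ a.1 a.2 (prefixSum (fun l => G.2 (l.map (κ s)))
            (fun w => multiBrace κ Gs (fun l => f (w :: l)))) (x :: t) +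
          (prefixSum a.2 (fun w t' => multiBrace κ (G :: Gs) (fun l => f (κ d w :: l)) t')
            (x :: t) +
          insertOp κ a.1 a.2 (multiBrace κ (G :: Gs) fun l => f (κ d (κ a.1 x) :: l)) t) := by
        simp only [insertOp, e1]
        rw [prefixSum_add_right, insertOp_add]
        abel
      have e3 : insertOp κ a.1 a.2 (prefixSum (fun l => G.2 (l.map (κ s)))
            (fun w => multiBrace κ Gs (fun l => f (w :: l)))) (x :: t) =
          insSum (fun cs => prefixSum (fun l => G.2 (l.map (κ (s + a.1))))
            (fun w => multiBrace κ cs (fun l => f (w :: l))) (x :: t)) a Gs := by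
        rw [insertOp_prefixSum _ _ _ _ fun t a b => multiBrace_add_head Gs hf t a b]
        -- `a` does not go inside `G`.
        have e4 : ∀ v, insertOp κ a.1 a.2 (fun l => G.2 (l.map (κ s))) v = 0 := by
          apply insertOp_eq_zero
          intro l v r
          rw [List.map_append, List.map_cons]
          exact hG s _ v _
        rw [show insertOp κ a.1 a.2 (fun l => G.2 (l.map (κ s))) = fun _ => 0 from funext e4]
        rw [prefixSum_eq_zero (g := fun _ => 0) fun v t => ?_, zero_add, ← prefixSum_insSum]
        · simp only [hκ.map_map]
          congr 1
          funext w t'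
          rw [ihG' (hf.cons w), insSum_apply]
        · have := multiBrace_add_head (κ := κ) Gs hf t 0 0
          simpa using this
      -- The Koszul rule for the map `a`.
      have e5 : prefixSum a.2 (fun w t' => multiBrace κ (G :: Gs) (fun l => f (κ d w :: l)) t')
            (x :: t) = (a.1 * d).negOnePow • prefixSum (fun l => a.2 (l.map (κ d)))
              (fun w t' => multiBrace κ (G :: Gs) (fun l => f (w :: l)) t') (x :: t) := by
        have h : ∀ (g : List M → M) (v : List M),
            prefixSum g (fun w t' => multiBrace κ (G :: Gs) (fun l => f (κ d w :: l)) t') v =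
            prefixSum (fun l => κ d (g l))
              (fun w t' => multiBrace κ (G :: Gs) (fun l => f (w :: l)) t') v := by
          intro g v
          induction v generalizing g with
          | nil => rfl
          | cons x t ih => simp only [prefixSum, ih]
        rw [h, mul_comm]
        simp only [graded_sign hκ ha]
        rw [prefixSum_sign_left, negOnePow_smul_self]
        intro t b
        exact multiBrace_sign_head _ hf _ _ _
      rw [e2, e3, e5, ih (hf.cons _), insSum, insSum, ← hd]
      -- The terms with `a` to the left of `G`, according to whether `a` is at the beginning of the
      -- list.
      have e6 : multiBrace κ (a :: G :: Gs) f (x :: t) =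
          prefixSum (fun l => a.2 (l.map (κ d)))
              (fun w t' => multiBrace κ (G :: Gs) (fun l => f (w :: l)) t') (x :: t) +
          multiBrace κ (a :: G :: Gs) (fun l => f (κ d (κ a.1 x) :: l)) t := by
        rw [← hκ.add d]
        simp only [multiBrace, insertThen, totalDeg_cons, ← hs, ← hds]
        rw [add_comm a.1]
      -- The terms with `a` to the right of `G`, according to whether `G` is at the beginning of the
      -- list.
      have e7 : insSum (fun cs => multiBrace κ (G :: cs) f (x :: t)) a Gs =
          insSum (fun cs => prefixSum (fun l => G.2 (l.map (κ (s + a.1))))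
            (fun w => multiBrace κ cs (fun l => f (w :: l))) (x :: t)) a Gs +
          insSum (fun cs => multiBrace κ (G :: cs) (fun l => f (κ d (κ a.1 x) :: l)) t) a Gs := by
        rw [← insSum_add]
        refine insSum_congr fun cs hcs => ?_
        have h1 : totalDeg cs = s + a.1 := by rw [totalDeg_perm hcs, totalDeg_cons, add_comm]
        rw [← hκ.add d]
        simp only [multiBrace, insertThen, totalDeg_cons, h1]
        rw [show G.1 + (s + a.1) = d + a.1 by rw [hds]; ring]
      rw [e6, e7, smul_add]
      abel

variable (κ) in
/-- The iterated insertion `f{a₁}⋯{aₙ}`, the maps being listed in reverse order. -/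
def iterInsert : List (ℤ × (List M → M)) → (List M → X) → List M → X
  | [], f => f
  | a :: L, f => insertOp κ a.1 a.2 (iterInsert L f)

theorem iterInsert_eq_permSum (hκ : SignRule 𝓜 κ) {L : List (ℤ × (List M → M))}
    (hL : ∀ a ∈ L, a.2 ∈ graded 𝓜 a.1) (hk : ∀ a ∈ L, ∀ b ∈ L, Kills κ b.2 a.2)
    {f : List M → X} (hf : IsMultilinear k f) :
    iterInsert κ L f = permSum (fun cs => multiBrace κ cs f) L := by
  induction L with
  | nil => rfl
  | cons a L ih =>
    rw [iterInsert, ih (fun b hb => hL b (by simp [hb]))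
      fun b hb c hc => hk b (by simp [hb]) c (by simp [hc]), permSum]
    change insertHom κ a.1 a.2 _ = _
    rw [← permSum_map]
    refine permSum_congr fun cs hcs => ?_
    exact insertOp_multiBrace hκ (hL a (by simp))
      (fun b hb => hk a (by simp) b (by simp [hcs.subset hb]))
      (fun b hb => homProd_multilinear (hL b (by simp [hcs.subset hb]))) hf

variable (κ) in
/-- The term `± c₁{F{c₂,…,cₙ}}`. -/
def headTerm (e : ℤ) (F : List M → M) : List (ℤ × (List M → M)) → List M → M
  | [] => 0
  | c :: cs => (c.1 * e).negOnePow • insertOp κ (e + totalDeg cs) (multiBrace κ cs F) c.2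

theorem insertOp_insertOp_of_kills (hκ : SignRule 𝓜 κ) {a : ℤ × (List M → M)}
    (ha : a.2 ∈ graded 𝓜 a.1) {c : List M → M} (hc : IsMultilinear k c) (hk : Kills κ c a.2)
    (d : ℤ) (f : List M → M) :
    insertOp κ a.1 a.2 (insertOp κ d f c) = insertOp κ (d + a.1) (insertOp κ a.1 a.2 f) c := by
  funext v
  rw [insertOp_insertOp hκ d a.1 (fun v => graded_sign hκ ha d v) hc, insertThen_eq_zero,
    insertThen_eq_zero, smul_zero, add_zero, add_zero]
  · intro l u v
    apply insertOp_eq_zero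
    intro l' v' r
    rw [hk.apply hκ]
  · intro l u v
    apply insertOp_eq_zero
    intro l' v' r
    have := hk.apply hκ (l ++ f u :: l') v' r
    simpa using this

/-- Iterated commutators with maps which do not accept each other's outputs are symmetrised
braces. -/
theorem iter_lieBr (hκ : SignRule 𝓜 κ) {e : ℤ} {F : List M → M} (hF : IsMultilinear k F)
    {A : List (Entry (List M → M))} (hA : ∀ t ∈ A, t.a ∈ graded 𝓜 t.p)
    (hk : ∀ s ∈ A, ∀ t ∈ A, Kills κ t.a s.a) :
    DerivedBracketData.iter (lieBr κ) e F A =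
      permSum (fun cs => multiBrace κ cs F) (A.map fun t => (t.p, t.a)) -
        permSum (headTerm κ e F) (A.map fun t => (t.p, t.a)) := by
  rw [← iterInsert_eq_permSum hκ (by simpa using hA) (by simpa using hk) hF]
  induction A with
  | nil => simp [DerivedBracketData.iter, iterInsert, permSum, headTerm]
  | cons t A ih =>
    have hA' : ∀ s ∈ A, s.a ∈ graded 𝓜 s.p := fun b hb => hA b (by simp [hb])
    have hk' : ∀ s ∈ A, ∀ t ∈ A, Kills κ t.a s.a :=
      fun b hb c hc => hk b (by simp [hb]) c (by simp [hc])
    have ht := homProd_multilinear (hA t (by simp))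
    have hkt : ∀ s ∈ A, Kills κ s.a t.a := fun s hs => hk t (by simp) s (by simp [hs])
    have hkt' : ∀ s ∈ A, Kills κ t.a s.a := fun s hs => hk s (by simp [hs]) t (by simp)
    have hdeg : totalP A = totalDeg (A.map fun t => (t.p, t.a)) := by
      simp only [totalP, totalDeg, List.map_map]
      rfl
    set L := A.map fun t => (t.p, t.a) with hLdef
    have hmem : ∀ cs : List (ℤ × (List M → M)), cs.Perm L → ∀ c ∈ cs, c.2 ∈ graded 𝓜 c.1 ∧
        Kills κ c.2 t.a ∧ Kills κ t.a c.2 := by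
      intro cs hcs c hc
      obtain ⟨s, hs, rfl⟩ := List.mem_map.1 (hcs.subset hc)
      exact ⟨hA' s hs, hkt s hs, hkt' s hs⟩
    rw [DerivedBracketData.iter, ih hA' hk', List.map_cons, iterInsert, permSum, lieBr]
    have e1 : insertOp κ t.p t.a (iterInsert κ L F - permSum (headTerm κ e F) L) =
        insertOp κ t.p t.a (iterInsert κ L F) -
          insertOp κ t.p t.a (permSum (headTerm κ e F) L) :=
      map_sub (insertHom κ t.p t.a) _ _
    -- The maps `headTerm` take values among the outputs of the inserted maps.
    have e2 : ∀ v, insertOp κ (e + totalP A) (permSum (headTerm κ e F) L) t.a v = 0 := by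
      apply insertOp_eq_zero
      intro l v r
      change (ht.slotMap l r) (permSum (headTerm κ e F) L v) = 0
      have h1 : (ht.slotMap l r) (permSum (headTerm κ e F) L v) =
          permSum (fun cs => (ht.slotMap l r) (headTerm κ e F cs v)) L :=
        (permSum_map ((ht.slotMap l r).toAddMonoidHom.comp
          (Pi.evalAddMonoidHom (fun _ => M) v)) (headTerm κ e F) L).symm
      rw [h1]
      have h2 : permSum (fun _ => (0 : M)) L = 0 := permSum_map (0 : M →+ M) (fun _ => 0) L
      rw [← h2]
      refine permSum_congr fun cs hcs => ?_
      cases cs with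
      | nil => exact map_zero _
      | cons c cs =>
        have h3 : (ht.slotMap l r) (insertOp κ (e + totalDeg cs) (multiBrace κ cs F) c.2 v) = 0 := by
          have := insertOp_map κ (ht.slotMap l r).toAddMonoidHom (e + totalDeg cs)
            (multiBrace κ cs F) c.2 v
          refine this.symm.trans (insertOp_eq_zero (fun l' v' r' => ?_) v)
          exact (hmem _ hcs c (by simp)).2.2.apply hκ l _ r
        simp only [headTerm, Pi.smul_apply, Units.smul_def, map_zsmul, h3, smul_zero]
    have e3 : insertOp κ (e + totalP A) (iterInsert κ L F - permSum (headTerm κ e F) L) t.a =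
        insertOp κ (e + totalP A) (iterInsert κ L F) t.a := by
      funext v
      have h1 := insertOp_add_left κ (e + totalP A)
        (fun l => (iterInsert κ L F - permSum (headTerm κ e F) L) l)
        (permSum (headTerm κ e F) L) ht v
      rw [e2, add_zero] at h1
      rw [← h1]
      congr 1
      funext l
      simp
    -- In the terms `headTerm` for all maps, the new map `t.a` is the outer one, or it is among
    -- those inserted into `F`.
    have e4 : permSum (insSum (headTerm κ e F) (t.p, t.a)) L =
        (t.p * (e + totalP A)).negOnePow • insertOp κ (e + totalP A) (iterInsert κ L F) t.a +
          insertOp κ t.p t.a (permSum (headTerm κ e F) L) := by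
      have h1 : (t.p * (e + totalP A)).negOnePow •
          insertOp κ (e + totalP A) (iterInsert κ L F) t.a =
          permSum (fun cs => (t.p * (e + totalP A)).negOnePow •
            insertOp κ (e + totalP A) (multiBrace κ cs F) t.a) L := by
        rw [iterInsert_eq_permSum hκ (by simpa [L] using hA') (by simpa [L] using hk') hF]
        have h2 := permSum_map ((DistribSMul.toAddMonoidHom (List M → M)
          (t.p * (e + totalP A)).negOnePow).comp (AddMonoidHom.mk'
            (fun g : List M → M => insertOp κ (e + totalP A) g t.a)
            fun g g' => funext fun v => insertOp_add_left κ (e + totalP A) g g' ht v))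
            (fun cs => multiBrace κ cs F) L
        exact h2.symm
      have h2 : insertOp κ t.p t.a (permSum (headTerm κ e F) L) =
          permSum (fun cs => insertOp κ t.p t.a (headTerm κ e F cs)) L :=
        (permSum_map (insertHom κ t.p t.a) (headTerm κ e F) L).symm
      rw [h1, h2, ← permSum_add]
      refine permSum_congr fun cs hcs => ?_
      have hc := hmem cs hcs
      have hd : totalP A = totalDeg cs := by rw [hdeg, totalDeg_perm hcs]
      rw [hd]
      cases cs with
      | nil =>
        have : insertOp κ t.p t.a (0 : List M → M) = 0 := map_zero (insertHom κ t.p t.a)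
        simp [insSum, headTerm, this]
      | cons b bs =>
        have hb := hc b (by simp)
        have h3 : insertOp κ t.p t.a (headTerm κ e F (b :: bs)) = (b.1 * e).negOnePow •
            insertOp κ (e + totalDeg bs + t.p) (insertOp κ t.p t.a (multiBrace κ bs F)) b.2 := by
          rw [← insertOp_insertOp_of_kills hκ (a := (t.p, t.a)) (hA t (by simp))
            (homProd_multilinear hb.1) hb.2.1]
          funext v
          exact insertOp_sign κ _ _ _ _ v
        have h4 : insertOp κ t.p t.a (multiBrace κ bs F) =
            insSum (fun cs => multiBrace κ cs F) (t.p, t.a) bs :=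
          insertOp_multiBrace hκ (a := (t.p, t.a)) (hA t (by simp))
            (fun c h => (hc c (by simp [h])).2.1)
            (fun c h => homProd_multilinear (hc c (by simp [h])).1) hF
        have h5 : (b.1 * e).negOnePow • insertOp κ (e + totalDeg bs + t.p)
            (insSum (fun cs => multiBrace κ cs F) (t.p, t.a) bs) b.2 =
            insSum (fun cs => headTerm κ e F (b :: cs)) (t.p, t.a) bs := by
          have h6 := insSum_map ((DistribSMul.toAddMonoidHom (List M → M)
            (b.1 * e).negOnePow).comp (AddMonoidHom.mk'
              (fun g : List M → M => insertOp κ (e + totalDeg bs + t.p) g b.2)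
              fun g g' => funext fun v => insertOp_add_left κ (e + totalDeg bs + t.p) g g'
                (homProd_multilinear hb.1) v)) (fun cs => multiBrace κ cs F) (t.p, t.a) bs
          refine h6.symm.trans (insSum_congr fun ds hds => ?_)
          have h7 : totalDeg ds = totalDeg bs + t.p := by
            rw [totalDeg_perm hds, totalDeg_cons, add_comm]
          rw [headTerm, h7, ← add_assoc]
          rfl
        rw [h3, h4, h5, insSum, headTerm, negOnePow_smul_smul, mul_add, add_comm (t.p * e)]
    rw [e1, e3, e4, mul_comm]
    abel

end

/-! ### Signs of permutations as products over pairs -/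

section PairProd

variable {n : ℕ}

/-- The product over all pairs `i < j`. -/
def pairProd (G : Fin n → Fin n → ℤˣ) : ℤˣ := ∏ i, ∏ j, if i < j then G i j else 1

theorem pairProd_mul (G H : Fin n → Fin n → ℤˣ) :
    pairProd (fun i j => G i j * H i j) = pairProd G * pairProd H := by
  simp only [pairProd, ← Finset.prod_mul_distrib]
  refine Finset.prod_congr rfl fun i _ => Finset.prod_congr rfl fun j _ => ?_
  split_ifs <;> simp

theorem pairProd_congr {G H : Fin n → Fin n → ℤˣ} (h : ∀ i j, i < j → G i j = H i j) :
    pairProd G = pairProd H := by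
  refine Finset.prod_congr rfl fun i _ => Finset.prod_congr rfl fun j _ => ?_
  split_ifs with hij
  · exact h i j hij
  · rfl

theorem pairProd_succAbove {G : Fin (n + 1) → Fin (n + 1) → ℤˣ} (hG : ∀ i j, G i j = G j i)
    (p : Fin (n + 1)) : pairProd G =
      (∏ j, G p (p.succAbove j)) * pairProd fun i j => G (p.succAbove i) (p.succAbove j) := by
  have h : ∀ j, G p (p.succAbove j) = (if p < p.succAbove j then G p (p.succAbove j) else 1) *
      (if p.succAbove j < p then G (p.succAbove j) p else 1) := by
    intro j
    rcases lt_or_gt_of_ne (Fin.succAbove_ne p j) with h | h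
    · rw [if_pos h, if_neg h.not_gt, one_mul, hG]
    · rw [if_pos h, if_neg h.not_gt, mul_one]
  simp only [pairProd]
  rw [Fin.prod_univ_succAbove _ p]
  simp only [Fin.prod_univ_succAbove _ p, lt_irrefl, if_false, one_mul]
  rw [Finset.prod_mul_distrib, ← mul_assoc, ← Finset.prod_mul_distrib]
  congr 1
  · exact Finset.prod_congr rfl fun j _ => (h j).symm
  · simp only [(Fin.strictMono_succAbove p).lt_iff_lt]

/-- The permutation which sends `p` to `q` and acts on the remaining indices, in their order, by
`τ`. -/
def insertPerm (p q : Fin (n + 1)) (τ : Equiv.Perm (Fin n)) : Equiv.Perm (Fin (n + 1)) :=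
  (finSuccEquiv' p).trans ((Equiv.optionCongr τ).trans (finSuccEquiv' q).symm)

@[simp] theorem insertPerm_same (p q : Fin (n + 1)) (τ : Equiv.Perm (Fin n)) :
    insertPerm p q τ p = q := by simp [insertPerm]

@[simp] theorem insertPerm_succAbove (p q : Fin (n + 1)) (τ : Equiv.Perm (Fin n)) (j : Fin n) :
    insertPerm p q τ (p.succAbove j) = q.succAbove (τ j) := by simp [insertPerm]

theorem insertPerm_injective (τ τ' : Equiv.Perm (Fin n)) {p q : Fin (n + 1)}
    (h : insertPerm p q τ = insertPerm p q τ') : τ = τ' := by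
  ext1 j
  apply Fin.succAbove_right_injective (p := q)
  rw [← insertPerm_succAbove p q, h, insertPerm_succAbove]

theorem bijective_insertPerm_right (p : Fin (n + 1)) :
    Function.Bijective fun x : Fin (n + 1) × Equiv.Perm (Fin n) => insertPerm p x.1 x.2 := by
  rw [Fintype.bijective_iff_injective_and_card]
  constructor
  · rintro ⟨q, τ⟩ ⟨q', τ'⟩ h
    have hq : q = q' := by
      have := congrArg (fun σ => σ p) h
      simpa using this
    subst hq
    rw [insertPerm_injective τ τ' h]
  · simp [Fintype.card_perm, Nat.factorial_succ]

theorem bijective_insertPerm_left (q : Fin (n + 1)) :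
    Function.Bijective fun x : Fin (n + 1) × Equiv.Perm (Fin n) => insertPerm x.1 q x.2 := by
  rw [Fintype.bijective_iff_injective_and_card]
  constructor
  · rintro ⟨p, τ⟩ ⟨p', τ'⟩ h
    have hp : p = p' := by
      apply (insertPerm p q τ).injective
      have h' : insertPerm p q τ = insertPerm p' q τ' := h
      conv_rhs => rw [h']
      simp
    subst hp
    rw [insertPerm_injective τ τ' h]
  · simp [Fintype.card_perm, Nat.factorial_succ]

theorem sum_perm_eq_right {X : Type*} [AddCommMonoid X] (p : Fin (n + 1))
    (F : Equiv.Perm (Fin (n + 1)) → X) :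
    ∑ σ, F σ = ∑ q, ∑ τ, F (insertPerm p q τ) := by
  rw [← Fintype.sum_prod_type']
  exact ((bijective_insertPerm_right p).sum_comp F).symm

theorem sum_perm_eq_left {X : Type*} [AddCommMonoid X] (q : Fin (n + 1))
    (F : Equiv.Perm (Fin (n + 1)) → X) :
    ∑ σ, F σ = ∑ p, ∑ τ, F (insertPerm p q τ) := by
  rw [← Fintype.sum_prod_type']
  exact ((bijective_insertPerm_left q).sum_comp F).symm

theorem pairProd_comp {G : Fin n → Fin n → ℤˣ} (hG : ∀ i j, G i j = G j i)
    (σ : Equiv.Perm (Fin n)) : pairProd (fun i j => G (σ i) (σ j)) = pairProd G := by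
  induction n with
  | zero => rfl
  | succ n ih =>
    obtain ⟨⟨q, τ⟩, rfl⟩ := (bijective_insertPerm_right 0).2 σ
    dsimp only
    rw [pairProd_succAbove (fun i j => hG _ _) 0, pairProd_succAbove hG q]
    simp only [insertPerm_same, insertPerm_succAbove]
    rw [ih (G := fun i j => G (q.succAbove i) (q.succAbove j)) fun i j => hG _ _]
    congr 1
    exact Equiv.prod_comp τ fun j => G q (q.succAbove j)

/-- `σ` reverses the order of `i` and `j`. -/
def Inverts (σ : Equiv.Perm (Fin n)) (i j : Fin n) : Prop :=
  (i < j ∧ σ j < σ i) ∨ (j < i ∧ σ i < σ j)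

instance (σ : Equiv.Perm (Fin n)) (i j : Fin n) : Decidable (Inverts σ i j) := by
  unfold Inverts; infer_instance

theorem Inverts.symm_iff (σ : Equiv.Perm (Fin n)) (i j : Fin n) :
    Inverts σ i j ↔ Inverts σ j i := by unfold Inverts; exact or_comm

/-- The product of `c` over the pairs whose order is reversed by `σ`. -/
def invSign (c : Fin n → Fin n → ℤˣ) (σ : Equiv.Perm (Fin n)) : ℤˣ :=
  pairProd fun i j => if Inverts σ i j then c (σ i) (σ j) else 1

theorem koszulSign_eq_invSign (σ : Equiv.Perm (Fin n)) (d : Fin n → ℤ) :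
    koszulSign σ d = invSign (fun a b => (d a * d b).negOnePow) σ := by
  refine Finset.prod_congr rfl fun i _ => Finset.prod_congr rfl fun j _ => ?_
  by_cases h : i < j
  · simp [Inverts, h, h.not_gt]
  · simp [h]

theorem chi_eq_invSign (σ : Equiv.Perm (Fin n)) (d : Fin n → ℤ) :
    chi σ d = invSign (fun a b => (d a * d b + 1).negOnePow) σ := by
  have h : Equiv.Perm.sign σ = pairProd fun i j => if Inverts σ i j then -1 else 1 := by
    rw [Equiv.Perm.sign_eq_prod_prod_Ioi]
    refine Finset.prod_congr rfl fun i _ => ?_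
    rw [← Finset.filter_lt_eq_Ioi, Finset.prod_filter]
    refine Finset.prod_congr rfl fun j _ => ?_
    by_cases hij : i < j
    · have : σ i ≠ σ j := fun e => hij.ne (σ.injective e)
      by_cases hs : σ i < σ j
      · simp [Inverts, hij, hij.not_gt, hs, hs.not_gt]
      · simp [Inverts, hij, hij.not_gt, hs, lt_of_le_of_ne (not_lt.1 hs) this.symm]
    · simp [hij]
  rw [chi, h, koszulSign_eq_invSign, invSign, ← pairProd_mul]
  refine pairProd_congr fun i j _ => ?_
  split_ifs
  · simp only [Int.negOnePow_succ, neg_one_mul]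
  · simp only [mul_one]

theorem invSign_insertPerm {c : Fin (n + 1) → Fin (n + 1) → ℤˣ} (hc : ∀ a b, c a b = c b a)
    (p q : Fin (n + 1)) (τ : Equiv.Perm (Fin n)) :
    invSign c (insertPerm p q τ) =
      (∏ j, if (p < p.succAbove j ∧ q.succAbove (τ j) < q) ∨
          (p.succAbove j < p ∧ q < q.succAbove (τ j)) then c q (q.succAbove (τ j)) else 1) *
        invSign (fun a b => c (q.succAbove a) (q.succAbove b)) τ := by
  rw [invSign, pairProd_succAbove (fun i j => by simp only [Inverts.symm_iff _ i j, hc]) p]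
  simp only [insertPerm_same, insertPerm_succAbove, Inverts,
    (Fin.strictMono_succAbove _).lt_iff_lt]
  rfl

theorem invSign_mul {c : Fin n → Fin n → ℤˣ} (hc : ∀ a b, c a b = c b a)
    (σ τ : Equiv.Perm (Fin n)) :
    invSign c (σ * τ) = invSign c σ * invSign (fun a b => c (σ a) (σ b)) τ := by
  have h : invSign c σ =
      pairProd fun i j => if Inverts σ (τ i) (τ j) then c (σ (τ i)) (σ (τ j)) else 1 :=
    (pairProd_comp (G := fun i j => if Inverts σ i j then c (σ i) (σ j) else 1)
      (fun i j => by simp only [Inverts.symm_iff _ i j, hc]) τ).symm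
  rw [h, invSign, invSign, ← pairProd_mul]
  refine pairProd_congr fun i j hij => ?_
  have h1 : τ i ≠ τ j := fun e => hij.ne (τ.injective e)
  have h2 : σ (τ i) ≠ σ (τ j) := fun e => h1 (σ.injective e)
  have h3 : c (σ (τ i)) (σ (τ j)) * c (σ (τ i)) (σ (τ j)) = 1 := Int.units_mul_self _
  simp only [Inverts, Equiv.Perm.mul_apply, hij, hij.not_gt, true_and, false_and, or_false]
  rcases lt_or_gt_of_ne h1 with h1 | h1 <;> rcases lt_or_gt_of_ne h2 with h2 | h2 <;>
    simp [h1, h1.not_gt, h2, h2.not_gt, h3]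

theorem chi_mul (σ τ : Equiv.Perm (Fin n)) (d : Fin n → ℤ) :
    chi (σ * τ) d = chi σ d * chi τ fun i => d (σ i) := by
  simp only [chi_eq_invSign]
  exact invSign_mul (fun a b => by rw [mul_comm]) σ τ

theorem negOnePow_sum {ι : Type*} (s : Finset ι) (f : ι → ℤ) :
    (∑ i ∈ s, f i).negOnePow = ∏ i ∈ s, (f i).negOnePow := by
  classical
  induction s using Finset.induction_on with
  | empty => simp
  | insert a s ha ih => rw [Finset.sum_insert ha, Finset.prod_insert ha, Int.negOnePow_add, ih]

/-- Moving the argument number `q` to the front. -/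
theorem chi_insertPerm_zero (q : Fin (n + 1)) (τ : Equiv.Perm (Fin n)) (d : Fin (n + 1) → ℤ) :
    chi (insertPerm 0 q τ) d =
      (d q * (∑ j, if j < q then d j else 0) + (q : ℕ)).negOnePow *
        chi τ fun j => d (q.succAbove j) := by
  rw [chi_eq_invSign, invSign_insertPerm fun a b => by rw [mul_comm], chi_eq_invSign]
  congr 1
  have h1 : ∀ j, ((0 : Fin (n + 1)) < (0 : Fin (n + 1)).succAbove j ∧ q.succAbove (τ j) < q) ∨
      ((0 : Fin (n + 1)).succAbove j < 0 ∧ q < q.succAbove (τ j)) ↔ q.succAbove (τ j) < q := by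
    intro j; simp
  simp only [h1]
  rw [Equiv.prod_comp τ fun j => if q.succAbove j < q then
    (d q * d (q.succAbove j) + 1).negOnePow else 1]
  have h2 : (∏ j, if j < q then (d q * d j + 1).negOnePow else 1) =
      ∏ j, if q.succAbove j < q then (d q * d (q.succAbove j) + 1).negOnePow else 1 := by
    rw [Fin.prod_univ_succAbove _ q]; simp
  rw [← h2]
  have h3 : d q * (∑ j, if j < q then d j else 0) + (q : ℕ) =
      ∑ j, if j < q then d q * d j + 1 else 0 := by
    have h4 : ((q : ℕ) : ℤ) = ∑ j : Fin (n + 1), if j < q then 1 else 0 := by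
      rw [Finset.sum_boole, Finset.filter_gt_eq_Iio, Fin.card_Iio]
    rw [h4, Finset.mul_sum, ← Finset.sum_add_distrib]
    refine Finset.sum_congr rfl fun j _ => ?_
    split_ifs <;> ring
  rw [h3, negOnePow_sum]
  refine Finset.prod_congr rfl fun j _ => ?_
  split_ifs <;> simp

/-- Moving the last argument to the place number `p`. -/
theorem koszulSign_insertPerm_last (p : Fin (n + 1)) (τ : Equiv.Perm (Fin n))
    (d : Fin (n + 1) → ℤ) :
    koszulSign (insertPerm p (Fin.last n) τ) d =
      (d (Fin.last n) * ∑ j : Fin n, if p ≤ j.castSucc then d (τ j).castSucc else 0).negOnePow *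
        koszulSign τ fun j => d j.castSucc := by
  rw [koszulSign_eq_invSign, invSign_insertPerm fun a b => by rw [mul_comm], koszulSign_eq_invSign]
  simp only [Fin.succAbove_last]
  congr 1
  rw [Finset.mul_sum, negOnePow_sum]
  refine Finset.prod_congr rfl fun j _ => ?_
  have h : ((p < p.succAbove j ∧ (τ j).castSucc < Fin.last n) ∨
      (p.succAbove j < p ∧ Fin.last n < (τ j).castSucc)) ↔ p ≤ j.castSucc := by
    simp [Fin.castSucc_lt_last, Fin.lt_succAbove_iff_le_castSucc, (Fin.le_last _).not_gt]
  simp only [h]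
  split_ifs <;> simp

end PairProd

/-! ### Symmetrised sums over lists and over permutations -/

section

variable {Y : Type v} {X : Type w} [AddCommGroup X]

theorem insSum_ofFn (Φ : List (ℤ × Y) → X) (a : ℤ × Y) {n : ℕ} (y : Fin n → ℤ × Y) :
    insSum Φ a (List.ofFn y) = ∑ p : Fin (n + 1),
      (a.1 * ∑ j : Fin n, if p ≤ j.castSucc then (y j).1 else 0).negOnePow •
        Φ (List.ofFn (p.insertNth a y : Fin (n + 1) → ℤ × Y)) := by
  induction n generalizing Φ with
  | zero => simp [insSum]
  | succ n ih =>
    rw [List.ofFn_succ, insSum, Fin.sum_univ_succ, ih]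
    congr 1
    · have h1 : totalDeg (y 0 :: List.ofFn fun i : Fin n => y i.succ) = ∑ j, (y j).1 := by
        rw [← List.ofFn_succ, totalDeg, List.map_ofFn, List.sum_ofFn]; rfl
      rw [h1]
      simp
    · refine Finset.sum_congr rfl fun p _ => ?_
      congr 3
      · rw [Fin.sum_univ_succ]
        simp [Fin.le_def]
      · have h2 : (p.succ.insertNth a y : Fin (n + 1 + 1) → ℤ × Y) =
            Fin.cons (y 0) (p.insertNth a fun i => y i.succ : Fin (n + 1) → ℤ × Y) := by
          conv_lhs => rw [← Fin.cons_self_tail y]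
          rw [Fin.insertNth_succ_cons]
          rfl
        rw [h2, List.ofFn_cons]

theorem permSum_reverse_ofFn (Φ : List (ℤ × Y) → X) {n : ℕ} (y : Fin n → ℤ × Y) :
    permSum Φ (List.ofFn y).reverse = ∑ σ : Equiv.Perm (Fin n),
      koszulSign σ (fun j => (y j).1) • Φ (List.ofFn fun j => y (σ j)) := by
  induction n generalizing Φ with
  | zero => simp [permSum, koszulSign]
  | succ n ih =>
    rw [List.ofFn_succ', List.concat_eq_append, List.reverse_append, List.reverse_singleton,
      List.singleton_append, permSum, ih, sum_perm_eq_left (Fin.last n), Finset.sum_comm]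
    refine Finset.sum_congr rfl fun τ _ => ?_
    rw [insSum_ofFn, Finset.smul_sum]
    refine Finset.sum_congr rfl fun p _ => ?_
    rw [koszulSign_insertPerm_last, smul_smul, mul_comm]
    congr 2
    congr 1
    rw [eq_comm, Fin.eq_insertNth_iff]
    constructor
    · simp
    · funext j
      simp [Fin.removeNth]

end

/-! ### Extension of scalars along `k[u] / (u² - lam u)` -/

section Extension

variable {k : Type u} {M : Type v} [Field k] [AddCommGroup M] [Module k M]
  {κ : ℤ → M →ₗ[k] M} {𝓜 : ℤ → Submodule k M}

/-- The grading of `M × M`. -/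
def pairGrading (𝓜 : ℤ → Submodule k M) (i : ℤ) : Submodule k (M × M) := (𝓜 i).prod (𝓜 i)

/-- The sign operators of `M × M`. -/
def pairSign (κ : ℤ → M →ₗ[k] M) (d : ℤ) : M × M →ₗ[k] M × M := (κ d).prodMap (κ d)

@[simp] theorem pairSign_mk (d : ℤ) (a b : M) : pairSign κ d (a, b) = (κ d a, κ d b) := rfl

theorem pairSign_apply (d : ℤ) (m : M × M) : pairSign κ d m = (κ d m.1, κ d m.2) := rfl

theorem units_smul_snd (c : ℤˣ) (m : M × M) : (c • m).2 = c • m.2 := rfl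

theorem SignRule.pair (hκ : SignRule 𝓜 κ) : SignRule (pairGrading 𝓜) (pairSign κ) where
  apply_mem := by
    rintro d i ⟨a, b⟩ ⟨ha, hb⟩
    rw [pairSign_mk, hκ.apply_mem d i a ha, hκ.apply_mem d i b hb]
    rfl
  span := by
    rw [eq_top_iff]
    rintro ⟨a, b⟩ -
    have h1 : ∀ a : M, (a, (0 : M)) ∈ ⨆ i, pairGrading 𝓜 i := fun a => by
      induction a using hκ.induction with
      | h0 => exact zero_mem _
      | hm i x hx => exact Submodule.mem_iSup_of_mem i ⟨hx, zero_mem _⟩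
      | ha x y hx hy => simpa using add_mem hx hy
    have h2 : ∀ a : M, ((0 : M), a) ∈ ⨆ i, pairGrading 𝓜 i := fun a => by
      induction a using hκ.induction with
      | h0 => exact zero_mem _
      | hm i x hx => exact Submodule.mem_iSup_of_mem i ⟨zero_mem _, hx⟩
      | ha x y hx hy => simpa using add_mem hx hy
    simpa using add_mem (h1 a) (h2 b)

/-- Multiplication by `u` on `u ⊗ M ⊕ 1 ⊗ M`, where `u² = lam u`. -/
def umul (lam : k) : M × M →ₗ[k] M × M :=
  (lam • LinearMap.fst k M M + LinearMap.snd k M M).prod 0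

theorem umul_mk (lam : k) (a b : M) : umul lam (a, b) = (lam • a + b, 0) := rfl

theorem umul_umul (lam : k) (m : M × M) : umul lam (umul lam m) = lam • umul lam m := by
  obtain ⟨a, b⟩ := m
  simp [umul_mk]

/-- The extension of a family of multilinear maps on `M` to one on `M × M = u ⊗ M ⊕ 1 ⊗ M` which is
multilinear over `k[u] / (u² - lam u)`. -/
def extend (lam : k) : (List M → M) → List (M × M) → M × M
  | h, [] => (0, h [])
  | h, m :: t => umul lam (extend lam (fun l => h (m.1 :: l)) t) +
      extend lam (fun l => h (m.2 :: l)) t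

variable (lam : k)

theorem extend_add (h h' : List M → M) (v : List (M × M)) :
    extend lam (fun l => h l + h' l) v = extend lam h v + extend lam h' v := by
  induction v generalizing h h' with
  | nil => simp [extend]
  | cons m t ih => simp only [extend, ih, map_add]; abel

theorem extend_smul (c : k) (h : List M → M) (v : List (M × M)) :
    extend lam (fun l => c • h l) v = c • extend lam h v := by
  induction v generalizing h with
  | nil => simp [extend]
  | cons m t ih => simp only [extend, ih, map_smul, smul_add]

theorem extend_zero (v : List (M × M)) : extend lam (fun _ => (0 : M)) v = 0 := by
  simpa using extend_smul lam 0 (fun _ => (0 : M)) v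

theorem extend_sub (h h' : List M → M) : extend lam (h - h') = extend lam h - extend lam h' := by
  rw [eq_sub_iff_add_eq]
  funext v
  rw [Pi.add_apply, ← extend_add]
  simp

theorem extend_sign (c : ℤ) (h : List M → M) :
    extend lam (c.negOnePow • h) = c.negOnePow • extend lam h := by
  funext v
  have := extend_smul lam (((c.negOnePow : ℤˣ) : ℤ) : k) h v
  simp only [negOnePow_cast_smul] at this
  exact this

theorem extend_multilinear {h : List M → M} (hh : IsMultilinear k h) :
    IsMultilinear k (extend lam h) := by
  constructor
  · intro l r a b
    induction l generalizing h with
    | nil =>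
      simp only [List.nil_append, extend, Prod.fst_add, Prod.snd_add, hh.add_head, extend_add,
        map_add]
      abel
    | cons x l ih => simp only [List.cons_append, extend, ih (hh.cons _), map_add]; abel
  · intro l r c a
    induction l generalizing h with
    | nil =>
      simp only [List.nil_append, extend, Prod.smul_fst, Prod.smul_snd, hh.smul_head, extend_smul,
        map_smul, smul_add]
    | cons x l ih => simp only [List.cons_append, extend, ih (hh.cons _), map_smul, smul_add]

theorem extend_umul_head {h : List M → M} (hh : IsMultilinear k h) (m : M × M)
    (t : List (M × M)) : extend lam h (umul lam m :: t) = umul lam (extend lam h (m :: t)) := by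
  obtain ⟨a, b⟩ := m
  simp only [extend, umul_mk, hh.add_head, hh.smul_head, extend_add, extend_smul, map_add, map_smul,
    umul_umul, hh.zero_head, extend_zero, add_zero]

theorem extend_snd (h : List M → M) (v : List (M × M)) :
    (extend lam h v).2 = h (v.map Prod.snd) := by
  induction v generalizing h with
  | nil => rfl
  | cons m t ih =>
    rw [extend, Prod.snd_add, ih]
    simp [umul]

theorem extend_mem {e : ℤ} {h : List M → M}
    (hh : ∀ i v, HomList 𝓜 i v → h v ∈ 𝓜 (i.sum + e)) {i : List ℤ} {v : List (M × M)}
    (hv : HomList (pairGrading 𝓜) i v) : extend lam h v ∈ pairGrading 𝓜 (i.sum + e) := by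
  induction hv generalizing h e with
  | nil => exact ⟨zero_mem _, hh [] [] .nil⟩
  | @cons j m i v hm hv ih =>
    have hs : (j :: i).sum + e = i.sum + (j + e) := by simp; ring
    rw [hs]
    have key : ∀ x ∈ 𝓜 j, extend lam (fun l => h (x :: l)) v ∈ pairGrading 𝓜 (i.sum + (j + e)) :=
      fun x hx => ih fun i' v' hv' => by
        have := hh _ _ (List.Forall₂.cons hx hv')
        convert this using 2
        simp; ring
    refine add_mem ?_ (key _ hm.2)
    have h1 := key _ hm.1
    exact ⟨add_mem (Submodule.smul_mem _ _ h1.1) h1.2, zero_mem _⟩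

theorem extend_mem_graded {e : ℤ} {h : List M → M} (hh : h ∈ graded 𝓜 e) :
    extend lam h ∈ graded (pairGrading 𝓜) e :=
  mem_homProd_iff.2 ⟨by simp [extend, homProd_nil hh],
    extend_multilinear lam (homProd_multilinear hh), fun i v hv =>
      extend_mem lam (fun i v h => homProd_apply_mem hh h) hv⟩

theorem prefixSum_map_left {X Y : Type*} [AddCommGroup X] [AddCommGroup Y] (φ : X → X)
    (φ' : Y →+ Y) (g : List X → X) {Ψ : X → List X → Y} (hΨ : ∀ t a, Ψ (φ a) t = φ' (Ψ a t))
    (v : List X) : prefixSum (fun l => φ (g l)) Ψ v = φ' (prefixSum g Ψ v) := by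
  induction v generalizing g with
  | nil => simp [prefixSum]
  | cons x t ih => simp only [prefixSum, ih, hΨ, map_add]

theorem extend_prefixSum (f : List M → M) {h : List M → M} (hh : IsMultilinear k h)
    (v : List (M × M)) : extend lam (prefixSum f fun w t => h (w :: t)) v =
      prefixSum (extend lam f) (fun w t => extend lam h (w :: t)) v := by
  induction v generalizing f with
  | nil => simp [extend, prefixSum]
  | cons m t ih =>
    have hm := extend_multilinear lam hh
    have h1 := prefixSum_add_left (fun l => umul lam (extend lam (fun l => f (m.1 :: l)) l))
      (extend lam fun l => f (m.2 :: l)) (Ψ := fun w t => extend lam h (w :: t))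
      (fun t a b => hm.add_head a b t) t
    have h2 := prefixSum_map_left (umul lam) (umul (M := M) lam).toAddMonoidHom
      (extend lam fun l => f (m.1 :: l)) (Ψ := fun w t => extend lam h (w :: t))
      (fun t a => extend_umul_head lam hh a t) t
    have h3 : extend lam f [m] = (f [m.1], f [m.2]) := by simp [extend, umul_mk]
    simp only [extend, prefixSum, extend_add, ih, map_add] at h1 h2 h3 ⊢
    rw [h1, h2, h3]
    simp only [LinearMap.toAddMonoidHom_coe]
    abel

/-- Extension of scalars is compatible with insertions. -/
theorem extend_insertOp (d : ℤ) (f : List M → M) {h : List M → M} (hh : IsMultilinear k h) :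
    extend lam (insertOp κ d f h) = insertOp (pairSign κ) d (extend lam f) (extend lam h) := by
  funext v
  induction v generalizing h with
  | nil => simp [extend, insertOp]
  | cons m t ih =>
    have h1 := insertOp_add (pairSign κ) d (extend lam f)
      (fun l => umul lam (extend lam (fun l => h (κ d m.1 :: l)) l))
      (extend lam (fun l => h (κ d m.2 :: l))) t
    have h2 := insertOp_map (pairSign κ) (umul (M := M) lam).toAddMonoidHom d (extend lam f)
      (extend lam (fun l => h (κ d m.1 :: l))) t
    have h3 := extend_prefixSum lam f hh (m :: t)
    simp only [LinearMap.toAddMonoidHom_coe] at h2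
    simp only [insertOp, ← h3]
    simp only [extend, insertOp, pairSign_apply, h1, h2, extend_add, ← ih (hh.cons _), map_add]
    abel

theorem extend_lieBr (d e : ℤ) {f g : List M → M} (hf : IsMultilinear k f)
    (hg : IsMultilinear k g) : extend lam (lieBr κ d e f g) =
      lieBr (pairSign κ) d e (extend lam f) (extend lam g) := by
  rw [lieBr, extend_sub, extend_sign, extend_insertOp lam _ _ hf, extend_insertOp lam _ _ hg, lieBr]

/-- A list of elements of `u ⊗ M` and of `1 ⊗ M`, according to whether the members of a list of
numbers vanish. -/
def pureList (w : List ℕ) (y : List M) : List (M × M) :=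
  List.zipWith (fun r x => if r = 0 then (x, 0) else (0, x)) w y

/-- On arguments in `u ⊗ M` and in `1 ⊗ M`, the extension is `h` times a power of `u`, the exponent
being the number of arguments in `u ⊗ M`. The powers of the weight in the brackets come from `u ^ (r
+ 1) = lam ^ r u`. -/
theorem extend_pureList {h : List M → M} (hh : IsMultilinear k h) {w : List ℕ} {y : List M}
    (hl : w.length = y.length) : extend lam h (pureList w y) =
      if patVertices w = w.length then (0, h y)
      else (lam ^ (w.length - patVertices w - 1) • h y, 0) := by
  induction w generalizing y h with
  | nil =>
    obtain rfl : y = [] := List.eq_nil_of_length_eq_zero hl.symm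
    simp [pureList, extend]
  | cons r w ih =>
    obtain _ | ⟨x, y⟩ := y
    · simp at hl
    have hv := patVertices_le_length w
    have ih' := ih (hh.cons x) (by simpa using hl)
    unfold pureList at ih' ⊢
    have h0 : extend lam (fun l => h (0 :: l)) = fun _ => 0 := by
      funext v
      rw [show (fun l => h (0 :: l)) = fun _ => 0 from funext fun l => hh.zero_head l, extend_zero]
    cases r with
    | zero =>
      rw [List.zipWith_cons_cons, if_pos rfl, extend, ih', h0, patVertices_zero, List.length_cons,
        if_neg (show ¬patVertices w = w.length + 1 by lia)]
      split_ifs with h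
      · simp [umul_mk, h]
      · rw [umul_mk, smul_smul, ← pow_succ', add_zero, add_zero,
          show w.length + 1 - patVertices w - 1 = w.length - patVertices w - 1 + 1 by lia]
    | succ r =>
      rw [List.zipWith_cons_cons, if_neg (by simp), extend, ih', h0, patVertices_succ,
        List.length_cons, map_zero, zero_add]
      split_ifs with h1 h2 h2
      · rfl
      · lia
      · lia
      · rw [show w.length + 1 - (patVertices w + 1) - 1 = w.length - patVertices w - 1 by lia]

/-! ### The abelian subalgebra of operators -/

/-- The operator `g` as the map on `M × M` which sends `u ⊗ M` to `1 ⊗ M` by `g`, and vanishes if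
one of its arguments is in `1 ⊗ M`. -/
def operatorLift (g : List M → M) : List (M × M) → M × M := fun v => (0, g (v.map Prod.fst))

theorem operatorLift_injective {g g' : List M → M} (h : operatorLift g = operatorLift g') :
    g = g' := by
  funext v
  have := congrArg Prod.snd (congrFun h (v.map fun x => (x, 0)))
  simpa [operatorLift, Function.comp_def] using this

theorem operatorLift_mem {p : ℤ} {g : List M → M} (hg : g ∈ graded 𝓜 p) :
    operatorLift g ∈ graded (pairGrading 𝓜) p := by
  refine mem_homProd_iff.2 ⟨by simp [operatorLift, homProd_nil hg], ?_, fun i v hv => ?_⟩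
  · exact ((homProd_multilinear hg).comp_map (LinearMap.fst k M M)).linear_comp
      (LinearMap.inr k M M)
  · refine ⟨zero_mem _, ?_⟩
    have : HomList 𝓜 i (v.map Prod.fst) := by
      induction hv with
      | nil => exact .nil
      | cons h _ ih => exact .cons h.1 ih
    simpa [operatorLift] using homProd_apply_mem hg this

theorem kills_operatorLift {g : List M → M} (hg : IsMultilinear k g) (g' : List M → M) :
    Kills (pairSign κ) (operatorLift g) (operatorLift g') := by
  intro c l v r
  simp [operatorLift, hg.zero_slot]

/-- The projection onto the operators. -/
def operatorProj : (List (M × M) → M × M) →ₗ[k] (List (M × M) → M × M) where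
  toFun f v := (0, (f (v.map fun m => (m.1, 0))).2)
  map_add' f g := by funext v; simp
  map_smul' c f := by funext v; simp

theorem operatorProj_apply (f : List (M × M) → M × M) (v : List (M × M)) :
    operatorProj (k := k) f v = (0, (f (v.map fun m => (m.1, 0))).2) := rfl

theorem operatorProj_operatorLift (g : List M → M) :
    operatorProj (k := k) (operatorLift g) = operatorLift g := by
  funext v
  simp [operatorProj_apply, operatorLift, Function.comp_def]

theorem operatorProj_extend {e : ℤ} {h : List M → M} (hh : h ∈ graded 𝓜 e) :
    operatorProj (k := k) (extend lam h) = 0 := by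
  funext v
  rw [operatorProj_apply, extend_snd]
  cases v with
  | nil => simp [homProd_nil hh]
  | cons m t => simp [(homProd_multilinear hh).zero_head]

theorem operatorProj_mem {d : ℤ} {f : List (M × M) → M × M} (hf : f ∈ graded (pairGrading 𝓜) d) :
    operatorProj (k := k) f ∈ graded (pairGrading 𝓜) d := by
  refine mem_homProd_iff.2 ⟨by simp [operatorProj_apply, homProd_nil hf], ?_, fun i v hv => ?_⟩
  · exact ((homProd_multilinear hf).comp_map
      ((LinearMap.inl k M M).comp (LinearMap.fst k M M))).linear_comp
        ((LinearMap.inr k M M).comp (LinearMap.snd k M M))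
  · refine ⟨zero_mem _, ?_⟩
    have : HomList (pairGrading 𝓜) i (v.map fun m => (m.1, 0)) := by
      induction hv with
      | nil => exact .nil
      | cons h _ ih => exact .cons ⟨h.1, zero_mem _⟩ ih
    simpa [operatorProj_apply] using (homProd_apply_mem hf this).2

/-- In the operator part of a composition, the output of the inner map is in `u ⊗ M`, and then only
the operator part of the outer map matters, or in `1 ⊗ M`, and then only the operator part of the
inner map does. -/
theorem prefixSum_operatorProj {f : List (M × M) → M × M} (hf : IsMultilinear k f)
    (g : List (M × M) → M × M) (v : List M) :
    (prefixSum g (fun w t => f (w :: t)) (v.map fun x => (x, 0))).2 =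
      (prefixSum g (fun w t => operatorProj (k := k) f (w :: t)) (v.map fun x => (x, 0))).2 +
      (prefixSum (operatorProj (k := k) g) (fun w t => f (w :: t)) (v.map fun x => (x, 0))).2 := by
  induction v generalizing g with
  | nil => simp [prefixSum]
  | cons x t ih =>
    have h1 : (fun l => operatorProj (k := k) g ((x, 0) :: l)) =
        operatorProj (k := k) fun l => g ((x, 0) :: l) := rfl
    have h2 : f (g [(x, 0)] :: t.map fun x => (x, 0)) =
        f (((g [(x, 0)]).1, 0) :: t.map fun x => (x, 0)) +
          f ((0, (g [(x, 0)]).2) :: t.map fun x => (x, 0)) := by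
      rw [← hf.add_head]; simp
    simp only [List.map_cons, prefixSum, h2, Prod.snd_add]
    rw [h1, ih fun l => g ((x, 0) :: l)]
    simp only [operatorProj_apply, List.map_cons, List.map_map, Function.comp_def, List.map_nil]
    abel

theorem operatorProj_insertOp (e : ℤ) (g : List (M × M) → M × M) {f : List (M × M) → M × M}
    (hf : IsMultilinear k f) : operatorProj (k := k) (insertOp (pairSign κ) e g f) =
      operatorProj (k := k) (insertOp (pairSign κ) e g (operatorProj (k := k) f)) +
      operatorProj (k := k) (insertOp (pairSign κ) e (operatorProj (k := k) g) f) := by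
  have key : ∀ v : List M, (insertOp (pairSign κ) e g f (v.map fun x => (x, 0))).2 =
      (insertOp (pairSign κ) e g (operatorProj (k := k) f) (v.map fun x => (x, 0))).2 +
      (insertOp (pairSign κ) e (operatorProj (k := k) g) f (v.map fun x => (x, 0))).2 := by
    intro v
    induction v generalizing f with
    | nil => simp [insertOp]
    | cons x t ih =>
      have h1 : (fun l => operatorProj (k := k) f (pairSign κ e (x, 0) :: l)) =
          operatorProj (k := k) fun l => f (pairSign κ e (x, 0) :: l) := by
        funext l
        simp [operatorProj_apply]
      have h2 := prefixSum_operatorProj hf g (x :: t)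
      simp only [List.map_cons] at h2
      simp only [List.map_cons, insertOp, h1, Prod.snd_add, ih (hf.cons _), h2]
      abel
  funext v
  have := key (v.map Prod.fst)
  simp only [List.map_map, Function.comp_def] at this
  simp [operatorProj_apply, this]

theorem insertOp_operatorProj (e : ℤ) {f : List (M × M) → M × M} (hf : IsMultilinear k f)
    (g : List (M × M) → M × M) :
    insertOp (pairSign κ) e (operatorProj (k := k) g) (operatorProj (k := k) f) = 0 := by
  funext v
  apply insertOp_eq_zero
  intro l v r
  have h := hf.zero_slot (l.map fun m => (m.1, 0)) (r.map fun m => (m.1, 0))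
  simp only [operatorProj_apply, List.map_append, List.map_cons]
  rw [show ((0 : M), (0 : M)) = 0 from rfl, h]
  rfl

theorem sub_smul_left_of_linear {X Y : Type*} [AddCommGroup X] [AddCommGroup Y] (φ : X →+ Y)
    (c : ℤˣ) (a b : X) : φ (a - c • b) = φ a - c • φ b := by
  rw [map_sub, Units.smul_def, Units.smul_def, map_zsmul]

theorem lieBr_add_left {κ : ℤ → M →ₗ[k] M} (d e : ℤ) (f f' : List M → M) {g : List M → M}
    (hg : IsMultilinear k g) :
    lieBr κ d e (f + f') g = lieBr κ d e f g + lieBr κ d e f' g := by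
  have h1 : insertOp κ e g (f + f') = insertOp κ e g f + insertOp κ e g f' :=
    funext fun v => insertOp_add κ e g f f' v
  have h2 : insertOp κ d (f + f') g = insertOp κ d f g + insertOp κ d f' g :=
    funext fun v => insertOp_add_left κ d f f' hg v
  rw [lieBr, h1, h2, smul_add, lieBr, lieBr]
  abel

theorem lieBr_smul_left {κ : ℤ → M →ₗ[k] M} (d e : ℤ) (c : k) (f : List M → M) {g : List M → M}
    (hg : IsMultilinear k g) : lieBr κ d e (c • f) g = c • lieBr κ d e f g := by
  have h1 : insertOp κ e g (c • f) = c • insertOp κ e g f :=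
    funext fun v => insertOp_map κ (DistribSMul.toAddMonoidHom M c) e g f v
  have h2 : insertOp κ d (c • f) g = c • insertOp κ d f g :=
    funext fun v => insertOp_smul_left κ c d f hg v
  rw [lieBr, h1, h2, lieBr, smul_sub, smul_comm]

/-- The Gerstenhaber bracket of `M × M` with the abelian subalgebra of operators. -/
theorem derivedBracketData_operatorProj (hκ : SignRule 𝓜 κ) :
    DerivedBracketData (graded (pairGrading 𝓜)) (lieBr (pairSign κ)) (operatorProj (k := k)) where
  mem hf hg := lieBr_mem hκ.pair hf hg
  add_left hg := lieBr_add_left _ _ _ _ (homProd_multilinear hg)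
  smul_left c hg := lieBr_smul_left _ _ c _ (homProd_multilinear hg)
  antisymm := lieBr_antisymm _ _ _ _
  jacobi hf hg hh := lieBr_jacobi hκ.pair hf hg hh
  P_idem f := by
    funext v
    simp [operatorProj_apply, Function.comp_def]
  P_mem hf := operatorProj_mem hf
  P_br {d e f g} hf hg := by
    have mf := homProd_multilinear hf
    have mg := homProd_multilinear hg
    have h1 := operatorProj_insertOp (κ := κ) e g mf
    have h2 := operatorProj_insertOp (κ := κ) d f mg
    have hP := sub_smul_left_of_linear (operatorProj (k := k) (M := M)).toAddMonoidHom
    simp only [LinearMap.toAddMonoidHom_coe] at hP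
    simp only [lieBr, hP, h1, h2, smul_add]
    abel
  P_comm {d e f g} hf hg := by
    rw [lieBr, insertOp_operatorProj e (homProd_multilinear hf),
      insertOp_operatorProj d (homProd_multilinear hg), smul_zero, sub_zero]

end Extension

/-! ### The explicit brackets as derived brackets -/

section

variable {k : Type u} {M : Type v} [Field k] [AddCommGroup M] [Module k M]
  {κ : ℤ → M →ₗ[k] M} {𝓜 : ℤ → Submodule k M}

/-- Operators, given with their degrees, as maps on `M × M`. -/
def liftList (Gs : List (ℤ × (List M → M))) : List (ℤ × (List (M × M) → M × M)) :=
  Gs.map fun G => (G.1, operatorLift G.2)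

@[simp] theorem totalDeg_liftList (Gs : List (ℤ × (List M → M))) :
    totalDeg (liftList Gs) = totalDeg Gs := by
  simp [totalDeg, liftList, Function.comp_def]

@[simp] theorem length_liftList (Gs : List (ℤ × (List M → M))) :
    (liftList Gs).length = Gs.length := by
  simp [liftList]

theorem applyPattern_liftList (w : List ℕ) (Gs : List (ℤ × (List M → M))) (v : List M) :
    applyPattern (pairSign κ) w (liftList Gs) (v.map fun x => (x, 0)) =
      pureList w (applyPattern κ w Gs v) := by
  induction w generalizing Gs v with
  | nil => rfl
  | cons r w ih =>
    unfold pureList at ih ⊢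
    cases r with
    | zero =>
      rw [applyPattern, applyPattern, List.zipWith_cons_cons, if_pos rfl, ← List.map_tail, ih,
        totalDeg_liftList]
      congr 1
      cases v <;> simp [pairSign]
    | succ r =>
      rw [applyPattern, applyPattern, List.zipWith_cons_cons, if_neg (by simp),
        show (liftList Gs).tail = liftList Gs.tail from List.map_tail.symm, ← List.map_drop, ih,
        totalDeg_liftList]
      congr 1
      cases Gs with
      | nil => rfl
      | cons G Gs => simp [liftList, operatorLift, Function.comp_def]

/-- The brace of an extended map with operators. Its part in `1 ⊗ M` consists of the terms in which
every input of `h` is the output of an operator. In its part in `u ⊗ M`, there is a factor `lam` for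
all but one of the other inputs. -/
theorem multiBrace_extend (hκ : SignRule 𝓜 κ) (lam : k) (Gs : List (ℤ × (List M → M)))
    {h : List M → M} (hh : IsMultilinear k h) (v : List M) :
    multiBrace (pairSign κ) (liftList Gs) (extend lam h) (v.map fun x => (x, 0)) =
      (multiBrace κ Gs (weighted lam (Gs.length + 1) h) v,
        multiBrace κ Gs (arityPart Gs.length h) v) := by
  rw [multiBrace_eq_sum hκ.pair, multiBrace_eq_sum hκ, multiBrace_eq_sum hκ, List.length_map]
  refine Eq.trans ?_ (Prod.ext (Prod.fst_sum ..) (Prod.snd_sum ..) :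
    ∑ w ∈ patterns v.length,
      (if patVertices w = Gs.length then
          weighted lam (Gs.length + 1) h (applyPattern κ w Gs v) else 0,
        if patVertices w = Gs.length then
          arityPart Gs.length h (applyPattern κ w Gs v) else 0) = _)
  refine Finset.sum_congr rfl fun w _ => ?_
  rw [applyPattern_liftList, length_liftList,
    extend_pureList lam hh (applyPattern_length κ w Gs v).symm]
  have hv := patVertices_le_length w
  by_cases h1 : patVertices w = Gs.length
  · simp only [if_pos h1, weighted, arityPart, applyPattern_length]
    by_cases h2 : patVertices w = w.length
    · rw [if_pos h2, if_neg (by lia), if_pos (by lia)]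
    · rw [if_neg h2, if_pos (by lia), if_neg (by lia), h1, Nat.sub_sub]
  · simp only [if_neg h1]
    rfl

theorem insertOp_operatorLift (d : ℤ) (G : List (M × M) → M × M) (g : List M → M) (v : List M) :
    insertOp (pairSign κ) d G (operatorLift g) (v.map fun x => (x, 0)) =
      (0, insertOp κ d (fun l => (G (l.map fun x => (x, 0))).1) g v) := by
  have hp : ∀ (G : List (M × M) → M × M) (g : List M → M) (v : List M),
      prefixSum G (fun w t => operatorLift g (w :: t)) (v.map fun x => (x, 0)) =
        (0, prefixSum (fun l => (G (l.map fun x => (x, 0))).1) (fun w t => g (w :: t)) v) := by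
    intro G g v
    induction v generalizing G with
    | nil => rfl
    | cons x t ih =>
      simp only [List.map_cons, prefixSum, ih]
      simp [operatorLift, Function.comp_def]
  induction v generalizing g with
  | nil => rfl
  | cons x t ih =>
    have h1 : (fun l => operatorLift g (pairSign κ d (x, 0) :: l)) =
        operatorLift fun l => g (κ d x :: l) := rfl
    have h2 := hp G g (x :: t)
    rw [List.map_cons] at h2
    rw [List.map_cons, insertOp, h1, ih, h2]
    simp [insertOp]

theorem operatorProj_eq_operatorLift {f : List (M × M) → M × M} {g : List M → M}
    (h : ∀ v : List M, (f (v.map fun x => (x, 0))).2 = g v) :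
    operatorProj (k := k) f = operatorLift g := by
  funext v
  have := h (v.map Prod.fst)
  rw [List.map_map] at this
  exact Prod.ext rfl this

theorem operatorLift_sign (c : ℤˣ) (f : List M → M) :
    operatorLift (c • f) = c • operatorLift f := by
  funext v
  exact Prod.ext (smul_zero c).symm rfl

theorem operatorLift_sum {ι : Type*} (s : Finset ι) (f : ι → List M → M) :
    operatorLift (∑ i ∈ s, f i) = ∑ i ∈ s, operatorLift (f i) :=
  map_sum (AddMonoidHom.mk' (operatorLift (M := M)) fun f g => by
    funext v; simp [operatorLift]) f s

theorem operatorProj_sign (c : ℤˣ) (f : List (M × M) → M × M) :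
    operatorProj (k := k) (c • f) = c • operatorProj (k := k) f := by
  rw [Units.smul_def, Units.smul_def, map_zsmul]

/-- The summand of the brackets with several operators, for operators in the given order. -/
def braceTerm (κ : ℤ → M →ₗ[k] M) (lam : k) (dh : ℤ) (h : List M → M) :
    List (ℤ × (List M → M)) → List M → M
  | [] => 0
  | G :: Gs => multiBrace κ (G :: Gs) (arityPart (Gs.length + 1) h) -
      (G.1 * dh).negOnePow • insertOp κ (dh + totalDeg Gs)
        (multiBrace κ Gs (weighted lam (Gs.length + 1) h)) G.2

/-- The operator part consists of the values of the brace in `1 ⊗ M`, and of the results of applying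
the first operator to values in `u ⊗ M`. -/
theorem operatorProj_braceTerm (hκ : SignRule 𝓜 κ) (lam : k) (dh : ℤ) {h : List M → M}
    (hh : IsMultilinear k h) {Gs : List (ℤ × (List M → M))} (hGs : Gs ≠ []) :
    operatorProj (k := k) (multiBrace (pairSign κ) (liftList Gs) (extend lam h) -
      headTerm (pairSign κ) dh (extend lam h) (liftList Gs)) =
        operatorLift (braceTerm κ lam dh h Gs) := by
  obtain ⟨G, Gs, rfl⟩ := List.exists_cons_of_ne_nil hGs
  apply operatorProj_eq_operatorLift
  intro v
  have h1 : headTerm (pairSign κ) dh (extend lam h) (liftList (G :: Gs)) =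
      (G.1 * dh).negOnePow • insertOp (pairSign κ) (dh + totalDeg Gs)
        (multiBrace (pairSign κ) (liftList Gs) (extend lam h)) (operatorLift G.2) := by
    rw [← totalDeg_liftList Gs]
    rfl
  rw [h1, Pi.sub_apply, Pi.smul_apply, Prod.snd_sub, units_smul_snd, multiBrace_extend hκ lam _ hh,
    insertOp_operatorLift]
  simp only [multiBrace_extend hκ lam _ hh]
  rfl

theorem multiBrace_singleton (hκ : SignRule 𝓜 κ) (G : ℤ × (List M → M)) (f : List M → M) :
    multiBrace κ [G] f = insertOp κ G.1 G.2 f := by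
  funext v
  induction v generalizing f with
  | nil => rfl
  | cons x t ih =>
    have h : (fun l : List M => G.2 (l.map (κ (totalDeg ([] : List (ℤ × (List M → M))))))) = G.2 :=
      funext fun l => by rw [totalDeg_nil, hκ.map_zero_list]
    have ih' := ih (fun l => f (κ G.1 x :: l))
    simp only [multiBrace, insertThen, insertOp, h] at ih' ⊢
    rw [← ih']
    simp

/-- The operator part of an iterated bracket of `h` with operators, as a sum over the orders of the
operators. -/
theorem operatorProj_iter (hκ : SignRule 𝓜 κ) (lam : k) (dh : ℤ) {h : List M → M}
    (hh : IsMultilinear k h) {m : ℕ} (G : Fin (m + 1) → ℤ × (List M → M))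
    (hG : ∀ j, (G j).2 ∈ graded 𝓜 (G j).1)
    {A : List (Entry (List (M × M) → M × M))}
    (hA : A.map (fun t => (t.p, t.a)) = liftList (List.ofFn G).reverse) :
    operatorProj (k := k) (DerivedBracketData.iter (lieBr (pairSign κ)) dh (extend lam h) A) =
      operatorLift (∑ σ : Equiv.Perm (Fin (m + 1)), koszulSign σ (fun j => (G j).1) •
        braceTerm κ lam dh h (List.ofFn fun j => G (σ j))) := by
  have hmem : ∀ t ∈ A, ∃ j, t.p = (G j).1 ∧ t.a = operatorLift (G j).2 := by
    intro t ht
    have : (t.p, t.a) ∈ liftList (List.ofFn G).reverse := hA ▸ List.mem_map_of_mem ht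
    rw [liftList, List.mem_map] at this
    obtain ⟨a, ha, hat⟩ := this
    rw [List.mem_reverse, List.mem_ofFn] at ha
    obtain ⟨j, rfl⟩ := ha
    exact ⟨j, (congrArg Prod.fst hat).symm, (congrArg Prod.snd hat).symm⟩
  rw [iter_lieBr hκ.pair (extend_multilinear lam hh), hA]
  · have hl : liftList (List.ofFn G).reverse =
        (List.ofFn fun j => ((G j).1, operatorLift (G j).2)).reverse := by
      rw [liftList, List.map_reverse, List.map_ofFn]; rfl
    rw [hl, permSum_reverse_ofFn, permSum_reverse_ofFn, ← Finset.sum_sub_distrib, map_sum,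
      operatorLift_sum]
    refine Finset.sum_congr rfl fun σ _ => ?_
    rw [← smul_sub, operatorProj_sign, operatorLift_sign,
      ← operatorProj_braceTerm hκ lam dh hh (by simp)]
    congr 4 <;> simp [liftList, List.map_ofFn, Function.comp_def]
  · intro t ht
    obtain ⟨j, h1, h2⟩ := hmem t ht
    rw [h1, h2]
    exact operatorLift_mem (hG j)
  · intro s hs t ht
    obtain ⟨i, -, h1⟩ := hmem s hs
    obtain ⟨j, -, h2⟩ := hmem t ht
    rw [h1, h2]
    exact kills_operatorLift (homProd_multilinear (hG j)) _

end

/-! ### Comparison of signs -/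

theorem pairProd_inverts {n : ℕ} (s : Fin n → ℤˣ) (σ : Equiv.Perm (Fin n)) :
    (pairProd fun i j => if Inverts σ i j then s (σ i) * s (σ j) else 1) *
      (pairProd fun i _ => s (σ i)) = pairProd fun i _ => s i := by
  have h1 : (pairProd fun i _ => s i) = pairProd fun i j => s (min i j) :=
    pairProd_congr fun i j hij => by rw [min_eq_left hij.le]
  rw [h1, ← pairProd_comp (G := fun i j => s (min i j)) (fun i j => by rw [min_comm]) σ, ← pairProd_mul]
  refine pairProd_congr fun i j hij => ?_
  have h2 : σ i ≠ σ j := fun e => hij.ne (σ.injective e)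
  rcases lt_or_gt_of_ne h2 with h2 | h2
  · simp [Inverts, hij.not_gt, h2.not_gt, min_eq_left h2.le]
  · simp [Inverts, hij, h2, min_eq_right h2.le, mul_right_comm, Int.units_mul_self]

theorem negOnePow_weighted_sum {n : ℕ} (d : Fin n → ℤ) :
    (∑ j : Fin n, ((n : ℤ) - 1 - (j : ℕ)) * d j).negOnePow = pairProd fun i _ => (d i).negOnePow := by
  rw [negOnePow_sum, pairProd]
  refine Finset.prod_congr rfl fun i _ => ?_
  rw [Finset.prod_ite, Finset.prod_const_one, mul_one, Finset.prod_const, Finset.filter_lt_eq_Ioi,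
    Fin.card_Ioi, Int.negOnePow_def, Int.negOnePow_def,
    show (n : ℤ) - 1 - (i : ℕ) = ((n - 1 - (i : ℕ) : ℕ) : ℤ) by have := i.2; lia, mul_comm,
    zpow_mul, zpow_natCast]

/-- The décalage sign: `chi` in the degrees `d` is the Koszul sign in the degrees `d + 1`, up to
signs which depend only on the order of the degrees. -/
theorem chi_mul_negOnePow {n : ℕ} (σ : Equiv.Perm (Fin n)) (d : Fin n → ℤ) :
    chi σ d * (∑ j : Fin n, ((n : ℤ) - 1 - (j : ℕ)) * d (σ j)).negOnePow =
      koszulSign σ (fun j => d j + 1) * (∑ j : Fin n, ((n : ℤ) - 1 - (j : ℕ)) * d j).negOnePow := by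
  have h : chi σ d = koszulSign σ (fun j => d j + 1) * pairProd fun i j =>
      if Inverts σ i j then (d (σ i)).negOnePow * (d (σ j)).negOnePow else 1 := by
    rw [chi_eq_invSign, koszulSign_eq_invSign, invSign, invSign, ← pairProd_mul]
    refine pairProd_congr fun i j _ => ?_
    split_ifs
    · rw [← Int.negOnePow_add, ← Int.negOnePow_add]
      apply negOnePow_congr
      grind
    · simp
  rw [negOnePow_weighted_sum, negOnePow_weighted_sum,
    ← pairProd_inverts (fun i => (d i).negOnePow) σ, h, mul_assoc]

section

variable {k : Type u} {V : Type v} [Field k] [AddCommGroup V] [Module k V]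
  (𝒱 : ℤ → Submodule k V) [DirectSum.Decomposition 𝒱]

theorem signRule_koszul : SignRule 𝒱 (koszul 𝒱 0) where
  apply_mem d i x hx := by rw [koszul_of_mem 𝒱 0 d i x hx, add_zero]
  span := (DirectSum.Decomposition.isInternal 𝒱).submodule_iSup_eq_top

theorem signRule_suspension : SignRule (suspension 𝒱) (koszul 𝒱 1) where
  apply_mem d i x hx := by rw [koszul_of_mem 𝒱 1 d (i - 1) x hx, sub_add_cancel]
  span := by
    rw [← (DirectSum.Decomposition.isInternal 𝒱).submodule_iSup_eq_top]
    exact (Equiv.subRight (1 : ℤ)).iSup_comp (g := 𝒱)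

variable (lam : k)

theorem mixedBracket_eq (m : ℕ) (dh : ℤ) (h : List V → V) (dg : Fin (m + 1) → ℤ)
    (g : Fin (m + 1) → List V → V) : mixedBracket 𝒱 lam (m + 1) dh h dg g =
      (((m : ℤ) + 1) * dh + ∑ j : Fin (m + 1), ((m : ℤ) - (j : ℕ)) * dg j).negOnePow •
        ∑ σ : Equiv.Perm (Fin (m + 1)), koszulSign σ (fun j => dg j + 1) •
          braceTerm (koszul 𝒱 1) lam dh h (List.ofFn fun j => (dg (σ j) + 1, g (σ j))) := by
  have hb : ∀ (f : List V → V) Gs, brace 𝒱 f Gs = multiBrace (koszul 𝒱 1) Gs f := fun f Gs =>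
    funext fun v => brace_eq_multiBrace 𝒱 f Gs v
  rw [mixedBracket, Finset.smul_sum]
  refine Finset.sum_congr rfl fun σ _ => ?_
  rw [smul_smul]
  congr 1
  · rw [Int.negOnePow_add, Int.negOnePow_add, mul_left_comm, mul_assoc]
    congr 1
    have := chi_mul_negOnePow σ dg
    push_cast at this
    simp only [add_sub_cancel_right] at this
    rw [this, mul_comm]
  · rw [List.ofFn_succ, braceTerm, hb, hb, hb, multiBrace_singleton (signRule_suspension 𝒱),
      ← List.ofFn_succ (f := fun j => (dg (σ j) + 1, g (σ j)))]
    simp [totalDeg, List.sum_ofFn, Function.comp_def]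

/-- The bracket with several operators is a projected iterated Gerstenhaber bracket. -/
theorem operatorLift_mixedBracket (m : ℕ) {dh : ℤ} {h : List V → V}
    (hh : h ∈ graded (suspension 𝒱) dh) (dg : Fin m → ℤ) (g : Fin m → List V → V)
    (hg : ∀ j, g j ∈ graded (suspension 𝒱) (dg j + 1))
    {A : List (Entry (List (V × V) → V × V))}
    (hA : A.map (fun t => (t.p, t.a)) =
      liftList (List.ofFn fun j => (dg j + 1, g j)).reverse) :
    operatorLift (mixedBracket 𝒱 lam m dh h dg g) =
      ((m : ℤ) * dh + ∑ j : Fin m, ((m : ℤ) - 1 - (j : ℕ)) * dg j).negOnePow •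
        operatorProj (k := k) (DerivedBracketData.iter (lieBr (pairSign (koszul 𝒱 1))) dh
          (extend lam h) A) := by
  cases m with
  | zero =>
    obtain rfl : A = [] := by simpa [liftList] using hA
    rw [DerivedBracketData.iter, operatorProj_extend lam hh, smul_zero, mixedBracket]
    rfl
  | succ m =>
    rw [operatorProj_iter (signRule_suspension 𝒱) lam dh (homProd_multilinear hh)
      (fun j => (dg j + 1, g j)) hg hA,
      mixedBracket_eq, operatorLift_sign]
    push_cast
    simp only [add_sub_cancel_right]

end

section

variable {k : Type u} {V : Type v} [Field k] [AddCommGroup V] [Module k V]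

theorem totalP_reverse_ofFn {E : Type*} {n : ℕ} (y : Fin n → Entry E) :
    totalP (List.ofFn y).reverse = ∑ i, (y i).p := by
  simp [totalP, List.sum_reverse, List.sum_ofFn, List.map_ofFn]

theorem reverse_ofFn_succ' {E : Type*} {n : ℕ} (y : Fin (n + 1) → E) :
    (List.ofFn y).reverse = y (Fin.last n) :: (List.ofFn fun i : Fin n => y i.castSucc).reverse := by
  rw [List.ofFn_succ', List.concat_eq_append, List.reverse_append, List.reverse_singleton,
    List.singleton_append]

/-- The derived bracket as a sum over the position of the argument which contributes `H`. -/
theorem DerivedBracketData.derived_reverse_ofFn {E : Type v} [AddCommGroup E] [Module k E]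
    {𝔏 : ℤ → Submodule k E} {br : ℤ → ℤ → E → E → E} {P : E →ₗ[k] E}
    (hD : DerivedBracketData 𝔏 br P) {n : ℕ} (y : Fin (n + 1) → Entry E)
    (hy : ∀ i, Valid 𝔏 P (y i)) : derived br (List.ofFn y).reverse =
      ∑ i : Fin (n + 1), ((y i).p * ∑ j, if j < i then (y j).p else 0).negOnePow •
        iter br ((y i).p - 1) (y i).H (List.ofFn fun j => y (i.succAbove j)).reverse := by
  induction n with
  | zero => simp [derived, iter, hD.zero_left (hy 0).2.1]
  | succ n ih =>
    rw [reverse_ofFn_succ', derived, ih _ fun i => hy _, Fin.sum_univ_castSucc (n := n + 1)]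
    congr 1
    · change hD.brHom _ (hy (Fin.last (n + 1))).2.1 _ = _
      rw [map_sum]
      refine Finset.sum_congr rfl fun i _ => ?_
      rw [Units.smul_def, map_zsmul, ← Units.smul_def]
      congr 1
      · conv_rhs => rw [Fin.sum_univ_castSucc]
        simp [(Fin.le_last _).not_gt]
      · rw [reverse_ofFn_succ' fun j => y (i.castSucc.succAbove j), iter]
        simp only [totalP_reverse_ofFn]
        have h1 : i.castSucc.succAbove (Fin.last n) = Fin.last (n + 1) := by
          rw [← Fin.succ_last, Fin.succAbove_of_le_castSucc _ _ (Fin.castSucc_le_castSucc_iff.2 (Fin.le_last i))]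
        have h2 : ∀ j : Fin n, i.castSucc.succAbove j.castSucc = (i.succAbove j).castSucc :=
          fun j => Fin.castSucc_succAbove_castSucc
        simp only [h1, h2]
        change br _ _ _ _ = br _ _ _ _
        congr 1
        rw [Fin.sum_univ_succAbove _ i]
        ring
    · congr 2
      · congr 1
        rw [totalP_reverse_ofFn]
        conv_rhs => rw [Fin.sum_univ_castSucc]
        simp [Fin.castSucc_lt_last]
      · simp only [Fin.succAbove_last_apply]

variable (𝒱 : ℤ → Submodule k V)

theorem homProd_suspension (d : ℤ) :
    (homProd (suspension 𝒱) 𝒱 fun _ => d) = graded (suspension 𝒱) (d + 1) := by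
  ext f
  rw [mem_homProd_iff, mem_homProd_iff]
  have h : ∀ i : List ℤ, suspension 𝒱 (i.sum + (d + 1)) = 𝒱 (i.sum + d) := fun i => by
    rw [suspension]; congr 1; ring
  simp only [h]

theorem mem_explicitCochains {d : ℤ} {y : (List V → V) × (List V → V)} :
    y ∈ explicitCochains 𝒱 d ↔
      y.1 ∈ graded (suspension 𝒱) d ∧ y.2 ∈ graded (suspension 𝒱) (d + 1) := by
  rw [explicitCochains, homProd_suspension]
  exact Submodule.mem_prod

variable [DirectSum.Decomposition 𝒱] (lam : k)

/-- An element of degree `d` as an argument of the derived brackets. -/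
def cochainEntry (d : ℤ) (y : (List V → V) × (List V → V)) : Entry (List (V × V) → V × V) :=
  ⟨d + 1, extend lam y.1, operatorLift y.2⟩

/-- The Gerstenhaber bracket of `V × V`, the suspension of `V` being understood. -/
abbrev pairLieBr (d e : ℤ) (f g : List (V × V) → V × V) : List (V × V) → V × V :=
  lieBr (pairSign (koszul 𝒱 1)) d e f g

theorem valid_cochainEntry {d : ℤ} {y : (List V → V) × (List V → V)}
    (hy : y ∈ explicitCochains 𝒱 d) :
    DerivedBracketData.Valid (graded (pairGrading (suspension 𝒱))) (operatorProj (k := k))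
      (cochainEntry lam d y) := by
  rw [mem_explicitCochains] at hy
  refine ⟨?_, operatorLift_mem hy.2, operatorProj_extend lam hy.1, operatorProj_operatorLift _⟩
  simpa [cochainEntry] using extend_mem_graded lam hy.1

theorem gerstenhaber_eq (d e : ℤ) (f g : List V → V) :
    gerstenhaber 𝒱 d e f g = lieBr (koszul 𝒱 1) d e f g := by
  have hb : ∀ (f : List V → V) Gs, brace 𝒱 f Gs = multiBrace (koszul 𝒱 1) Gs f := fun f Gs =>
    funext fun v => brace_eq_multiBrace 𝒱 f Gs v
  rw [gerstenhaber, hb, hb, multiBrace_singleton (signRule_suspension 𝒱),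
    multiBrace_singleton (signRule_suspension 𝒱), lieBr]

/-- The sign relating the explicit brackets and the derived brackets. -/
def bracketSign {n : ℕ} (d : Fin n → ℤ) : ℤ := ∑ i : Fin n, ((n : ℤ) - 1 - (i : ℕ)) * d i

variable {n : ℕ} {d : Fin n → ℤ} {y : Fin n → (List V → V) × (List V → V)}

/-- On `V × V`, the first component of the explicit bracket is the bracket `[H₁, H₂]`. -/
theorem extend_algebraBracket (hy : ∀ i, y i ∈ explicitCochains 𝒱 (d i)) :
    extend lam (algebraBracket 𝒱 n d fun i => (y i).1) = (bracketSign d).negOnePow •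
      DerivedBracketData.pairBr (pairLieBr 𝒱)
        (List.ofFn fun i => cochainEntry lam (d i) (y i)).reverse := by
  have h0 : extend lam (0 : List V → V) = 0 := funext fun v => extend_zero lam v
  match n, d, y, hy with
  | 0, _, _, _ => simp [algebraBracket, DerivedBracketData.pairBr, h0]
  | 1, _, _, _ => simp [algebraBracket, DerivedBracketData.pairBr, h0]
  | 2, d, y, hy =>
    have h1 := (mem_explicitCochains 𝒱).1 (hy 0)
    have h2 := (mem_explicitCochains 𝒱).1 (hy 1)
    have h3 : (List.ofFn fun i => cochainEntry lam (d i) (y i)).reverse =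
        [cochainEntry lam (d 1) (y 1), cochainEntry lam (d 0) (y 0)] := by
      simp [List.ofFn_succ]
    rw [h3, DerivedBracketData.pairBr, negOnePow_smul_smul, Int.negOnePow_even, one_smul,
      algebraBracket, gerstenhaber_eq, extend_lieBr lam _ _ (homProd_multilinear h1.1)
        (homProd_multilinear h2.1)]
    · simp [cochainEntry]
    · simp [bracketSign, Fin.sum_univ_two, cochainEntry]
      grind
  | n + 3, _, _, _ =>
    rw [algebraBracket, h0, reverse_ofFn_succ', reverse_ofFn_succ', reverse_ofFn_succ',
      DerivedBracketData.pairBr, smul_zero]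
    · simp
    · simp

theorem bracketSign_succAbove (d : Fin (n + 1) → ℤ) (i : Fin (n + 1)) :
    bracketSign d = ((n : ℤ) - (i : ℕ)) * d i + bracketSign (fun j => d (i.succAbove j)) +
      ∑ j, if j < i then d j else 0 := by
  have h : (∑ j, if j < i then d j else 0) =
      ∑ j : Fin n, if i.succAbove j < i then d (i.succAbove j) else 0 := by
    rw [Fin.sum_univ_succAbove _ i]
    simp
  rw [h, bracketSign, bracketSign, Fin.sum_univ_succAbove _ i, add_assoc, ← Finset.sum_add_distrib]
  congr 1
  · push_cast; ring
  · refine Finset.sum_congr rfl fun j _ => ?_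
    rcases lt_or_ge j.castSucc i with hj | hj
    · rw [if_pos (by rwa [Fin.succAbove_lt_iff_castSucc_lt]), Fin.succAbove_of_castSucc_lt _ _ hj]
      push_cast
      simp only [Fin.val_castSucc]
      ring
    · rw [if_neg (by rwa [Fin.succAbove_lt_iff_castSucc_lt, not_lt]),
        Fin.succAbove_of_le_castSucc _ _ hj]
      push_cast
      simp only [Fin.val_succ]
      push_cast
      ring

/-- On `V × V`, the second component of the explicit bracket is the derived bracket. -/
theorem operatorLift_operatorBracket (hy : ∀ i, y i ∈ explicitCochains 𝒱 (d i)) :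
    operatorLift (operatorBracket 𝒱 lam n d y) = (bracketSign d).negOnePow •
      operatorProj (k := k) (DerivedBracketData.derived (pairLieBr 𝒱)
        (List.ofFn fun i => cochainEntry lam (d i) (y i)).reverse) := by
  cases n with
  | zero => simp [operatorBracket, DerivedBracketData.derived]; rfl
  | succ n =>
    have hy' := fun i => (mem_explicitCochains 𝒱).1 (hy i)
    rw [(derivedBracketData_operatorProj (signRule_suspension 𝒱)).derived_reverse_ofFn _
      fun i => valid_cochainEntry 𝒱 lam (hy i), map_sum, Finset.smul_sum, operatorBracket,
      operatorLift_sum]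
    refine Finset.sum_congr rfl fun i _ => ?_
    have hA : (List.ofFn fun j =>
        cochainEntry lam (d (i.succAbove j)) (y (i.succAbove j))).reverse.map
          (fun t => (t.p, t.a)) =
        liftList (List.ofFn fun j =>
          (d (i.succAbove j) + 1, (y (i.succAbove j)).2)).reverse := by
      simp [liftList, List.map_ofFn, cochainEntry, Function.comp_def]
    rw [operatorProj_sign, operatorLift_sign, operatorLift_mixedBracket 𝒱 lam n (hy' i).1 _ _
      (fun j => (hy' _).2) hA, negOnePow_smul_smul, negOnePow_smul_smul]
    have h1 : (cochainEntry lam (d i) (y i)).p - 1 = d i := by simp [cochainEntry]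
    rw [h1]
    congr 1
    apply negOnePow_congr
    rw [bracketSign_succAbove d i, bracketSign]
    have h2 : (∑ j, if j < i then (cochainEntry lam (d j) (y j)).p else 0) =
        (∑ j, if j < i then d j else 0) + (i : ℕ) := by
      have h4 : ((i : ℕ) : ℤ) = ∑ j : Fin (n + 1), if j < i then 1 else 0 := by
        rw [Finset.sum_boole, Finset.filter_gt_eq_Iio, Fin.card_Iio]
      rw [h4, ← Finset.sum_add_distrib]
      refine Finset.sum_congr rfl fun j _ => ?_
      split_ifs <;> simp [cochainEntry]
    rw [h2]
    simp only [cochainEntry]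
    grind

end

/-! ### Shuffles -/

section Shuffles

/-- In a shuffle, the last index is at the end of the first block or of the second one. -/
theorem isShuffle_insertPerm_last {n i : ℕ} (hi : i ≤ n + 1) (p : Fin (n + 1))
    (τ : Equiv.Perm (Fin n)) : IsShuffle i (insertPerm p (Fin.last n) τ) ↔
      ((p : ℕ) + 1 = i ∧ IsShuffle p τ) ∨ (p = Fin.last n ∧ i ≤ n ∧ IsShuffle i τ) := by
  have hlt : ∀ a, insertPerm p (Fin.last n) τ (p.succAbove a) < Fin.last n := fun a => by
    rw [insertPerm_succAbove, Fin.succAbove_last]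
    exact Fin.castSucc_lt_last _
  have hcmp : ∀ a b, insertPerm p (Fin.last n) τ (p.succAbove a) <
      insertPerm p (Fin.last n) τ (p.succAbove b) ↔ τ a < τ b := fun a b => by
    rw [insertPerm_succAbove, insertPerm_succAbove, (Fin.strictMono_succAbove _).lt_iff_lt]
  have hval : ∀ a : Fin n, ((a : ℕ) < p ∧ ((p.succAbove a : Fin (n + 1)) : ℕ) = a) ∨
      ((p : ℕ) ≤ a ∧ ((p.succAbove a : Fin (n + 1)) : ℕ) = a + 1) := fun a => by
    rcases lt_or_ge a.castSucc p with h | h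
    · exact .inl ⟨h, by rw [Fin.succAbove_of_castSucc_lt _ _ h]; rfl⟩
    · exact .inr ⟨h, by rw [Fin.succAbove_of_le_castSucc _ _ h]; rfl⟩
  have hmono : ∀ {a b : Fin n}, a < b → p.succAbove a < p.succAbove b :=
    fun h => Fin.strictMono_succAbove p h
  constructor
  · intro h
    by_cases hp : (p : ℕ) + 1 = i
    · refine .inl ⟨hp, fun a b hab hc => (hcmp a b).1 (h _ _ (hmono hab) ?_)⟩
      have := hval a; have := hval b
      lia
    · have hlast : p = Fin.last n := by
        by_contra hne
        have hpn : (p : ℕ) < n := by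
          have := Fin.val_lt_last hne
          exact this
        have h1 := h p (p.succAbove ⟨p, hpn⟩) (by
          rw [Fin.lt_def]
          have := hval ⟨p, hpn⟩
          simp only at this
          lia) (by
          have := hval ⟨p, hpn⟩
          simp only at this
          lia)
        rw [insertPerm_same] at h1
        exact absurd (hlt _) h1.not_gt
      have hpn : (p : ℕ) = n := by rw [hlast]; rfl
      refine .inr ⟨hlast, by lia, fun a b hab hc => (hcmp a b).1 (h _ _ (hmono hab) ?_)⟩
      have := hval a; have := hval b
      have := a.2
      have := b.2
      lia
  · rintro (⟨rfl, h⟩ | ⟨hlast, hin, h⟩) a b hab hc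
    · rcases Fin.eq_self_or_eq_succAbove p b with rfl | ⟨b', rfl⟩
      · obtain ⟨a', rfl⟩ := Fin.exists_succAbove_eq hab.ne
        rw [insertPerm_same]
        exact hlt a'
      · rcases Fin.eq_self_or_eq_succAbove p a with rfl | ⟨a', rfl⟩
        · rw [Fin.lt_def] at hab
          lia
        · rw [hcmp]
          have := hval a'; have := hval b'
          exact h _ _ ((Fin.strictMono_succAbove p).lt_iff_lt.1 hab) (by lia)
    · have hpn : (p : ℕ) = n := by rw [hlast]; rfl
      rcases Fin.eq_self_or_eq_succAbove p b with rfl | ⟨b', rfl⟩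
      · obtain ⟨a', rfl⟩ := Fin.exists_succAbove_eq hab.ne
        rw [insertPerm_same]
        exact hlt a'
      · rcases Fin.eq_self_or_eq_succAbove p a with rfl | ⟨a', rfl⟩
        · rw [Fin.lt_def] at hab
          have := hval b'
          have := b'.2
          lia
        · rw [hcmp]
          have := hval a'; have := hval b'
          have := a'.2
          have := b'.2
          exact h _ _ ((Fin.strictMono_succAbove p).lt_iff_lt.1 hab) (by lia)

theorem ofFn_eq_of_succAbove {α : Type*} {n : ℕ} (p : Fin (n + 1)) (z : Fin (n + 1) → α)
    (f : Fin n → α) (hf : ∀ j, z (p.succAbove j) = f j) :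
    List.ofFn z = (List.ofFn f).take p ++ z p :: (List.ofFn f).drop p := by
  have hp := p.2
  apply List.ext_getElem
  · simp
    lia
  · intro i h1 h2
    rw [List.getElem_ofFn]
    rcases Fin.eq_self_or_eq_succAbove p ⟨i, by simpa using h1⟩ with h | ⟨j, h⟩
    · have hi : i = p := congrArg Fin.val h
      subst hi
      have hmin : min (p : ℕ) n = p := by lia
      rw [List.getElem_append_right (by simp)]
      simp only [List.length_take, List.length_ofFn, hmin, Nat.sub_self, List.getElem_cons_zero, h]
    · rw [h, hf]
      have hi : i = ((p.succAbove j : Fin (n + 1)) : ℕ) := congrArg Fin.val h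
      rcases lt_or_ge j.castSucc p with hj | hj
      · have hi' : i = j := by rw [hi, Fin.succAbove_of_castSucc_lt _ _ hj]; rfl
        subst hi'
        have hj' : (j : ℕ) < p := hj
        rw [List.getElem_append_left (by simp [hj'])]
        simp
      · have hi' : i = j + 1 := by rw [hi, Fin.succAbove_of_le_castSucc _ _ hj]; rfl
        subst hi'
        have hj' : (p : ℕ) ≤ j := hj
        rw [List.getElem_append_right (by simp; lia)]
        have hmin : min (p : ℕ) n = p := by lia
        simp only [List.length_take, List.length_ofFn, hmin]
        have hs : (j : ℕ) + 1 - p = (j - p) + 1 := by lia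
        simp only [hs, List.getElem_cons_succ, List.getElem_drop, List.getElem_ofFn]
        congr 1
        ext
        simp
        lia

theorem sum_drop_ofFn {n : ℕ} (g : Fin n → ℤ) (p : ℕ) :
    ((List.ofFn g).drop p).sum = ∑ j : Fin n, if p ≤ j then g j else 0 := by
  induction n generalizing p with
  | zero => simp
  | succ n ih =>
    rw [List.ofFn_succ, Fin.sum_univ_succ]
    cases p with
    | zero => simp [List.sum_ofFn]
    | succ p => simp [ih]

open Classical in
/-- The sums over the ways to distribute the members of a list as sums over shuffles. -/
theorem splitSum_reverse_ofFn {E : Type v} {X : Type w} [AddCommGroup X] {n : ℕ}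
    (Φ : List (Entry E) → List (Entry E) → X) (y : Fin n → Entry E) :
    splitSum Φ (List.ofFn y).reverse = ∑ i : Fin (n + 1), ∑ σ : Equiv.Perm (Fin n),
      if IsShuffle i σ then koszulSign σ (fun j => (y j).p) •
        Φ ((List.ofFn fun j => y (σ j)).take i).reverse
          ((List.ofFn fun j => y (σ j)).drop i).reverse else 0 := by
  induction n generalizing Φ with
  | zero =>
    have h : IsShuffle 0 (1 : Equiv.Perm (Fin 0)) := fun a => a.elim0
    simp [splitSum, koszulSign, h]
  | succ n ih =>
    rw [reverse_ofFn_succ', splitSum, ih, ih]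
    -- The last member of the sequence is at the end of the first block or of the second one.
    have hX : ∀ (i : Fin (n + 2)) (p : Fin (n + 1)) (τ : Equiv.Perm (Fin n)),
        (if IsShuffle i (insertPerm p (Fin.last n) τ) then
          koszulSign (insertPerm p (Fin.last n) τ) (fun j => (y j).p) •
            Φ ((List.ofFn fun j => y (insertPerm p (Fin.last n) τ j)).take i).reverse
              ((List.ofFn fun j => y (insertPerm p (Fin.last n) τ j)).drop i).reverse else 0) =
        (if i = p.succ then if IsShuffle p τ then koszulSign τ (fun j => (y j.castSucc).p) •
          ((y (Fin.last n)).p * totalP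
            ((List.ofFn fun j => y (τ j).castSucc).drop p).reverse).negOnePow •
            Φ (y (Fin.last n) :: ((List.ofFn fun j => y (τ j).castSucc).take p).reverse)
              ((List.ofFn fun j => y (τ j).castSucc).drop p).reverse else 0 else 0) +
        (if p = Fin.last n then if (i : ℕ) ≤ n then if IsShuffle i τ then
          koszulSign τ (fun j => (y j.castSucc).p) •
            Φ ((List.ofFn fun j => y (τ j).castSucc).take i).reverse
              (y (Fin.last n) :: ((List.ofFn fun j => y (τ j).castSucc).drop i).reverse)
            else 0 else 0 else 0) := by
      intro i p τ
      have hl := ofFn_eq_of_succAbove p (fun j => y (insertPerm p (Fin.last n) τ j))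
        (fun j => y (τ j).castSucc) (fun j => by simp [Fin.succAbove_last])
      simp only [insertPerm_same] at hl
      rw [hl, koszulSign_insertPerm_last, isShuffle_insertPerm_last (Fin.is_le i)]
      set l := List.ofFn fun j => y (τ j).castSucc with hldef
      have hln : l.length = n := by simp [hldef]
      have hp := p.2
      by_cases h1 : i = p.succ
      · have h2 : (p : ℕ) + 1 = i := by rw [h1]; rfl
        have h3 : ¬(p = Fin.last n ∧ (i : ℕ) ≤ n ∧ IsShuffle i τ) := by
          rintro ⟨h, h', -⟩
          have : (p : ℕ) = n := by rw [h]; rfl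
          lia
        have h4 : (if p = Fin.last n then if (i : ℕ) ≤ n then if IsShuffle i τ then
          koszulSign τ (fun j => (y j.castSucc).p) •
            Φ (l.take i).reverse (y (Fin.last n) :: (l.drop i).reverse)
            else 0 else 0 else 0) = 0 := by
          split_ifs <;> tauto
        rw [h4, if_pos h1, add_zero]
        by_cases h5 : IsShuffle p τ
        · rw [if_pos (.inl ⟨h2, h5⟩), if_pos h5, smul_smul, mul_comm]
          have hlen : (l.take p).length = p := by simp; lia
          rw [← h2, List.take_append, List.drop_append, hlen]
          have h6 : (p : ℕ) + 1 - p = 1 := by lia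
          rw [h6, List.take_of_length_le (l := l.take p) (by lia),
            List.drop_of_length_le (l := l.take p) (by lia)]
          simp only [List.take_succ_cons, List.take_zero, List.drop_succ_cons, List.drop_zero,
            List.nil_append, List.reverse_append, List.reverse_singleton, List.singleton_append]
          congr 3
          rw [totalP, List.map_reverse, List.sum_reverse, hldef, List.map_drop, List.map_ofFn]
          rw [sum_drop_ofFn]
          rfl
        · rw [if_neg h5, if_neg (by tauto)]
      · have h2 : ¬(p : ℕ) + 1 = i := fun h => h1 (Fin.ext (by simp [h]))
        rw [if_neg h1, zero_add]
        by_cases h3 : p = Fin.last n ∧ (i : ℕ) ≤ n ∧ IsShuffle i τ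
        · obtain ⟨h4, h5, h6⟩ := h3
          rw [if_pos (.inr ⟨h4, h5, h6⟩), if_pos h4, if_pos h5, if_pos h6]
          have hpn : (p : ℕ) = n := by rw [h4]; rfl
          have h7 : (∑ j : Fin n, if p ≤ j.castSucc then (y (τ j).castSucc).p else 0) = 0 :=
            Finset.sum_eq_zero fun j _ => by
              rw [if_neg (by rw [h4]; exact (Fin.castSucc_lt_last j).not_ge)]
          rw [h7, mul_zero, Int.negOnePow_zero, one_mul, List.take_of_length_le (i := p) (by lia),
            List.drop_of_length_le (i := p) (by lia), List.take_append_of_le_length (by lia),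
            List.drop_append_of_le_length (by lia), List.reverse_append, List.reverse_singleton,
            List.singleton_append]
        · rw [if_neg (by tauto)]
          split_ifs <;> tauto
    simp only [sum_perm_eq_left (Fin.last n), hX, Finset.sum_add_distrib]
    congr 1
    · conv_rhs => rw [Finset.sum_comm]
      refine Finset.sum_congr rfl fun p _ => ?_
      rw [Finset.sum_comm]
      refine Finset.sum_congr rfl fun τ _ => ?_
      rw [Finset.sum_ite_eq' Finset.univ p.succ, if_pos (Finset.mem_univ _)]
    · rw [Fin.sum_univ_castSucc (n := n + 1)]
      have h0 : ∀ (f : Equiv.Perm (Fin n) → X), (∑ p : Fin (n + 1), ∑ τ : Equiv.Perm (Fin n),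
          if p = Fin.last n then if ((Fin.last (n + 1) : Fin (n + 2)) : ℕ) ≤ n then f τ else 0
            else 0) = 0 := fun f => by simp
      rw [h0, add_zero]
      refine Finset.sum_congr rfl fun i _ => ?_
      rw [Finset.sum_comm]
      refine Finset.sum_congr rfl fun τ _ => ?_
      rw [Finset.sum_ite_eq' Finset.univ (Fin.last n), if_pos (Finset.mem_univ _),
        Fin.val_castSucc, if_pos (Fin.is_le i)]

end Shuffles

/-! ### The explicit brackets satisfy the generalised Jacobi identities -/

namespace DerivedBracketData

variable {k : Type u} {E : Type v} [Field k] [AddCommGroup E] [Module k E]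
  {𝔏 : ℤ → Submodule k E} {br : ℤ → ℤ → E → E → E} {P : E →ₗ[k] E}
  (hD : DerivedBracketData 𝔏 br P)
include hD

theorem iter_smul_add {e : ℤ} (c : k) {f f' : E} {A : List (Entry E)}
    (hA : ∀ t ∈ A, Valid 𝔏 P t) :
    iter br e (c • f + f') A = c • iter br e f A + iter br e f' A := by
  induction A with
  | nil => rfl
  | cons t A ih =>
    have ht := (hA t (by simp)).2.1
    rw [iter, ih fun s hs => hA s (by simp [hs]), hD.add_left ht, hD.smul_left c ht, iter, iter]

theorem iter_slot {e p : ℤ} (c : k) {f H H' a a' : E} (hf : f ∈ 𝔏 e) {A B : List (Entry E)}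
    (hA : ∀ t ∈ A, Valid 𝔏 P t) (hB : ∀ t ∈ B, Valid 𝔏 P t) :
    iter br e f (A ++ ⟨p, c • H + H', c • a + a'⟩ :: B) =
      c • iter br e f (A ++ ⟨p, H, a⟩ :: B) + iter br e f (A ++ ⟨p, H', a'⟩ :: B) := by
  induction A with
  | nil =>
    simp only [List.nil_append, iter]
    rw [hD.add_right (hD.iter_mem hf hB), hD.smul_right c (hD.iter_mem hf hB)]
  | cons t A ih =>
    have ht := (hA t (by simp)).2.1
    simp only [List.cons_append, iter, totalP_append, totalP_cons]
    rw [ih fun s hs => hA s (by simp [hs]), hD.add_left ht, hD.smul_left c ht]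

theorem derived_slot {p : ℤ} (c : k) {H H' a a' : E} {A B : List (Entry E)}
    (hA : ∀ t ∈ A, Valid 𝔏 P t) (hB : ∀ t ∈ B, Valid 𝔏 P t) :
    derived br (A ++ ⟨p, c • H + H', c • a + a'⟩ :: B) =
      c • derived br (A ++ ⟨p, H, a⟩ :: B) + derived br (A ++ ⟨p, H', a'⟩ :: B) := by
  induction A with
  | nil =>
    simp only [List.nil_append, derived]
    rw [hD.add_right (hD.derived_mem hB), hD.smul_right c (hD.derived_mem hB),
      hD.iter_smul_add c hB]
    simp only [smul_add, smul_comm c]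
    abel
  | cons t A ih =>
    have ht := hA t (by simp)
    have hA' : ∀ s ∈ A, Valid 𝔏 P s := fun s hs => hA s (by simp [hs])
    simp only [List.cons_append, derived, totalP_append, totalP_cons]
    rw [ih hA', hD.add_left ht.2.1, hD.smul_left c ht.2.1, hD.iter_slot c ht.1 hA' hB]
    simp only [smul_add, smul_comm c]
    abel

theorem pairBr_slot {p : ℤ} (c : k) {H H' a a' : E} {A B : List (Entry E)}
    (hA : ∀ t ∈ A, Valid 𝔏 P t) (hB : ∀ t ∈ B, Valid 𝔏 P t) :
    pairBr br (A ++ ⟨p, c • H + H', c • a + a'⟩ :: B) =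
      c • pairBr br (A ++ ⟨p, H, a⟩ :: B) + pairBr br (A ++ ⟨p, H', a'⟩ :: B) := by
  match A, B, hA, hB with
  | [], [], _, _ => simp [pairBr]
  | [t], [], hA, _ =>
    have ht := (hA t (by simp)).1
    simp only [List.singleton_append, pairBr]
    rw [hD.add_left ht, hD.smul_left c ht, smul_add, smul_comm c]
  | [], [t], _, hB =>
    have ht := (hB t (by simp)).1
    simp only [List.nil_append, pairBr]
    rw [hD.add_right ht, hD.smul_right c ht, smul_add, smul_comm c]
  | [], t :: s :: B, _, _ => simp [pairBr]
  | [r], t :: B, _, _ => simp [pairBr]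
  | r :: s :: A, B, _, _ => cases A <;> simp [pairBr]

theorem derived_append_zero {B : List (Entry E)} (hB : ∀ t ∈ B, Valid 𝔏 P t) (p : ℤ) :
    derived br (B ++ [⟨p, 0, 0⟩]) = 0 := by
  simpa using hD.derived_slot (p := p) (1 : k) (H := 0) (H' := 0) (a := 0) (a' := 0) hB
    (B := []) (by simp)

theorem pairBr_append_zero {B : List (Entry E)} (hB : ∀ t ∈ B, Valid 𝔏 P t) (p : ℤ) :
    pairBr br (B ++ [⟨p, 0, 0⟩]) = 0 := by
  simpa using hD.pairBr_slot (p := p) (1 : k) (H := 0) (H' := 0) (a := 0) (a' := 0) hB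
    (B := []) (by simp)

theorem derived_append_sign {B : List (Entry E)} (hB : ∀ t ∈ B, Valid 𝔏 P t) (c p : ℤ) (H a : E) :
    derived br (B ++ [⟨p, c.negOnePow • H, c.negOnePow • a⟩]) =
      c.negOnePow • derived br (B ++ [⟨p, H, a⟩]) := by
  have := hD.derived_slot (p := p) (((c.negOnePow : ℤˣ) : ℤ) : k) (H := H) (H' := 0) (a := a)
    (a' := 0) hB (B := []) (by simp)
  simpa only [negOnePow_cast_smul, add_zero, hD.derived_append_zero hB] using this

theorem pairBr_append_sign {B : List (Entry E)} (hB : ∀ t ∈ B, Valid 𝔏 P t) (c p : ℤ) (H a : E) :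
    pairBr br (B ++ [⟨p, c.negOnePow • H, c.negOnePow • a⟩]) =
      c.negOnePow • pairBr br (B ++ [⟨p, H, a⟩]) := by
  have := hD.pairBr_slot (p := p) (((c.negOnePow : ℤˣ) : ℤ) : k) (H := H) (H' := 0) (a := a)
    (a' := 0) hB (B := []) (by simp)
  simpa only [negOnePow_cast_smul, add_zero, hD.pairBr_append_zero hB] using this

/-- The Jacobi identity of the Lie bracket, in the form of the derived brackets. -/
theorem pairBr_jacobi {L : List (Entry E)} (hL : ∀ t ∈ L, Valid 𝔏 P t) :
    splitSum (fun A B => pairBr br (B ++ [⟨totalP A - 1, pairBr br A, P (derived br A)⟩])) L =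
      0 := by
  by_cases h3 : L.length = 3
  · obtain ⟨t, s, r, rfl⟩ := List.length_eq_three.1 h3
    have ht := (hL t (by simp)).1
    have hs := (hL s (by simp)).1
    have hr := (hL r (by simp)).1
    have hJ := hD.jacobi hr hs ht
    have hA := hD.antisymm (d := r.p - 1) (e := s.p - 1 + (t.p - 1)) (f := r.H)
      (g := br (s.p - 1) (t.p - 1) s.H t.H)
    simp only [splitSum, totalP_cons, totalP_nil, pairBr, List.nil_append, List.cons_append,
      smul_zero, add_zero, zero_add]
    rw [hD.sign_left _ ht, hD.sign_left _ hs, hD.sign_left _ hr,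
      show s.p + r.p - 1 - 1 = r.p - 1 + (s.p - 1) by ring,
      show t.p + r.p - 1 - 1 = r.p - 1 + (t.p - 1) by ring,
      show t.p + s.p - 1 - 1 = s.p - 1 + (t.p - 1) by ring, hJ, hA]
    simp only [smul_add, smul_neg, negOnePow_smul_smul]
    set x := br (r.p - 1) (s.p - 1 + (t.p - 1)) r.H (br (s.p - 1) (t.p - 1) s.H t.H)
    set y := br (r.p - 1 + (t.p - 1)) (s.p - 1) (br (r.p - 1) (t.p - 1) r.H t.H) s.H
    have key : ∀ {a b c d : ℤ}, Even (a - c) → Even (b - (d + 1)) →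
        -(a.negOnePow • x) + b.negOnePow • y + (c.negOnePow • x + d.negOnePow • y) = 0 := by
      intro a b c d h1 h2
      rw [negOnePow_congr h1, negOnePow_congr h2, Int.negOnePow_succ, Units.neg_smul]
      abel
    apply key <;> grind
  · rw [← splitSum_zero (X := E) L]
    refine splitSum_congr fun A B hA hB _ hl => ?_
    match A, B, hA, hB, hl with
    | A, [], _, _, _ => rfl
    | A, _ :: _ :: B, _, _, _ => cases B <;> rfl
    | [], [b], _, hB, _ =>
      simp [pairBr, hD.zero_left (hL b (hB b (by simp))).1]
    | [_], [b], _, hB, _ =>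
      simp [pairBr, hD.zero_left (hL b (hB b (by simp))).1]
    | [_, _], [b], _, _, hl => exact absurd hl.symm h3
    | _ :: _ :: _ :: _, [b], _, hB, _ =>
      simp [pairBr, hD.zero_left (hL b (hB b (by simp))).1]

end DerivedBracketData

theorem take_ofFn {α : Type*} {n a : ℕ} (g : Fin n → α) (h : a ≤ n) :
    (List.ofFn g).take a = List.ofFn fun t : Fin a => g ⟨t, by omega⟩ := by
  apply List.ext_getElem
  · simp [h]
  · intro i h1 h2
    simp

theorem drop_ofFn {α : Type*} {n a : ℕ} (g : Fin n → α) (h : a ≤ n) :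
    (List.ofFn g).drop a = List.ofFn fun t : Fin (n - a) => g ⟨a + t, by omega⟩ := by
  apply List.ext_getElem
  · simp
  · intro i h1 h2
    simp

/-- The sum `∑ (n - j) d_j` over the members of a list of length `n`. -/
def listSign : List ℤ → ℤ
  | [] => 0
  | a :: t => t.length * a + listSign t

theorem listSign_append (l m : List ℤ) :
    listSign (l ++ m) = listSign l + m.length * l.sum + listSign m := by
  induction l with
  | nil => simp [listSign]
  | cons a l ih =>
    simp only [List.cons_append, listSign, ih, List.length_append, List.sum_cons]
    push_cast
    ring

theorem bracketSign_eq {n : ℕ} (d : Fin n → ℤ) : bracketSign d = listSign (List.ofFn d) := by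
  induction n with
  | zero => simp [bracketSign, listSign]
  | succ n ih =>
    rw [List.ofFn_succ, listSign, ← ih, bracketSign, Fin.sum_univ_succ, bracketSign]
    simp only [List.length_ofFn, Fin.val_zero, Fin.val_succ]
    push_cast
    congr 1
    · ring
    · exact Finset.sum_congr rfl fun j _ => by ring

section

variable {k : Type u} {V : Type v} [Field k] [AddCommGroup V] [Module k V]
  (𝒱 : ℤ → Submodule k V) [DirectSum.Decomposition 𝒱] (lam : k)

theorem operatorLift_mem_iff {𝓜 : ℤ → Submodule k V} {p : ℤ} {g : List V → V} :
    operatorLift g ∈ graded (pairGrading 𝓜) p ↔ g ∈ graded 𝓜 p := by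
  refine ⟨fun h => ?_, operatorLift_mem⟩
  have hz : ∀ v : List V, (v.map fun x => (x, (0 : V))).map Prod.fst = v := fun v => by
    simp [Function.comp_def]
  refine mem_homProd_iff.2 ⟨congrArg Prod.snd (homProd_nil h), ?_, fun i v hv => ?_⟩
  · have := ((homProd_multilinear h).comp_map (LinearMap.inl k V V)).linear_comp
      (LinearMap.snd k V V)
    refine ⟨fun l r a b => ?_, fun l r c a => ?_⟩
    · simpa [operatorLift, Function.comp_def] using this.add l r a b
    · simpa [operatorLift, Function.comp_def] using this.smul l r c a
  · have : HomList (pairGrading 𝓜) i (v.map fun x => (x, 0)) := by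
      induction hv with
      | nil => exact .nil
      | cons h _ ih => exact .cons ⟨h, zero_mem _⟩ ih
    have := (homProd_apply_mem h this).2
    simp only [operatorLift, hz] at this
    exact this

variable {n : ℕ} {d : Fin n → ℤ} {y : Fin n → (List V → V) × (List V → V)}

theorem valid_reverse_ofFn (hy : ∀ i, y i ∈ explicitCochains 𝒱 (d i)) :
    ∀ t ∈ (List.ofFn fun i => cochainEntry lam (d i) (y i)).reverse,
      DerivedBracketData.Valid (graded (pairGrading (suspension 𝒱))) (operatorProj (k := k)) t := by
  intro t ht
  rw [List.mem_reverse, List.mem_ofFn] at ht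
  obtain ⟨i, rfl⟩ := ht
  exact valid_cochainEntry 𝒱 lam (hy i)

theorem explicitBracket_mem (hy : ∀ i, y i ∈ explicitCochains 𝒱 (d i)) :
    explicitBracket 𝒱 lam n d y ∈ explicitCochains 𝒱 ((∑ i, d i) + (n : ℤ) - 2) := by
  rw [mem_explicitCochains]
  constructor
  · change algebraBracket 𝒱 n d _ ∈ _
    match n, d, y, hy with
    | 0, _, _, _ => exact zero_mem _
    | 1, _, _, _ => exact zero_mem _
    | 2, d, y, hy =>
      rw [algebraBracket, gerstenhaber_eq]
      have := lieBr_mem (signRule_suspension 𝒱) ((mem_explicitCochains 𝒱).1 (hy 0)).1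
        ((mem_explicitCochains 𝒱).1 (hy 1)).1
      simpa [Fin.sum_univ_two] using this
    | n + 3, _, _, _ => exact zero_mem _
  · change operatorBracket 𝒱 lam n d y ∈ _
    rw [← operatorLift_mem_iff, operatorLift_operatorBracket 𝒱 lam hy]
    refine DerivedBracketData.sign_mem _ (operatorProj_mem ?_)
    have hD := derivedBracketData_operatorProj (k := k) (signRule_suspension 𝒱)
    have := hD.derived_mem (valid_reverse_ofFn 𝒱 lam hy)
    rw [totalP_reverse_ofFn] at this
    convert this using 2
    simp only [cochainEntry, Finset.sum_add_distrib]
    simp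
    ring

theorem extend_injective {h h' : List V → V} (e : extend lam h = extend lam h') : h = h' := by
  funext v
  have := congrArg Prod.snd (congrFun e (v.map fun x => (0, x)))
  simpa [extend_snd, Function.comp_def] using this

/-- The first component of an element, as a map on `V × V`. -/
def extendHom : (List V → V) × (List V → V) →+ (List (V × V) → V × V) :=
  AddMonoidHom.mk' (fun y => extend lam y.1) fun y z => funext fun v => extend_add lam y.1 z.1 v

/-- The second component of an element, as a map on `V × V`. -/
def operatorHom : (List V → V) × (List V → V) →+ (List (V × V) → V × V) :=
  AddMonoidHom.mk' (fun y => operatorLift y.2) fun y z => by funext v; simp [operatorLift]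

theorem explicit_ext {y z : (List V → V) × (List V → V)} (h1 : extendHom lam y = extendHom lam z)
    (h2 : operatorHom y = operatorHom z) : y = z :=
  Prod.ext (extend_injective lam h1) (operatorLift_injective h2)

/-- The jacobiator as a sum over the ways to distribute the arguments over the inner and the outer
bracket, for a component `Λ` of the brackets which is given by a function `Ψ` of the list of
arguments. -/
theorem map_jacobiator (Λ : (List V → V) × (List V → V) →+ (List (V × V) → V × V))
    (Ψ : List (Entry (List (V × V) → V × V)) → List (V × V) → V × V)
    (hΛ : ∀ (n : ℕ) (d : Fin n → ℤ) (y : Fin n → (List V → V) × (List V → V)),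
      (∀ i, y i ∈ explicitCochains 𝒱 (d i)) → Λ (explicitBracket 𝒱 lam n d y) =
        (bracketSign d).negOnePow • Ψ (List.ofFn fun i => cochainEntry lam (d i) (y i)).reverse)
    (hΨ : ∀ B, (∀ t ∈ B, DerivedBracketData.Valid (graded (pairGrading (suspension 𝒱)))
        (operatorProj (k := k)) t) → ∀ (c p : ℤ) H a,
      Ψ (B ++ [⟨p, c.negOnePow • H, c.negOnePow • a⟩]) = c.negOnePow • Ψ (B ++ [⟨p, H, a⟩]))
    (hy : ∀ i, y i ∈ explicitCochains 𝒱 (d i)) :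
    Λ (jacobiator (explicitBracket 𝒱 lam) n d y) = (bracketSign d).negOnePow •
      splitSum (fun A B => if A = [] then 0 else
        Ψ (B ++ [⟨totalP A - 1, DerivedBracketData.pairBr (pairLieBr 𝒱) A,
          operatorProj (k := k) (DerivedBracketData.derived (pairLieBr 𝒱) A)⟩]))
        (List.ofFn fun i => cochainEntry lam (d i) (y i)).reverse := by
  classical
  rw [splitSum_reverse_ofFn, Fin.sum_univ_succ, jacobiator, map_sum]
  -- There is no inner bracket without arguments.
  have h0 : (∑ σ : Equiv.Perm (Fin n), if IsShuffle ((0 : Fin (n + 1)) : ℕ) σ then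
      koszulSign σ (fun j => (cochainEntry lam (d j) (y j)).p) •
        (if ((List.ofFn fun j => cochainEntry lam (d (σ j)) (y (σ j))).take
            ((0 : Fin (n + 1)) : ℕ)).reverse = [] then (0 : List (V × V) → V × V) else
        Ψ (((List.ofFn fun j => cochainEntry lam (d (σ j)) (y (σ j))).drop
            ((0 : Fin (n + 1)) : ℕ)).reverse ++ [⟨totalP ((List.ofFn fun j =>
              cochainEntry lam (d (σ j)) (y (σ j))).take ((0 : Fin (n + 1)) : ℕ)).reverse - 1,
            DerivedBracketData.pairBr (pairLieBr 𝒱) ((List.ofFn fun j =>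
              cochainEntry lam (d (σ j)) (y (σ j))).take ((0 : Fin (n + 1)) : ℕ)).reverse,
          operatorProj (k := k) (DerivedBracketData.derived (pairLieBr 𝒱) ((List.ofFn fun j =>
              cochainEntry lam (d (σ j)) (y (σ j))).take ((0 : Fin (n + 1)) : ℕ)).reverse)⟩]))
      else 0) = 0 := by simp
  rw [h0, zero_add, Finset.smul_sum]
  refine Finset.sum_congr rfl fun i _ => ?_
  rw [map_sum, Finset.smul_sum]
  refine Finset.sum_congr rfl fun σ _ => ?_
  have hi := i.2
  have hsucc : ((i.succ : Fin (n + 1)) : ℕ) = (i : ℕ) + 1 := Fin.val_succ i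
  rw [hsucc]
  by_cases hσ : IsShuffle ((i : ℕ) + 1) σ
  swap
  · rw [if_neg hσ, if_neg hσ, map_zero, smul_zero]
  rw [if_pos hσ, if_pos hσ, take_ofFn _ hi, drop_ofFn _ hi, if_neg (by simp)]
  extract_lets s r
  -- The inner bracket and its degree.
  set D : ℤ := (∑ t, d (s t)) + (((i : ℕ) + 1 : ℕ) : ℤ) - 2 with hD
  have hs : ∀ t, y (s t) ∈ explicitCochains 𝒱 (d (s t)) := fun t => hy _
  have hr : ∀ t, y (r t) ∈ explicitCochains 𝒱 (d (r t)) := fun t => hy _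
  have hmem := explicitBracket_mem 𝒱 lam hs
  have hentry : cochainEntry lam D
      (explicitBracket 𝒱 lam ((i : ℕ) + 1) (fun t => d (s t)) fun t => y (s t)) =
      ⟨totalP (List.ofFn fun t => cochainEntry lam (d (s t)) (y (s t))).reverse - 1,
        (bracketSign fun t => d (s t)).negOnePow • DerivedBracketData.pairBr (pairLieBr 𝒱)
          (List.ofFn fun t => cochainEntry lam (d (s t)) (y (s t))).reverse,
        (bracketSign fun t => d (s t)).negOnePow • operatorProj (k := k)
          (DerivedBracketData.derived (pairLieBr 𝒱)
            (List.ofFn fun t => cochainEntry lam (d (s t)) (y (s t))).reverse)⟩ := by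
    rw [← extend_algebraBracket 𝒱 lam hs, ← operatorLift_operatorBracket 𝒱 lam hs,
      totalP_reverse_ofFn, cochainEntry]
    congr 1
    simp only [cochainEntry, Finset.sum_add_distrib, hD]
    simp
    ring
  have hΛ' := hΛ (n - ((i : ℕ) + 1) + 1) (Fin.cons D fun t => d (r t))
    (Fin.cons (explicitBracket 𝒱 lam ((i : ℕ) + 1) (fun t => d (s t)) fun t => y (s t))
      fun t => y (r t)) (Fin.cases hmem hr)
  rw [List.ofFn_succ] at hΛ'
  simp only [Fin.cons_zero, Fin.cons_succ, List.reverse_cons] at hΛ'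
  rw [hentry, hΨ _ (valid_reverse_ofFn 𝒱 lam hr)] at hΛ'
  have hsmul : ∀ (c : ℤˣ) z, Λ (c • z) = c • Λ z := fun c z => by
    rw [Units.smul_def, Units.smul_def, map_zsmul]
  rw [hsmul, hΛ', smul_smul, smul_smul, smul_smul]
  congr 1
  -- The comparison of the signs.
  have hchi := chi_mul_negOnePow σ d
  have hsplit : bracketSign (fun j => d (σ j)) = bracketSign (fun t => d (s t)) +
      ((n - ((i : ℕ) + 1) : ℕ) : ℤ) * (∑ t, d (s t)) + bracketSign fun t => d (r t) := by
    rw [bracketSign_eq, ← List.take_append_drop ((i : ℕ) + 1) (List.ofFn fun j => d (σ j)),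
      listSign_append, take_ofFn _ hi, drop_ofFn _ hi, ← bracketSign_eq, ← bracketSign_eq,
      List.sum_ofFn, List.length_ofFn]
  have hcons : bracketSign (Fin.cons D fun t => d (r t) : Fin (n - ((i : ℕ) + 1) + 1) → ℤ) =
      ((n - ((i : ℕ) + 1) : ℕ) : ℤ) * D + bracketSign fun t => d (r t) := by
    rw [bracketSign_eq, List.ofFn_succ, listSign, bracketSign_eq]
    simp
  change chi σ d * (bracketSign fun j => d (σ j)).negOnePow =
    koszulSign σ (fun j => d j + 1) * (bracketSign d).negOnePow at hchi
  change _ = _ * koszulSign σ fun j => d j + 1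
  rw [mul_comm (bracketSign d).negOnePow, ← hchi, hsplit, hcons, hD, mul_assoc, mul_assoc,
    ← Int.negOnePow_add, ← Int.negOnePow_add]
  congr 1
  apply negOnePow_congr
  push_cast
  grind

/-- The two components of the jacobiator are the Jacobi identity of the Gerstenhaber bracket and the
generalised Jacobi identity of the derived brackets. -/
theorem jacobiator_explicitBracket [CharZero k] (hy : ∀ i, y i ∈ explicitCochains 𝒱 (d i)) :
    jacobiator (explicitBracket 𝒱 lam) n d y = 0 := by
  have hD := derivedBracketData_operatorProj (k := k) (signRule_suspension 𝒱)
  have hL := valid_reverse_ofFn 𝒱 lam hy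
  apply explicit_ext lam
  · rw [map_zero, map_jacobiator 𝒱 lam (extendHom lam)
      (DerivedBracketData.pairBr (pairLieBr 𝒱)) (fun n d y hy => extend_algebraBracket 𝒱 lam hy)
      (fun B hB c p H a => hD.pairBr_append_sign hB c p H a) hy]
    refine (congrArg _ ((splitSum_congr fun A B hA hB _ _ => ?_).trans
      (hD.pairBr_jacobi hL))).trans (smul_zero _)
    -- The terms with an empty inner bracket vanish.
    split_ifs with h
    · subst h
      rw [show DerivedBracketData.pairBr (pairLieBr 𝒱) [] = 0 from rfl,
        show DerivedBracketData.derived (pairLieBr 𝒱) [] = 0 from rfl, map_zero,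
        hD.pairBr_append_zero fun t ht => hL t (hB t ht)]
    · rfl
  · rw [map_zero, map_jacobiator 𝒱 lam operatorHom
      (fun L => operatorProj (k := k) (DerivedBracketData.derived (pairLieBr 𝒱) L))
      (fun n d y hy => operatorLift_operatorBracket 𝒱 lam hy)
      (fun B hB c p H a => by rw [hD.derived_append_sign hB, operatorProj_sign]) hy]
    refine (congrArg _ ((splitSum_congr fun A B hA hB _ _ => ?_).trans
      (hD.derived_jacobi hL))).trans (smul_zero _)
    -- The terms with an empty inner bracket vanish.
    split_ifs with h
    · subst h
      rw [show DerivedBracketData.pairBr (pairLieBr 𝒱) [] = 0 from rfl,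
        show DerivedBracketData.derived (pairLieBr 𝒱) [] = 0 from rfl, map_zero,
        hD.derived_append_zero fun t ht => hL t (hB t ht), map_zero]
    · rfl

end

/-! ### Multilinearity of the explicit brackets -/

section

variable {k : Type u} {V : Type v} [Field k] [AddCommGroup V] [Module k V]
  (𝒱 : ℤ → Submodule k V) [DirectSum.Decomposition 𝒱] (lam : k)
  {n : ℕ} {d : Fin n → ℤ} {y : Fin n → (List V → V) × (List V → V)}

theorem ofFn_cochainEntry_update (i : Fin n) (z : (List V → V) × (List V → V)) :
    (List.ofFn fun j => cochainEntry lam (d j) (Function.update y i z j)).reverse =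
      ((List.ofFn fun j => cochainEntry lam (d j) (y j)).drop (i + 1)).reverse ++
        cochainEntry lam (d i) z ::
          ((List.ofFn fun j => cochainEntry lam (d j) (y j)).take i).reverse := by
  have h : (fun j => cochainEntry lam (d j) (Function.update y i z j)) =
      Function.update (fun j => cochainEntry lam (d j) (y j)) i (cochainEntry lam (d i) z) := by
    funext j
    exact Function.apply_update (fun j => cochainEntry lam (d j)) y i z j
  rw [h, ofFn_update_eq, List.reverse_append, List.reverse_cons, List.append_assoc,
    List.singleton_append]

theorem cochainEntry_smul_add (c : k) (e : ℤ) (z z' : (List V → V) × (List V → V)) :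
    cochainEntry lam e (c • z + z') = ⟨e + 1, c • extend lam z.1 + extend lam z'.1,
      c • operatorLift z.2 + operatorLift z'.2⟩ := by
  have h1 : extend lam (c • z + z').1 = c • extend lam z.1 + extend lam z'.1 := by
    funext v
    exact (extend_add lam (fun l => c • z.1 l) z'.1 v).trans
      (congrArg (· + _) (extend_smul lam c z.1 v))
  have h2 : operatorLift (c • z + z').2 = c • operatorLift z.2 + operatorLift z'.2 := by
    funext v
    simp [operatorLift]
  rw [cochainEntry, h1, h2]

theorem explicitBracket_update (hy : ∀ i, y i ∈ explicitCochains 𝒱 (d i)) (i : Fin n) (c : k)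
    {z z' : (List V → V) × (List V → V)} (hz : z ∈ explicitCochains 𝒱 (d i))
    (hz' : z' ∈ explicitCochains 𝒱 (d i)) :
    explicitBracket 𝒱 lam n d (Function.update y i (c • z + z')) =
      c • explicitBracket 𝒱 lam n d (Function.update y i z) +
        explicitBracket 𝒱 lam n d (Function.update y i z') := by
  have hD := derivedBracketData_operatorProj (k := k) (signRule_suspension 𝒱)
  have hup : ∀ u ∈ explicitCochains 𝒱 (d i), ∀ j, Function.update y i u j ∈
      explicitCochains 𝒱 (d j) := by
    intro u hu j
    by_cases h : j = i
    · subst h; simpa using hu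
    · simpa [h] using hy j
  have hv : ∀ t ∈ List.ofFn fun j => cochainEntry lam (d j) (y j),
      DerivedBracketData.Valid (graded (pairGrading (suspension 𝒱))) (operatorProj (k := k)) t :=
    fun t ht => valid_reverse_ofFn 𝒱 lam hy t (List.mem_reverse.2 ht)
  have hA : ∀ t ∈ ((List.ofFn fun j => cochainEntry lam (d j) (y j)).drop (i + 1)).reverse,
      DerivedBracketData.Valid (graded (pairGrading (suspension 𝒱))) (operatorProj (k := k)) t :=
    fun t ht => hv t (List.mem_of_mem_drop (List.mem_reverse.1 ht))
  have hB : ∀ t ∈ ((List.ofFn fun j => cochainEntry lam (d j) (y j)).take i).reverse,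
      DerivedBracketData.Valid (graded (pairGrading (suspension 𝒱))) (operatorProj (k := k)) t :=
    fun t ht => hv t (List.mem_of_mem_take (List.mem_reverse.1 ht))
  have hs := add_mem (Submodule.smul_mem _ c hz) hz'
  apply explicit_ext lam
  · have hE : ∀ y : (List V → V) × (List V → V), extendHom lam (c • y) = c • extendHom lam y :=
      fun y => funext fun v => extend_smul lam c y.1 v
    rw [map_add, hE]
    change extend lam (algebraBracket 𝒱 n d _) = c • extend lam (algebraBracket 𝒱 n d _) +
      extend lam (algebraBracket 𝒱 n d _)
    rw [extend_algebraBracket 𝒱 lam (hup _ hs), extend_algebraBracket 𝒱 lam (hup _ hz),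
      extend_algebraBracket 𝒱 lam (hup _ hz'), ofFn_cochainEntry_update, ofFn_cochainEntry_update,
      ofFn_cochainEntry_update, cochainEntry_smul_add, hD.pairBr_slot c hA hB, smul_add,
      smul_comm c]
    rfl
  · have hO : ∀ y : (List V → V) × (List V → V), operatorHom (c • y) = c • operatorHom y :=
      fun y => by funext v; simp [operatorHom, operatorLift]
    rw [map_add, hO]
    change operatorLift (operatorBracket 𝒱 lam n d _) =
      c • operatorLift (operatorBracket 𝒱 lam n d _) + operatorLift (operatorBracket 𝒱 lam n d _)
    rw [operatorLift_operatorBracket 𝒱 lam (hup _ hs), operatorLift_operatorBracket 𝒱 lam (hup _ hz),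
      operatorLift_operatorBracket 𝒱 lam (hup _ hz'), ofFn_cochainEntry_update,
      ofFn_cochainEntry_update, ofFn_cochainEntry_update, cochainEntry_smul_add,
      hD.derived_slot c hA hB, map_add, map_smul, smul_add, smul_comm c]
    rfl

/-! ### The identification with the explicit complex -/

theorem koszul_one (c : ℤ) (a : V) : koszul 𝒱 1 c a = c.negOnePow • koszul 𝒱 0 c a := by
  induction a using (signRule_koszul 𝒱).induction with
  | h0 => simp
  | hm i x hx =>
    rw [koszul_of_mem 𝒱 1 c i x hx, koszul_of_mem 𝒱 0 c i x hx, negOnePow_smul_smul]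
    congr 2; ring
  | ha x y hx hy => simp [hx, hy]

@[simp] theorem length_desuspend (v : List V) : (desuspend 𝒱 v).length = v.length := by
  induction v with
  | nil => rfl
  | cons a t ih => simp [desuspend, ih]

theorem desuspend_desuspend (v : List V) : desuspend 𝒱 (desuspend 𝒱 v) = v := by
  induction v with
  | nil => rfl
  | cons a t ih =>
    rw [desuspend, desuspend, ih, length_desuspend, ← (signRule_koszul 𝒱).add,
      (signRule_koszul 𝒱).even ⟨_, rfl⟩]

theorem desuspend_append (l r : List V) : desuspend 𝒱 (l ++ r) =
    (desuspend 𝒱 l).map (koszul 𝒱 0 r.length) ++ desuspend 𝒱 r := by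
  induction l with
  | nil => rfl
  | cons a l ih =>
    simp only [List.cons_append, desuspend, ih, List.map_cons, List.length_append]
    congr 1
    rw [← (signRule_koszul 𝒱).add]
    push_cast
    rw [add_comm]

theorem desuspend_map (c : ℤ) (v : List V) :
    desuspend 𝒱 (v.map (koszul 𝒱 0 c)) = (desuspend 𝒱 v).map (koszul 𝒱 0 c) := by
  induction v with
  | nil => rfl
  | cons a l ih =>
    simp only [List.map_cons, desuspend, ih, List.length_map]
    rw [(signRule_koszul 𝒱).comm]

theorem IsMultilinear.comp_desuspend {X : Type*} [AddCommGroup X] [Module k X] {f : List V → X}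
    (hf : IsMultilinear k f) : IsMultilinear k fun v => f (desuspend 𝒱 v) := by
  constructor
  · intro l r a b
    induction l generalizing f with
    | nil => simp only [List.nil_append, desuspend, map_add, hf.add_head]
    | cons x l ih =>
      simp only [List.cons_append, desuspend, List.length_append, List.length_cons]
      exact ih (hf.cons _)
  · intro l r c a
    induction l generalizing f with
    | nil => simp only [List.nil_append, desuspend, map_smul, hf.smul_head]
    | cons x l ih =>
      simp only [List.cons_append, desuspend, List.length_append, List.length_cons]
      exact ih (hf.cons _)

theorem HomList.shift {𝓜 𝓝 : ℤ → Submodule k V} {c : ℤ} (h : ∀ i, 𝓜 i = 𝓝 (i + c)) {i : List ℤ}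
    {v : List V} (hv : HomList 𝓜 i v) : ∃ j : List ℤ, HomList 𝓝 j v ∧
      j.sum = i.sum + v.length * c := by
  induction hv with
  | nil => exact ⟨[], .nil, by simp⟩
  | @cons a x i v hx _ ih =>
    obtain ⟨j, hj, hs⟩ := ih
    refine ⟨(a + c) :: j, .cons (h a ▸ hx) hj, ?_⟩
    simp only [List.sum_cons, hs, List.length_cons]
    push_cast
    ring

theorem HomList.desuspend {𝓜 : ℤ → Submodule k V}
    (h : ∀ (e i : ℤ) x, x ∈ 𝓜 i → koszul 𝒱 0 e x ∈ 𝓜 i)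
    {i : List ℤ} {v : List V} (hv : HomList 𝓜 i v) : HomList 𝓜 i (desuspend 𝒱 v) := by
  induction hv with
  | nil => exact .nil
  | cons hx _ ih => exact .cons (h _ _ _ hx) ih

theorem comp_desuspend_mem {c : ℤ} {f : List V → V} :
    (fun v => f (desuspend 𝒱 v)) ∈ (homProd (suspension 𝒱) 𝒱 fun _ => c) ↔
      f ∈ homProd 𝒱 𝒱 fun n => c + (n : ℤ) := by
  have hk := signRule_koszul 𝒱
  have hk' : ∀ (e i : ℤ) x, x ∈ suspension 𝒱 i → koszul 𝒱 0 e x ∈ suspension 𝒱 i :=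
    fun e i x hx => hk.mem (i := i - 1) e hx
  constructor
  · intro h
    have hm := (homProd_multilinear h).comp_desuspend 𝒱
    simp only [desuspend_desuspend] at hm
    refine mem_homProd_iff.2
      ⟨homProd_nil (f := fun v => f (desuspend 𝒱 v)) h, hm, fun i v hv => ?_⟩
    obtain ⟨j, hj, hs⟩ := HomList.shift (𝓝 := suspension 𝒱) (c := 1)
      (fun i => by rw [suspension, add_sub_cancel_right]) hv
    have := homProd_apply_mem h (hj.desuspend 𝒱 hk')
    simp only [desuspend_desuspend] at this
    rw [hs] at this
    convert this using 2
    ring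
  · intro h
    refine mem_homProd_iff.2 ⟨homProd_nil h, (homProd_multilinear h).comp_desuspend 𝒱,
      fun i v hv => ?_⟩
    obtain ⟨j, hj, hs⟩ := HomList.shift (𝓝 := 𝒱) (c := -1) (fun i => rfl) hv
    have := homProd_apply_mem h (hj.desuspend 𝒱 fun e i x hx => hk.mem e hx)
    rw [hs, length_desuspend] at this
    convert this using 2
    ring

theorem mem_cochains_iff {d : ℤ} {x : Gen → List V → V} : x ∈ cochains 𝒱 d ↔
    (x .e ∈ homProd 𝒱 𝒱 fun n => d - 1 + (n : ℤ)) ∧ x .o ∈ homProd 𝒱 𝒱 fun n => d + (n : ℤ) := by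
  have h : (fun n : ℕ => d - 1 + (n : ℤ)) = fun n : ℕ => d + Gen.e.degree n := by
    funext n; simp [Gen.degree]; ring
  rw [h]
  constructor
  · intro hx
    exact ⟨hx .e trivial, hx .o trivial⟩
  · rintro ⟨h1, h2⟩ (_ | _) -
    · exact h1
    · exact h2

theorem sign_mem_iff {X : Type*} [AddCommGroup X] [Module k X] (S : Submodule k X) (c : ℤ) (x : X) :
    c.negOnePow • x ∈ S ↔ x ∈ S := by
  have h : ∀ x : X, x ∈ S → c.negOnePow • x ∈ S := fun x hx => by
    rw [Units.smul_def]
    exact zsmul_mem hx _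
  exact ⟨fun hx => by simpa only [negOnePow_smul_self] using h _ hx, h x⟩

theorem identification_mem_iff {d : ℤ} {x : Gen → List V → V} :
    identification 𝒱 d x ∈ explicitCochains 𝒱 d ↔ x ∈ cochains 𝒱 d := by
  have h : graded (suspension 𝒱) d = homProd (suspension 𝒱) 𝒱 fun _ => d - 1 := by
    rw [homProd_suspension, sub_add_cancel]
  rw [mem_explicitCochains, ← homProd_suspension, h, mem_cochains_iff, ← comp_desuspend_mem,
    ← comp_desuspend_mem]
  refine and_congr Iff.rfl ?_
  exact sign_mem_iff _ d fun v => x .o (desuspend 𝒱 v)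

/-- The inverse of the identification. -/
def identificationInv (d : ℤ) (y : (List V → V) × (List V → V)) : Gen → List V → V
  | .e => fun v => y.1 (desuspend 𝒱 v)
  | .o => fun v => d.negOnePow • y.2 (desuspend 𝒱 v)

theorem identificationInv_identification (d : ℤ) (x : Gen → List V → V) :
    identificationInv 𝒱 d (identification 𝒱 d x) = x := by
  funext b v
  cases b <;> simp [identification, identificationInv, desuspend_desuspend, negOnePow_smul_self]

theorem identification_identificationInv (d : ℤ) (y : (List V → V) × (List V → V)) :
    identification 𝒱 d (identificationInv 𝒱 d y) = y := by
  simp [identification, identificationInv, desuspend_desuspend, negOnePow_smul_self]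

theorem identification_bijOn (d : ℤ) :
    Set.BijOn (identification 𝒱 d) (cochains 𝒱 d) (explicitCochains 𝒱 d) := by
  refine ⟨fun x hx => (identification_mem_iff 𝒱).2 hx, fun x _ y _ h => ?_, fun y hy => ?_⟩
  · rw [← identificationInv_identification 𝒱 d x, h, identificationInv_identification]
  · refine ⟨identificationInv 𝒱 d y, (identification_mem_iff 𝒱).1 ?_,
      identification_identificationInv 𝒱 d y⟩
    rwa [identification_identificationInv]

theorem identification_smul_add (d : ℤ) (c : k) (x y : Gen → List V → V) :
    identification 𝒱 d (c • x + y) = c • identification 𝒱 d x + identification 𝒱 d y := by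
  refine Prod.ext rfl (funext fun v => ?_)
  simp only [identification, Prod.snd_add, Prod.smul_snd, Pi.add_apply, Pi.smul_apply, smul_add]
  rw [smul_comm]

/-- The identification as an additive map. -/
def identificationHom (d : ℤ) : (Gen → List V → V) →+ (List V → V) × (List V → V) :=
  AddMonoidHom.mk' (identification 𝒱 d) fun x y => by
    simpa using identification_smul_add 𝒱 d (1 : k) x y

end

/-! ### Composition along trees with corollas -/

namespace Forest

section

variable {X : Type v}

@[simp] theorem width_addLeaves (n : ℕ) (r : Forest X) : (addLeaves n r).width = n + r.width := by
  induction n with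
  | zero => simp [addLeaves]
  | succ n ih => simp [addLeaves, width, ih]; lia

@[simp] theorem leaves_addLeaves (n : ℕ) (r : Forest X) :
    (addLeaves n r).leaves = n + r.leaves := by
  induction n with
  | zero => simp [addLeaves]
  | succ n ih => simp [addLeaves, leaves, ih]; lia

@[simp] theorem weight_addLeaves (n : ℕ) (r : Forest X) : (addLeaves n r).weight = r.weight := by
  induction n with
  | zero => rfl
  | succ n ih => simpa [addLeaves, weight] using ih

@[simp] theorem width_corollas (x : X) (w : List ℕ) : (corollas x w).width = w.length := by
  induction w with
  | nil => rfl
  | cons r w ih => cases r <;> simp [corollas, corolla, width, ih]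

@[simp] theorem leaves_corollas (x : X) (w : List ℕ) : (corollas x w).leaves = patLeaves w := by
  induction w with
  | nil => rfl
  | cons r w ih => cases r <;> simp [corollas, corolla, leaves, ih]; lia

@[simp] theorem weight_corollas (x : X) (w : List ℕ) : (corollas x w).weight = patVertices w := by
  induction w with
  | nil => rfl
  | cons r w ih => cases r <;> simp [corollas, corolla, weight, ih]; lia

@[simp] theorem vertexDegrees_addLeaves (n : ℕ) (r : Forest Gen) :
    (addLeaves n r).vertexDegrees = r.vertexDegrees := by
  induction n with
  | zero => rfl
  | succ n ih => simpa [addLeaves, vertexDegrees] using ih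

theorem vertexDegrees_corollas (w : List ℕ) : (corollas Gen.o w).vertexDegrees =
    (w.filter fun r => r ≠ 0).map fun r : ℕ => (r : ℤ) := by
  induction w with
  | nil => rfl
  | cons r w ih =>
    cases r with
    | zero => simpa [corollas, vertexDegrees] using ih
    | succ r => simpa [corollas, corolla, vertexDegrees, width, Gen.degree] using ih

end

section

variable {k : Type u} {V : Type v} [Field k] [AddCommGroup V] [Module k V]

@[simp] theorem totalDegree_addLeaves (n : ℕ) (r : Forest (ℤ × (List V → V))) :
    (addLeaves n r).totalDegree = r.totalDegree := by
  induction n with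
  | zero => rfl
  | succ n ih => simpa [addLeaves, totalDegree] using ih

theorem decorate_addLeaves (n : ℕ) (r : Forest Gen) (xs : List (ℤ × (Gen → List V → V))) :
    (addLeaves n r).decorate xs = addLeaves n (r.decorate xs) := by
  induction n with
  | zero => rfl
  | succ n ih => simpa [addLeaves, decorate] using ih

theorem decorate_corollas_zero (w : List ℕ) (xs : List (ℤ × (Gen → List V → V))) :
    (corollas Gen.o (0 :: w)).decorate xs = leaf ((corollas Gen.o w).decorate xs) := rfl

theorem decorate_corollas_succ (r : ℕ) (w : List ℕ) (x : ℤ × (Gen → List V → V))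
    (xs : List (ℤ × (Gen → List V → V))) :
    (corollas Gen.o ((r + 1) :: w)).decorate (x :: xs) =
      vertex (x.1 + (r + 1 : ℕ), x.2 Gen.o) (addLeaves (r + 1) nil)
        ((corollas Gen.o w).decorate xs) := by
  rw [corollas, corolla, decorate, weight_addLeaves, decorate_addLeaves]
  simp [weight, width, Gen.degree, decorate]

theorem totalDegree_decorate_corollas (w : List ℕ) (xs : List (ℤ × (Gen → List V → V)))
    (h : patVertices w = xs.length) :
    ((corollas Gen.o w).decorate xs).totalDegree = totalDeg xs + w.sum := by
  induction w generalizing xs with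
  | nil =>
    obtain rfl : xs = [] := List.eq_nil_of_length_eq_zero h.symm
    rfl
  | cons r w ih =>
    cases r with
    | zero => simpa [decorate_corollas_zero, totalDegree] using ih xs (by simpa using h)
    | succ r =>
      obtain _ | ⟨x, xs⟩ := xs
      · simp at h
      rw [decorate_corollas_succ, totalDegree, totalDegree_addLeaves, ih xs (by simpa using h)]
      simp [totalDegree]
      ring

variable (𝒱 : ℤ → Submodule k V) [DirectSum.Decomposition 𝒱]

theorem comp_addLeaves (n : ℕ) (r : Forest (ℤ × (List V → V))) (z : List V) (h : n ≤ z.length) :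
    comp 𝒱 (addLeaves n r) z =
      (z.take n).map (koszul 𝒱 0 r.totalDegree) ++ comp 𝒱 r (z.drop n) := by
  induction n generalizing z with
  | zero => simp [addLeaves]
  | succ n ih =>
    obtain _ | ⟨a, z⟩ := z
    · simp at h
    rw [addLeaves, comp, totalDegree_addLeaves, List.tail_cons, ih z (by simpa using h)]
    rfl

theorem comp_addLeaves_nil (z : List V) : comp 𝒱 (addLeaves z.length nil) z = z := by
  rw [comp_addLeaves 𝒱 _ _ _ le_rfl]
  simp [comp, totalDegree, (signRule_koszul 𝒱).map_zero_list]

end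

end Forest

section

variable {k : Type u} {V : Type v} [Field k] [AddCommGroup V] [Module k V]
  (𝒱 : ℤ → Submodule k V) [DirectSum.Decomposition 𝒱]

theorem map_negOnePow_smul {M N : Type*} [AddCommGroup M] [Module k M] [AddCommGroup N]
    [Module k N] (f : M →ₗ[k] N) (e : ℤ) (a : M) : f (e.negOnePow • a) = e.negOnePow • f a := by
  rw [Units.smul_def, map_zsmul, ← Units.smul_def]

theorem insertOp_eq_sum {M X : Type*} [AddCommGroup M] [Module k M] [AddCommGroup X]
    (κ : ℤ → M →ₗ[k] M) (d : ℤ) (g : List M → M) (f : List M → X) (v : List M) :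
    insertOp κ d g f v = ∑ i ∈ Finset.range v.length, ∑ j ∈ Finset.range (v.length - i),
      f ((v.take i).map (κ d) ++ g ((v.drop i).take (j + 1)) :: v.drop (i + (j + 1))) := by
  induction v generalizing f with
  | nil => rfl
  | cons x t ih =>
    rw [insertOp, List.length_cons, Finset.sum_range_succ', prefixSum_eq_sum, ih, add_comm]
    congr 1
    · refine Finset.sum_congr rfl fun i _ => ?_
      rw [Nat.succ_sub_succ]
      refine Finset.sum_congr rfl fun j _ => ?_
      rw [show i + 1 + (j + 1) = i + (j + 1) + 1 by ring]
      simp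
    · simp

theorem IsMultilinear.map_koszul_one {X : Type*} [AddCommGroup X] [Module k X] {f : List V → X}
    (hf : IsMultilinear k f) (c : ℤ) (v : List V) :
    f (v.map (koszul 𝒱 1 c)) = (c * v.length).negOnePow • f (v.map (koszul 𝒱 0 c)) := by
  induction v generalizing f with
  | nil => simp
  | cons a v ih =>
    simp only [List.map_cons, List.length_cons]
    rw [koszul_one, hf.sign_head, ih (hf.cons _), negOnePow_smul_smul]
    congr 2
    push_cast
    ring

/-- The operators of a list of cochains, on the suspension. -/
def operators (xs : List (ℤ × (Gen → List V → V))) : List (ℤ × (List V → V)) :=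
  xs.map fun x => (x.1 + 1, (identification 𝒱 x.1 x.2).2)

@[simp] theorem totalDeg_operators (xs : List (ℤ × (Gen → List V → V))) :
    totalDeg (operators 𝒱 xs) = totalDeg xs + xs.length := by
  induction xs with
  | nil => rfl
  | cons x xs ih =>
    rw [operators, List.map_cons, totalDeg_cons, totalDeg_cons, List.length_cons]
    change _ + totalDeg (operators 𝒱 xs) = _
    rw [ih]
    push_cast
    ring

/-- The sign which relates the composition of operators on `V` according to a pattern and their
composition on the suspension. -/
def patternSign : List ℕ → List ℤ → ℤ
  | [], _ => 0
  | 0 :: w, ds => patternSign w ds + (ds.sum + ds.length)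
  | (r + 1) :: w, ds => patternSign w ds.tail + (ds.headD 0 +
      (r + 1 : ℕ) * (ds.tail.sum + ds.tail.length) + w.length * (ds.headD 0 + (r + 1 : ℕ)))

theorem sum_add_length_eq (w : List ℕ) : patLeaves w + patVertices w = w.sum + w.length := by
  induction w with
  | nil => rfl
  | cons r w ih => cases r <;> simp <;> lia

/-- The composition of operators according to a pattern, in terms of the suspension. -/
theorem comp_corollas {X : Type*} [AddCommGroup X] [Module k X] {F : List V → X}
    (hF : IsMultilinear k F) {w : List ℕ} {xs : List (ℤ × (Gen → List V → V))}
    (hxs : ∀ x ∈ xs, x.2 ∈ cochains 𝒱 x.1) (hw : patVertices w = xs.length) {v : List V}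
    (hv : v.length = patLeaves w) :
    F (Forest.comp 𝒱 ((Forest.corollas Gen.o w).decorate xs) (desuspend 𝒱 v)) =
      (patternSign w (xs.map Prod.fst)).negOnePow •
        F (desuspend 𝒱 (applyPattern (koszul 𝒱 1) w (operators 𝒱 xs) v)) := by
  have hk := signRule_koszul 𝒱
  induction w generalizing F xs v with
  | nil =>
    obtain rfl : v = [] := List.eq_nil_of_length_eq_zero hv
    simp [Forest.corollas, Forest.decorate, Forest.comp, applyPattern, desuspend, patternSign]
  | cons r w ih =>
    have hsum := sum_add_length_eq w
    cases r with
    | zero =>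
      obtain _ | ⟨a, v⟩ := v
      · simp at hv
      have hw' : patVertices w = xs.length := by simpa using hw
      have hv' : v.length = patLeaves w := by simpa using hv
      have h1 : koszul 𝒱 0 (totalDeg xs + w.sum) (koszul 𝒱 0 v.length a) =
          (totalDeg xs + xs.length).negOnePow •
            koszul 𝒱 0 w.length (koszul 𝒱 1 (totalDeg xs + xs.length) a) := by
        rw [koszul_one, map_negOnePow_smul, negOnePow_smul_self,
          ← hk.add, ← hk.add]
        exact hk.congr ⟨w.sum - xs.length, by lia⟩ a
      rw [Forest.decorate_corollas_zero, Forest.comp, desuspend, List.headD_cons, List.tail_cons,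
        Forest.totalDegree_decorate_corollas _ _ hw', h1, hF.sign_head, ih (hF.cons _) hxs hw' hv',
        negOnePow_smul_smul, applyPattern, desuspend, applyPattern_length, totalDeg_operators,
        patternSign]
      simp only [List.headD_cons, List.tail_cons, List.length_map, totalDeg]
      congr 2
      ring
    | succ r =>
      obtain _ | ⟨x, xs⟩ := xs
      · simp at hw
      have hw' : patVertices w = xs.length := by simpa using hw
      have hv0 : v.length = patLeaves w + (r + 1) := by simpa using hv
      have hv' : (v.drop (r + 1)).length = patLeaves w := by simp; lia
      have hv1 : (v.take (r + 1)).length = r + 1 := by simp; lia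
      have hx : x.2 .o ∈ homProd 𝒱 𝒱 fun n => x.1 + (n : ℤ) :=
        ((mem_cochains_iff 𝒱).1 (hxs x (by simp))).2
      have hsplit : desuspend 𝒱 v = (desuspend 𝒱 (v.take (r + 1))).map
          (koszul 𝒱 0 (v.drop (r + 1)).length) ++ desuspend 𝒱 (v.drop (r + 1)) := by
        rw [← desuspend_append, List.take_append_drop]
      have hl : ((desuspend 𝒱 (v.take (r + 1))).map
          (koszul 𝒱 0 (v.drop (r + 1)).length)).length = r + 1 := by
        rw [List.length_map, length_desuspend, hv1]
      have h1 : x.2 .o (((desuspend 𝒱 (v.take (r + 1))).map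
            (koszul 𝒱 0 (v.drop (r + 1)).length)).map (koszul 𝒱 0 (totalDeg xs + w.sum))) =
          (x.1 + (r + 1 : ℕ) * (totalDeg xs + xs.length) +
            w.length * (x.1 + (r + 1 : ℕ))).negOnePow •
            koszul 𝒱 0 w.length ((identification 𝒱 x.1 x.2).2
              ((v.take (r + 1)).map (koszul 𝒱 1 (totalDeg xs + xs.length)))) := by
        have hm := (homProd_multilinear hx).comp_desuspend 𝒱
        have h2 := hm.map_koszul_one 𝒱 (totalDeg xs + xs.length) (v.take (r + 1))
        have h3 := homProd_map_sign hk hk hx w.length (desuspend 𝒱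
          ((v.take (r + 1)).map (koszul 𝒱 0 (totalDeg xs + xs.length))))
        rw [← negOnePow_smul_self (w.length * (x.1 + (r + 1 : ℕ)))
          (koszul 𝒱 0 w.length ((identification 𝒱 x.1 x.2).2
              ((v.take (r + 1)).map (koszul 𝒱 1 (totalDeg xs + xs.length)))))]
        rw [length_desuspend, List.length_map, hv1] at h3
        have hid : ∀ l, (identification 𝒱 x.1 x.2).2 l = x.1.negOnePow • x.2 .o (desuspend 𝒱 l) :=
          fun _ => rfl
        rw [hid, h2, hv1, map_negOnePow_smul, map_negOnePow_smul, smul_comm _ x.1.negOnePow, smul_comm _ ((totalDeg xs + xs.length) * _).negOnePow, ← h3,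
          negOnePow_smul_smul, negOnePow_smul_smul, negOnePow_smul_smul, Int.negOnePow_even,
          one_smul, desuspend_map, hk.map_map, hk.map_map]
        · refine congrArg _ (hk.map_congr ⟨w.sum - xs.length, ?_⟩ _)
          rw [hv']
          lia
        · grind
      rw [Forest.decorate_corollas_succ, Forest.comp, Forest.leaves_addLeaves, Forest.leaves,
        add_zero, hsplit, List.take_left' hl, List.drop_left' hl,
        Forest.totalDegree_decorate_corollas _ _ hw']
      have h4 := Forest.comp_addLeaves_nil 𝒱 (((desuspend 𝒱 (v.take (r + 1))).map
            (koszul 𝒱 0 (v.drop (r + 1)).length)).map (koszul 𝒱 0 (totalDeg xs + w.sum)))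
      rw [List.length_map, hl] at h4
      rw [h4]
      dsimp only
      rw [h1, hF.sign_head, ih (hF.cons _) (fun x hx => hxs x (by simp [hx])) hw' hv',
        negOnePow_smul_smul, applyPattern, desuspend, applyPattern_length, patternSign]
      have h5 : (operators 𝒱 (x :: xs)).tail = operators 𝒱 xs := rfl
      rw [h5, totalDeg_operators]
      simp only [List.headD_cons, List.tail_cons, List.length_map, totalDeg, List.map_cons]
      congr 2
      ring

/-- Composition of operators according to a pattern satisfies the Koszul rule. -/
theorem comp_corollas_map {X : Type*} [AddCommGroup X] [Module k X] {F : List V → X}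
    (hF : IsMultilinear k F) {w : List ℕ} {xs : List (ℤ × (Gen → List V → V))}
    (hxs : ∀ x ∈ xs, x.2 ∈ cochains 𝒱 x.1) (hw : patVertices w = xs.length) {v : List V}
    (hv : v.length = patLeaves w) (b : ℤ) :
    F (Forest.comp 𝒱 ((Forest.corollas Gen.o w).decorate xs) (v.map (koszul 𝒱 0 b))) =
      (b * (totalDeg xs + w.sum)).negOnePow •
        F ((Forest.comp 𝒱 ((Forest.corollas Gen.o w).decorate xs) v).map (koszul 𝒱 0 b)) := by
  have hk := signRule_koszul 𝒱
  induction w generalizing F xs v with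
  | nil =>
    obtain rfl : xs = [] := List.eq_nil_of_length_eq_zero hw.symm
    simp [Forest.corollas, Forest.decorate, Forest.comp]
  | cons r w ih =>
    cases r with
    | zero =>
      obtain _ | ⟨a, v⟩ := v
      · simp at hv
      have hw' : patVertices w = xs.length := by simpa using hw
      have hv' : v.length = patLeaves w := by simpa using hv
      rw [Forest.decorate_corollas_zero, Forest.comp, List.map_cons, List.headD_cons,
        List.tail_cons, ih (hF.cons _) hxs hw' hv', Forest.comp, List.map_cons, hk.comm]
      simp
    | succ r =>
      obtain _ | ⟨x, xs⟩ := xs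
      · simp at hw
      have hw' : patVertices w = xs.length := by simpa using hw
      have hv0 : v.length = patLeaves w + (r + 1) := by simpa using hv
      have hv' : (v.drop (r + 1)).length = patLeaves w := by simp; lia
      have hv1 : (v.take (r + 1)).length = r + 1 := by simp; lia
      have hx : x.2 .o ∈ homProd 𝒱 𝒱 fun n => x.1 + (n : ℤ) :=
        ((mem_cochains_iff 𝒱).1 (hxs x (by simp))).2
      have hl : ∀ e e' : ℤ, Forest.comp 𝒱 (Forest.addLeaves (r + 1) Forest.nil)
          (((v.take (r + 1)).map (koszul 𝒱 0 e)).map (koszul 𝒱 0 e')) =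
            ((v.take (r + 1)).map (koszul 𝒱 0 e)).map (koszul 𝒱 0 e') := fun e e' => by
        have h4 := Forest.comp_addLeaves_nil 𝒱
          (((v.take (r + 1)).map (koszul 𝒱 0 e)).map (koszul 𝒱 0 e'))
        rwa [List.length_map, List.length_map, hv1] at h4
      have hl' : ∀ e : ℤ, Forest.comp 𝒱 (Forest.addLeaves (r + 1) Forest.nil)
          ((v.take (r + 1)).map (koszul 𝒱 0 e)) = (v.take (r + 1)).map (koszul 𝒱 0 e) := fun e => by
        have h4 := Forest.comp_addLeaves_nil 𝒱 ((v.take (r + 1)).map (koszul 𝒱 0 e))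
        rwa [List.length_map, hv1] at h4
      rw [Forest.decorate_corollas_succ, Forest.comp, Forest.comp, Forest.leaves_addLeaves,
        Forest.leaves, add_zero, ← List.map_take, ← List.map_drop, hl, hl']
      dsimp only
      rw [hk.map_map, add_comm _ b, ← hk.map_map, homProd_map_sign hk hk hx, hF.sign_head,
        ih (hF.cons _) (fun x hx => hxs x (by simp [hx])) hw' hv', negOnePow_smul_smul,
        List.map_cons, List.length_map, hv1]
      congr 2
      simp
      ring

end

/-! ### The signs of the convolution operations -/

theorem zmod_two_mul_self (x : ZMod 2) : x * x = x := by
  revert x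
  decide

/-- The sum of `d_j r_i` over all `i < j`, for lists `d` and `r`. -/
def crossSign : List ℤ → List ℤ → ℤ
  | _ :: ds, r :: rs => r * ds.sum + crossSign ds rs
  | _, _ => 0

theorem crossSign_eq {n : ℕ} (d : Fin n → ℤ) (rs : List ℤ) :
    (∑ j : Fin n, ∑ i : Fin n, if i < j then d j * rs.getD (i : ℕ) 0 else 0) =
      crossSign (List.ofFn d) rs := by
  induction n generalizing rs with
  | zero => simp [crossSign]
  | succ n ih =>
    rw [List.ofFn_succ, Fin.sum_univ_succ]
    simp only [Fin.sum_univ_succ, Fin.succ_lt_succ_iff, Fin.not_lt_zero, if_false, Fin.succ_pos,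
      if_true, Finset.sum_const_zero, Fin.val_zero, Fin.val_succ, Finset.sum_add_distrib,
      zero_add]
    cases rs with
    | nil => simp [crossSign]
    | cons r rs =>
      simp only [List.getD_cons_zero, List.getD_cons_succ]
      rw [ih, crossSign, List.sum_ofFn, ← Finset.sum_mul, mul_comm]

/-- The version of `inputSign` for patterns. -/
def patternInputSign : List ℕ → ℤ
  | [] => 0
  | 0 :: w => patternInputSign w
  | (r + 1) :: w => (r + 1 : ℕ) * patVertices w + r * w.length + patternInputSign w

theorem inputSign_eq {p : ℕ} (w : Fin p → ℕ) : inputSign w = patternInputSign (List.ofFn w) := by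
  induction p with
  | zero => simp [inputSign, patternInputSign]
  | succ p ih =>
    have hc : ∀ t : Fin p, (Finset.univ.filter fun s => t.succ < s ∧ w s ≠ 0).card =
        (Finset.univ.filter fun s : Fin p => t < s ∧ w s.succ ≠ 0).card := fun t => by
      rw [Finset.card_filter, Finset.card_filter, Fin.sum_univ_succ]
      simp [-Finset.sum_boole]
    have hc0 : (Finset.univ.filter fun s => (0 : Fin (p + 1)) < s ∧ w s ≠ 0).card =
        inputVertices fun s : Fin p => w s.succ := by
      rw [inputVertices, Finset.card_filter, Finset.card_filter, Fin.sum_univ_succ]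
      simp [-Finset.sum_boole]
    have h : inputSign w = (if w 0 = 0 then 0 else
        (w 0 : ℤ) * patVertices (List.ofFn fun s : Fin p => w s.succ) + ((w 0 : ℤ) - 1) * p) +
          patternInputSign (List.ofFn fun s : Fin p => w s.succ) := by
      rw [← ih, ← inputVertices_eq, inputSign, Fin.sum_univ_succ, inputSign, hc0]
      congr 1
      · simp
      · refine Finset.sum_congr rfl fun t _ => ?_
        rw [hc]
        push_cast
        simp only [Fin.val_succ, Nat.cast_add, Nat.cast_one]
        congr 2
        ring
    rw [h, List.ofFn_succ]
    rcases w 0 with _ | r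
    · simp [patternInputSign]
    · simp [patternInputSign]

/-- The vertex degrees of the corollas of a pattern. -/
def patDegrees (w : List ℕ) : List ℤ := (w.filter fun r => r ≠ 0).map fun r : ℕ => (r : ℤ)

theorem triangle_succ (m : ℕ) : (m + 1) * (m + 1 - 1) / 2 = m * (m - 1) / 2 + m := by
  have h := Nat.triangle_succ m
  rwa [Nat.add_sub_cancel] at h ⊢

theorem even_patternInputSign {w : List ℕ} (hw : patVertices w = w.length) :
    Even (patternInputSign w - ((w.length * (w.length - 1) / 2 : ℕ) : ℤ)) := by
  induction w with
  | nil => simp [patternInputSign]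
  | cons r w ih =>
    rw [← ZMod.intCast_eq_zero_iff_even]
    cases r with
    | zero =>
      have h1 := patVertices_le_length w
      have h2 : patVertices w = w.length + 1 := by simpa using hw
      lia
    | succ r =>
      have h0 : patVertices w = w.length := by simpa using hw
      have h1 := ZMod.intCast_eq_zero_iff_even.2 (ih h0)
      rw [patternInputSign, List.length_cons, triangle_succ, h0]
      push_cast at h1 ⊢
      grind

/-- The total sign of a composition according to a pattern depends only on the degrees of the
operators and on the length of the pattern. -/
theorem pattern_signs {w : List ℕ} {ds : List ℤ} (h : patVertices w = ds.length) :
    Even (patternSign w ds + patternInputSign w + crossSign ds (patDegrees w) -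
      (listSign ds + (1 + (w.length - ds.length)) * ds.sum + (w.length - ds.length) * ds.length +
        ((ds.length * (ds.length - 1) / 2 : ℕ) : ℤ))) := by
  induction w generalizing ds with
  | nil =>
    obtain rfl : ds = [] := List.eq_nil_of_length_eq_zero h.symm
    simp [patternSign, patternInputSign, crossSign, listSign]
  | cons r w ih =>
    rw [← ZMod.intCast_eq_zero_iff_even]
    cases r with
    | zero =>
      have h1 := ZMod.intCast_eq_zero_iff_even.2 (ih (by simpa using h))
      have h2 : patDegrees (0 :: w) = patDegrees w := rfl
      rw [patternSign, patternInputSign, h2, List.length_cons]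
      push_cast at h1 ⊢
      linear_combination h1
    | succ r =>
      obtain _ | ⟨d, ds⟩ := ds
      · simp at h
      have h0 : patVertices w = ds.length := by simpa using h
      have h1 := ZMod.intCast_eq_zero_iff_even.2 (ih h0)
      have h2 : patDegrees ((r + 1) :: w) = ((r + 1 : ℕ) : ℤ) :: patDegrees w := rfl
      rw [patternSign, patternInputSign, h2, crossSign, List.length_cons, List.length_cons,
        triangle_succ, listSign, h0]
      simp only [List.tail_cons, List.headD_cons, List.sum_cons]
      push_cast at h1 ⊢
      have h3 := zmod_two_mul_self ds.length
      grind

/-! ### The summands of the convolution operations -/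

section

variable {k : Type u} {V : Type v} [Field k] [AddCommGroup V] [Module k V]
  (𝒱 : ℤ → Submodule k V) [DirectSum.Decomposition 𝒱]

theorem IsMultilinear.append_right {M X : Type*} [AddCommGroup M] [Module k M] [AddCommGroup X]
    [Module k X] {f : List M → X} (hf : IsMultilinear k f) (r : List M) :
    IsMultilinear k fun l => f (l ++ r) :=
  ⟨fun l r' a b => by simpa using hf.add l (r' ++ r) a b,
    fun l r' c a => by simpa using hf.smul l (r' ++ r) c a⟩

/-- Inserting an element into a list commutes with the passage to the suspension up to sign. -/
theorem apply_desuspend_slot {X : Type*} [AddCommGroup X] [Module k X] {F : List V → X}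
    (hF : IsMultilinear k F) (l r : List V) (y : V) (s : ℤ) {D d' : ℤ}
    (h : Even (D - (d' + r.length + 1))) :
    F ((desuspend 𝒱 l).map (koszul 𝒱 0 D) ++ s.negOnePow • koszul 𝒱 0 r.length y ::
        desuspend 𝒱 r) =
      (s + l.length * d').negOnePow • F (desuspend 𝒱 (l.map (koszul 𝒱 1 d') ++ y :: r)) := by
  have hk := signRule_koszul 𝒱
  have h1 := (((hF.append_right (koszul 𝒱 0 r.length y :: desuspend 𝒱 r)).comp_map
    (koszul 𝒱 0 (r.length + 1 : ℕ))).comp_desuspend 𝒱).map_koszul_one 𝒱 d' l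
  rw [hF.sign_slot, desuspend_append, desuspend, List.length_cons, h1, negOnePow_smul_smul,
    desuspend_map, hk.map_map]
  have h2 : Even ((r.length + 1 : ℕ) + d' - D) := by
    obtain ⟨t, ht⟩ := h
    exact ⟨-t, by push_cast; linarith⟩
  rw [hk.map_congr h2]
  congr 1
  apply negOnePow_congr
  exact ⟨-(l.length * d'), by ring⟩

/-- The summand of `convolution` belonging to a tree. -/
def treeValue (n : ℕ) (d : Fin n → ℤ) (x : Fin n → Gen → List V → V) (v : List V)
    (T : Forest Gen) : V :=
  if T.weight = n then
    (((n * (n - 1) / 2 : ℕ) : ℤ) + 1 + n * (∑ i, d i) +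
        crossSign (List.ofFn d) T.vertexDegrees).negOnePow •
      (Forest.comp 𝒱 (T.decorate (List.ofFn fun i => (d i, x i))) v).headD 0
  else 0

theorem convolution_eq (lam : k) (n : ℕ) (d : Fin n → ℤ) (x : Fin n → Gen → List V → V) (b : Gen)
    (v : List V) : convolution 𝒱 lam n d x b v =
      Finsupp.linearCombination k (treeValue 𝒱 n d x v) (coproduct lam b v.length) := by
  rw [Finsupp.linearCombination_apply, convolution]
  refine Finsupp.sum_congr fun T _ => ?_
  rw [treeValue, crossSign_eq]
  split_ifs
  · rw [smul_comm]
  · rw [smul_zero]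

/-- Composition along a tree whose root has exactly one input which is not a leaf. -/
theorem comp_insert (D e : ℤ) (f g : List V → V) {c : Forest (ℤ × (List V → V))} {mid : List V}
    (hc : c.leaves = mid.length) (l r : List V) :
    (Forest.comp 𝒱 (Forest.vertex (D, f) (Forest.addLeaves l.length (Forest.vertex (e, g) c
      (Forest.addLeaves r.length Forest.nil))) Forest.nil) (l ++ (mid ++ r))).headD 0 =
    f (l.map (koszul 𝒱 0 (e + c.totalDegree)) ++ g (Forest.comp 𝒱 c mid) :: r) := by
  have hk := signRule_koszul 𝒱
  rw [Forest.comp, List.headD_cons, Forest.totalDegree, hk.map_zero_list,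
    List.take_of_length_le (by simp [Forest.leaves, hc]),
    Forest.comp_addLeaves _ _ _ _ (by simp), List.take_left' rfl,
    List.drop_left' rfl, Forest.comp, hc, List.take_left' rfl, List.drop_left' rfl,
    Forest.comp_addLeaves_nil]
  simp only [Forest.totalDegree, Forest.totalDegree_addLeaves, add_zero, hk.map_zero_list]

theorem comp_insert_desuspend (D e : ℤ) (f g : List V → V) {c : Forest (ℤ × (List V → V))}
    {mid : List V} (hc : c.leaves = mid.length) (l r : List V) :
    (Forest.comp 𝒱 (Forest.vertex (D, f) (Forest.addLeaves l.length (Forest.vertex (e, g) c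
      (Forest.addLeaves r.length Forest.nil))) Forest.nil) (desuspend 𝒱 (l ++ (mid ++ r)))).headD 0 =
    f ((desuspend 𝒱 l).map (koszul 𝒱 0 (e + c.totalDegree + (mid.length + r.length : ℕ))) ++
      g (Forest.comp 𝒱 c ((desuspend 𝒱 mid).map (koszul 𝒱 0 r.length))) :: desuspend 𝒱 r) := by
  have h := comp_insert 𝒱 D e f g (c := c)
    (mid := (desuspend 𝒱 mid).map (koszul 𝒱 0 r.length)) (by simp [length_desuspend, hc])
    ((desuspend 𝒱 l).map (koszul 𝒱 0 (mid.length + r.length : ℕ))) (desuspend 𝒱 r)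
  rw [List.length_map, length_desuspend, length_desuspend, (signRule_koszul 𝒱).map_map] at h
  rw [desuspend_append, desuspend_append, List.length_append, h]

/-- The summand of a tree with two vertices `e`. -/
theorem treeValue_ee {d : Fin 2 → ℤ} {x : Fin 2 → Gen → List V → V}
    (hx : ∀ i, x i ∈ cochains 𝒱 (d i)) (l mid r : List V) :
    (((mid.length : ℤ) - 1) * (mid.length + r.length)).negOnePow •
      treeValue 𝒱 2 d x (desuspend 𝒱 (l ++ (mid ++ r)))
        (Forest.vertex Gen.e (Forest.addLeaves l.length
          (Forest.corolla Gen.e mid.length (Forest.addLeaves r.length Forest.nil))) Forest.nil) =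
      x 0 .e (desuspend 𝒱 (l.map (koszul 𝒱 1 (d 1)) ++ x 1 .e (desuspend 𝒱 mid) :: r)) := by
  have hk := signRule_koszul 𝒱
  have h0 := homProd_multilinear ((mem_cochains_iff 𝒱).1 (hx 0)).1
  have h1 := ((mem_cochains_iff 𝒱).1 (hx 1)).1
  have hm := homProd_map_sign hk hk h1 r.length (desuspend 𝒱 mid)
  have hc := Forest.comp_addLeaves_nil 𝒱 ((desuspend 𝒱 mid).map (koszul 𝒱 0 r.length))
  rw [List.length_map, length_desuspend] at hc
  rw [treeValue, if_pos (by simp [Forest.weight, Forest.corolla])]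
  simp only [Forest.decorate, Forest.decorate_addLeaves, Forest.corolla, List.ofFn_succ,
    List.headD_cons, List.tail_cons, List.take_succ_cons, Forest.weight_addLeaves, Forest.weight,
    Forest.width_addLeaves, Forest.width]
  rw [comp_insert_desuspend 𝒱 _ _ _ _ (by simp [Forest.leaves]), hc]
  change _ • _ • x 0 .e (_ ++ x 1 .e _ :: _) = _
  rw [hm, apply_desuspend_slot 𝒱 h0 l r _ _ (d' := d 1), negOnePow_smul_smul, negOnePow_smul_smul]
  · rw [Int.negOnePow_even, one_smul]
    simp only [Forest.vertexDegrees, Forest.vertexDegrees_addLeaves, Forest.width_addLeaves,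
      Forest.width, crossSign, List.ofFn_zero, List.sum_cons, List.sum_nil,
      Gen.degree, List.append_nil, length_desuspend]
    have := zmod_two_mul_self (mid.length : ZMod 2)
    rw [← ZMod.intCast_eq_zero_iff_even]
    push_cast
    grind
  · refine ⟨mid.length - 1, ?_⟩
    simp only [Gen.degree, Forest.totalDegree_addLeaves, Forest.totalDegree]
    push_cast
    ring

theorem Forest.leaves_decorate (T : Forest Gen) (xs : List (ℤ × (Gen → List V → V))) :
    (T.decorate xs).leaves = T.leaves := by
  induction T generalizing xs with
  | nil => rfl
  | leaf r ih => simp [Forest.decorate, Forest.leaves, ih]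
  | vertex b c r ihc ihr => simp [Forest.decorate, Forest.leaves, ihc, ihr]

theorem Forest.width_decorate (T : Forest Gen) (xs : List (ℤ × (Gen → List V → V))) :
    (T.decorate xs).width = T.width := by
  induction T generalizing xs with
  | nil => rfl
  | leaf r ih => simp [Forest.decorate, Forest.width, ih]
  | vertex b c r ihc ihr => simp [Forest.decorate, Forest.width, ihr]

theorem Forest.length_comp (T : Forest (ℤ × (List V → V))) (v : List V) :
    (Forest.comp 𝒱 T v).length = T.width := by
  induction T generalizing v with
  | nil => rfl
  | leaf r ih => simp [Forest.comp, Forest.width, ih]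
  | vertex b c r ihc ihr => simp [Forest.comp, Forest.width, ihr]

theorem vertexDegrees_corollas_eq (w : List ℕ) :
    (Forest.corollas Gen.o w).vertexDegrees = patDegrees w := Forest.vertexDegrees_corollas w

theorem patVertices_eq_length_iff {w : List ℕ} : patVertices w = w.length ↔ ∀ r ∈ w, r ≠ 0 := by
  simp [patVertices]

variable {m : ℕ} {d : Fin (m + 2) → ℤ} {x : Fin (m + 2) → Gen → List V → V}

/-- The summand of a tree whose root is an `e` with inputs `o`. -/
theorem treeValue_root_e (hx : ∀ i, x i ∈ cochains 𝒱 (d i)) {w : List ℕ}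
    (hw : patVertices w = w.length) (hl : w.length = m + 1) {v : List V}
    (hv : v.length = patLeaves w) :
    ((∑ i, d i) + m).negOnePow • (((w.length * (w.length - 1) / 2 : ℕ) : ℤ)).negOnePow •
      treeValue 𝒱 (m + 2) d x (desuspend 𝒱 v)
        (Forest.vertex Gen.e (Forest.corollas Gen.o w) Forest.nil) =
      ((m + 1) * d 0 + listSign (List.ofFn fun i : Fin (m + 1) => d i.succ)).negOnePow •
        x 0 .e (desuspend 𝒱 (applyPattern (koszul 𝒱 1) w
          (operators 𝒱 (List.ofFn fun i : Fin (m + 1) => (d i.succ, x i.succ))) v)) := by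
  have hk := signRule_koszul 𝒱
  have h0 := homProd_multilinear ((mem_cochains_iff 𝒱).1 (hx 0)).1
  set xs := List.ofFn fun i : Fin (m + 1) => (d i.succ, x i.succ) with hxs
  have hlen : xs.length = m + 1 := by simp [hxs]
  have hmem : ∀ y ∈ xs, y.2 ∈ cochains 𝒱 y.1 := by
    intro y hy
    obtain ⟨i, rfl⟩ := List.mem_ofFn.1 hy
    exact hx _
  have hds : xs.map Prod.fst = List.ofFn fun i : Fin (m + 1) => d i.succ := by
    rw [hxs, List.map_ofFn]
    rfl
  have hvx : patVertices w = xs.length := by rw [hw, hl, hlen]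
  have hcomp := comp_corollas 𝒱 h0 hmem hvx hv
  have hsgn := pattern_signs (w := w) (ds := List.ofFn fun i : Fin (m + 1) => d i.succ)
    (by rw [List.length_ofFn, hw, hl])
  have hin := even_patternInputSign hw
  rw [treeValue, if_pos (by simp [Forest.weight, hw, hl]; lia), List.ofFn_succ (f := d),
    List.ofFn_succ (f := fun i => (d i, x i)), ← hxs]
  simp only [Forest.decorate, List.headD_cons, List.tail_cons, Forest.weight_corollas, Forest.comp,
    Forest.totalDegree, hk.map_zero_list, Forest.vertexDegrees, List.append_nil, crossSign,
    vertexDegrees_corollas_eq, Forest.width_corollas]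
  rw [List.take_of_length_le hvx.ge, List.take_of_length_le, hcomp, hds, negOnePow_smul_smul,
    negOnePow_smul_smul, negOnePow_smul_smul]
  · congr 1
    apply negOnePow_congr
    rw [hl, List.length_ofFn] at hsgn
    rw [hl] at hin ⊢
    rw [List.sum_ofFn] at hsgn ⊢
    rw [← ZMod.intCast_eq_zero_iff_even] at hsgn hin ⊢
    rw [Fin.sum_univ_succ, show (m + 2) * (m + 2 - 1) / 2 = _ from triangle_succ (m + 1)]
    simp only [Gen.degree]
    push_cast at hsgn hin ⊢
    have := zmod_two_mul_self (m : ZMod 2)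
    grind
  · rw [length_desuspend, hv, Forest.leaves_decorate, Forest.leaves_corollas]

/-- The summand of a tree whose root is an `o`. -/
theorem treeValue_root_o (hx : ∀ i, x i ∈ cochains 𝒱 (d i)) {w : List ℕ}
    (hw : patVertices w = m) {l mid r : List V} (hv : mid.length = patLeaves w) :
    ((∑ i, d i) + m).negOnePow • ((m : ℤ) * (l.length + 1 + r.length) + ((w.length : ℤ) - 1) * m +
        ((mid.length : ℤ) - 1) * r.length + patternInputSign w).negOnePow •
      treeValue 𝒱 (m + 2) d x (desuspend 𝒱 (l ++ (mid ++ r)))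
        (Forest.vertex Gen.o (Forest.addLeaves l.length (Forest.vertex Gen.e
          (Forest.corollas Gen.o w) (Forest.addLeaves r.length Forest.nil))) Forest.nil) =
      (m * (d 0 + d 1) + listSign (List.ofFn fun i : Fin m => d i.succ.succ)).negOnePow •
        (identification 𝒱 (d 0) (x 0)).2 (l.map (koszul 𝒱 1 (d 1 + totalDeg (operators 𝒱
            (List.ofFn fun i : Fin m => (d i.succ.succ, x i.succ.succ))))) ++
          x 1 .e (desuspend 𝒱 (applyPattern (koszul 𝒱 1) w
            (operators 𝒱 (List.ofFn fun i : Fin m => (d i.succ.succ, x i.succ.succ))) mid)) ::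
          r) := by
  have hk := signRule_koszul 𝒱
  have h0 := homProd_multilinear ((mem_cochains_iff 𝒱).1 (hx 0)).2
  have h1 := ((mem_cochains_iff 𝒱).1 (hx 1)).1
  have h1' := homProd_multilinear h1
  set xs := List.ofFn fun i : Fin m => (d i.succ.succ, x i.succ.succ) with hxs
  have hlen : xs.length = m := by simp [hxs]
  have hmem : ∀ y ∈ xs, y.2 ∈ cochains 𝒱 y.1 := by
    intro y hy
    obtain ⟨i, rfl⟩ := List.mem_ofFn.1 hy
    exact hx _
  have hds : xs.map Prod.fst = List.ofFn fun i : Fin m => d i.succ.succ := by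
    rw [hxs, List.map_ofFn]
    rfl
  have htd : totalDeg xs = ∑ i : Fin m, d i.succ.succ := by
    rw [totalDeg, hds, List.sum_ofFn]
  have hvx : patVertices w = xs.length := by rw [hw, hlen]
  have hsgn := pattern_signs (w := w) (ds := List.ofFn fun i : Fin m => d i.succ.succ)
    (by rw [List.length_ofFn, hw])
  have hcomp := comp_corollas 𝒱 h1' hmem hvx hv
  have hcomp' := comp_corollas_map 𝒱 h1' hmem hvx
    (v := desuspend 𝒱 mid) (by rw [length_desuspend, hv]) r.length
  have hwl : (Forest.comp 𝒱 ((Forest.corollas Gen.o w).decorate xs)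
      (desuspend 𝒱 mid)).length = w.length := by
    rw [Forest.length_comp, Forest.width_decorate, Forest.width_corollas]
  rw [homProd_map_sign hk hk h1, hwl, hcomp, hds, map_negOnePow_smul, negOnePow_smul_smul,
    negOnePow_smul_smul] at hcomp'
  rw [treeValue, if_pos (by simp [Forest.weight, hw]; lia), List.ofFn_succ (f := d),
    List.ofFn_succ (f := fun i => (d i, x i)), List.ofFn_succ (f := fun i : Fin (m + 1) => d i.succ),
    List.ofFn_succ (f := fun i : Fin (m + 1) => (d i.succ, x i.succ)), ← hxs]
  simp only [Forest.decorate, Forest.decorate_addLeaves, List.headD_cons, List.tail_cons,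
    Forest.weight_addLeaves, Forest.weight, Forest.weight_corollas,
    Forest.width_addLeaves, Forest.width, Forest.width_corollas]
  have hfin : Fin.succ (0 : Fin (m + 1)) = 1 := rfl
  rw [List.take_of_length_le (l := (d (Fin.succ 0), x (Fin.succ 0)) :: xs)
    (by rw [List.length_cons]; lia), List.tail_cons, List.take_of_length_le hvx.ge,
    List.headD_cons, comp_insert_desuspend 𝒱 _ _ _ _
      (by rw [Forest.leaves_decorate, Forest.leaves_corollas, hv])]
  have hid : ∀ u, (identification 𝒱 (d 0) (x 0)).2 u =
    (d 0).negOnePow • x 0 .o (desuspend 𝒱 u) := fun _ => rfl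
  have hsum := sum_add_length_eq w
  rw [hid]
  dsimp only
  rw [hfin, hcomp',
    apply_desuspend_slot 𝒱 h0 l r _ _ (d' := d 1 + totalDeg (operators 𝒱 xs)), negOnePow_smul_smul,
    negOnePow_smul_smul, negOnePow_smul_smul, negOnePow_smul_smul]
  · congr 1
    apply negOnePow_congr
    simp only [Forest.vertexDegrees, Forest.vertexDegrees_addLeaves, Forest.width_addLeaves,
      Forest.width, crossSign, List.sum_cons, vertexDegrees_corollas_eq, Forest.width_corollas,
      Gen.degree, List.append_nil, totalDeg_operators]
    rw [List.length_ofFn] at hsgn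
    rw [List.sum_ofFn] at hsgn ⊢
    rw [Fin.sum_univ_succ, Fin.sum_univ_succ, htd, hlen, hv, triangle_succ, triangle_succ, hfin]
    rw [hw] at hsum
    generalize w.sum = W at hsum ⊢
    have hsum' : (patLeaves w : ZMod 2) + m = W + w.length := by exact_mod_cast congrArg _ hsum
    rw [← ZMod.intCast_eq_zero_iff_even] at hsgn ⊢
    push_cast at hsgn ⊢
    have := zmod_two_mul_self (m : ZMod 2)
    grind
  · rw [Forest.totalDegree_decorate_corollas _ _ hvx, totalDeg_operators, hv, hlen]
    generalize w.sum = W at hsum ⊢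
    refine ⟨W + w.length - m - 1, ?_⟩
    simp only [Gen.degree]
    lia

end

/-! ### The convolution operations as braces -/

section

variable {k : Type u} {V : Type v} [Field k] [AddCommGroup V] [Module k V]
  (𝒱 : ℤ → Submodule k V) [DirectSum.Decomposition 𝒱] (lam : k)

theorem length_eq_of_splits {X : Type*} (v : List X) {a t : ℕ} (h : a + t ≤ v.length) :
    (v.take a).length = a ∧ ((v.drop a).take t).length = t ∧
      (v.drop (a + t)).length = v.length - (a + t) ∧
      v = v.take a ++ ((v.drop a).take t ++ v.drop (a + t)) := by
  refine ⟨by simp; lia, by simp; lia, by simp, ?_⟩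
  rw [← List.drop_drop, List.take_append_drop, List.take_append_drop]

theorem sum_comm_dependent {X : Type*} [AddCommMonoid X] (A : Finset ℕ) (J : ℕ → Finset ℕ)
    (P : Finset ℕ) (R : ℕ → Type*) [∀ p, Fintype (R p)] (f : ℕ → ℕ → (p : ℕ) → R p → X) :
    ∑ a ∈ A, ∑ j ∈ J a, ∑ p ∈ P, ∑ r : R p, f a j p r =
      ∑ p ∈ P, ∑ r : R p, ∑ a ∈ A, ∑ j ∈ J a, f a j p r := by
  rw [Finset.sum_sigma', Finset.sum_comm]
  refine Finset.sum_congr rfl fun p _ => ?_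
  rw [Finset.sum_comm]
  exact Finset.sum_congr rfl fun r _ =>
    (Finset.sum_sigma' A J fun a j => f a j p r).symm

/-- On the algebra parts, the binary operation is the insertion of maps of the suspension. -/
theorem convolution_e {d : Fin 2 → ℤ} {x : Fin 2 → Gen → List V → V}
    (hx : ∀ i, x i ∈ cochains 𝒱 (d i)) (v : List V) :
    convolution 𝒱 lam 2 d x .e (desuspend 𝒱 v) =
      insertOp (koszul 𝒱 1) (d 1) (fun v => x 1 .e (desuspend 𝒱 v))
        (fun v => x 0 .e (desuspend 𝒱 v)) v := by
  rw [convolution_eq, coproduct, insertOp_eq_sum, length_desuspend]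
  simp only [map_sum, Finsupp.linearCombination_single, negOnePow_cast_smul]
  rw [Finset.sum_sigma', Finset.sum_sigma']
  refine Finset.sum_nbij' (fun p => ⟨p.2 - 1, p.1 - 1⟩) (fun p => ⟨p.2 + 1, p.1 + 1⟩) ?_ ?_ ?_ ?_ ?_
  · rintro ⟨j, i⟩ h
    simp only [Finset.mem_sigma, Finset.mem_Icc, Finset.mem_range] at h ⊢
    lia
  · rintro ⟨i, j⟩ h
    simp only [Finset.mem_sigma, Finset.mem_Icc, Finset.mem_range] at h ⊢
    lia
  · rintro ⟨j, i⟩ h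
    simp only [Finset.mem_sigma, Finset.mem_Icc] at h
    simp only [Nat.sub_add_cancel h.1.1, Nat.sub_add_cancel h.2.1]
  · rintro ⟨i, j⟩ _
    rfl
  · rintro ⟨j, i⟩ h
    simp only [Finset.mem_sigma, Finset.mem_Icc] at h
    obtain ⟨⟨hj, hj'⟩, hi, hi'⟩ := h
    dsimp only
    obtain ⟨h1, h2, h3, h4⟩ := length_eq_of_splits v (a := i - 1) (t := j) (by lia)
    have key := treeValue_ee 𝒱 hx (v.take (i - 1)) ((v.drop (i - 1)).take j) (v.drop (i - 1 + j))
    rw [← h4, h1, h2, h3] at key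
    rw [Nat.sub_add_cancel hj, ← key, show v.length - j + 1 - i = v.length - (i - 1 + j) by lia]
    congr 2
    congr 1
    lia

theorem convolution_e_eq_zero {n : ℕ} (hn : n ≠ 2) (d : Fin n → ℤ) (x : Fin n → Gen → List V → V)
    (v : List V) : convolution 𝒱 lam n d x .e v = 0 := by
  rw [convolution_eq, coproduct]
  simp only [map_sum, Finsupp.linearCombination_single]
  refine Finset.sum_eq_zero fun j _ => Finset.sum_eq_zero fun i _ => ?_
  rw [treeValue, if_neg, smul_zero]
  simp [Forest.weight, Forest.corolla]
  lia

/-- The trees whose root is an `e` with inputs `o`. -/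
def rootETree (w : List ℕ) : Forest Gen :=
  Forest.vertex Gen.e (Forest.corollas Gen.o w) Forest.nil

/-- The trees whose root is an `o`. -/
def rootOTree (a : ℕ) (w : List ℕ) (b : ℕ) : Forest Gen :=
  Forest.vertex Gen.o (Forest.addLeaves a
    (Forest.vertex Gen.e (Forest.corollas Gen.o w) (Forest.addLeaves b Forest.nil))) Forest.nil

/-- The sign of the tree `rootOTree a w b` in the decomposition of `o`. -/
def rootOSign (a : ℕ) (w : List ℕ) (b : ℕ) : ℤ :=
  (patVertices w : ℤ) * ((a : ℤ) + 1 + b) + ((w.length : ℤ) - 1) * patVertices w +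
    ((patLeaves w : ℤ) - 1) * b + patternInputSign w

/-- The contribution of the tree `rootETree w` to the decomposition of `o`. -/
def rootETerm (φ : Forest Gen → V) (w : List ℕ) : V :=
  if patVertices w = w.length then
    (((w.length * (w.length - 1) / 2 : ℕ) : ℤ)).negOnePow • φ (rootETree w) else 0

/-- The contribution of the tree `rootOTree a w b` with `N` leaves to the decomposition of `o`. -/
def rootOTerm (φ : Forest Gen → V) (N a : ℕ) (w : List ℕ) : V :=
  if patVertices w + 1 ≤ w.length ∧ a + patLeaves w ≤ N then
    lam ^ (w.length - (patVertices w + 1)) • (rootOSign a w (N - (a + patLeaves w))).negOnePow •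
      φ (rootOTree a w (N - (a + patLeaves w))) else 0

/-- The decomposition of `o`, evaluated on trees, in terms of patterns. -/
theorem linearCombination_coproduct_o (φ : Forest Gen → V) (N : ℕ) :
    Finsupp.linearCombination k φ (coproduct lam .o N) =
      (∑ p ∈ Finset.Icc 1 N, ∑ r : Fin p → Fin (N + 1),
        if patLeaves (List.ofFn fun t => (r t : ℕ)) = N then
          rootETerm φ (List.ofFn fun t => (r t : ℕ)) else 0) +
      ∑ p ∈ Finset.Icc 1 N, ∑ r : Fin p → Fin (N + 1), ∑ a ∈ Finset.range N,
        rootOTerm lam φ N a (List.ofFn fun t => (r t : ℕ)) := by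
  rw [coproduct, map_add]
  congr 1
  · rw [map_sum]
    refine Finset.sum_congr rfl fun p _ => ?_
    rw [map_sum]
    refine Finset.sum_congr rfl fun r _ => ?_
    have h1 : (∀ t, (r t : ℕ) ≠ 0) ↔ patVertices (List.ofFn fun t => (r t : ℕ)) =
        (List.ofFn fun t => (r t : ℕ)).length := by
      rw [patVertices_eq_length_iff]
      simp
    have h2 : (∑ t, (r t : ℕ)) = (List.ofFn fun t => (r t : ℕ)).sum := by rw [List.sum_ofFn]
    have h3 := sum_add_length_eq (List.ofFn fun t => (r t : ℕ))
    simp only [h1, h2]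
    by_cases h4 : patVertices (List.ofFn fun t => (r t : ℕ)) =
        (List.ofFn fun t => (r t : ℕ)).length
    · have h5 : (List.ofFn fun t => (r t : ℕ)).sum = patLeaves (List.ofFn fun t => (r t : ℕ)) := by
        lia
      rw [h5, rootETerm]
      simp only [h4, true_and, if_true]
      split_ifs
      · rw [Finsupp.linearCombination_single, negOnePow_cast_smul, List.length_ofFn]
        rfl
      · rw [map_zero]
    · simp only [rootETerm, h4, false_and, if_false, map_zero, ite_self]
  · simp only [map_sum]
    refine Finset.sum_congr rfl fun p hp => Finset.sum_congr rfl fun r _ =>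
      Finset.sum_congr rfl fun a _ => ?_
    have hp' := (Finset.mem_Icc.1 hp).1
    have hL := length_le_patLeaves (List.ofFn fun t => (r t : ℕ))
    rw [inputLeaves_eq, inputVertices_eq, inputSign_eq]
    set w := List.ofFn fun t => (r t : ℕ) with hw
    have hlen : w.length = p := by rw [hw, List.length_ofFn]
    rw [← hlen] at hp' ⊢
    rw [rootOTerm]
    split_ifs with h
    · rw [Finset.sum_eq_single (N - (a + patLeaves w)), if_pos ⟨h.1, by lia⟩,
        Finsupp.linearCombination_single, mul_comm, mul_smul, negOnePow_cast_smul]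
      · congr 3
        rw [rootOSign]
        push_cast
        ring
      · intro b _ hb
        rw [if_neg (by lia), map_zero]
      · intro hb
        rw [Finset.mem_range] at hb
        lia
    · refine Finset.sum_eq_zero fun b _ => ?_
      rw [if_neg (by lia), map_zero]

variable {m : ℕ} {d : Fin (m + 2) → ℤ} {x : Fin (m + 2) → Gen → List V → V}

/-- The trees with root `e` give the brace of the algebra part of `x 0` with the operators of the
other cochains. -/
theorem sum_root_e (hx : ∀ i, x i ∈ cochains 𝒱 (d i)) (v : List V) :
    ((∑ i, d i) + m).negOnePow • (∑ p ∈ Finset.Icc 1 v.length,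
      ∑ r : Fin p → Fin (v.length + 1),
        if patLeaves (List.ofFn fun t => (r t : ℕ)) = v.length then
          rootETerm (treeValue 𝒱 (m + 2) d x (desuspend 𝒱 v)) (List.ofFn fun t => (r t : ℕ))
        else 0) =
      ((m + 1) * d 0 + listSign (List.ofFn fun i : Fin (m + 1) => d i.succ)).negOnePow •
        multiBrace (koszul 𝒱 1)
          (operators 𝒱 (List.ofFn fun i : Fin (m + 1) => (d i.succ, x i.succ)))
          (arityPart (m + 1) fun v => x 0 .e (desuspend 𝒱 v)) v := by
  have hops : (operators 𝒱 (List.ofFn fun i : Fin (m + 1) => (d i.succ, x i.succ))).length =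
      m + 1 := by simp [operators]
  rcases Nat.eq_zero_or_pos v.length with h0 | h0
  · rw [multiBrace_eq_sum (signRule_suspension 𝒱), h0, sum_patterns_zero, hops]
    simp
  · rw [sum_fin_eq_sum_patterns _ h0 le_rfl, multiBrace_eq_sum (signRule_suspension 𝒱), hops,
      Finset.smul_sum, Finset.smul_sum]
    refine Finset.sum_congr rfl fun w hw => ?_
    have hw' := (mem_patterns.1 hw).symm
    rw [rootETerm]
    by_cases h1 : patVertices w = w.length
    · by_cases h2 : w.length = m + 1
      · rw [if_pos h1, if_pos (h1.trans h2), arityPart, applyPattern_length, if_pos h2]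
        exact treeValue_root_e 𝒱 hx h1 h2 hw'
      · rw [if_pos h1, if_neg (by lia), treeValue, if_neg, smul_zero, smul_zero, smul_zero]
        simp [rootETree, Forest.weight]
        lia
    · rw [if_neg h1, smul_zero]
      split_ifs with h2
      · rw [arityPart, applyPattern_length, if_neg (by lia), smul_zero]
      · rw [smul_zero]

/-- The trees with root `o` give the insertion into the operator of `x 0` of the brace of the
algebra part of `x 1` with the remaining operators. -/
theorem sum_root_o (hx : ∀ i, x i ∈ cochains 𝒱 (d i)) (v : List V) :
    ((∑ i, d i) + m).negOnePow • (∑ p ∈ Finset.Icc 1 v.length, ∑ r : Fin p → Fin (v.length + 1),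
      ∑ a ∈ Finset.range v.length,
        rootOTerm lam (treeValue 𝒱 (m + 2) d x (desuspend 𝒱 v)) v.length a
          (List.ofFn fun t => (r t : ℕ))) =
      (m * (d 0 + d 1) + listSign (List.ofFn fun i : Fin m => d i.succ.succ)).negOnePow •
        insertOp (koszul 𝒱 1) (d 1 + totalDeg (operators 𝒱
            (List.ofFn fun i : Fin m => (d i.succ.succ, x i.succ.succ))))
          (multiBrace (koszul 𝒱 1) (operators 𝒱
            (List.ofFn fun i : Fin m => (d i.succ.succ, x i.succ.succ)))
            (weighted lam (m + 1) fun v => x 1 .e (desuspend 𝒱 v)))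
          (identification 𝒱 (d 0) (x 0)).2 v := by
  set ops := operators 𝒱 (List.ofFn fun i : Fin m => (d i.succ.succ, x i.succ.succ)) with hops'
  have hops : ops.length = m := by simp [hops', operators]
  have hg : IsMultilinear k (identification 𝒱 (d 0) (x 0)).2 :=
    (((homProd_multilinear ((mem_cochains_iff 𝒱).1 (hx 0)).2).comp_desuspend 𝒱).sign_length
      fun _ => d 0)
  rw [insertOp_eq_sum]
  obtain ⟨F, hF⟩ : ∃ F : ℕ → List ℕ → V, ∀ a w, F a w = if patVertices w = m ∧ m + 1 ≤ w.length then
      lam ^ (w.length - (m + 1)) • (identification 𝒱 (d 0) (x 0)).2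
        ((v.take a).map (koszul 𝒱 1 (d 1 + totalDeg ops)) ++
          x 1 .e (desuspend 𝒱 (applyPattern (koszul 𝒱 1) w ops
            ((v.drop a).take (patLeaves w)))) :: v.drop (a + patLeaves w)) else 0 :=
    ⟨_, fun _ _ => rfl⟩
  -- both sides are sums over the pattern and the number of leaves to the left of the inner vertex
  have hR : ∀ a ∈ Finset.range v.length, ∀ j ∈ Finset.range (v.length - a),
      (identification 𝒱 (d 0) (x 0)).2 ((v.take a).map (koszul 𝒱 1 (d 1 + totalDeg ops)) ++
        multiBrace (koszul 𝒱 1) ops (weighted lam (m + 1) fun v => x 1 .e (desuspend 𝒱 v))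
          ((v.drop a).take (j + 1)) :: v.drop (a + (j + 1))) =
      ∑ p ∈ Finset.Icc 1 v.length, ∑ r : Fin p → Fin (v.length + 1),
        if patLeaves (List.ofFn fun t => (r t : ℕ)) = j + 1 then
          F a (List.ofFn fun t => (r t : ℕ)) else 0 := by
    intro a ha j hj
    rw [Finset.mem_range] at ha hj
    obtain ⟨-, h2, -, -⟩ := length_eq_of_splits v (a := a) (t := j + 1) (by lia)
    rw [sum_fin_eq_sum_patterns _ (by lia) (by lia), multiBrace_eq_sum (signRule_suspension 𝒱), h2,
      hg.sum_slot]
    refine Finset.sum_congr rfl fun w hw => ?_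
    rw [mem_patterns] at hw
    rw [hops, hF, hw]
    by_cases h1 : patVertices w = m
    · rw [if_pos h1, weighted, applyPattern_length]
      by_cases h3 : m + 1 ≤ w.length
      · rw [if_pos h3, if_pos ⟨h1, h3⟩, hg.smul]
      · rw [if_neg h3, if_neg (by lia), hg.zero_slot]
    · rw [if_neg h1, if_neg (by lia), hg.zero_slot]
  rw [Finset.sum_congr rfl fun a ha => Finset.sum_congr rfl (hR a ha)]
  rw [sum_comm_dependent]
  simp only [Finset.smul_sum]
  refine Finset.sum_congr rfl fun p hp => Finset.sum_congr rfl fun r _ =>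
    Finset.sum_congr rfl fun a _ => ?_
  have hp' := (Finset.mem_Icc.1 hp).1
  have hL := length_le_patLeaves (List.ofFn fun t => (r t : ℕ))
  rw [List.length_ofFn] at hL
  have hlen : (List.ofFn fun t => (r t : ℕ)).length = p := List.length_ofFn
  generalize (List.ofFn fun t => (r t : ℕ)) = w at hL hlen ⊢
  rw [← Finset.smul_sum, hF, rootOTerm]
  by_cases h1 : patVertices w = m
  · rw [h1]
    by_cases h2 : m + 1 ≤ w.length ∧ a + patLeaves w ≤ v.length
    · rw [if_pos h2, if_pos ⟨rfl, h2.1⟩, Finset.sum_eq_single (patLeaves w - 1), if_pos (by lia)]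
      · obtain ⟨h3, h4, h5, h6⟩ := length_eq_of_splits v h2.2
        have key := treeValue_root_o 𝒱 hx h1 (l := v.take a) (r := v.drop (a + patLeaves w)) h4
        rw [← h6, h3, h4, h5] at key
        rw [smul_comm _ (lam ^ _), smul_comm _ (lam ^ _), ← key, rootOTree, rootOSign, h1]
      · intro j _ hj
        rw [if_neg (by lia)]
      · intro hj
        rw [Finset.mem_range] at hj
        lia
    · rw [if_neg h2, smul_zero, Finset.sum_eq_zero, smul_zero]
      intro j hj
      rw [Finset.mem_range] at hj
      split_ifs
      · lia
      · rfl
      · rfl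
  · simp only [h1, false_and, if_false, ite_self, Finset.sum_const_zero, smul_zero]
    split_ifs
    · rw [treeValue, if_neg, smul_zero, smul_zero, smul_zero]
      simp [rootOTree, Forest.weight]
      lia
    · rw [smul_zero]

/-- The part of the convolution operations with values in the operators, in terms of braces. -/
theorem identification_convolution_o (hx : ∀ i, x i ∈ cochains 𝒱 (d i)) (v : List V) :
    ((∑ i, d i) + m).negOnePow • convolution 𝒱 lam (m + 2) d x .o (desuspend 𝒱 v) =
      ((m + 1) * d 0 + listSign (List.ofFn fun i : Fin (m + 1) => d i.succ)).negOnePow •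
        multiBrace (koszul 𝒱 1)
          (operators 𝒱 (List.ofFn fun i : Fin (m + 1) => (d i.succ, x i.succ)))
          (arityPart (m + 1) fun v => x 0 .e (desuspend 𝒱 v)) v +
      (m * (d 0 + d 1) + listSign (List.ofFn fun i : Fin m => d i.succ.succ)).negOnePow •
        insertOp (koszul 𝒱 1) (d 1 + totalDeg (operators 𝒱
            (List.ofFn fun i : Fin m => (d i.succ.succ, x i.succ.succ))))
          (multiBrace (koszul 𝒱 1) (operators 𝒱
            (List.ofFn fun i : Fin m => (d i.succ.succ, x i.succ.succ)))
            (weighted lam (m + 1) fun v => x 1 .e (desuspend 𝒱 v)))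
          (identification 𝒱 (d 0) (x 0)).2 v := by
  rw [convolution_eq, linearCombination_coproduct_o, smul_add, length_desuspend,
    sum_root_e 𝒱 hx, sum_root_o 𝒱 lam hx]

theorem convolution_o_one (d : Fin 1 → ℤ) (x : Fin 1 → Gen → List V → V) (v : List V) :
    convolution 𝒱 lam 1 d x .o v = 0 := by
  rw [convolution_eq, linearCombination_coproduct_o, Finset.sum_eq_zero, Finset.sum_eq_zero, zero_add]
  · refine fun p _ => Finset.sum_eq_zero fun r _ => Finset.sum_eq_zero fun a _ => ?_
    rw [rootOTerm]
    split_ifs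
    · rw [treeValue, if_neg, smul_zero, smul_zero]
      simp [rootOTree, Forest.weight]
    · rfl
  · intro p hp
    refine Finset.sum_eq_zero fun r _ => ?_
    have hlen : (List.ofFn fun t => (r t : ℕ)).length = p := List.length_ofFn
    have hp' := (Finset.mem_Icc.1 hp).1
    rw [rootETerm]
    split_ifs with h1 h2
    · rw [treeValue, if_neg, smul_zero]
      rw [rootETree, Forest.weight, Forest.weight_corollas, h2]
      simp [Forest.weight]
      lia
    · rfl
    · rfl

end

/-! ### The explicit form of the brackets -/

section

variable {k : Type u} {V : Type v} [Field k] [AddCommGroup V] [Module k V]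
  (𝒱 : ℤ → Submodule k V) [DirectSum.Decomposition 𝒱] (lam : k)

theorem operators_ofFn {n : ℕ} (d : Fin n → ℤ) (x : Fin n → Gen → List V → V) :
    operators 𝒱 (List.ofFn fun i => (d i, x i)) =
      List.ofFn fun i => (d i + 1, (identification 𝒱 (d i) (x i)).2) := by
  rw [operators, List.map_ofFn]
  rfl

variable {m : ℕ} (d : Fin (m + 2) → ℤ) (x : Fin (m + 2) → Gen → List V → V)

/-- The part of the bracket in which the algebra part of the cochain `x 0` is at the root, and the
operators of the other cochains are at its inputs. -/
def bracketE : List V → V :=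
  multiBrace (koszul 𝒱 1) (operators 𝒱 (List.ofFn fun i : Fin (m + 1) => (d i.succ, x i.succ)))
    (arityPart (m + 1) fun v => x 0 .e (desuspend 𝒱 v))

/-- The part of the bracket in which the operator of the cochain `x 0` is at the root, and the
algebra part of the cochain `x 1` at its input. -/
def bracketO : List V → V :=
  insertOp (koszul 𝒱 1) (d 1 + totalDeg (operators 𝒱
      (List.ofFn fun i : Fin m => (d i.succ.succ, x i.succ.succ))))
    (multiBrace (koszul 𝒱 1) (operators 𝒱
      (List.ofFn fun i : Fin m => (d i.succ.succ, x i.succ.succ)))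
      (weighted lam (m + 1) fun v => x 1 .e (desuspend 𝒱 v)))
    (identification 𝒱 (d 0) (x 0)).2

/-- The transposition of the first two elements. -/
def swapFirst (m : ℕ) : Equiv.Perm (Fin (m + 2)) := insertPerm 0 1 1

@[simp] theorem swapFirst_zero : swapFirst m 0 = 1 := insertPerm_same _ _ _

@[simp] theorem swapFirst_one : swapFirst m 1 = 0 := by
  have h := insertPerm_succAbove (0 : Fin (m + 2)) 1 1 0
  rw [Equiv.Perm.one_apply, Fin.succAbove_zero, Fin.one_succAbove_zero] at h
  exact h

@[simp] theorem swapFirst_succ_succ (j : Fin m) : swapFirst m j.succ.succ = j.succ.succ := by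
  have h := insertPerm_succAbove (0 : Fin (m + 2)) 1 1 j.succ
  rw [Equiv.Perm.one_apply, Fin.succAbove_zero, Fin.one_succAbove_succ] at h
  exact h

theorem neg_negOnePow_smul {X : Type*} [AddCommGroup X] (a : ℤ) (x : X) :
    -(a.negOnePow • x) = (a + 1).negOnePow • x := by
  rw [Int.negOnePow_succ, Units.neg_smul]

theorem chi_one {n : ℕ} (d : Fin n → ℤ) : chi 1 d = 1 := by
  have h := chi_mul 1 1 d
  rw [mul_one] at h
  exact left_eq_mul.1 h

theorem chi_swapFirst : chi (swapFirst m) d = (d 0 * d 1 + 1).negOnePow := by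
  rw [swapFirst, chi_insertPerm_zero, chi_one, mul_one, Fin.sum_univ_succ, Finset.sum_eq_zero]
  · rw [mul_comm]; simp
  · intro j _
    simp

/-- The sum over the position of the algebra part and over the orders of the operators is a sum over
all permutations `σ`, the algebra part being that of `x (σ 0)`. In `bracketO` the algebra part has
the second place, whence the transposition. -/
theorem operatorBracket_eq (v : List V) :
    operatorBracket 𝒱 lam (m + 2) d (fun i => identification 𝒱 (d i) (x i)) v =
      ∑ σ : Equiv.Perm (Fin (m + 2)), chi σ d •
        ((m + 1) * d (σ 0) + listSign (List.ofFn fun i : Fin (m + 1) => d (σ i.succ))).negOnePow •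
          (bracketE 𝒱 (fun i => d (σ i)) (fun i => x (σ i)) v -
            ((d (σ 1) + 1) * d (σ 0)).negOnePow •
              bracketO 𝒱 lam (fun i => d (σ (swapFirst m i))) (fun i => x (σ (swapFirst m i))) v) := by
  have hb : ∀ (f : List V → V) Gs, brace 𝒱 f Gs = multiBrace (koszul 𝒱 1) Gs f := fun f Gs =>
    funext fun v => brace_eq_multiBrace 𝒱 f Gs v
  rw [sum_perm_eq_right 0, operatorBracket, Finset.sum_apply]
  refine Finset.sum_congr rfl fun q _ => ?_
  rw [mixedBracket, Finset.smul_sum, Finset.sum_apply]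
  refine Finset.sum_congr rfl fun τ _ => ?_
  have h0 : ∀ j : Fin (m + 1), insertPerm 0 q τ j.succ = q.succAbove (τ j) := fun j => by
    simpa using insertPerm_succAbove 0 q τ j
  have h1 : insertPerm 0 q τ 1 = q.succAbove (τ 0) := h0 0
  simp only [bracketE, bracketO, operators_ofFn, h0, h1, insertPerm_same, swapFirst_zero,
    swapFirst_one, swapFirst_succ_succ]
  have hB : (bracketSign fun i => d (q.succAbove (τ i))) =
      ∑ j : Fin (m + 1), ((m : ℤ) - (j : ℕ)) * d (q.succAbove (τ j)) := by
    rw [bracketSign]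
    refine Finset.sum_congr rfl fun j _ => ?_
    push_cast
    ring
  have hT : totalDeg (List.ofFn fun j : Fin m => (d (q.succAbove (τ j.succ)) + 1,
      (identification 𝒱 (d (q.succAbove (τ j.succ))) (x (q.succAbove (τ j.succ)))).2)) =
      ∑ j : Fin m, (d (q.succAbove (τ j.succ)) + 1) := by
    rw [totalDeg, List.map_ofFn, List.sum_ofFn]
    rfl
  rw [chi_insertPerm_zero, mul_smul, ← bracketSign_eq, hB, hT, hb, hb, hb,
    multiBrace_singleton (signRule_suspension 𝒱)]
  simp only [Pi.smul_apply, Pi.sub_apply, mul_smul]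
  rfl

/-- The brackets of cochains in the same form: the terms `bracketO` are reindexed along the
transposition of the first two arguments. -/
theorem identification_bracket_o (hx : ∀ i, x i ∈ cochains 𝒱 (d i)) (v : List V) :
    ((∑ i, d i) + m).negOnePow • bracket 𝒱 lam (m + 2) d x .o (desuspend 𝒱 v) =
      ∑ σ : Equiv.Perm (Fin (m + 2)), chi σ d •
        ((m + 1) * d (σ 0) + listSign (List.ofFn fun i : Fin (m + 1) => d (σ i.succ))).negOnePow •
          (bracketE 𝒱 (fun i => d (σ i)) (fun i => x (σ i)) v -
            ((d (σ 1) + 1) * d (σ 0)).negOnePow •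
              bracketO 𝒱 lam (fun i => d (σ (swapFirst m i))) (fun i => x (σ (swapFirst m i))) v) := by
  have hconv : ∀ σ : Equiv.Perm (Fin (m + 2)), ((∑ i, d i) + m).negOnePow • convolution 𝒱 lam (m + 2)
      (fun i => d (σ i)) (fun i => x (σ i)) .o (desuspend 𝒱 v) =
      ((m + 1) * d (σ 0) + listSign (List.ofFn fun i : Fin (m + 1) => d (σ i.succ))).negOnePow •
        bracketE 𝒱 (fun i => d (σ i)) (fun i => x (σ i)) v +
      (m * (d (σ 0) + d (σ 1)) +
          listSign (List.ofFn fun i : Fin m => d (σ i.succ.succ))).negOnePow •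
        bracketO 𝒱 lam (fun i => d (σ i)) (fun i => x (σ i)) v := fun σ => by
    rw [← Equiv.sum_comp σ d]
    exact identification_convolution_o 𝒱 lam (fun i => hx (σ i)) v
  rw [bracket, Finset.sum_apply, Finset.sum_apply, Finset.smul_sum]
  simp only [Pi.smul_apply, smul_comm _ (chi _ d), hconv, smul_add, smul_sub,
    Finset.sum_add_distrib, Finset.sum_sub_distrib]
  rw [sub_eq_add_neg, ← Finset.sum_neg_distrib]
  congr 1
  -- The operator parts at the root, with the first two arguments exchanged.
  rw [← Equiv.sum_comp (Equiv.mulRight (swapFirst m))]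
  refine Finset.sum_congr rfl fun σ _ => ?_
  simp only [Equiv.coe_mulRight, Equiv.Perm.mul_apply, chi_mul, chi_swapFirst, swapFirst_zero,
    swapFirst_one, swapFirst_succ_succ]
  rw [List.ofFn_succ (f := fun i : Fin (m + 1) => d (σ i.succ)), listSign, mul_smul, ← smul_neg,
    List.length_ofFn, negOnePow_smul_smul, negOnePow_smul_smul, neg_negOnePow_smul]
  congr 2
  apply negOnePow_congr
  have h1 : Fin.succ (0 : Fin (m + 1)) = 1 := rfl
  rw [h1, ← ZMod.intCast_eq_zero_iff_even]
  push_cast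
  grind

/-- The identification carries the brackets to the explicit brackets. -/
theorem identification_bracket {n : ℕ} (hn : 1 ≤ n) (d : Fin n → ℤ) (x : Fin n → Gen → List V → V)
    (hx : ∀ i, x i ∈ cochains 𝒱 (d i)) :
    identification 𝒱 ((∑ i, d i) + (n : ℤ) - 2) (bracket 𝒱 lam n d x) =
      explicitBracket 𝒱 lam n d fun i => identification 𝒱 (d i) (x i) := by
  have hb : ∀ (f : List V → V) Gs, brace 𝒱 f Gs = multiBrace (koszul 𝒱 1) Gs f := fun f Gs =>
    funext fun v => brace_eq_multiBrace 𝒱 f Gs v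
  have hz : n ≠ 2 → ∀ v, bracket 𝒱 lam n d x .e v = 0 := fun h v => by
    rw [bracket, Finset.sum_apply, Finset.sum_apply]
    refine Finset.sum_eq_zero fun σ _ => ?_
    simp only [Pi.smul_apply, convolution_e_eq_zero 𝒱 lam h, smul_zero]
  obtain _ | _ | m := n
  · lia
  · refine Prod.ext (funext fun v => hz (by lia) _) (funext fun v => ?_)
    have hc : ∀ σ : Equiv.Perm (Fin (0 + 1)), convolution 𝒱 lam (0 + 1) (fun i => d (σ i))
        (fun i => x (σ i)) .o (desuspend 𝒱 v) = 0 := fun σ => convolution_o_one 𝒱 lam _ _ _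
    simp only [identification, bracket, Finset.sum_apply, Pi.smul_apply, hc,
      smul_zero, Finset.sum_const_zero, explicitBracket, operatorBracket, mixedBracket]
    rfl
  · refine Prod.ext (funext fun v => ?_) (funext fun v => ?_)
    · obtain _ | m := m
      · change bracket 𝒱 lam 2 d x .e (desuspend 𝒱 v) = gerstenhaber 𝒱 (d 0) (d 1) _ _ v
        have hc : ∀ σ : Equiv.Perm (Fin 2), _ := fun σ => convolution_e 𝒱 lam (fun i => hx (σ i)) v
        rw [bracket, Finset.sum_apply, Finset.sum_apply]
        simp only [Pi.smul_apply, hc]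
        rw [sum_perm_eq_right 0, Fin.sum_univ_two, Fintype.sum_unique, Fintype.sum_unique]
        simp only [chi_insertPerm_zero, insertPerm_same]
        have h0 : insertPerm (0 : Fin 2) 0 default 1 = 1 := by decide
        have h1 : insertPerm (0 : Fin 2) 1 default 1 = 0 := by decide
        have hd : ∀ e : Fin 1 → ℤ, chi default e = 1 := chi_one
        have hs0 : (∑ j : Fin 2, if j < 0 then d j else 0) = 0 := by simp
        have hs1 : (∑ j : Fin 2, if j < 1 then d j else 0) = d 0 := by
          simp
        rw [h0, h1, hd, hd, hs0, hs1, gerstenhaber, hb, hb,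
          multiBrace_singleton (signRule_suspension 𝒱), multiBrace_singleton (signRule_suspension 𝒱),
          Pi.sub_apply, sub_eq_add_neg, Pi.smul_apply, neg_negOnePow_smul, mul_comm (d 1)]
        simp
        rfl
      · exact hz (by lia) _
    · change _ = operatorBracket 𝒱 lam (m + 2) d (fun i => identification 𝒱 (d i) (x i)) v
      rw [operatorBracket_eq, ← identification_bracket_o 𝒱 lam d x hx]
      change ((∑ i, d i) + ((m + 2 : ℕ) : ℤ) - 2).negOnePow • _ = _
      congr 2
      push_cast
      ring

end

/-! ### The homotopy Lie algebra -/

section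

variable {k : Type u} {V : Type v} [Field k] [AddCommGroup V] [Module k V]
  (𝒱 : ℤ → Submodule k V) [DirectSum.Decomposition 𝒱] (lam : k)

theorem bracket_mem {n : ℕ} (hn : 1 ≤ n) (d : Fin n → ℤ) (x : Fin n → Gen → List V → V)
    (hx : ∀ i, x i ∈ cochains 𝒱 (d i)) :
    bracket 𝒱 lam n d x ∈ cochains 𝒱 ((∑ i, d i) + (n : ℤ) - 2) := by
  rw [← identification_mem_iff, identification_bracket 𝒱 lam hn d x hx]
  exact explicitBracket_mem 𝒱 lam fun i => (identification_mem_iff 𝒱).2 (hx i)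

theorem identification_injective (d : ℤ) : Function.Injective (identification 𝒱 d) :=
  Function.LeftInverse.injective (identificationInv_identification 𝒱 d)

theorem bracket_update {n : ℕ} (hn : 1 ≤ n) (d : Fin n → ℤ) (x : Fin n → Gen → List V → V)
    (hx : ∀ i, x i ∈ cochains 𝒱 (d i)) (i : Fin n) (c : k) {z z' : Gen → List V → V}
    (hz : z ∈ cochains 𝒱 (d i)) (hz' : z' ∈ cochains 𝒱 (d i)) :
    bracket 𝒱 lam n d (Function.update x i (c • z + z')) =
      c • bracket 𝒱 lam n d (Function.update x i z) +
        bracket 𝒱 lam n d (Function.update x i z') := by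
  have hup : ∀ u ∈ cochains 𝒱 (d i), ∀ j, Function.update x i u j ∈ cochains 𝒱 (d j) := by
    intro u hu j
    by_cases hj : j = i
    · subst hj
      simpa using hu
    · simpa [hj] using hx j
  have hid : ∀ u : Gen → List V → V, (fun j => identification 𝒱 (d j) (Function.update x i u j)) =
      Function.update (fun j => identification 𝒱 (d j) (x j)) i (identification 𝒱 (d i) u) := by
    intro u
    funext j
    by_cases hj : j = i
    · subst hj
      simp
    · simp [hj]
  apply identification_injective 𝒱 ((∑ i, d i) + (n : ℤ) - 2)
  rw [identification_smul_add, identification_bracket 𝒱 lam hn d _ (hup _ hz),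
    identification_bracket 𝒱 lam hn d _ (hup _ hz'), identification_bracket 𝒱 lam hn d _
      (hup _ (add_mem (Submodule.smul_mem _ c hz) hz')), hid, hid, hid, identification_smul_add]
  exact explicitBracket_update 𝒱 lam (fun j => (identification_mem_iff 𝒱).2 (hx j)) i c
    ((identification_mem_iff 𝒱).2 hz) ((identification_mem_iff 𝒱).2 hz')

theorem bracket_perm {n : ℕ} (d : Fin n → ℤ) (x : Fin n → Gen → List V → V)
    (σ : Equiv.Perm (Fin n)) : bracket 𝒱 lam n (fun t => d (σ t)) (fun t => x (σ t)) =
      chi σ d • bracket 𝒱 lam n d x := by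
  conv_rhs => rw [bracket, Finset.smul_sum, ← Equiv.sum_comp (Equiv.mulLeft σ)]
  rw [bracket]
  refine Finset.sum_congr rfl fun τ _ => ?_
  rw [Equiv.coe_mulLeft, chi_mul, smul_smul, ← mul_assoc, Int.units_mul_self, one_mul]
  rfl

theorem jacobiator_bracket [CharZero k] {n : ℕ} (d : Fin n → ℤ)
    (x : Fin n → Gen → List V → V) (hx : ∀ i, x i ∈ cochains 𝒱 (d i)) :
    jacobiator (bracket 𝒱 lam) n d x = 0 := by
  apply identification_injective 𝒱 ((∑ i, d i) + (n : ℤ) - 3)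
  change identificationHom 𝒱 _ _ = identificationHom 𝒱 _ _
  rw [map_zero, ← jacobiator_explicitBracket 𝒱 lam (y := fun i => identification 𝒱 (d i) (x i))
    fun i => (identification_mem_iff 𝒱).2 (hx i)]
  simp only [jacobiator, map_sum]
  refine Finset.sum_congr rfl fun i _ => Finset.sum_congr rfl fun σ _ => ?_
  split_ifs with h
  · rw [Units.smul_def, map_zsmul, ← Units.smul_def]
    congr 1
    have hi : (i : ℕ) + 1 ≤ n := i.2
    -- The degree of the inner bracket.
    set e : ℤ := (∑ t : Fin ((i : ℕ) + 1), d (σ ⟨t, by lia⟩)) + (((i : ℕ) + 1 : ℕ) : ℤ) - 2 with he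
    have hsum : (∑ t : Fin ((i : ℕ) + 1), d (σ ⟨t, by lia⟩)) +
        (∑ t : Fin (n - ((i : ℕ) + 1)), d (σ ⟨(i : ℕ) + 1 + t, by lia⟩)) = ∑ t, d t := by
      rw [← Equiv.sum_comp σ d, ← List.sum_ofFn (f := fun t => d (σ t)),
        ← List.take_append_drop ((i : ℕ) + 1) (List.ofFn fun j => d (σ j)), List.sum_append,
        take_ofFn _ hi, drop_ofFn _ hi, List.sum_ofFn, List.sum_ofFn]
    have hmem := bracket_mem 𝒱 lam (by lia) (fun t : Fin ((i : ℕ) + 1) => d (σ ⟨t, by lia⟩))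
      (fun t => x (σ ⟨t, by lia⟩)) fun t => hx _
    have hid := identification_bracket 𝒱 lam (by lia)
      (fun t : Fin ((i : ℕ) + 1) => d (σ ⟨t, by lia⟩)) (fun t => x (σ ⟨t, by lia⟩)) fun t => hx _
    rw [← he] at hmem hid
    rw [← hid]
    have key := identification_bracket 𝒱 lam (n := n - ((i : ℕ) + 1) + 1) (by lia)
      (Fin.cons e fun t : Fin (n - ((i : ℕ) + 1)) => d (σ ⟨(i : ℕ) + 1 + t, by lia⟩))
      (Fin.cons (bracket 𝒱 lam ((i : ℕ) + 1) (fun t => d (σ ⟨t, by lia⟩))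
        fun t => x (σ ⟨t, by lia⟩)) fun t => x (σ ⟨(i : ℕ) + 1 + t, by lia⟩))
      (Fin.cases hmem fun t => hx _)
    refine Eq.trans ?_ (key.trans ?_)
    · change identification 𝒱 _ _ = _
      congr 1
      rw [Fin.sum_univ_succ]
      simp only [Fin.cons_zero, Fin.cons_succ]
      push_cast [Nat.cast_sub hi] at he ⊢
      lia
    · congr 1
      funext t
      refine Fin.cases rfl (fun t => rfl) t
  · exact map_zero _

theorem coe_update {n : ℕ} {L : Type*} [AddCommGroup L] [Module k L] {S : Fin n → Submodule k L}
    [inst : DecidableEq (Fin n)] (x : (t : Fin n) → S t) (i : Fin n) (a : S i) :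
    (fun t => ((Function.update x i a t : S t) : L)) = Function.update (fun t => (x t : L)) i a := by
  funext t
  by_cases h : t = i
  · subst h
    simp
  · simp [h]

theorem isLInfinity [CharZero k] : IsLInfinity (cochains 𝒱) (bracket 𝒱 lam) where
  multilinear n d hn := by
    refine ⟨{ toFun := fun x => bracket 𝒱 lam n d fun t => (x t : Gen → List V → V)
              map_update_add' := ?_
              map_update_smul' := ?_ }, fun x => rfl⟩
    · intro inst x i a b
      obtain rfl : inst = instDecidableEqFin n := Subsingleton.elim _ _
      have h := bracket_update 𝒱 lam hn d (fun t => x t) (fun t => (x t).2) i 1 a.2 b.2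
      rw [one_smul, one_smul] at h
      simpa only [coe_update, Submodule.coe_add] using h
    · intro inst x i c a
      obtain rfl : inst = instDecidableEqFin n := Subsingleton.elim _ _
      have h := bracket_update 𝒱 lam hn d (fun t => x t) (fun t => (x t).2) i c a.2
        (zero_mem (cochains 𝒱 (d i)))
      -- The bracket vanishes if one of its arguments does.
      have h0 := bracket_update 𝒱 lam hn d (fun t => x t) (fun t => (x t).2) i 1
        (zero_mem (cochains 𝒱 (d i))) (zero_mem (cochains 𝒱 (d i)))
      rw [one_smul, one_smul, add_zero, left_eq_add] at h0
      rw [h0, add_zero, add_zero] at h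
      simpa only [coe_update, Submodule.coe_smul] using h
  degree n d x hn hx := bracket_mem 𝒱 lam hn d x hx
  antisymm n d x σ _ _ := bracket_perm 𝒱 lam d x σ
  jacobi n d x _ hx := jacobiator_bracket 𝒱 lam d x hx

end

/-! ### The Maurer–Cartan series -/

section

variable {k : Type u} {V : Type v} [Field k] [AddCommGroup V] [Module k V]
  (𝒱 : ℤ → Submodule k V) [DirectSum.Decomposition 𝒱] (lam : k) (α : Gen → List V → V)

/-- The contribution of a tree to the Maurer–Cartan series. -/
def mcValue (v : List V) (T : Forest Gen) : V :=
  (1 + T.weight + crossSign (List.replicate T.weight (-1)) T.vertexDegrees : ℤ).negOnePow •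
    (Forest.comp 𝒱 (T.decorate (List.replicate T.weight (-1, α))) v).headD 0

theorem chi_const {n : ℕ} (σ : Equiv.Perm (Fin n)) : chi σ (fun _ => -1) = 1 := by
  rw [chi_eq_invSign]
  have h : (-1 * -1 + 1 : ℤ).negOnePow = 1 := Int.negOnePow_even _ ⟨1, rfl⟩
  simp only [h, invSign, pairProd, ite_self, Finset.prod_const_one]

/-- The `n !` summands of the bracket of `n` equal arguments of degree `-1` are equal, so that the
denominator cancels. -/
theorem mcTerm_eq [CharZero k] (n : ℕ) (b : Gen) (v : List V) : mcTerm 𝒱 lam α n b v =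
    Finsupp.linearCombination k (fun T => if T.weight = n then mcValue 𝒱 α v T else 0)
      (coproduct lam b v.length) := by
  have h0 : bracket 𝒱 lam n (fun _ => -1) (fun _ => α) =
      (n.factorial : k) • convolution 𝒱 lam n (fun _ => -1) (fun _ => α) := by
    rw [bracket]
    simp only [chi_const, one_smul, Finset.sum_const, Finset.card_univ, Fintype.card_perm,
      Fintype.card_fin, Nat.cast_smul_eq_nsmul]
  rw [mcTerm, h0, inv_smul_smul₀ (Nat.cast_ne_zero.2 n.factorial_ne_zero), Pi.smul_apply,
    Pi.smul_apply, convolution_eq, Finsupp.linearCombination_apply, Finsupp.linearCombination_apply,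
    Finsupp.smul_sum]
  refine Finsupp.sum_congr fun T _ => ?_
  rw [smul_comm]
  congr 1
  rw [treeValue]
  split_ifs with h
  · subst h
    rw [mcValue, negOnePow_smul_smul, List.ofFn_const, List.ofFn_const]
    congr 1
    apply negOnePow_congr
    rw [Finset.sum_const, Finset.card_univ, Fintype.card_fin]
    generalize T.weight * (T.weight - 1) / 2 = A
    -- The three signs in front of the composition combine to the sign of `1 + n`.
    obtain ⟨t, ht⟩ := Int.even_mul_succ_self T.weight
    exact ⟨A - t, by rw [nsmul_eq_mul]; linear_combination -ht⟩
  · rw [smul_zero]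

theorem weight_pos_of_mem_support {b : Gen} {N : ℕ} {T : Forest Gen}
    (hT : T ∈ (coproduct lam b N).support) : 1 ≤ T.weight := by
  have h : coproduct lam b N ∈ Finsupp.supported k k {T : Forest Gen | 1 ≤ T.weight} := by
    have hs : ∀ (b : Gen) c r (x : k), Finsupp.single (Forest.vertex b c r) x ∈
        Finsupp.supported k k {T : Forest Gen | 1 ≤ T.weight} := fun b c r x =>
      Finsupp.single_mem_supported k x (by simp [Forest.weight]; lia)
    cases b with
    | e => exact sum_mem fun j _ => sum_mem fun i _ => hs _ _ _ _
    | o =>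
      refine add_mem (sum_mem fun p _ => sum_mem fun r _ => ?_)
        (sum_mem fun p _ => sum_mem fun r _ => sum_mem fun a _ => sum_mem fun b _ => ?_)
      · split_ifs
        · exact hs _ _ _ _
        · exact zero_mem _
      · dsimp only
        split_ifs
        · exact hs _ _ _ _
        · exact zero_mem _
  exact h hT

theorem finite_mcTerm [CharZero k] (b : Gen) (N : ℕ) :
    {n : ℕ | ∃ v : List V, v.length = N ∧ mcTerm 𝒱 lam α (n + 1) b v ≠ 0}.Finite := by
  refine ((coproduct lam b N).support.image fun T => T.weight - 1).finite_toSet.subset ?_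
  rintro n ⟨v, rfl, hv⟩
  rw [mcTerm_eq, Finsupp.linearCombination_apply] at hv
  obtain ⟨T, hT, h⟩ := Finset.exists_ne_zero_of_sum_ne_zero hv
  have hw : T.weight = n + 1 := by
    by_contra hc
    exact h (by simp only [if_neg hc, smul_zero])
  simp only [Finset.coe_image, Set.mem_image]
  exact ⟨T, hT, by lia⟩

/-- The Maurer–Cartan series is the sum over all trees of the decomposition. -/
theorem finsum_mcTerm [CharZero k] (b : Gen) (v : List V) :
    ∑ᶠ n : ℕ, mcTerm 𝒱 lam α (n + 1) b v =
      Finsupp.linearCombination k (mcValue 𝒱 α v) (coproduct lam b v.length) := by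
  have hf : (Function.support fun n : ℕ => mcTerm 𝒱 lam α (n + 1) b v).Finite :=
    (finite_mcTerm 𝒱 lam α b v.length).subset fun n hn => ⟨v, rfl, hn⟩
  set S := (coproduct lam b v.length).support.image fun T => T.weight - 1 with hS
  rw [finsum_eq_sum_of_support_subset (s := S)]
  · simp only [mcTerm_eq, Finsupp.linearCombination_apply, Finsupp.sum]
    rw [Finset.sum_comm]
    refine Finset.sum_congr rfl fun T hT => ?_
    have hw := weight_pos_of_mem_support lam hT
    rw [← Finset.smul_sum, Finset.sum_eq_single (T.weight - 1), if_pos (by lia)]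
    · intro n _ hn
      rw [if_neg (by lia)]
    · intro h
      exact absurd (Finset.mem_image_of_mem _ hT) h
  · intro n hn
    rw [Function.mem_support, mcTerm_eq, Finsupp.linearCombination_apply] at hn
    obtain ⟨T, hT, h⟩ := Finset.exists_ne_zero_of_sum_ne_zero hn
    have hw : T.weight = n + 1 := by
      by_contra hc
      exact h (by simp only [if_neg hc, smul_zero])
    simp only [hS, Finset.coe_image, Set.mem_image]
    exact ⟨T, hT, by lia⟩

/-- The Maurer–Cartan equation as a sum over trees; the finiteness of the series is automatic. -/
theorem isMaurerCartan_iff [CharZero k] : IsMaurerCartan 𝒱 lam α ↔ α ∈ cochains 𝒱 (-1) ∧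
    ∀ (b : Gen) (v : List V), Finsupp.linearCombination k (mcValue 𝒱 α v)
      (coproduct lam b v.length) = 0 := by
  simp only [IsMaurerCartan, finsum_mcTerm]
  exact ⟨fun h => ⟨h.1, h.2.2⟩, fun h => ⟨h.1, finite_mcTerm 𝒱 lam α, h.2⟩⟩

end

/-! ### The Maurer–Cartan equation and homotopy Rota–Baxter algebras -/

section

variable {k : Type u} {V : Type v} [Field k] [AddCommGroup V] [Module k V]
  (𝒱 : ℤ → Submodule k V) [DirectSum.Decomposition 𝒱]

theorem tensorEval_replicate_id_append (a : ℕ) (fs : List (Piece V)) {v : List V}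
    (h : a ≤ v.length) : tensorEval 𝒱 (List.replicate a Piece.id ++ fs) v =
      (v.take a).map (koszul 𝒱 0 (fs.map Piece.degree).sum) ++ tensorEval 𝒱 fs (v.drop a) := by
  induction a generalizing v with
  | zero => simp
  | succ a ih =>
    obtain _ | ⟨x, v⟩ := v
    · simp at h
    rw [List.replicate_succ, List.cons_append, tensorEval]
    have h1 : (Piece.id : Piece V).arity = 1 := rfl
    have h2 : ((List.replicate a (Piece.id : Piece V)).map Piece.degree).sum = 0 := by
      simp [Piece.id]
    rw [h1, List.drop_succ_cons, List.drop_zero, ih (by simpa using h), List.map_append,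
      List.sum_append, h2, zero_add]
    rfl

theorem tensorEval_replicate_id (v : List V) :
    tensorEval 𝒱 (List.replicate v.length Piece.id) v = v := by
  have h := tensorEval_replicate_id_append 𝒱 v.length [] (le_refl v.length)
  simpa [tensorEval, (signRule_koszul 𝒱).map_zero_list] using h

/-- A tensor product of maps in which all but one are identities. -/
theorem tensorEval_insert (f : Piece V) (l r : List V) {mid : List V} (hf : f.arity = mid.length) :
    tensorEval 𝒱 (List.replicate l.length Piece.id ++ [f] ++ List.replicate r.length Piece.id)
      (l ++ (mid ++ r)) = l.map (koszul 𝒱 0 f.degree) ++ f.map mid :: r := by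
  have h2 : ((List.replicate r.length (Piece.id : Piece V)).map Piece.degree).sum = 0 := by
    simp [Piece.id]
  rw [List.append_assoc, tensorEval_replicate_id_append 𝒱 _ _ (by simp), List.take_left' rfl,
    List.drop_left' rfl, List.singleton_append, tensorEval, hf, List.take_left' rfl,
    List.drop_left' rfl, tensorEval_replicate_id, List.map_cons, List.sum_cons, h2, add_zero,
    (signRule_koszul 𝒱).map_zero_list]

/-- The tensor factors described by a pattern: `0` stands for the identity and `r > 0` for the
component of arity `r` of `T`. -/
def patPieces (T : List V → V) (w : List ℕ) : List (Piece V) :=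
  w.map fun r : ℕ => if r = 0 then Piece.id else ⟨(r : ℤ) - 1, r, T⟩

theorem sum_degree_patPieces (T : List V → V) (w : List ℕ) :
    ((patPieces T w).map Piece.degree).sum = w.sum - patVertices w := by
  induction w with
  | nil => rfl
  | cons r w ih =>
    rw [patPieces, List.map_cons, List.map_cons, List.sum_cons, List.sum_cons]
    change _ + ((patPieces T w).map Piece.degree).sum = _
    rw [ih]
    cases r
    · simp [Piece.id]
    · simp; ring

theorem totalDeg_replicate {Y : Type*} (n : ℕ) (y : Y) :
    totalDeg (List.replicate n ((-1 : ℤ), y)) = -n := by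
  simp [totalDeg]

theorem IsMultilinear.neg_head {M X : Type*} [AddCommGroup M] [Module k M] [AddCommGroup X]
    [Module k X] {f : List M → X} (hf : IsMultilinear k f) (a : M) (r : List M) :
    f (-a :: r) = -f (a :: r) := map_neg (hf.headMap r) a

/-- Each corolla of a pattern contributes a sign, because the operators are `T = -α o`. -/
theorem comp_corollas_patPieces {X : Type*} [AddCommGroup X] [Module k X] {F : List V → X}
    (hF : IsMultilinear k F) (α : Gen → List V → V) {w : List ℕ} {z : List V}
    (hz : z.length = patLeaves w) :
    F (Forest.comp 𝒱 ((Forest.corollas Gen.o w).decorate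
      (List.replicate (patVertices w) (-1, α))) z) =
        (patVertices w : ℤ).negOnePow • F (tensorEval 𝒱 (patPieces (-α .o) w) z) := by
  induction w generalizing F z with
  | nil => simp [Forest.corollas, Forest.decorate, Forest.comp, patPieces, tensorEval]
  | cons r w ih =>
    have hd := sum_degree_patPieces (-α .o) w
    have htd := Forest.totalDegree_decorate_corollas w (List.replicate (patVertices w) (-1, α))
      (by simp)
    rw [totalDeg_replicate] at htd
    have hdeg : ((patPieces (-α .o) w).map Piece.degree).sum = -(patVertices w : ℤ) + w.sum := by
      rw [hd]; ring
    cases r with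
    | zero =>
      obtain _ | ⟨a, z⟩ := z
      · simp at hz
      rw [patVertices_zero, Forest.decorate_corollas_zero, Forest.comp, htd, List.headD_cons,
        List.tail_cons, ih (hF.cons _) (by simpa using hz), ← hdeg]
      rfl
    | succ r =>
      have hz0 : z.length = patLeaves w + (r + 1) := by simpa using hz
      have hz' : (z.drop (r + 1)).length = patLeaves w := by simp; lia
      have hz1 : (z.take (r + 1)).length = r + 1 := by simp; lia
      have h4 := Forest.comp_addLeaves_nil 𝒱 ((z.take (r + 1)).map
        (koszul 𝒱 0 (-(patVertices w : ℤ) + w.sum)))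
      rw [List.length_map, hz1] at h4
      have h5 : tensorEval 𝒱 (patPieces (-α .o) ((r + 1) :: w)) z =
          (-α .o) ((z.take (r + 1)).map (koszul 𝒱 0 (-(patVertices w : ℤ) + w.sum))) ::
            tensorEval 𝒱 (patPieces (-α .o) w) (z.drop (r + 1)) := by
        rw [← hdeg]; rfl
      rw [h5, Pi.neg_apply, hF.neg_head, smul_neg, neg_negOnePow_smul, patVertices_succ,
        List.replicate_succ, Forest.decorate_corollas_succ, Forest.comp,
        Forest.leaves_addLeaves, Forest.leaves, add_zero, htd, h4, ih (hF.cons _) hz']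
      have h6 : ((patVertices w + 1 : ℕ) + 1 : ℤ).negOnePow = (patVertices w : ℤ).negOnePow :=
        negOnePow_congr ⟨1, by push_cast; ring⟩
      rw [h6]

theorem crossSign_replicate (rs : List ℤ) :
    crossSign (List.replicate rs.length (-1)) rs = -listSign rs := by
  induction rs with
  | nil => rfl
  | cons r rs ih =>
    rw [List.length_cons, List.replicate_succ, crossSign, ih, listSign]
    simp
    ring

theorem length_patDegrees (w : List ℕ) : (patDegrees w).length = patVertices w := by
  simp [patDegrees, patVertices]

theorem patDegrees_eq {w : List ℕ} (hw : patVertices w = w.length) :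
    patDegrees w = w.map fun r : ℕ => (r : ℤ) := by
  rw [patDegrees, List.filter_eq_self.2]
  simpa using patVertices_eq_length_iff.1 hw

end

section

variable {k : Type u} {V : Type v} [Field k] [AddCommGroup V] [Module k V]
  (𝒱 : ℤ → Submodule k V) [DirectSum.Decomposition 𝒱] (lam : k) {α : Gen → List V → V}

theorem IsMultilinear.neg_slot {M X : Type*} [AddCommGroup M] [Module k M] [AddCommGroup X]
    [Module k X] {f : List M → X} (hf : IsMultilinear k f) (l r : List M) (a : M) :
    f (l ++ -a :: r) = -f (l ++ a :: r) := (hf.append l).neg_head a r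

/-- The contribution of a tree with two vertices `e` is a term of the Stasheff identity. -/
theorem mcValue_ee (h : IsMultilinear k (α .e)) (l mid r : List V) :
    (((mid.length : ℤ) - 1) * (mid.length + r.length)).negOnePow •
      mcValue 𝒱 α (l ++ (mid ++ r)) (Forest.vertex Gen.e (Forest.addLeaves l.length
        (Forest.corolla Gen.e mid.length (Forest.addLeaves r.length Forest.nil))) Forest.nil) =
      -((l.length + mid.length * r.length : ℤ).negOnePow •
        (-α .e) (tensorEval 𝒱 (List.replicate l.length Piece.id ++
          [⟨(mid.length : ℤ) - 2, mid.length, -α .e⟩] ++ List.replicate r.length Piece.id)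
          (l ++ (mid ++ r)))) := by
  have hw : (Forest.vertex Gen.e (Forest.addLeaves l.length (Forest.corolla Gen.e mid.length
      (Forest.addLeaves r.length Forest.nil))) Forest.nil).weight = 2 := by
    simp [Forest.weight, Forest.corolla]
  rw [tensorEval_insert 𝒱 _ l r rfl]
  dsimp only
  rw [Pi.neg_apply, Pi.neg_apply, h.neg_slot, neg_neg, mcValue, hw]
  simp only [Forest.decorate, Forest.decorate_addLeaves, Forest.corolla, List.replicate_succ,
    List.headD_cons, List.tail_cons, List.take_succ_cons, Forest.weight_addLeaves, Forest.weight,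
    Forest.width_addLeaves, Forest.width]
  rw [comp_insert 𝒱 _ _ _ _ (by simp [Forest.leaves]), Forest.comp_addLeaves_nil]
  have hd : (-1 : ℤ) + Gen.e.degree (mid.length + 0) +
      (Forest.addLeaves mid.length Forest.nil : Forest (ℤ × (List V → V))).totalDegree =
      (mid.length : ℤ) - 2 := by
    rw [Forest.totalDegree_addLeaves, Forest.totalDegree, Gen.degree]
    push_cast
    ring
  rw [hd, negOnePow_smul_smul, neg_negOnePow_smul]
  congr 1
  apply negOnePow_congr
  simp only [Forest.vertexDegrees, Forest.vertexDegrees_addLeaves, Forest.width_addLeaves,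
    Forest.width, crossSign, List.replicate_zero, List.sum_cons, List.sum_nil,
    Gen.degree, List.append_nil]
  have := zmod_two_mul_self (mid.length : ZMod 2)
  rw [← ZMod.intCast_eq_zero_iff_even]
  push_cast
  grind

/-- The Maurer–Cartan series in the component of the products is the Stasheff sum. -/
theorem linearCombination_mcValue_e (h : IsMultilinear k (α .e)) (v : List V) :
    Finsupp.linearCombination k (mcValue 𝒱 α v) (coproduct lam .e v.length) =
      -stasheff 𝒱 (-α .e) v := by
  rw [coproduct, stasheff]
  simp only [map_sum, Finsupp.linearCombination_single, negOnePow_cast_smul]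
  rw [← Finset.sum_neg_distrib]
  refine Finset.sum_congr rfl fun j hj => ?_
  rw [← Finset.sum_neg_distrib]
  refine Finset.sum_nbij' (fun i => i - 1) (fun i => i + 1) ?_ ?_ ?_ ?_ ?_
  · intro i hi
    simp only [Finset.mem_Icc, Finset.mem_range] at hi ⊢
    lia
  · intro i hi
    simp only [Finset.mem_Icc, Finset.mem_range] at hi ⊢
    lia
  · intro i hi
    exact Nat.sub_add_cancel (Finset.mem_Icc.1 hi).1
  · intro i _
    rfl
  · intro i hi
    rw [Finset.mem_Icc] at hj hi
    obtain ⟨h1, h2, h3, h4⟩ := length_eq_of_splits v (a := i - 1) (t := j) (by lia)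
    have key := mcValue_ee 𝒱 h (v.take (i - 1)) ((v.drop (i - 1)).take j) (v.drop (i - 1 + j))
    rw [← h4, h1, h2, h3] at key
    rw [show v.length - j - (i - 1) = v.length - (i - 1 + j) by lia, ← key,
      show v.length - j + 1 - i = v.length - (i - 1 + j) by lia]
    congr 2
    congr 1
    lia

/-- The contribution of a tree with root `e` and inputs `o` is a term of the left side of the
homotopy Rota–Baxter identity. -/
theorem mcValue_rootETree (h : IsMultilinear k (α .e)) {w : List ℕ}
    (hw : patVertices w = w.length) {v : List V} (hv : v.length = patLeaves w) :
    mcValue 𝒱 α v (rootETree w) =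
      -((listSign (w.map fun r : ℕ => (r : ℤ))).negOnePow •
        (-α .e) (tensorEval 𝒱 (patPieces (-α .o) w) v)) := by
  have hk := signRule_koszul 𝒱
  have hW : (rootETree w).weight = patVertices w + 1 := by
    simp [rootETree, Forest.weight, add_comm]
  have hcs := crossSign_replicate ((w.length - 1 : ℤ) :: patDegrees w)
  rw [List.length_cons, length_patDegrees, listSign, length_patDegrees] at hcs
  have hds : (rootETree w).vertexDegrees = (w.length - 1 : ℤ) :: patDegrees w := by
    simp [rootETree, Forest.vertexDegrees, vertexDegrees_corollas_eq, Gen.degree]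
  rw [mcValue, hW, hds, hcs, rootETree, List.replicate_succ]
  simp only [Forest.decorate, List.headD_cons, List.tail_cons, Forest.weight_corollas, Forest.comp,
    Forest.totalDegree, hk.map_zero_list]
  rw [List.take_of_length_le (l := List.replicate (patVertices w) (-1, α)) (by simp),
    List.take_of_length_le (by rw [hv, Forest.leaves_decorate, Forest.leaves_corollas]),
    comp_corollas_patPieces 𝒱 h α hv, negOnePow_smul_smul, Pi.neg_apply, smul_neg, neg_neg,
    ← patDegrees_eq hw]
  congr 1
  apply negOnePow_congr
  rw [hw]
  obtain ⟨t, ht⟩ := Int.even_mul_pred_self (w.length : ℤ)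
  exact ⟨w.length + 1 - t - listSign (patDegrees w), by push_cast; linear_combination -ht⟩

/-- The contribution of a tree with root `o` is a term of the right side of the homotopy Rota–Baxter
identity. -/
theorem mcValue_rootOTree (h : IsMultilinear k (α .e)) (h' : IsMultilinear k (α .o)) {w : List ℕ}
    {l mid r : List V} (hv : mid.length = patLeaves w) :
    (rootOSign l.length w r.length).negOnePow •
      mcValue 𝒱 α (l ++ (mid ++ r)) (rootOTree l.length w r.length) =
      (l.length + (w.length + (w.sum - patVertices w)) * r.length +
          (patternInputSign w - listSign (patDegrees w)) : ℤ).negOnePow •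
        (-α .o) (tensorEval 𝒱 (List.replicate l.length Piece.id ++
          [⟨w.length - 2 + (w.sum - patVertices w), patLeaves w,
            fun u => (-α .e) (tensorEval 𝒱 (patPieces (-α .o) w) u)⟩] ++
          List.replicate r.length Piece.id) (l ++ (mid ++ r))) := by
  have hW : (rootOTree l.length w r.length).weight = patVertices w + 1 + 1 := by
    simp [rootOTree, Forest.weight]
    ring
  have hcs := crossSign_replicate ((l.length + 1 + r.length : ℤ) :: (w.length - 1 : ℤ) ::
    patDegrees w)
  rw [List.length_cons, List.length_cons, length_patDegrees, listSign, listSign, List.length_cons,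
    length_patDegrees] at hcs
  have hds : (rootOTree l.length w r.length).vertexDegrees =
      (l.length + 1 + r.length : ℤ) :: (w.length - 1 : ℤ) :: patDegrees w := by
    simp [rootOTree, Forest.vertexDegrees, vertexDegrees_corollas_eq, Gen.degree,
      Forest.vertexDegrees_addLeaves, Forest.width]
    ring
  rw [tensorEval_insert 𝒱 _ l r hv.symm, mcValue, hW, hds, hcs, rootOTree, List.replicate_succ,
    List.replicate_succ]
  simp only [Forest.decorate, Forest.decorate_addLeaves, List.headD_cons, List.tail_cons,
    Forest.weight_addLeaves, Forest.weight, Forest.weight_corollas,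
    Forest.width_addLeaves, Forest.width, Forest.width_corollas]
  rw [List.take_of_length_le (l := (-1, α) :: List.replicate (patVertices w) (-1, α))
    (by rw [List.length_cons, List.length_replicate]; lia), List.tail_cons,
    List.take_of_length_le (l := List.replicate (patVertices w) (-1, α)) (by simp),
    List.headD_cons, comp_insert 𝒱 _ _ _ _
      (by rw [Forest.leaves_decorate, Forest.leaves_corollas, hv])]
  dsimp only
  rw [comp_corollas_patPieces 𝒱 h α hv, h'.sign_slot, Pi.neg_apply, Pi.neg_apply, h'.neg_slot,
    neg_neg, negOnePow_smul_smul, negOnePow_smul_smul,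
    Forest.totalDegree_decorate_corollas _ _ (by simp), totalDeg_replicate]
  have hd : (-1 + Gen.e.degree w.length + (-(patVertices w : ℤ) + w.sum)) =
      w.length - 2 + (w.sum - patVertices w) := by
    rw [Gen.degree]
    ring
  rw [hd]
  congr 1
  apply negOnePow_congr
  rw [rootOSign]
  have hsum := sum_add_length_eq w
  generalize w.sum = W at hsum ⊢
  have hsum' : (patLeaves w : ZMod 2) + patVertices w = W + w.length := by
    exact_mod_cast congrArg _ hsum
  rw [← ZMod.intCast_eq_zero_iff_even]
  push_cast
  have := zmod_two_mul_self (patVertices w : ZMod 2)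
  grind

/-- The sign of the operators at the inputs of the product, in terms of patterns. -/
theorem sum_inputs_eq {p : ℕ} (w : Fin p → ℕ) :
    (∑ t : Fin p, if w t = 0 then 0 else ((w t : ℤ) - 1) * ((p : ℤ) - 1 - t)) =
      patternInputSign (List.ofFn w) - listSign (patDegrees (List.ofFn w)) := by
  induction p with
  | zero => simp [patternInputSign, patDegrees, listSign]
  | succ p ih =>
    have h1 : ∀ t : Fin p, ((p + 1 : ℕ) : ℤ) - 1 - (t.succ : Fin (p + 1)) = (p : ℤ) - 1 - t := by
      intro t
      rw [Fin.val_succ]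
      push_cast
      ring
    rw [Fin.sum_univ_succ, List.ofFn_succ]
    simp only [h1]
    rw [ih fun t => w t.succ]
    generalize w 0 = r
    cases r with
    | zero => simp [patternInputSign, patDegrees]
    | succ r =>
      rw [patternInputSign, if_neg r.succ_ne_zero]
      have h2 : ∀ w : List ℕ, patDegrees ((r + 1) :: w) = ((r + 1 : ℕ) : ℤ) :: patDegrees w := by
        intro w
        simp [patDegrees]
      rw [h2, listSign, length_patDegrees, List.length_ofFn]
      push_cast
      simp
      ring

theorem sum_degrees_eq {p : ℕ} (w : Fin p → ℕ) :
    (∑ t : Fin p, if w t = 0 then 0 else (w t : ℤ) - 1) =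
      (List.ofFn w).sum - patVertices (List.ofFn w) := by
  rw [← sum_degree_patPieces (0 : List ℤ → ℤ), patPieces, List.map_map, List.map_ofFn,
    List.sum_ofFn]
  refine Finset.sum_congr rfl fun t _ => ?_
  rw [Function.comp_apply, Function.comp_apply]
  split_ifs <;> rfl

/-- The Maurer–Cartan series in the component of the operators is the homotopy Rota–Baxter
identity. -/
theorem linearCombination_mcValue_o (h : IsMultilinear k (α .e)) (h' : IsMultilinear k (α .o))
    (v : List V) :
    Finsupp.linearCombination k (mcValue 𝒱 α v) (coproduct lam .o v.length) =
      -(((v.length * (v.length - 1) / 2 : ℕ) : ℤ).negOnePow •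
        rotaBaxterLeft 𝒱 (-α .e) (-α .o) v) +
      ((v.length * (v.length - 1) / 2 : ℕ) : ℤ).negOnePow •
        rotaBaxterRight 𝒱 lam (-α .e) (-α .o) v := by
  rw [coproduct, map_add, rotaBaxterLeft, rotaBaxterRight]
  generalize hN : ((v.length * (v.length - 1) / 2 : ℕ) : ℤ) = N
  congr 1
  · simp only [map_sum, Finset.smul_sum, ← Finset.sum_neg_distrib]
    refine Finset.sum_congr rfl fun p _ => Finset.sum_congr rfl fun r _ => ?_
    split_ifs with hr
    · obtain ⟨hr, hr'⟩ := hr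
      have hw : patVertices (List.ofFn fun t => (r t : ℕ)) =
          (List.ofFn fun t => (r t : ℕ)).length := by
        rw [patVertices_eq_length_iff]
        simpa using hr
      have h3 := sum_add_length_eq (List.ofFn fun t => (r t : ℕ))
      rw [hw, List.sum_ofFn, hr'] at h3
      have key := mcValue_rootETree 𝒱 h hw (v := v) (by lia)
      have hp : patPieces (-α .o) (List.ofFn fun t => (r t : ℕ)) =
          List.ofFn fun t => ⟨((r t : ℕ) : ℤ) - 1, r t, -α .o⟩ := by
        rw [patPieces, List.map_ofFn]
        congr 1
        funext t
        exact if_neg (hr t)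
      have hs : listSign ((List.ofFn fun t => (r t : ℕ)).map fun r : ℕ => (r : ℤ)) =
          ∑ t : Fin p, ((p : ℤ) - 1 - t) * (r t : ℕ) := by
        rw [List.map_ofFn, show (_ ∘ _) = fun t : Fin p => ((r t : ℕ) : ℤ) from rfl,
          ← bracketSign_eq]
        rfl
      rw [hs, hp] at key
      rw [Finsupp.linearCombination_single, negOnePow_cast_smul]
      change _ • mcValue 𝒱 α v (rootETree _) = _
      rw [key, smul_neg, negOnePow_smul_smul, negOnePow_smul_smul]
      congr 2
      exact negOnePow_congr ⟨-N, by ring⟩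
    · rw [map_zero, smul_zero, neg_zero]
  · simp only [map_sum, Finset.smul_sum]
    refine Finset.sum_congr rfl fun p _ => Finset.sum_congr rfl fun w _ =>
      Finset.sum_congr rfl fun a _ => Finset.sum_congr rfl fun b _ => ?_
    split_ifs with hw
    · obtain ⟨hq, hL⟩ := hw
      rw [inputLeaves_eq] at hL
      obtain ⟨h1, h2, h3, h4⟩ := length_eq_of_splits v (a := a)
        (t := patLeaves (List.ofFn fun t => (w t : ℕ))) (by lia)
      have key := mcValue_rootOTree 𝒱 h h' (l := v.take a)
        (r := v.drop (a + patLeaves (List.ofFn fun t => (w t : ℕ)))) h2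
      rw [← h4, h1, h3, show v.length - (a + patLeaves (List.ofFn fun t => (w t : ℕ))) = b by lia,
        List.length_ofFn, ← sum_inputs_eq, ← sum_degrees_eq] at key
      have hp : patPieces (-α .o) (List.ofFn fun t => (w t : ℕ)) =
          List.ofFn fun t => if (w t : ℕ) = 0 then Piece.id else
            ⟨((w t : ℕ) : ℤ) - 1, w t, -α .o⟩ := by
        rw [patPieces, List.map_ofFn]
        rfl
      rw [hp] at key
      rw [Finsupp.linearCombination_single, mul_comm, mul_smul, negOnePow_cast_smul, inputLeaves_eq,
        inputVertices_eq, inputSign_eq, smul_comm _ (lam ^ _), smul_comm _ (lam ^ _)]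
      congr 1
      have hs : rootOSign a (List.ofFn fun t => (w t : ℕ)) b =
          ((patVertices (List.ofFn fun t => (w t : ℕ)) + 1 : ℕ) - 1) * ((a : ℤ) + 1 + b) +
            ((p : ℤ) - 1) * ((patVertices (List.ofFn fun t => (w t : ℕ)) + 1 : ℕ) - 1) +
            ((patLeaves (List.ofFn fun t => (w t : ℕ)) : ℤ) - 1) * b +
            patternInputSign (List.ofFn fun t => (w t : ℕ)) := by
        rw [rootOSign, List.length_ofFn]
        push_cast
        ring
      rw [← hs]
      change _ • mcValue 𝒱 α v (rootOTree a _ b) = _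
      rw [key, negOnePow_smul_smul]
      congr 1
      exact negOnePow_congr ⟨-N, by ring⟩
    · rw [map_zero, smul_zero]

/-- Maurer–Cartan elements are homotopy Rota–Baxter algebra structures. -/
theorem isMaurerCartan_iff_homotopyRotaBaxter [CharZero k] : IsMaurerCartan 𝒱 lam α ↔
    (-α .e ∈ homProd 𝒱 𝒱 fun n => (n : ℤ) - 2) ∧ (-α .o ∈ homProd 𝒱 𝒱 fun n => (n : ℤ) - 1) ∧
      (∀ v, stasheff 𝒱 (-α .e) v = 0) ∧
      ∀ v, rotaBaxterLeft 𝒱 (-α .e) (-α .o) v = rotaBaxterRight 𝒱 lam (-α .e) (-α .o) v := by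
  have h1 : (fun n : ℕ => (n : ℤ) - 2) = fun n : ℕ => -1 - 1 + (n : ℤ) := by
    funext n
    ring
  have h2 : (fun n : ℕ => (n : ℤ) - 1) = fun n : ℕ => -1 + (n : ℤ) := by
    funext n
    ring
  rw [isMaurerCartan_iff, mem_cochains_iff, h1, h2, Submodule.neg_mem_iff, Submodule.neg_mem_iff,
    and_assoc]
  refine and_congr_right fun he => and_congr_right fun ho => ?_
  have he' := homProd_multilinear he
  have ho' := homProd_multilinear ho
  constructor
  · intro h
    refine ⟨fun v => ?_, fun v => ?_⟩
    · rw [← neg_eq_zero, ← linearCombination_mcValue_e 𝒱 lam he', h]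
    · have := h .o v
      rwa [linearCombination_mcValue_o 𝒱 lam he' ho', neg_add_eq_zero, smul_left_cancel_iff] at this
  · rintro ⟨h, h'⟩ (_ | _) v
    · rw [linearCombination_mcValue_e 𝒱 lam he', h, neg_zero]
    · rw [linearCombination_mcValue_o 𝒱 lam he' ho', h', neg_add_cancel]

/-- The bijection between Maurer–Cartan elements and homotopy Rota–Baxter algebra structures. -/
def maurerCartanEquiv [CharZero k] :
    {α // IsMaurerCartan 𝒱 lam α} ≃ HomotopyRotaBaxter 𝒱 lam where
  toFun α :=
    have h := (isMaurerCartan_iff_homotopyRotaBaxter 𝒱 lam).1 α.2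
    ⟨-α.1 .e, -α.1 .o, h.1, h.2.1, h.2.2.1, h.2.2.2⟩
  invFun S := ⟨fun | .e => -S.m | .o => -S.T, (isMaurerCartan_iff_homotopyRotaBaxter 𝒱 lam).2 (by
    simp only [neg_neg]
    exact ⟨S.m_mem, S.T_mem, S.stasheff_eq, S.rotaBaxter_eq⟩)⟩
  left_inv α := by
    apply Subtype.ext
    funext b
    cases b <;> simp only [neg_neg]
  right_inv S := by
    simp only [neg_neg]

end

/-! ### Spaces concentrated in degree zero -/

section

variable {k : Type u} {V : Type v} [Field k] [AddCommGroup V] [Module k V]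
  {𝒱 : ℤ → Submodule k V} [DirectSum.Decomposition 𝒱] {lam : k} {α : Gen → List V → V}

theorem mem_zero_of_concentrated (h𝒱 : ∀ i : ℤ, i ≠ 0 → 𝒱 i = ⊥) (x : V) : x ∈ 𝒱 0 := by
  classical
  rw [← DirectSum.sum_support_decompose 𝒱 x]
  refine Submodule.sum_mem _ fun i _ => ?_
  have hi := (DirectSum.decompose 𝒱 x i).2
  generalize (DirectSum.decompose 𝒱 x i : V) = y at hi ⊢
  by_cases h : i = 0
  · rwa [h] at hi
  · rw [h𝒱 i h, Submodule.mem_bot] at hi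
    rw [hi]
    exact Submodule.zero_mem _

theorem koszul_of_concentrated (h𝒱 : ∀ i : ℤ, i ≠ 0 → 𝒱 i = ⊥) (d : ℤ) (x : V) :
    koszul 𝒱 0 d x = x := by
  rw [koszul_of_mem 𝒱 0 d 0 x (mem_zero_of_concentrated h𝒱 x)]
  simp

/-- In a space concentrated in degree zero, only the components of degree zero remain. -/
theorem mem_homProd_of_concentrated (h𝒱 : ∀ i : ℤ, i ≠ 0 → 𝒱 i = ⊥) {e : ℕ → ℤ}
    {f : List V → V} : f ∈ homProd 𝒱 𝒱 e ↔
      f [] = 0 ∧ IsMultilinear k f ∧ ∀ v, e v.length ≠ 0 → f v = 0 := by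
  constructor
  · intro h
    refine ⟨homProd_nil h, homProd_multilinear h, fun v hv => ?_⟩
    have hl : HomList 𝒱 (List.replicate v.length 0) v :=
      List.forall₂_iff_get.2 ⟨by simp, fun j h1 h2 => by
        simpa using mem_zero_of_concentrated h𝒱 _⟩
    have := homProd_apply_mem h hl
    rwa [h𝒱 _ (by simpa using hv), Submodule.mem_bot] at this
  · rintro ⟨h0, h1, h2⟩
    refine ⟨h0, fun n => ⟨(isMultilinear_iff f).1 h1 n, fun i v hv => ?_⟩⟩
    obtain ⟨F, hF⟩ := (isMultilinear_iff f).1 h1 n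
    by_cases hi : ∃ t, i t ≠ 0
    · obtain ⟨t, ht⟩ := hi
      have := hv t
      rw [h𝒱 _ ht, Submodule.mem_bot] at this
      rw [hF, F.map_coord_zero t this]
      exact Submodule.zero_mem _
    · by_cases he : e n = 0
      · rw [he, Finset.sum_eq_zero fun t _ => not_not.1 fun h => hi ⟨t, h⟩]
        exact mem_zero_of_concentrated h𝒱 _
      · rw [h2 _ (by rwa [List.length_ofFn])]
        exact Submodule.zero_mem _

/-- All terms of the Maurer–Cartan series have degree `-2`. -/
theorem mcTerm_mem [CharZero k] (hα : α ∈ cochains 𝒱 (-1)) {n : ℕ} (hn : 1 ≤ n) :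
    mcTerm 𝒱 lam α n ∈ cochains 𝒱 (-2) := by
  have h := bracket_mem 𝒱 lam hn (fun _ => -1) (fun _ => α) fun _ => hα
  rw [Finset.sum_const, Finset.card_univ, Fintype.card_fin, nsmul_eq_mul,
    show (n : ℤ) * -1 + n - 2 = -2 by ring] at h
  rw [mcTerm, Units.smul_def]
  exact zsmul_mem (Submodule.smul_mem _ _ h) _

/-- For degree reasons, the Maurer–Cartan equation in a space concentrated in degree zero has only
two components, namely associativity and the Rota–Baxter identity. -/
theorem isMaurerCartan_iff_of_concentrated [CharZero k] (h𝒱 : ∀ i : ℤ, i ≠ 0 → 𝒱 i = ⊥) :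
    IsMaurerCartan 𝒱 lam α ↔ α ∈ cochains 𝒱 (-1) ∧
      (∀ a b c, stasheff 𝒱 (-α .e) [a, b, c] = 0) ∧
      ∀ a b, rotaBaxterLeft 𝒱 (-α .e) (-α .o) [a, b] =
        rotaBaxterRight 𝒱 lam (-α .e) (-α .o) [a, b] := by
  constructor
  · intro h
    have h' := (isMaurerCartan_iff_homotopyRotaBaxter 𝒱 lam).1 h
    exact ⟨h.1, fun a b c => h'.2.2.1 _, fun a b => h'.2.2.2 _⟩
  · rintro ⟨hα, hm, hT⟩
    have he := homProd_multilinear ((mem_cochains_iff 𝒱).1 hα).1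
    have ho := homProd_multilinear ((mem_cochains_iff 𝒱).1 hα).2
    refine (isMaurerCartan_iff 𝒱 lam α).2 ⟨hα, ?_⟩
    rintro (_ | _) v
    · by_cases hv : v.length = 3
      · obtain ⟨a, b, c, rfl⟩ := List.length_eq_three.1 hv
        rw [linearCombination_mcValue_e 𝒱 lam he, hm, neg_zero]
      · rw [← finsum_mcTerm]
        refine finsum_eq_zero_of_forall_eq_zero fun n => ?_
        have := ((mem_cochains_iff 𝒱).1 (mcTerm_mem (lam := lam) hα n.succ_pos)).1
        exact ((mem_homProd_of_concentrated h𝒱).1 this).2.2 v (by lia)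
    · by_cases hv : v.length = 2
      · obtain ⟨a, b, rfl⟩ := List.length_eq_two.1 hv
        rw [linearCombination_mcValue_o 𝒱 lam he ho, hT, neg_add_cancel]
      · rw [← finsum_mcTerm]
        refine finsum_eq_zero_of_forall_eq_zero fun n => ?_
        have := ((mem_cochains_iff 𝒱).1 (mcTerm_mem (lam := lam) hα n.succ_pos)).2
        exact ((mem_homProd_of_concentrated h𝒱).1 this).2.2 v (by lia)

/-- A bilinear map as a family of multilinear maps. -/
def binaryMap (B : V →ₗ[k] V →ₗ[k] V) : List V → V
  | [a, b] => B a b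
  | _ => 0

/-- A linear map as a family of multilinear maps. -/
def unaryMap (T : V →ₗ[k] V) : List V → V
  | [a] => T a
  | _ => 0

theorem binaryMap_multilinear (B : V →ₗ[k] V →ₗ[k] V) : IsMultilinear k (binaryMap B) := by
  constructor
  · rintro (_ | ⟨x, _ | ⟨y, l⟩⟩) (_ | ⟨x', _ | ⟨y', r⟩⟩) a b <;> simp [binaryMap]
  · rintro (_ | ⟨x, _ | ⟨y, l⟩⟩) (_ | ⟨x', _ | ⟨y', r⟩⟩) c a <;> simp [binaryMap]

theorem unaryMap_multilinear (T : V →ₗ[k] V) : IsMultilinear k (unaryMap T) := by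
  constructor
  · rintro (_ | ⟨x, l⟩) (_ | ⟨x', r⟩) a b <;> simp [unaryMap]
  · rintro (_ | ⟨x, l⟩) (_ | ⟨x', r⟩) c a <;> simp [unaryMap]

theorem binaryMap_eq_zero (B : V →ₗ[k] V →ₗ[k] V) {v : List V} (hv : v.length ≠ 2) :
    binaryMap B v = 0 := by
  obtain _ | ⟨a, _ | ⟨b, _ | ⟨c, v⟩⟩⟩ := v <;> first | rfl | simp at hv

theorem unaryMap_eq_zero (T : V →ₗ[k] V) {v : List V} (hv : v.length ≠ 1) :
    unaryMap T v = 0 := by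
  obtain _ | ⟨a, _ | ⟨b, v⟩⟩ := v <;> first | rfl | simp at hv

theorem stasheff_three (h𝒱 : ∀ i : ℤ, i ≠ 0 → 𝒱 i = ⊥) (B : V →ₗ[k] V →ₗ[k] V) (a b c : V) :
    stasheff 𝒱 (binaryMap B) [a, b, c] = B (B a b) c - B a (B b c) := by
  have h3 : Finset.Icc 1 3 = {1, 2, 3} := rfl
  have hs : (2 : ℤ).negOnePow = 1 := rfl
  simp [stasheff, h3, Finset.sum_range_succ, tensorEval, Piece.id, binaryMap,
    koszul_of_concentrated h𝒱, List.replicate_succ, hs, sub_eq_add_neg]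

theorem rotaBaxterLeft_two (h𝒱 : ∀ i : ℤ, i ≠ 0 → 𝒱 i = ⊥) (B : V →ₗ[k] V →ₗ[k] V)
    (T : V →ₗ[k] V) (a b : V) :
    rotaBaxterLeft 𝒱 (binaryMap B) (unaryMap T) [a, b] = -B (T a) (T b) := by
  have h2 : Finset.Icc 1 2 = {1, 2} := rfl
  have hs : (3 : ℤ).negOnePow = -1 := rfl
  simp only [rotaBaxterLeft, h2, List.length_cons, List.length_nil, zero_add, Nat.reduceAdd]
  rw [Finset.sum_pair (by decide), ← (finTwoArrowEquiv (Fin 3)).symm.sum_comp,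
    Fintype.sum_prod_type]
  simp [Fin.sum_univ_three, tensorEval, binaryMap, unaryMap, koszul_of_concentrated h𝒱, hs]

theorem rotaBaxterRight_two (h𝒱 : ∀ i : ℤ, i ≠ 0 → 𝒱 i = ⊥) (B : V →ₗ[k] V →ₗ[k] V)
    (T : V →ₗ[k] V) (a b : V) :
    rotaBaxterRight 𝒱 lam (binaryMap B) (unaryMap T) [a, b] =
      -T (B a (T b) + B (T a) b + lam • B a b) := by
  have h2 : Finset.Icc 1 2 = {1, 2} := rfl
  simp only [rotaBaxterRight, h2, List.length_cons, List.length_nil, zero_add, Nat.reduceAdd]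
  rw [Finset.sum_pair (by decide), ← (finTwoArrowEquiv (Fin 3)).symm.sum_comp,
    Fintype.sum_prod_type]
  simp [Fin.sum_univ_three, Finset.sum_range_succ, tensorEval, Piece.id, binaryMap, unaryMap,
    koszul_of_concentrated h𝒱, List.replicate_succ, inputLeaves_eq, inputVertices_eq, patLeaves,
    patVertices]
  abel

/-- The cochain with components `-B` and `-T` is a Maurer–Cartan element if and only if `B` and `T`
form a Rota–Baxter algebra. -/
theorem isMaurerCartan_binaryMap_iff [CharZero k] (h𝒱 : ∀ i : ℤ, i ≠ 0 → 𝒱 i = ⊥)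
    {B : V →ₗ[k] V →ₗ[k] V} {T : V →ₗ[k] V} (he : α .e = -binaryMap B) (ho : α .o = -unaryMap T) :
    IsMaurerCartan 𝒱 lam α ↔ (∀ a b c, B (B a b) c = B a (B b c)) ∧
      ∀ a b, B (T a) (T b) = T (B a (T b) + B (T a) b + lam • B a b) := by
  rw [isMaurerCartan_iff_of_concentrated h𝒱, he, ho, neg_neg, neg_neg]
  have hα : α ∈ cochains 𝒱 (-1) := by
    rw [mem_cochains_iff, he, ho, Submodule.neg_mem_iff, Submodule.neg_mem_iff,
      mem_homProd_of_concentrated h𝒱, mem_homProd_of_concentrated h𝒱]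
    exact ⟨⟨rfl, binaryMap_multilinear B, fun v hv => binaryMap_eq_zero B (by lia)⟩,
      rfl, unaryMap_multilinear T, fun v hv => unaryMap_eq_zero T (by lia)⟩
  simp only [hα, true_and, stasheff_three h𝒱, rotaBaxterLeft_two h𝒱, rotaBaxterRight_two h𝒱,
    sub_eq_zero, neg_inj]

/-- The binary component of a family of multilinear maps. -/
def binaryPart {f : List V → V} (hf : IsMultilinear k f) : V →ₗ[k] V →ₗ[k] V :=
  LinearMap.mk₂ k (fun a b => f [a, b]) (fun a b c => hf.add [] [c] a b)
    (fun c a b => hf.smul [] [b] c a) (fun a b c => hf.add [a] [] b c)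
    fun c a b => hf.smul [a] [] c b

/-- The unary component of a family of multilinear maps. -/
def unaryPart {f : List V → V} (hf : IsMultilinear k f) : V →ₗ[k] V where
  toFun a := f [a]
  map_add' := hf.add [] []
  map_smul' := hf.smul [] []

theorem eq_neg_binaryMap (h𝒱 : ∀ i : ℤ, i ≠ 0 → 𝒱 i = ⊥) (hα : α ∈ cochains 𝒱 (-1))
    (h : IsMultilinear k (-α .e)) : α .e = -binaryMap (binaryPart h) := by
  have he := ((mem_homProd_of_concentrated h𝒱).1 ((mem_cochains_iff 𝒱).1 hα).1).2.2
  funext v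
  by_cases hv : v.length = 2
  · obtain ⟨a, b, rfl⟩ := List.length_eq_two.1 hv
    simp [binaryMap, binaryPart]
  · rw [he v (by lia), Pi.neg_apply, binaryMap_eq_zero _ hv, neg_zero]

theorem eq_neg_unaryMap (h𝒱 : ∀ i : ℤ, i ≠ 0 → 𝒱 i = ⊥) (hα : α ∈ cochains 𝒱 (-1))
    (h : IsMultilinear k (-α .o)) : α .o = -unaryMap (unaryPart h) := by
  have ho := ((mem_homProd_of_concentrated h𝒱).1 ((mem_cochains_iff 𝒱).1 hα).2).2.2
  funext v
  by_cases hv : v.length = 1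
  · obtain ⟨a, rfl⟩ := List.length_eq_one_iff.1 hv
    simp [unaryMap, unaryPart]
  · rw [ho v (by lia), Pi.neg_apply, unaryMap_eq_zero _ hv, neg_zero]

theorem cochains_multilinear {d : ℤ} {x : Gen → List V → V} (hx : x ∈ cochains 𝒱 d) (b : Gen) :
    IsMultilinear k (x b) := by
  cases b
  · exact homProd_multilinear ((mem_cochains_iff 𝒱).1 hx).1
  · exact homProd_multilinear ((mem_cochains_iff 𝒱).1 hx).2

/-- The bijection between Maurer–Cartan elements and Rota–Baxter algebra structures on a space
concentrated in degree zero. -/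
def maurerCartanEquivRotaBaxter [CharZero k] (h𝒱 : ∀ i : ℤ, i ≠ 0 → 𝒱 i = ⊥) :
    {α // IsMaurerCartan 𝒱 lam α} ≃ RotaBaxter V lam where
  toFun α :=
    have he := (cochains_multilinear α.2.1 .e).neg
    have ho := (cochains_multilinear α.2.1 .o).neg
    have h := (isMaurerCartan_binaryMap_iff h𝒱 (eq_neg_binaryMap h𝒱 α.2.1 he)
      (eq_neg_unaryMap h𝒱 α.2.1 ho)).1 α.2
    ⟨binaryPart he, unaryPart ho, h.1, h.2⟩
  invFun R := ⟨fun | .e => -binaryMap R.mul | .o => -unaryMap R.T,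
    (isMaurerCartan_binaryMap_iff h𝒱 rfl rfl).2 ⟨R.mul_assoc, R.rotaBaxter⟩⟩
  left_inv α := by
    apply Subtype.ext
    funext b
    cases b
    · exact (eq_neg_binaryMap h𝒱 α.2.1 (cochains_multilinear α.2.1 .e).neg).symm
    · exact (eq_neg_unaryMap h𝒱 α.2.1 (cochains_multilinear α.2.1 .o).neg).symm
  right_inv R := by
    obtain ⟨B, T, h1, h2⟩ := R
    simp only [RotaBaxter.mk.injEq]
    constructor
    · ext a b
      simp [binaryPart, binaryMap]
    · ext a
      simp [unaryPart, unaryMap]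

end

end HomotopyRB

end

theorem mainTheorem4 {k : Type*} {V : Type*} [Field k] [CharZero k] [AddCommGroup V] [Module k V]
    (𝒱 : ℤ → Submodule k V) [DirectSum.Decomposition 𝒱] (lam : k) :
    HomotopyRB.IsLInfinity (HomotopyRB.cochains 𝒱) (HomotopyRB.bracket 𝒱 lam) ∧
    (∀ d : ℤ, Set.BijOn (HomotopyRB.identification 𝒱 d)
        (HomotopyRB.cochains 𝒱 d) (HomotopyRB.explicitCochains 𝒱 d)) ∧
    (∀ (n : ℕ) (d : Fin n → ℤ) (x : Fin n → HomotopyRB.Gen → List V → V), 1 ≤ n →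
        (∀ i, x i ∈ HomotopyRB.cochains 𝒱 (d i)) →
        HomotopyRB.identification 𝒱 ((∑ i, d i) + (n : ℤ) - 2) (HomotopyRB.bracket 𝒱 lam n d x) =
          HomotopyRB.explicitBracket 𝒱 lam n d
            (fun i => HomotopyRB.identification 𝒱 (d i) (x i))) ∧
    (∃ Φ : {α // HomotopyRB.IsMaurerCartan 𝒱 lam α} ≃ HomotopyRB.HomotopyRotaBaxter 𝒱 lam,
        ∀ α, (Φ α).m = -(α.1 HomotopyRB.Gen.e) ∧ (Φ α).T = -(α.1 HomotopyRB.Gen.o)) ∧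
    ((∀ i : ℤ, i ≠ 0 → 𝒱 i = ⊥) →
      ∃ Ψ : {α // HomotopyRB.IsMaurerCartan 𝒱 lam α} ≃ HomotopyRB.RotaBaxter V lam,
        ∀ α, (∀ a b : V, (Ψ α).mul a b = -(α.1 HomotopyRB.Gen.e [a, b])) ∧
          (∀ a : V, (Ψ α).T a = -(α.1 HomotopyRB.Gen.o [a]))) := by
  refine ⟨HomotopyRB.isLInfinity 𝒱 lam, HomotopyRB.identification_bijOn 𝒱,
    fun n d x hn hx => HomotopyRB.identification_bracket 𝒱 lam hn d x hx,
    ⟨HomotopyRB.maurerCartanEquiv 𝒱 lam, fun α => ⟨rfl, rfl⟩⟩,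
    fun h𝒱 => ⟨HomotopyRB.maurerCartanEquivRotaBaxter h𝒱, fun α => ⟨fun a b => rfl, fun a => rfl⟩⟩⟩
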